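/- Let $(M,\omega)$ be a compact Hermitian manifold of complex dimension $n$ and let $1\le k\le n$. Let $\chi(z,t)$ be a real $(1,1)$-form on $M$ depending smoothly on $z\in M$ and on a parameter $t\in\mathbb R$, let $\psi(z,v,t)$ be a positive smooth function on $(T^{1,0}M)^*\times\mathbb R$, let $a$ be a smooth $(1,0)$-form on $M$, and let $\varepsilon>0$. For a real function $u$ on $M$ put $$\tilde g=\chi(z,u)+\sqrt{-1}\,a\wedge\bar\partial u-\sqrt{-1}\,\bar a\wedge\partial u+\sqrt{-1}\,\partial\bar\partial u ,$$ and write $Du=\partial u$, with components $u_i$, and $D\bar Du$ for the tensor with components $u_{i\bar j}=\partial^2u/\partial z^i\partial\bar z^j$. For all real $K_0,K_1$ there is a constant $C$, depending only on $(M,\omega)$, $\varepsilon$, $n$, $k$, $\chi$, $\psi$, $a$, $K_0$, $K_1$, such that every real function $u\in C^4(M)$ that satisfies (i) $\tilde g>0$ on $M$ (that is, $u$ is $\tilde\chi$-plurisubharmonic), (ii) $\tilde g^{\,k}\wedge\omega^{n-k}=\psi(z,Du,u)\,\omega^n$ on $M$, (iii) $\chi(z,u)\ge\varepsilon\,\omega$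 on $M$, (iv) $\sup_M|u|\le K_0$ and $\sup_M|Du|_\omega\le K_1$ also satisfies $|D\bar D u|_\omega\le C$ on all of $M$. -/

import Mathlib

open scoped Manifold ContDiff

noncomputable section

namespace HermitianHessian

/-- The model space `ℂⁿ`. -/
abbrev Cn (n : ℕ) : Type := EuclideanSpace ℂ (Fin n)

/-- The standard basis of `ℂⁿ`. -/
def stdVec {n : ℕ} (i : Fin n) : Cn n := EuclideanSpace.single i (1 : ℂ)

/-- The Wirtinger derivative `∂f/∂zⁱ` of a (real differentiable) function on `ℂⁿ`. -/
def wirtinger {n : ℕ} (i : Fin n) (f : Cn n → ℂ) (z : Cn n) : ℂ :=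
  (1 / 2 : ℂ) * (fderiv ℝ f z (stdVec i) - Complex.I * fderiv ℝ f z (Complex.I • stdVec i))

/-- The conjugate Wirtinger derivative `∂f/∂z̄ⁱ`. -/
def wirtingerBar {n : ℕ} (i : Fin n) (f : Cn n → ℂ) (z : Cn n) : ℂ :=
  (1 / 2 : ℂ) * (fderiv ℝ f z (stdVec i) + Complex.I * fderiv ℝ f z (Complex.I • stdVec i))

section LinearAlgebra

variable {V : Type*} [AddCommGroup V] [Module ℂ V]

/-- For covectors `α`, `β` of type `(1,0)`, the sesquilinear form `α ⊗ β̄`, that is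
`(X, Y) ↦ α X * conj (β Y)`. -/
def sesq (α β : V →ₗ[ℂ] ℂ) : V →ₗ[ℂ] V →ₗ⋆[ℂ] ℂ :=
  LinearMap.mk₂'ₛₗ (RingHom.id ℂ) (starRingEnd ℂ)
    (fun X Y => α X * (starRingEnd ℂ) (β Y))
    (fun X X' Y => by simp [add_mul])
    (fun c X Y => by simp [mul_assoc])
    (fun X Y Y' => by simp [mul_add])
    (fun c X Y => by simp [mul_left_comm])

/-- A covector of type `(1,0)`, as a complex-valued real-linear form. -/
def cov10 (α : V →ₗ[ℂ] ℂ) : V →ₗ[ℝ] ℂ := α.restrictScalars ℝ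

/-- The conjugate `ᾱ`, of type `(0,1)`, of a covector `α` of type `(1,0)`. -/
def cov01 (α : V →ₗ[ℂ] ℂ) : V →ₗ[ℝ] ℂ where
  toFun X := (starRingEnd ℂ) (α X)
  map_add' X Y := by simp
  map_smul' c X := by
    have h : α (c • X) = (c : ℂ) * α X := by
      rw [← smul_eq_mul, ← map_smul]; rfl
    simp [h]

end LinearAlgebra

variable {n : ℕ} {M : Type*} [TopologicalSpace M] [ChartedSpace (Cn n) M]

/-- The holomorphic tangent space at `p` (a complex vector space). In Mathlib it is `ℂⁿ`, identified
with the tangent space through the preferred chart `chartAt (Cn n) p`; a `(1,0)`-covector at `p` is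
a complex-linear functional on it. -/
abbrev Tan (n : ℕ) {M : Type*} [TopologicalSpace M] [ChartedSpace (Cn n) M] (p : M) : Type :=
  TangentSpace 𝓘(ℂ, Cn n) p

/-- Hermitian (sesquilinear) forms on the tangent space at `p`. A real `(1,1)`-form
`√-1 ∑ hᵢⱼ dzⁱ ∧ dz̄ʲ` is the same thing as the Hermitian form `h(X, Y) = ∑ hᵢⱼ Xⁱ conj(Yʲ)`. -/
abbrev Sesq (n : ℕ) {M : Type*} [TopologicalSpace M] [ChartedSpace (Cn n) M] (p : M) : Type :=
  Tan n p →ₗ[ℂ] Tan n p →ₗ⋆[ℂ] ℂ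

/-- The algebra of complex-valued exterior forms at `p`: the exterior algebra over `ℂ` of the
complex-valued real-linear functionals on the tangent space. Its product is the wedge product. -/
abbrev Forms (n : ℕ) {M : Type*} [TopologicalSpace M] [ChartedSpace (Cn n) M] (p : M) : Type :=
  ExteriorAlgebra ℂ (Tan n p →ₗ[ℝ] ℂ)

/-- The coordinate vector `∂/∂zⁱ` at `p`, for the preferred chart at `p`. -/
def coordVec (p : M) (i : Fin n) : Tan n p := (stdVec i : Cn n)

/-- The coordinate covector `dzⁱ` at `p`, for the preferred chart at `p`. -/
def coordCov (p : M) (i : Fin n) : Tan n p →ₗ[ℂ] ℂ :=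
  ((EuclideanSpace.proj i : Cn n →L[ℂ] ℂ) : Cn n →ₗ[ℂ] ℂ)

/-- The exterior form `√-1 ∑ hᵢⱼ dzⁱ ∧ dz̄ʲ` at `p` given by a sesquilinear form `h`. -/
def toForm (p : M) (h : Sesq n p) : Forms n p :=
  Complex.I • ∑ i, ∑ j, h (coordVec p i) (coordVec p j) •
    (ExteriorAlgebra.ι ℂ (cov10 (coordCov p i)) * ExteriorAlgebra.ι ℂ (cov01 (coordCov p j)))

/-- The matrix `hᵢⱼ = h(∂/∂zⁱ, ∂/∂zʲ)` of a sesquilinear form at `p`. -/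
def formMatrix (p : M) (h : Sesq n p) : Matrix (Fin n) (Fin n) ℂ :=
  Matrix.of fun i j => h (coordVec p i) (coordVec p j)

/-! ### Smooth tensors

Smoothness means real smoothness of the components in the charts of the complex atlas. -/

/-- The vector `∂/∂zⁱ` of the chart `e`, at the point of `M` with coordinate `z`. -/
def chartVec (e : OpenPartialHomeomorph M (Cn n)) (z : Cn n) (i : Fin n) : Tan n (e.symm z) :=
  mfderiv 𝓘(ℂ, Cn n) 𝓘(ℂ, Cn n) e.symm z (stdVec i : Cn n)

/-- The covector `∑ vᵢ dzⁱ` of the chart `e`, at the point of `M` with coordinate `z`. -/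
def chartCov (e : OpenPartialHomeomorph M (Cn n)) (z v : Cn n) : Tan n (e.symm z) →ₗ[ℂ] ℂ :=
  (∑ i, v i • ((EuclideanSpace.proj i : Cn n →L[ℂ] ℂ) : Cn n →ₗ[ℂ] ℂ)) ∘ₗ
    (mfderiv 𝓘(ℂ, Cn n) 𝓘(ℂ, Cn n) e (e.symm z)).toLinearMap

variable (n M)

/-- A smooth Hermitian metric, with its fundamental form `√-1 ∑ hᵢⱼ dzⁱ ∧ dz̄ʲ`. -/
structure HermitianMetric where
  /-- the Hermitian form on each tangent space -/
  form : ∀ p : M, Sesq n p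
  herm : ∀ p X Y, form p Y X = (starRingEnd ℂ) (form p X Y)
  pos : ∀ p X, X ≠ 0 → 0 < (form p X X).re
  smooth : ∀ e ∈ atlas (Cn n) M, ∀ i j,
    ContDiffOn ℝ ∞ (fun z => form (e.symm z) (chartVec e z i) (chartVec e z j)) e.target

/-- A real `(1,1)`-form `χ(z, t)` on `M` depending smoothly on `z` and on a real parameter `t`. -/
structure FormFamily where
  /-- the Hermitian form on each tangent space, for each value of the parameter -/
  form : ∀ p : M, ℝ → Sesq n p
  herm : ∀ p t X Y, form p t Y X = (starRingEnd ℂ) (form p t X Y)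
  smooth : ∀ e ∈ atlas (Cn n) M, ∀ i j,
    ContDiffOn ℝ ∞
      (fun q : Cn n × ℝ => form (e.symm q.1) q.2 (chartVec e q.1 i) (chartVec e q.1 j))
      (e.target ×ˢ Set.univ)

/-- A smooth `(1,0)`-form on `M`. -/
structure OneZeroForm where
  /-- the covector at each point -/
  form : ∀ p : M, Tan n p →ₗ[ℂ] ℂ
  smooth : ∀ e ∈ atlas (Cn n) M, ∀ i,
    ContDiffOn ℝ ∞ (fun z => form (e.symm z) (chartVec e z i)) e.target

/-- A positive smooth function `ψ(z, v, t)` on `(T^{1,0}M)^* × ℝ`. -/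
structure PositiveRHS where
  /-- the value at a point, a covector there and a real number -/
  toFun : ∀ p : M, (Tan n p →ₗ[ℂ] ℂ) → ℝ → ℝ
  pos : ∀ p v t, 0 < toFun p v t
  smooth : ∀ e ∈ atlas (Cn n) M,
    ContDiffOn ℝ ∞
      (fun q : Cn n × Cn n × ℝ => toFun (e.symm q.1) (chartCov e q.1 q.2.1) q.2.2)
      (e.target ×ˢ Set.univ)

variable {n M}

/-! ### Derivatives of a function -/

variable (n) in
/-- The function `u` read in the preferred chart at `p`. -/
def inChart (u : M → ℝ) (p : M) (z : Cn n) : ℂ := ((u ((chartAt (Cn n) p).symm z) : ℝ) : ℂ)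

variable (n) in
/-- `∂u` at `p` (this is the covector `Du`, with components `uᵢ`). Since `u` is real, `∂̄u` is its
conjugate. -/
def del (u : M → ℝ) (p : M) : Tan n p →ₗ[ℂ] ℂ :=
  ∑ i, wirtinger i (inChart n u p) (chartAt (Cn n) p p) • coordCov p i

variable (n) in
/-- The Hermitian form with components `uᵢⱼ = ∂²u/∂zⁱ∂z̄ʲ` at `p`: it represents `√-1 ∂∂̄u`, and is
also the mixed second covariant derivative `D D̄ u` for the Chern connection. -/
def levi (u : M → ℝ) (p : M) : Sesq n p :=
  ∑ i, ∑ j, wirtinger i (wirtingerBar j (inChart n u p)) (chartAt (Cn n) p p) •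
    sesq (coordCov p i) (coordCov p j)

/-- The Hermitian form of
`g̃ = χ(z,u) + √-1 a ∧ ∂̄u - √-1 ā ∧ ∂u + √-1 ∂∂̄u`, with components
`χᵢⱼ + aᵢ conj(uⱼ) + uᵢ conj(aⱼ) + uᵢⱼ`; see `toForm_gTilde`. -/
def gTilde (χ : FormFamily n M) (a : OneZeroForm n M) (u : M → ℝ) (p : M) : Sesq n p :=
  χ.form p (u p) + sesq (a.form p) (del n u p) + sesq (del n u p) (a.form p) + levi n u p

/-- `|Du|_ω`, where `|Du|² = ω^{m l̄} u_m conj(u_l)`. -/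
def normDel (Ω : HermitianMetric n M) (u : M → ℝ) (p : M) : ℝ :=
  let P := (formMatrix p (Ω.form p))⁻¹
  Real.sqrt (∑ l, ∑ m, P l m * del n u p (coordVec p m) *
    (starRingEnd ℂ) (del n u p (coordVec p l))).re

/-- `|D D̄ u|_ω`, where `|D D̄ u|² = ω^{i j̄} ω^{k l̄} u_{i l̄} conj(u_{j k̄})`. -/
def normLevi (Ω : HermitianMetric n M) (u : M → ℝ) (p : M) : ℝ :=
  let P := (formMatrix p (Ω.form p))⁻¹
  let U := formMatrix p (levi n u p)
  Real.sqrt (Matrix.trace (P * U * P * U.conjTranspose)).re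

/-- `u` is `χ̃`-plurisubharmonic: `g̃ > 0`. -/
def IsPsh (χ : FormFamily n M) (a : OneZeroForm n M) (u : M → ℝ) : Prop :=
  ∀ p : M, ∀ X : Tan n p, X ≠ 0 → 0 < (gTilde χ a u p X X).re

/-- The complex Hessian equation `g̃ᵏ ∧ ωⁿ⁻ᵏ = ψ(z, Du, u) ωⁿ`. -/
def IsSolution (k : ℕ) (Ω : HermitianMetric n M) (χ : FormFamily n M) (a : OneZeroForm n M)
    (ψ : PositiveRHS n M) (u : M → ℝ) : Prop :=
  ∀ p : M, toForm p (gTilde χ a u p) ^ k * toForm p (Ω.form p) ^ (n - k) =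
    ((ψ.toFun p (del n u p) (u p) : ℝ) : ℂ) • toForm p (Ω.form p) ^ n

/-- `χ(z, u) ≥ ε ω`. -/
def LowerBound (ε : ℝ) (Ω : HermitianMetric n M) (χ : FormFamily n M) (u : M → ℝ) : Prop :=
  ∀ p : M, ∀ X : Tan n p, ε * (Ω.form p X X).re ≤ (χ.form p (u p) X X).re

/-! ### The form represented by `gTilde` -/

lemma coordCov_coordVec (p : M) (i j : Fin n) :
    coordCov p i (coordVec p j) = if i = j then 1 else 0 := by
  change (EuclideanSpace.single j (1 : ℂ) : Cn n) i = _
  simp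

lemma sum_coordCov (p : M) (α : Tan n p →ₗ[ℂ] ℂ) :
    ∑ i, α (coordVec p i) • coordCov p i = α := by
  refine LinearMap.ext fun X => ?_
  have hX : X = ∑ i, coordCov p i X • coordVec p i := by
    have key : ∀ Y : Cn n, Y = ∑ i, Y i • (EuclideanSpace.single i (1 : ℂ) : Cn n) := by
      intro Y
      ext j
      simp [Finset.sum_apply, Pi.single_apply]
    exact key X
  conv_rhs => rw [hX]
  simp [LinearMap.sum_apply, mul_comm]

/-- `α ⊗ β̄` represents `√-1 α ∧ β̄`. -/
lemma toForm_sesq (p : M) (α β : Tan n p →ₗ[ℂ] ℂ) :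
    toForm p (sesq α β) =
      Complex.I • (ExteriorAlgebra.ι ℂ (cov10 α) * ExteriorAlgebra.ι ℂ (cov01 β)) := by
  have h1 : cov10 α = ∑ i, α (coordVec p i) • cov10 (coordCov p i) := by
    conv_lhs => rw [← sum_coordCov p α]
    ext X
    simp [cov10, LinearMap.sum_apply]
  have h2 : cov01 β = ∑ i, (starRingEnd ℂ) (β (coordVec p i)) • cov01 (coordCov p i) := by
    conv_lhs => rw [← sum_coordCov p β]
    ext X
    simp [cov01, LinearMap.sum_apply]
  rw [h1, h2]
  simp only [map_sum, map_smul, Finset.sum_mul_sum, smul_mul_smul_comm]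
  rfl

lemma toForm_add (p : M) (h h' : Sesq n p) : toForm p (h + h') = toForm p h + toForm p h' := by
  simp [toForm, add_smul, Finset.sum_add_distrib]

/-- `gTilde` represents `χ(z,u) + √-1 a ∧ ∂̄u - √-1 ā ∧ ∂u + √-1 ∂∂̄u`. -/
lemma toForm_gTilde (χ : FormFamily n M) (a : OneZeroForm n M) (u : M → ℝ) (p : M) :
    toForm p (gTilde χ a u p) =
      toForm p (χ.form p (u p))
      + Complex.I •
        (ExteriorAlgebra.ι ℂ (cov10 (a.form p)) * ExteriorAlgebra.ι ℂ (cov01 (del n u p)))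
      - Complex.I •
        (ExteriorAlgebra.ι ℂ (cov01 (a.form p)) * ExteriorAlgebra.ι ℂ (cov10 (del n u p)))
      + toForm p (levi n u p) := by
  have h : ExteriorAlgebra.ι ℂ (cov10 (del n u p)) * ExteriorAlgebra.ι ℂ (cov01 (a.form p)) =
      - (ExteriorAlgebra.ι ℂ (cov01 (a.form p)) * ExteriorAlgebra.ι ℂ (cov10 (del n u p))) :=
    eq_neg_of_add_eq_zero_left (ExteriorAlgebra.ι_add_mul_swap _ _)
  rw [gTilde, toForm_add, toForm_add, toForm_add, toForm_sesq, toForm_sesq, h]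
  simp [sub_eq_add_neg]

end HermitianHessian

end

/-!
# The second order estimate for complex Hessian equations with gradient terms

The proof is a maximum principle for the largest eigenvalue `λ` of `gTilde` with respect to the
metric, multiplied by `e^φ` with `φ = N |∂u|² + exp (B (K₀ - u))`. The largest eigenvalue need not be
differentiable, so it is not differentiated. At a maximum point `z` one considers instead the
Hermitian form `λ(z) e^{φ(z) - φ} Ω - gTilde`. It is nonnegative near `z` and has a zero at `z` in the
direction `o` of the largest eigenvalue. Testing it on vectors that rotate out of `o` gives the first
and second order conditions (`NonnegFamily.second_variation`, `LocalData.Regular.critical`,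
`LocalData.Regular.maximum`), including the good term that perturbation theory of a simple eigenvalue
would supply.

The equation is used in the form `log σ_k(λ) = log` of the right-hand side, where `σ_k` is read off as
a coefficient of `det (h + t g)` (`hessCoeff`), a polynomial in the entries that is differentiated
without diagonalizing `g` near the point. Its first and second derivatives are
`LocalData.Regular.equation_one` and `LocalData.Regular.equation_two`. The condition `gTilde > 0` enters
through `esym_strong_concavity`: for positive eigenvalues, `σ_k` bounded and `λ_o` large, the function
`log σ_k` is so concave in the direction `o` that the second derivative of the equation controls
`(1 - δ) F_o |∂_o g_oo|² / λ_o` with `F = ∂ log σ_k`, up to a small multiple of the other diagonal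
terms. Its source is the factorization `σ_k = σ_{k-1}(x|o) (x_o + q)` with
`q = σ_k(x|o) / σ_{k-1}(x|o)` concave and bounded.

Together with the off-diagonal terms of the concavity and the second variation of the eigenvalue this
absorbs all squares of third derivatives, and `∂_i λ = -λ ∂_i φ` to leading order turns what is left
into the inequality `phi_inequality` for `φ` alone, with an error `δ F_o |∂_o φ|²`. The remaining
third derivatives, linear ones that come from the gradient dependence of the equation and of `gTilde`,
combine into first derivatives of `φ` or cancel. The two parts of `φ` then finish the argument. The
gradient part gives half the weighted square norm `Z = ∑ F_i (|u_{mi}|² + |u_{m ī}|²)` of the second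
derivatives (`gradient_lower`), which is at least `λ / 4` up to a constant because `F_o λ_o ≥ 1 / 2`.
The exponential part, with `χ ≥ ε Ω`, gives a multiple of `∑ F_i` (`exponential_lower`). Choosing `N`,
then `B`, then `δ`, one obtains a bound for `λ` at the maximum (`top_le_of_rel`,
`LocalData.exists_top_le`). For `k = 1` no derivatives are needed: the trace of `gTilde` is bounded
and its eigenvalues are positive.

Everything above happens in a chart, in a constant frame that is orthonormal for the metric and
diagonalizes `gTilde` at the point. The top power of a form of degree two is `n!` times a determinant,
which translates the equation between exterior forms (`hessCoeff_of_toForm_eq`). Compactness enters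
twice. The manifold is covered by finitely many closed balls in charts, on which the jets of the given
data have uniform bounds (`exists_regular`), and the quotient of `gTilde` and the metric, times `e^φ`,
attains its maximum on the nonzero tangent vectors (`exists_max_quotient`). As `φ` is bounded, the
bound for `λ` at the maximum spreads to the whole manifold, and it bounds the complex Hessian because
all eigenvalues of `gTilde` are positive and the lower order terms of `gTilde` are bounded.
-/

noncomputable section

namespace HermitianHessian

set_option linter.unusedSectionVars false

open Finset

/-! ### Elementary symmetric functions on the positive orthant -/

/-- The elementary symmetric function `σ_k` of the values `x i`, `i ∈ s`. -/
def esym {ι : Type*} (s : Finset ι) (k : ℕ) (x : ι → ℝ) : ℝ :=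
  ∑ t ∈ s.powersetCard k, ∏ i ∈ t, x i

section Esym
variable {ι : Type*} [DecidableEq ι] {s : Finset ι} {k : ℕ} {x y : ι → ℝ}

lemma esym_zero (s : Finset ι) (x : ι → ℝ) : esym s 0 x = 1 := by simp [esym]

lemma esym_insert {p : ι} (hp : p ∉ s) (k : ℕ) (x : ι → ℝ) :
    esym (insert p s) (k + 1) x = esym s (k + 1) x + x p * esym s k x := by
  unfold esym
  rw [powersetCard_succ_insert hp, sum_union, mul_sum, sum_image]
  · congr 1
    refine sum_congr rfl fun t ht => ?_
    rw [prod_insert fun h => hp ((mem_powersetCard.1 ht).1 h)]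
  · intro t ht t' ht' h
    have h1 : p ∉ t := fun h => hp ((mem_powersetCard.1 ht).1 h)
    have h2 : p ∉ t' := fun h => hp ((mem_powersetCard.1 ht').1 h)
    simpa [erase_insert h1, erase_insert h2] using congrArg (fun u => u.erase p) h
  · rw [disjoint_left]
    intro t ht ht'
    obtain ⟨t', -, rfl⟩ := mem_image.1 ht'
    exact hp ((mem_powersetCard.1 ht).1 (mem_insert_self _ _))

lemma esym_erase {p : ι} (hp : p ∈ s) (k : ℕ) (x : ι → ℝ) :
    esym s (k + 1) x = esym (s.erase p) (k + 1) x + x p * esym (s.erase p) k x := by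
  conv_lhs => rw [← insert_erase hp]
  exact esym_insert (notMem_erase _ _) k x

lemma esym_nonneg (hx : ∀ i ∈ s, 0 ≤ x i) : 0 ≤ esym s k x :=
  sum_nonneg fun _ ht => prod_nonneg fun i hi => hx i ((mem_powersetCard.1 ht).1 hi)

lemma esym_pos (hx : ∀ i ∈ s, 0 < x i) (hk : k ≤ s.card) : 0 < esym s k x :=
  sum_pos (fun _ ht => prod_pos fun i hi => hx i ((mem_powersetCard.1 ht).1 hi))
    (powersetCard_nonempty.2 hk)

lemma esym_eq_zero (hk : s.card < k) : esym s k x = 0 := by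
  simp [esym, powersetCard_eq_empty.2 hk]

lemma sum_mul_esym_erase_eq (s : Finset ι) (k : ℕ) (x y : ι → ℝ) :
    ∑ i ∈ s, y i * esym (s.erase i) k x =
      ∑ t ∈ s.powersetCard (k + 1), ∑ i ∈ t, y i * ∏ j ∈ t.erase i, x j := by
  have h : ∀ i ∈ s, y i * esym (s.erase i) k x =
      ∑ t ∈ s.powersetCard (k + 1), if i ∈ t then y i * ∏ j ∈ t.erase i, x j else 0 := by
    intro i hi
    rw [← sum_filter, esym, mul_sum]
    symm
    refine sum_bij' (fun t _ => t.erase i) (fun t _ => insert i t) ?_ ?_ ?_ ?_ ?_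
    · intro t ht
      obtain ⟨h1, h2⟩ := mem_filter.1 ht
      obtain ⟨h3, h4⟩ := mem_powersetCard.1 h1
      exact mem_powersetCard.2 ⟨erase_subset_erase _ h3, by rw [card_erase_of_mem h2, h4]; rfl⟩
    · intro t ht
      obtain ⟨h3, h4⟩ := mem_powersetCard.1 ht
      have hit : i ∉ t := fun h => notMem_erase i s (h3 h)
      refine mem_filter.2 ⟨mem_powersetCard.2 ⟨?_, ?_⟩, mem_insert_self _ _⟩
      · exact insert_subset hi (h3.trans (erase_subset _ _))
      · rw [card_insert_of_notMem hit, h4]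
    · intro t ht
      exact insert_erase (mem_filter.1 ht).2
    · intro t ht
      have hit : i ∉ t := fun h => notMem_erase i s ((mem_powersetCard.1 ht).1 h)
      exact erase_insert hit
    · intro t ht
      rfl
  rw [sum_congr rfl h, sum_comm]
  refine sum_congr rfl fun t ht => ?_
  obtain ⟨h3, h4⟩ := mem_powersetCard.1 ht
  rw [← sum_filter]
  have : s.filter (· ∈ t) = t := by
    ext j; simp only [mem_filter]; exact ⟨fun h => h.2, fun h => ⟨h3 h, h⟩⟩
  rw [this]

/-- Euler's identity: `∑ x_i σ_k(x | i) = (k + 1) σ_{k+1}(x)`. -/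
lemma sum_mul_esym_erase (s : Finset ι) (k : ℕ) (x : ι → ℝ) :
    ∑ i ∈ s, x i * esym (s.erase i) k x = (k + 1) * esym s (k + 1) x := by
  rw [sum_mul_esym_erase_eq, esym, mul_sum]
  refine sum_congr rfl fun t ht => ?_
  rw [sum_congr rfl fun i hi => mul_prod_erase t x hi, sum_const, nsmul_eq_mul,
    (mem_powersetCard.1 ht).2]
  push_cast; ring

/-- The quotient `σ_{k+1} / σ_k`. -/
def equot (s : Finset ι) (k : ℕ) (x : ι → ℝ) : ℝ := esym s (k + 1) x / esym s k x

lemma equot_nonneg (hx : ∀ i ∈ s, 0 ≤ x i) : 0 ≤ equot s k x :=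
  div_nonneg (esym_nonneg hx) (esym_nonneg hx)

/-- The recursion that makes `σ_{k+1} / σ_k` a sum of harmonic means. -/
lemma equot_succ (hx : ∀ i ∈ s, 0 < x i) (hk : k + 1 ≤ s.card) :
    ((k : ℝ) + 2) * equot s (k + 1) x =
      ∑ i ∈ s, x i * equot (s.erase i) k x / (x i + equot (s.erase i) k x) := by
  have hA : 0 < esym s (k + 1) x := esym_pos hx hk
  have h := sum_mul_esym_erase s (k + 1) x
  have h1 : ((k : ℝ) + 2) * equot s (k + 1) x =
      ∑ i ∈ s, x i * esym (s.erase i) (k + 1) x / esym s (k + 1) x := by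
    rw [← sum_div, h, equot]; push_cast; ring
  rw [h1]
  refine sum_congr rfl fun i hi => ?_
  have hpos : ∀ j ∈ s.erase i, 0 < x j := fun j hj => hx j (mem_of_mem_erase hj)
  have hB : 0 < esym (s.erase i) k x := esym_pos hpos (by rw [card_erase_of_mem hi]; omega)
  have hq := equot_nonneg (k := k) fun j hj => (hpos j hj).le
  have hxi := hx i hi
  have e1 : esym (s.erase i) (k + 1) x = equot (s.erase i) k x * esym (s.erase i) k x := by
    rw [equot]; field_simp
  rw [esym_erase hi, e1]
  have : 0 < x i + equot (s.erase i) k x := by linarith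
  field_simp
  ring

/-- Half the harmonic mean is superadditive. -/
lemma parallel_add_le {a b a' b' : ℝ} (ha : 0 < a) (hb : 0 ≤ b) (ha' : 0 < a') (hb' : 0 ≤ b') :
    a * b / (a + b) + a' * b' / (a' + b') ≤ (a + a') * (b + b') / (a + a' + (b + b')) := by
  rw [div_add_div _ _ (by positivity) (by positivity), div_le_div_iff₀ (by positivity) (by positivity)]
  nlinarith [mul_nonneg (mul_nonneg ha.le ha'.le) (sq_nonneg (b - b')), sq_nonneg (a * b' - a' * b),
    sq_nonneg (a * b' - a' * b)]

lemma parallel_mono {a b b' : ℝ} (ha : 0 < a) (hb : 0 ≤ b) (h : b ≤ b') :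
    a * b / (a + b) ≤ a * b' / (a + b') := by
  rw [div_le_div_iff₀ (by positivity) (by linarith)]
  nlinarith [mul_nonneg ha.le (sub_nonneg.2 h), mul_nonneg (mul_nonneg ha.le ha.le) (sub_nonneg.2 h)]

lemma esym_smul (c : ℝ) : esym s k (fun i => c * x i) = c ^ k * esym s k x := by
  unfold esym
  rw [mul_sum]
  refine sum_congr rfl fun t ht => ?_
  rw [prod_mul_distrib, prod_const, (mem_powersetCard.1 ht).2]

lemma equot_smul {c : ℝ} (hc : 0 < c) : equot s k (fun i => c * x i) = c * equot s k x := by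
  rw [equot, equot, esym_smul, esym_smul]
  have : c ^ k ≠ 0 := by positivity
  rw [pow_succ]
  field_simp

/-- Superadditivity of `σ_{k+1} / σ_k` on the positive orthant; with homogeneity this is concavity. -/
lemma equot_superadditive (k : ℕ) : ∀ (s : Finset ι) (x y : ι → ℝ), (∀ i ∈ s, 0 < x i) →
    (∀ i ∈ s, 0 < y i) → k ≤ s.card →
    equot s k x + equot s k y ≤ equot s k (fun i => x i + y i) := by
  induction k with
  | zero =>
    intro s x y _ _ _
    have h1 : ∀ x : ι → ℝ, equot s 0 x = ∑ i ∈ s, x i := by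
      intro x
      simp [equot, esym, powersetCard_one]
    rw [h1, h1, h1, sum_add_distrib]
  | succ k ih =>
    intro s x y hx hy hk
    have hxy : ∀ i ∈ s, 0 < x i + y i := fun i hi => add_pos (hx i hi) (hy i hi)
    have e1 := equot_succ hx hk
    have e2 := equot_succ hy hk
    have e3 := equot_succ (x := fun i => x i + y i) hxy hk
    have hk2 : (0 : ℝ) < k + 2 := by positivity
    refine le_of_mul_le_mul_left ?_ hk2
    rw [mul_add, e1, e2, e3, ← sum_add_distrib]
    refine sum_le_sum fun i hi => ?_
    have px : ∀ j ∈ s.erase i, 0 < x j := fun j hj => hx j (mem_of_mem_erase hj)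
    have py : ∀ j ∈ s.erase i, 0 < y j := fun j hj => hy j (mem_of_mem_erase hj)
    have qx := equot_nonneg (k := k) fun j hj => (px j hj).le
    have qy := equot_nonneg (k := k) fun j hj => (py j hj).le
    refine (parallel_add_le (hx i hi) qx (hy i hi) qy).trans ?_
    exact parallel_mono (hxy i hi) (add_nonneg qx qy)
      (ih _ x y px py (by rw [card_erase_of_mem hi]; omega))

/-- Midpoint form of the concavity of `σ_{k+1} / σ_k`. -/
lemma equot_midpoint (hx : ∀ i ∈ s, 0 < x i) (hy : ∀ i ∈ s, 0 < y i) (hk : k ≤ s.card) :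
    equot s k x + equot s k y ≤ 2 * equot s k (fun i => (x i + y i) / 2) := by
  have h := equot_superadditive k s x y hx hy hk
  have e : (fun i => x i + y i) = fun i => 2 * ((x i + y i) / 2) := by ext i; ring
  rw [e, equot_smul two_pos] at h
  exact h

end Esym

section Esym
variable {ι : Type*} [DecidableEq ι] {s : Finset ι} {k : ℕ} {x y : ι → ℝ}

/-- Newton's inequality, in the form that `σ_{k+1} / σ_k` decreases in `k`. -/
lemma equot_succ_le (k : ℕ) : ∀ (s : Finset ι) (x : ι → ℝ), (∀ i ∈ s, 0 < x i) →
    equot s (k + 1) x ≤ equot s k x := by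
  induction k with
  | zero =>
    intro s x hx
    by_cases hk : 1 ≤ s.card
    · have h := equot_succ hx hk
      have h0 : equot s 0 x = ∑ i ∈ s, x i := by simp [equot, esym, powersetCard_one]
      have : ∑ i ∈ s, x i * equot (s.erase i) 0 x / (x i + equot (s.erase i) 0 x) ≤ ∑ i ∈ s, x i := by
        refine sum_le_sum fun i hi => ?_
        have hq := equot_nonneg (k := 0) fun j hj => (hx j (mem_of_mem_erase (a := i) hj)).le
        have hxi := hx i hi
        rw [div_le_iff₀ (by linarith)]
        nlinarith
      have h3 : 0 ≤ equot s 0 x := equot_nonneg fun i hi => (hx i hi).le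
      have h4 : 0 ≤ equot s (0 + 1) x := equot_nonneg fun i hi => (hx i hi).le
      rw [← h, ← h0] at this
      push_cast at this
      linarith
    · have : equot s (0 + 1) x = 0 := by rw [equot, esym_eq_zero (by omega), zero_div]
      rw [this]
      exact equot_nonneg fun i hi => (hx i hi).le
  | succ k ih =>
    intro s x hx
    by_cases hk : k + 2 ≤ s.card
    · have h := equot_succ hx hk
      have h' := equot_succ (k := k) hx (by omega)
      have : ∑ i ∈ s, x i * equot (s.erase i) (k + 1) x / (x i + equot (s.erase i) (k + 1) x) ≤
          ∑ i ∈ s, x i * equot (s.erase i) k x / (x i + equot (s.erase i) k x) := by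
        refine sum_le_sum fun i hi => ?_
        have px : ∀ j ∈ s.erase i, 0 < x j := fun j hj => hx j (mem_of_mem_erase hj)
        exact parallel_mono (hx i hi) (equot_nonneg fun j hj => (px j hj).le) (ih _ _ px)
      rw [← h, ← h'] at this
      have h4 : 0 ≤ equot s (k + 1 + 1) x := equot_nonneg fun i hi => (hx i hi).le
      push_cast at this
      nlinarith
    · have : equot s (k + 1 + 1) x = 0 := by rw [equot, esym_eq_zero (by omega), zero_div]
      rw [this]
      exact equot_nonneg fun i hi => (hx i hi).le

lemma newton_inequality (hx : ∀ i ∈ s, 0 < x i) (k : ℕ) :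
    esym s (k + 2) x * esym s k x ≤ esym s (k + 1) x ^ 2 := by
  by_cases hk : k + 1 ≤ s.card
  · have h := equot_succ_le k s x hx
    rw [equot, equot, div_le_div_iff₀ (esym_pos hx hk) (esym_pos hx (by omega))] at h
    linarith
  · rw [esym_eq_zero (k := k + 2) (by omega), zero_mul]
    positivity

/-- Midpoint form of the concavity of `log σ_k`. -/
lemma esym_mul_le_sq (k : ℕ) (hx : ∀ i ∈ s, 0 < x i) (hy : ∀ i ∈ s, 0 < y i) (hk : k ≤ s.card) :
    esym s k x * esym s k y ≤ esym s k (fun i => (x i + y i) / 2) ^ 2 := by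
  induction k with
  | zero => simp [esym_zero]
  | succ k ih =>
    have hm : ∀ i ∈ s, 0 < (x i + y i) / 2 := fun i hi => by linarith [hx i hi, hy i hi]
    have e : ∀ z : ι → ℝ, (∀ i ∈ s, 0 < z i) → esym s (k + 1) z = esym s k z * equot s k z := by
      intro z hz
      have := (esym_pos hz (show k ≤ s.card by omega)).ne'
      rw [equot]; field_simp
    have qx := equot_nonneg (k := k) fun j hj => (hx j hj).le
    have qy := equot_nonneg (k := k) fun j hj => (hy j hj).le
    have hq : equot s k x * equot s k y ≤ equot s k (fun i => (x i + y i) / 2) ^ 2 := by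
      have := equot_midpoint hx hy (show k ≤ s.card by omega)
      nlinarith [sq_nonneg (equot s k x - equot s k y)]
    have ih := ih (by omega)
    rw [e x hx, e y hy, e _ hm]
    calc _ = (esym s k x * esym s k y) * (equot s k x * equot s k y) := by ring
      _ ≤ _ := by
        rw [mul_pow]
        exact mul_le_mul ih hq (mul_nonneg qx qy) (by positivity)

lemma esym_mono_set {t : Finset ι} (h : t ⊆ s) (hx : ∀ i ∈ s, 0 ≤ x i) : esym t k x ≤ esym s k x :=
  sum_le_sum_of_subset_of_nonneg (powersetCard_mono h) fun _ ht _ =>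
    prod_nonneg fun i hi => hx i ((mem_powersetCard.1 ht).1 hi)

/-- If every `(k+1)`-subset contains a value at most `c`, then `σ_{k+1} ≤ |s| c σ_k`. -/
lemma esym_succ_le {c : ℝ} (hc : 0 ≤ c) (hx : ∀ i ∈ s, 0 ≤ x i)
    (h : ∀ t ⊆ s, t.card = k + 1 → ∃ i ∈ t, x i ≤ c) :
    esym s (k + 1) x ≤ s.card * c * esym s k x := by
  have h1 : esym s (k + 1) x ≤ ∑ i ∈ s, c * esym (s.erase i) k x := by
    rw [sum_mul_esym_erase_eq s k x fun _ => c, esym]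
    refine sum_le_sum fun t ht => ?_
    obtain ⟨h3, h4⟩ := mem_powersetCard.1 ht
    have hn : ∀ i, 0 ≤ ∏ j ∈ t.erase i, x j := fun i =>
      prod_nonneg fun j hj => hx j (h3 (mem_of_mem_erase hj))
    obtain ⟨i, hi, hic⟩ := h t h3 h4
    rw [← mul_prod_erase t x hi]
    exact (mul_le_mul_of_nonneg_right hic (hn i)).trans
      (single_le_sum (f := fun i => c * ∏ j ∈ t.erase i, x j) (fun j _ => mul_nonneg hc (hn j)) hi)
  refine h1.trans ?_
  have : ∑ i ∈ s, c * esym (s.erase i) k x ≤ ∑ i ∈ s, c * esym s k x :=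
    sum_le_sum fun i _ => mul_le_mul_of_nonneg_left (esym_mono_set (erase_subset _ _) hx) hc
  refine this.trans (le_of_eq ?_)
  rw [sum_const, nsmul_eq_mul]; ring

lemma exists_le_of_esym_le {c : ℝ} (hc : 1 ≤ c) (hx : ∀ i ∈ s, 0 < x i) (hS : esym s (k + 1) x ≤ c)
    {t : Finset ι} (ht : t ⊆ s) (htk : t.card = k + 1) : ∃ i ∈ t, x i ≤ c := by
  by_contra! hcon
  have h1 : ∏ i ∈ t, x i ≤ c :=
    (single_le_sum (f := fun t => ∏ i ∈ t, x i)
      (fun u hu => prod_nonneg fun i hi => (hx i ((mem_powersetCard.1 hu).1 hi)).le)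
      (mem_powersetCard.2 ⟨ht, htk⟩)).trans hS
  obtain ⟨i, hi⟩ : t.Nonempty := card_pos.1 (by omega)
  have h2 : 1 ≤ ∏ j ∈ t.erase i, x j :=
    Finset.one_le_prod fun j hj => (hc.trans (hcon j (mem_of_mem_erase hj)).le)
  rw [← mul_prod_erase t x hi] at h1
  nlinarith [hcon i hi]

lemma hasDerivAt_esym (x y : ι → ℝ) (s : Finset ι) : ∀ (k : ℕ) (r : ℝ),
    HasDerivAt (fun r => esym s (k + 1) fun i => x i + r * y i)
      (∑ p ∈ s, y p * esym (s.erase p) k fun i => x i + r * y i) r := by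
  induction s using Finset.induction_on with
  | empty =>
    intro k r
    have : (fun r : ℝ => esym (∅ : Finset ι) (k + 1) fun i => x i + r * y i) = fun _ => 0 := by
      ext r; exact esym_eq_zero (by simp)
    rw [this]; simpa using hasDerivAt_const r (0 : ℝ)
  | insert a s ha ih =>
    intro k r
    have e : (fun r : ℝ => esym (insert a s) (k + 1) fun i => x i + r * y i) =
        fun r => (esym s (k + 1) fun i => x i + r * y i) +
          (x a + r * y a) * esym s k fun i => x i + r * y i := by
      ext r; exact esym_insert ha k _
    rw [e, sum_insert ha, erase_insert ha]
    have hlin : HasDerivAt (fun r : ℝ => x a + r * y a) (y a) r := by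
      simpa using ((hasDerivAt_id r).mul_const (y a)).const_add (x a)
    have hset : ∀ p ∈ s, (insert a s).erase p = insert a (s.erase p) := by
      intro p hp
      rw [erase_insert_of_ne]; rintro rfl; exact ha hp
    have ha' : ∀ p, a ∉ s.erase p := fun p h => ha (mem_of_mem_erase h)
    cases k with
    | zero =>
      have h1 := (ih 0 r).add hlin
      simp only [esym_zero, mul_one] at h1 ⊢
      exact h1.congr_deriv (by ring)
    | succ k =>
      refine ((ih (k + 1) r).add (hlin.mul (ih k r))).congr_deriv ?_
      have : ∀ p ∈ s, y p * (esym ((insert a s).erase p) (k + 1) fun i => x i + r * y i) =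
          y p * (esym (s.erase p) (k + 1) fun i => x i + r * y i) +
          (x a + r * y a) * (y p * esym (s.erase p) k fun i => x i + r * y i) := by
        intro p hp
        rw [hset p hp, esym_insert (ha' p)]; ring
      rw [sum_congr rfl this, sum_add_distrib, ← mul_sum]
      ring

end Esym

/-- The necessary second-order condition at a local minimum. -/
lemma second_deriv_nonneg_of_isLocalMin {f f' : ℝ → ℝ} {c a : ℝ} (hmin : IsLocalMin f a)
    (h1 : ∀ᶠ t in nhds a, HasDerivAt f (f' t) t) (h2 : HasDerivAt f' c a) : 0 ≤ c := by
  by_contra! hc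
  have hf0 : f' a = 0 := hmin.hasDerivAt_eq_zero h1.self_of_nhds
  have hd : deriv f =ᶠ[nhds a] f' := h1.mono fun t ht => ht.deriv
  have hmax : IsLocalMin (fun t => - f t) a := by
    refine isLocalMin_of_deriv_deriv_pos ?_ ?_ ?_
    · have : deriv (fun t => - f t) =ᶠ[nhds a] fun t => - f' t :=
        h1.mono fun t ht => ht.fun_neg.deriv
      rw [this.deriv_eq, h2.fun_neg.deriv]; linarith
    · rw [h1.self_of_nhds.fun_neg.deriv, hf0, neg_zero]
    · exact h1.self_of_nhds.continuousAt.neg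
  have hconst : f =ᶠ[nhds a] fun _ => f a := by
    filter_upwards [hmin, hmax] with t h h'
    linarith
  have h3 : f' =ᶠ[nhds a] fun _ => 0 := by
    filter_upwards [h1, hconst.eventuallyEq_nhds] with t h h'
    rw [← h.deriv, h'.deriv_eq]; simp
  have := (h2.congr_of_eventuallyEq h3.symm).unique (hasDerivAt_const a (0 : ℝ))
  linarith

section Esym
variable {ι : Type*} [DecidableEq ι] {s : Finset ι} {k : ℕ} {x y : ι → ℝ}

lemma differentiable_esym (s : Finset ι) (k : ℕ) (x y : ι → ℝ) :
    Differentiable ℝ fun r : ℝ => esym s k fun i => x i + r * y i := by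
  cases k with
  | zero => simp only [esym_zero]; fun_prop
  | succ k => exact fun r => (hasDerivAt_esym x y s k r).differentiableAt

lemma hasDerivAt_mul_of_eq_zero {f g : ℝ → ℝ} {f' : ℝ} (hf : HasDerivAt f f' 0) (h0 : f 0 = 0)
    (hg : DifferentiableAt ℝ g 0) : HasDerivAt (fun r => f r * g r) (f' * g 0) 0 := by
  refine (hf.mul hg.hasDerivAt).congr_deriv ?_
  rw [h0]; ring

lemma hasDerivAt_comp_neg_zero {f : ℝ → ℝ} {f' r : ℝ} (hf : HasDerivAt f f' (-r)) :
    HasDerivAt (fun r => f (-r)) (-f') r := by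
  exact (hf.comp r (hasDerivAt_neg r)).congr_deriv (by ring)

/-- Second-order concavity of `log σ_{m+2}` along a line, from the factorization
`σ_{m+2} = σ_{m+1}(x|o) (x_o + q)`, where both `log σ_{m+1}(x|o)` and the quotient
`q = σ_{m+2}(x|o) / σ_{m+1}(x|o)` are concave functions of the variables other than `x_o`. -/
lemma esym_second_variation {m : ℕ} {o : ι} (ho : o ∈ s) (hk : m + 2 ≤ s.card)
    (hx : ∀ i ∈ s, 0 < x i) (y : ι → ℝ) :
    esym s (m + 2) x *
        (∑ p ∈ s, ∑ q ∈ s.erase p, esym ((s.erase p).erase q) m x * y p * y q) ≤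
      (∑ p ∈ s, esym (s.erase p) (m + 1) x * y p) ^ 2 -
      (esym (s.erase o) (m + 1) x * y o +
        ((∑ p ∈ s.erase o, y p * esym ((s.erase o).erase p) (m + 1) x) * esym (s.erase o) (m + 1) x
        - esym (s.erase o) (m + 2) x * ∑ p ∈ s.erase o, y p * esym ((s.erase o).erase p) m x)
          / esym (s.erase o) (m + 1) x) ^ 2 := by
  set t := s.erase o with ht
  have htc : m + 1 ≤ t.card := by rw [ht, card_erase_of_mem ho]; omega
  have hxt : ∀ i ∈ t, 0 < x i := fun i hi => hx i (mem_of_mem_erase hi)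
  set A : ℝ → ℝ := fun r => esym t (m + 1) fun i => x i + r * y i with hA
  set B : ℝ → ℝ := fun r => esym t (m + 2) fun i => x i + r * y i with hB
  set S : ℝ → ℝ := fun r => esym s (m + 2) fun i => x i + r * y i with hS
  set A' : ℝ → ℝ := fun r => ∑ p ∈ t, y p * esym (t.erase p) m fun i => x i + r * y i with hA'
  set B' : ℝ → ℝ := fun r => ∑ p ∈ t, y p * esym (t.erase p) (m + 1) fun i => x i + r * y i with hB'
  set S' : ℝ → ℝ := fun r => ∑ p ∈ s, y p * esym (s.erase p) (m + 1) fun i => x i + r * y i with hS'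
  set S'' : ℝ := ∑ p ∈ s, ∑ q ∈ s.erase p, esym ((s.erase p).erase q) m x * y p * y q with hS''
  have dA : ∀ r, HasDerivAt A (A' r) r := hasDerivAt_esym x y t m
  have dB : ∀ r, HasDerivAt B (B' r) r := hasDerivAt_esym x y t (m + 1)
  have dS : ∀ r, HasDerivAt S (S' r) r := hasDerivAt_esym x y s (m + 1)
  have dS' : HasDerivAt S' S'' 0 := by
    have := HasDerivAt.fun_sum (u := s) fun p _ => (hasDerivAt_esym x y (s.erase p) m 0).const_mul (y p)
    refine this.congr_deriv ?_
    rw [hS'']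
    refine sum_congr rfl fun p _ => ?_
    rw [mul_sum]
    refine sum_congr rfl fun q _ => ?_
    simp only [zero_mul, add_zero]; ring
  have ddA' : DifferentiableAt ℝ A' 0 := by
    apply DifferentiableAt.fun_sum
    exact fun p _ => ((differentiable_esym (t.erase p) m x y) 0).const_mul (y p)
  have ddB' : DifferentiableAt ℝ B' 0 := by
    apply DifferentiableAt.fun_sum
    exact fun p _ => ((differentiable_esym (t.erase p) (m + 1) x y) 0).const_mul (y p)
  have hA0 : 0 < A 0 := by simpa [hA] using esym_pos hxt htc
  have hpos : ∀ᶠ r in nhds (0 : ℝ), ∀ i ∈ s, 0 < x i + r * y i := by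
    refine (Filter.eventually_all_finset s).2 fun i hi => ?_
    have : ContinuousAt (fun r : ℝ => x i + r * y i) 0 := by fun_prop
    exact this.eventually_const_lt (by simpa using hx i hi)
  have htend : Filter.Tendsto (fun r : ℝ => -r) (nhds 0) (nhds 0) := by
    simpa using (continuous_neg (G := ℝ)).tendsto 0
  have hposn := htend.eventually hpos
  have Apos : ∀ r, (∀ i ∈ s, 0 < x i + r * y i) → 0 < A r := fun r h =>
    esym_pos (fun i hi => h i (mem_of_mem_erase hi)) htc
  set q : ℝ → ℝ := fun r => B r / A r with hq
  set q' : ℝ → ℝ := fun r => (B' r * A r - B r * A' r) / A r ^ 2 with hq'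
  have dq : ∀ r, 0 < A r → HasDerivAt q (q' r) r := fun r h => (dB r).div (dA r) h.ne'
  have ddq' : DifferentiableAt ℝ q' 0 :=
    ((ddB'.mul (dA 0).differentiableAt).sub ((dB 0).differentiableAt.mul ddA')).div
      ((dA 0).differentiableAt.pow 2) (by positivity)
  set D : ℝ → ℝ := fun r => r * y o + (q r - q (-r)) / 2 with hD
  set D' : ℝ → ℝ := fun r => y o + (q' r + q' (-r)) / 2 with hD'
  have dD : ∀ r, 0 < A r → 0 < A (-r) → HasDerivAt D (D' r) r := by
    intro r h h'
    have h1 := ((hasDerivAt_id r).mul_const (y o)).add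
      (((dq r h).sub (hasDerivAt_comp_neg_zero (dq (-r) h'))).div_const 2)
    refine h1.congr_deriv ?_
    simp only [hD']; ring
  have ddD' : DifferentiableAt ℝ D' 0 := by
    have h0 : DifferentiableAt ℝ (fun r => q' (-r)) 0 := by
      have := hasDerivAt_comp_neg_zero (f := q') (r := 0)
        (f' := deriv q' 0) (by rw [neg_zero]; exact ddq'.hasDerivAt)
      exact this.differentiableAt
    simp only [hD']
    exact (differentiableAt_const _).add ((ddq'.add h0).div_const 2)
  -- midpoint concavity of `log A` and of `q`, applied at `± r`, makes `0` a local minimum of `g`; the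
  -- claim is that the second derivative of `g` at `0` is nonnegative
  set g : ℝ → ℝ := fun r => A 0 ^ 2 * ((x o + q 0) ^ 2 - D r ^ 2) - S r * S (-r) with hg
  have hSfac : ∀ r, 0 < A r → S r = A r * (q r + (x o + r * y o)) := by
    intro r h
    have : S r = B r + (x o + r * y o) * A r := esym_erase ho (m + 1) _
    rw [this, hq]; field_simp
  have hD0 : D 0 = 0 := by simp [hD]
  have hmin : IsLocalMin g 0 := by
    have hg0 : g 0 = 0 := by
      simp only [hg, hD0, neg_zero, hSfac 0 hA0, zero_mul, add_zero]; ring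
    filter_upwards [hpos, hposn] with r h h'
    rw [hg0]
    have a1 := Apos r h
    have a2 := Apos _ h'
    have hAA : A r * A (-r) ≤ A 0 ^ 2 := by
      have := esym_mul_le_sq (s := t) (m + 1) (x := fun i => x i + r * y i)
        (y := fun i => x i + -r * y i) (fun i hi => h i (mem_of_mem_erase hi))
        (fun i hi => h' i (mem_of_mem_erase hi)) htc
      have e : (fun i => (x i + r * y i + (x i + -r * y i)) / 2) = fun i => x i + 0 * y i := by
        ext i; ring
      rw [e] at this
      exact this
    have hqq : q r + q (-r) ≤ 2 * q 0 := by
      have := equot_midpoint (s := t) (k := m + 1) (x := fun i => x i + r * y i)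
        (y := fun i => x i + -r * y i) (fun i hi => h i (mem_of_mem_erase hi))
        (fun i hi => h' i (mem_of_mem_erase hi)) htc
      have e : (fun i => (x i + r * y i + (x i + -r * y i)) / 2) = fun i => x i + 0 * y i := by
        ext i; ring
      rw [e] at this
      exact this
    have q1 : 0 ≤ q r := equot_nonneg fun i hi => (h i (mem_of_mem_erase hi)).le
    have q2 : 0 ≤ q (-r) := equot_nonneg fun i hi => (h' i (mem_of_mem_erase hi)).le
    have o1 := h o ho
    have o2 := h' o ho
    have hPP : (q r + (x o + r * y o)) * (q (-r) + (x o + -r * y o)) ≤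
        (x o + q 0) ^ 2 - D r ^ 2 := by
      simp only [hD]
      nlinarith [hx o ho]
    have hP0 : 0 ≤ (q r + (x o + r * y o)) * (q (-r) + (x o + -r * y o)) := by positivity
    have : S r * S (-r) ≤ A 0 ^ 2 * ((x o + q 0) ^ 2 - D r ^ 2) := by
      rw [hSfac r a1, hSfac _ a2]
      calc _ = (A r * A (-r)) * ((q r + (x o + r * y o)) * (q (-r) + (x o + -r * y o))) := by ring
        _ ≤ _ := mul_le_mul hAA hPP hP0 (by positivity)
    simp only [hg]; linarith
  have hgd : ∀ᶠ r in nhds (0 : ℝ),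
      HasDerivAt g (A 0 ^ 2 * (-(2 * (D r * D' r))) - (S' r * S (-r) - S r * S' (-r))) r := by
    filter_upwards [hpos, hposn] with r h h'
    have h1 := dD r (Apos r h) (Apos _ h')
    have h2 := (dS r).mul (hasDerivAt_comp_neg_zero (dS (-r)))
    have h3 := ((h1.pow 2).const_sub ((x o + q 0) ^ 2)).const_mul (A 0 ^ 2)
    refine (h3.sub h2).congr_deriv ?_
    push_cast; ring
  have hgdd : HasDerivAt
      (fun r => A 0 ^ 2 * (-(2 * (D r * D' r))) - (S' r * S (-r) - S r * S' (-r)))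
      (A 0 ^ 2 * (-(2 * (D' 0 * D' 0))) - ((S'' * S 0 - S' 0 * S' 0) - (S' 0 * S' 0 - S 0 * S''))) 0 := by
    have h1 := hasDerivAt_mul_of_eq_zero (dD 0 hA0 (by simpa using hA0)) hD0 ddD'
    have nS := hasDerivAt_comp_neg_zero (r := 0) (f := S) (by simpa using dS 0)
    have nS' := hasDerivAt_comp_neg_zero (r := 0) (f := S') (by simpa using dS')
    have h2 := ((h1.const_mul 2).neg.const_mul (A 0 ^ 2)).sub ((dS'.mul nS).sub ((dS 0).mul nS'))
    refine h2.congr_deriv ?_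
    simp only [neg_zero]; ring
  have key := second_deriv_nonneg_of_isLocalMin hmin hgd hgdd
  have z : (fun i => x i + 0 * y i) = x := by ext i; ring
  have eD : A 0 * D' 0 = esym t (m + 1) x * y o +
      ((∑ p ∈ t, y p * esym (t.erase p) (m + 1) x) * esym t (m + 1) x
        - esym t (m + 2) x * ∑ p ∈ t, y p * esym (t.erase p) m x) / esym t (m + 1) x := by
    have : D' 0 = y o + q' 0 := by simp only [hD', neg_zero]; ring
    rw [this]
    simp only [hq', hA, hB, hA', hB', z] at hA0 ⊢
    field_simp
  rw [← eD]
  have eS : S 0 = esym s (m + 2) x := by simp only [hS, z]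
  have eS' : S' 0 = ∑ p ∈ s, esym (s.erase p) (m + 1) x * y p := by
    simp only [hS', z]; exact sum_congr rfl fun _ _ => mul_comm _ _
  rw [← eS, ← eS']
  nlinarith

set_option maxHeartbeats 800000 in
/-- The strong concavity of `log σ_k` in the direction of the largest variable `x_o`: if `σ_k` is
bounded and `x_o` is large, then `-(log σ_k)''` controls `(1 - δ) ∂_o log σ_k · y_o² / x_o`, up to a
small multiple of `∑_{p ≠ o} ∂_p log σ_k · y_p² / x_o`. -/
theorem esym_strong_concavity {m : ℕ} {o : ι} (ho : o ∈ s) (hk : m + 2 ≤ s.card)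
    (hx : ∀ i ∈ s, 0 < x i) (hmax : ∀ i ∈ s, x i ≤ x o) {c δ : ℝ} (hc : 1 ≤ c)
    (hS : esym s (m + 2) x ≤ c) (hδ : 0 < δ) (hδ1 : δ ≤ 1)
    (hlarge : 4 * (s.card : ℝ) * (s.card * c) ≤ δ ^ 2 * x o) (y : ι → ℝ) :
    (∑ p ∈ s, ∑ q ∈ s.erase p, esym ((s.erase p).erase q) m x * y p * y q) / esym s (m + 2) x ≤
      (∑ p ∈ s, esym (s.erase p) (m + 1) x / esym s (m + 2) x * y p) ^ 2 -
      (1 - δ) * (esym (s.erase o) (m + 1) x / esym s (m + 2) x) * y o ^ 2 / x o +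
      δ / x o * ∑ p ∈ s.erase o, esym (s.erase p) (m + 1) x / esym s (m + 2) x * y p ^ 2 := by
  have main := esym_second_variation ho hk hx y
  set t := s.erase o with ht
  have htc : m + 1 ≤ t.card := by rw [ht, card_erase_of_mem ho]; omega
  have hxt : ∀ i ∈ t, 0 < x i := fun i hi => hx i (mem_of_mem_erase hi)
  have hxo := hx o ho
  set S := esym s (m + 2) x with hSdef
  set A := esym t (m + 1) x with hA
  set B := esym t (m + 2) x with hB
  have hSpos : 0 < S := esym_pos hx hk
  have hApos : 0 < A := esym_pos hxt htc
  have hBnn : 0 ≤ B := esym_nonneg fun i hi => (hxt i hi).le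
  set N : ℝ := (s.card : ℝ) with hN
  have hN1 : 1 ≤ N := by
    rw [hN]; exact_mod_cast (by omega : 1 ≤ s.card)
  have htN : (t.card : ℝ) ≤ N := by
    rw [hN]; exact_mod_cast card_le_card (erase_subset _ _)
  set κ := N * c with hκ
  have hκ1 : 1 ≤ κ := by nlinarith
  have hS_eq : S = A * x o + B := by
    have : S = B + x o * A := esym_erase ho (m + 1) x
    rw [this]; ring
  -- the quotient `q` is bounded, because some variable in each `(m+2)`-subset is
  have hBκ : B ≤ κ * A := by
    have := esym_succ_le (s := t) (k := m + 1) (x := x) (c := c) (by linarith)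
      (fun i hi => (hxt i hi).le) fun u hu huc =>
        exists_le_of_esym_le hc hx hS (hu.trans (erase_subset _ _)) huc
    refine this.trans (mul_le_mul_of_nonneg_right ?_ hApos.le)
    exact mul_le_mul_of_nonneg_right htN (by linarith)
  set cc : ι → ℝ := fun p => esym (t.erase p) (m + 1) x with hcc
  set b : ι → ℝ := fun p => esym (t.erase p) m x with hb
  have hcnn : ∀ p, 0 ≤ cc p := fun p => esym_nonneg fun i hi => (hxt i (mem_of_mem_erase hi)).le
  have hbnn : ∀ p, 0 ≤ b p := fun p => esym_nonneg fun i hi => (hxt i (mem_of_mem_erase hi)).le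
  have hcb : ∀ p ∈ t, cc p ≤ κ * b p := by
    intro p hp
    have := esym_succ_le (s := t.erase p) (k := m) (x := x) (c := c) (by linarith)
      (fun i hi => (hxt i (mem_of_mem_erase hi)).le) fun u hu huc => by
        have hou : o ∉ u := fun h => notMem_erase o s (mem_of_mem_erase (hu h))
        obtain ⟨i, hi, hic⟩ := exists_le_of_esym_le (k := m + 1) hc hx hS (t := insert o u)
          (insert_subset ho ((hu.trans (erase_subset _ _)).trans (erase_subset _ _)))
          (by rw [card_insert_of_notMem hou, huc])
        rcases mem_insert.1 hi with rfl | hi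
        · obtain ⟨j, hj⟩ : u.Nonempty := card_pos.1 (by omega)
          exact ⟨j, hj, (hmax j (mem_of_mem_erase (mem_of_mem_erase (hu hj)))).trans hic⟩
        · exact ⟨i, hi, hic⟩
    refine this.trans (mul_le_mul_of_nonneg_right ?_ (hbnn p))
    refine mul_le_mul_of_nonneg_right (le_trans ?_ htN) (by linarith)
    exact_mod_cast card_le_card (erase_subset _ _)
  have hlarge' : 4 * N * κ ≤ δ ^ 2 * x o := hlarge
  have hδ2 : δ ^ 2 ≤ δ := by nlinarith
  have hκN : κ ≤ N * κ := le_mul_of_one_le_left (by linarith) hN1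
  have hκx : 4 * κ ≤ δ * x o := by
    linarith [mul_le_mul_of_nonneg_right hδ2 hxo.le]
  have hκx' : 4 * κ ≤ x o := by
    linarith [mul_le_mul_of_nonneg_right hδ1 hxo.le]
  have hSA : S ≤ 2 * A * x o := by
    linarith [mul_le_mul_of_nonneg_right hκx' hApos.le, mul_nonneg hxo.le hApos.le]
  have hSA' : A * x o ≤ S := by linarith
  -- the derivative of the quotient
  set w : ι → ℝ := fun p => (cc p * A - B * b p) / A ^ 2 with hw
  set F : ι → ℝ := fun p => esym (s.erase p) (m + 1) x / S with hF
  have hw0 : ∀ p ∈ t, 0 ≤ w p ∧ w p ≤ 1 ∧ w p ≤ 2 * κ * F p := by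
    intro p hp
    have hps : p ∈ s := mem_of_mem_erase hp
    have hpo : o ≠ p := (ne_of_mem_erase hp).symm
    have eA : A = cc p + x p * b p := esym_erase hp m x
    have eB : B = esym (t.erase p) (m + 2) x + x p * cc p := esym_erase hp (m + 1) x
    have hnew : esym (t.erase p) (m + 2) x * b p ≤ cc p ^ 2 :=
      newton_inequality (fun i hi => hxt i (mem_of_mem_erase hi)) m
    have hdn : 0 ≤ esym (t.erase p) (m + 2) x :=
      esym_nonneg fun i hi => (hxt i (mem_of_mem_erase hi)).le
    have enum : cc p * A - B * b p = cc p ^ 2 - esym (t.erase p) (m + 2) x * b p := by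
      rw [eA, eB]; ring
    have hnum0 : 0 ≤ cc p * A - B * b p := by rw [enum]; linarith
    have hcA : cc p ≤ A := by
      rw [eA]; linarith [mul_nonneg (hxt p hp).le (hbnn p)]
    have hwle : w p ≤ cc p / A := by
      rw [hw]
      simp only
      rw [div_le_div_iff₀ (by positivity) hApos]
      have : 0 ≤ A * (B * b p) := mul_nonneg hApos.le (mul_nonneg hBnn (hbnn p))
      linarith
    refine ⟨div_nonneg hnum0 (by positivity), hwle.trans ?_, hwle.trans ?_⟩
    · rw [div_le_one hApos]; exact hcA
    · have hFp : x o * b p ≤ esym (s.erase p) (m + 1) x := by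
        have e : esym (s.erase p) (m + 1) x =
            esym ((s.erase p).erase o) (m + 1) x + x o * esym ((s.erase p).erase o) m x :=
          esym_erase (mem_erase.2 ⟨hpo, ho⟩) m x
        rw [erase_right_comm] at e
        rw [e]
        linarith [hcnn p]
      have hcb := hcb p hp
      rw [hF]
      simp only
      rw [← mul_div_assoc, div_le_div_iff₀ hApos hSpos]
      have h1 : cc p * S ≤ κ * b p * (2 * A * x o) :=
        mul_le_mul hcb hSA hSpos.le (mul_nonneg (by linarith) (hbnn p))
      have h2 : κ * (2 * A) * (x o * b p) ≤ κ * (2 * A) * esym (s.erase p) (m + 1) x :=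
        mul_le_mul_of_nonneg_left hFp (by positivity)
      linarith
  have hFnn : ∀ p, 0 ≤ F p := fun p =>
    div_nonneg (esym_nonneg fun i hi => (hx i (mem_of_mem_erase hi)).le) hSpos.le
  set Y := ∑ p ∈ t, w p * y p with hY
  have hYeq : ((∑ p ∈ t, y p * esym (t.erase p) (m + 1) x) * A
        - B * ∑ p ∈ t, y p * esym (t.erase p) m x) / A = A * Y := by
    rw [hY, mul_sum, sum_mul, mul_sum, ← sum_sub_distrib, sum_div]
    refine sum_congr rfl fun p _ => ?_
    simp only [hw, hcc, hb]
    field_simp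
  rw [hYeq] at main
  set G := ∑ p ∈ t, F p * y p ^ 2 with hG
  have hGnn : 0 ≤ G := sum_nonneg fun p _ => mul_nonneg (hFnn p) (sq_nonneg _)
  have hYsq : Y ^ 2 ≤ 2 * N * κ * G := by
    have h1 : Y ^ 2 ≤ (∑ p ∈ t, w p) * ∑ p ∈ t, w p * y p ^ 2 := by
      refine sum_sq_le_sum_mul_sum_of_sq_le_mul t (fun p hp => (hw0 p hp).1)
        (fun p hp => mul_nonneg (hw0 p hp).1 (sq_nonneg _)) fun p _ => le_of_eq (by ring)
    have h2 : ∑ p ∈ t, w p ≤ N := by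
      refine (sum_le_sum fun p hp => (hw0 p hp).2.1).trans ?_
      simpa using htN
    have h3 : ∑ p ∈ t, w p * y p ^ 2 ≤ 2 * κ * G := by
      rw [hG, mul_sum]
      refine sum_le_sum fun p hp => ?_
      have := mul_le_mul_of_nonneg_right (hw0 p hp).2.2 (sq_nonneg (y p))
      linarith
    have h4 : 0 ≤ ∑ p ∈ t, w p * y p ^ 2 :=
      sum_nonneg fun p hp => mul_nonneg (hw0 p hp).1 (sq_nonneg _)
    calc Y ^ 2 ≤ N * (2 * κ * G) := h1.trans (mul_le_mul h2 h3 h4 (by linarith))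
      _ = _ := by ring
  have hsumF : ∑ p ∈ s, esym (s.erase p) (m + 1) x * y p = S * ∑ p ∈ s, F p * y p := by
    rw [mul_sum]; refine sum_congr rfl fun p _ => ?_
    simp only [hF]; field_simp
  rw [hsumF] at main
  have hFo : F o = A / S := rfl
  set P := ∑ p ∈ s, F p * y p with hP
  have hgoal : (∑ p ∈ s, ∑ q ∈ s.erase p, esym ((s.erase p).erase q) m x * y p * y q) / S ≤
      P ^ 2 - (F o * (y o + Y)) ^ 2 := by
    rw [div_le_iff₀ hSpos]
    have : (P ^ 2 - (F o * (y o + Y)) ^ 2) * S = ((S * P) ^ 2 - (A * y o + A * Y) ^ 2) / S := by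
      rw [hFo]; field_simp
    rw [this, le_div_iff₀ hSpos]
    linarith
  refine hgoal.trans ?_
  change P ^ 2 - (F o * (y o + Y)) ^ 2 ≤ P ^ 2 - (1 - δ) * F o * y o ^ 2 / x o + δ / x o * G
  have hFox : F o ≤ 1 / x o := by
    rw [hFo, div_le_div_iff₀ hSpos hxo]; linarith
  have hFox' : (1 - δ / 2) / x o ≤ F o := by
    rw [hFo, div_le_div_iff₀ hxo hSpos, hS_eq]
    linarith [mul_le_mul_of_nonneg_right hκx hApos.le, mul_nonneg hδ.le hBnn]
  have hsq : (1 - δ / 2) * y o ^ 2 - 2 / δ * Y ^ 2 ≤ (y o + Y) ^ 2 := by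
    have : (y o + Y) ^ 2 - ((1 - δ / 2) * y o ^ 2 - 2 / δ * Y ^ 2) =
        (δ * y o + 2 * Y) ^ 2 / (2 * δ) + Y ^ 2 := by field_simp; ring
    have : 0 ≤ (δ * y o + 2 * Y) ^ 2 / (2 * δ) + Y ^ 2 := by positivity
    linarith
  have h1 : (1 - δ) * F o * y o ^ 2 / x o ≤ F o ^ 2 * ((1 - δ / 2) * y o ^ 2) := by
    have h2 : (1 - δ) / x o ≤ F o * (1 - δ / 2) := by
      have : (1 - δ / 2) / x o * (1 - δ / 2) ≤ F o * (1 - δ / 2) :=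
        mul_le_mul_of_nonneg_right hFox' (by linarith)
      refine le_trans ?_ this
      rw [div_mul_eq_mul_div]
      gcongr
      nlinarith
    calc _ = (1 - δ) / x o * (F o * y o ^ 2) := by ring
      _ ≤ F o * (1 - δ / 2) * (F o * y o ^ 2) :=
        mul_le_mul_of_nonneg_right h2 (mul_nonneg (hFnn o) (sq_nonneg _))
      _ = _ := by ring
  have h2 : F o ^ 2 * (2 / δ * Y ^ 2) ≤ δ / x o * G := by
    have h3 : F o ^ 2 ≤ (1 / x o) ^ 2 := pow_le_pow_left₀ (hFnn o) hFox 2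
    calc _ ≤ (1 / x o) ^ 2 * (2 / δ * (2 * N * κ * G)) := by gcongr
      _ = (4 * N * κ) * (G / (δ * x o ^ 2)) := by field_simp; ring
      _ ≤ (δ ^ 2 * x o) * (G / (δ * x o ^ 2)) := by gcongr
      _ = _ := by field_simp
  have h3 := mul_le_mul_of_nonneg_left hsq (sq_nonneg (F o))
  rw [mul_pow]
  linarith

end Esym

/-! ### The algebra at a maximum point -/

lemma sq_sub_le_of_sub_le {x y c : ℝ} (hx : 0 ≤ x) (hy : 0 ≤ y) (hc : 0 ≤ c) (h : x - c ≤ y) :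
    x ^ 2 - 2 * c * x ≤ y ^ 2 := by
  rcases le_total x c with h1 | h1
  · nlinarith
  · nlinarith

/-- The derivatives at a maximum point of the test function, in an orthonormal frame that
diagonalizes `g`, with `o` the direction of the largest eigenvalue. Here `F p = ∂_p log σ_k`,
`s p = σ_{k-2}(λ|op) / σ_k`, `u2 m i = ∂_i ∂_m u`, `b m i = ∂̄_i ∂_m u`, `T p q i = ∂_i g_{pq}`,
`H p q i = ∂_i h_{pq}`, `U3 i m = ∂̄_i ∂_i ∂_m u`, `gOO i = ∂̄_i ∂_i g_{oo}`, `gDD i = ∂̄_o ∂_o g_{ii}`,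
`φ1 i = ∂_i φ` and `φ2 i = ∂̄_i ∂_i φ`; `l` is the derivative of the right-hand side in the gradient
variable and `a` the given `(1,0)`-form. -/
structure MaxPointData (n : ℕ) where
  /-- the direction of the largest eigenvalue -/
  o : Fin n
  /-- the eigenvalues of `g` -/
  lam : Fin n → ℝ
  /-- the derivatives of `log σ_k` at the eigenvalues -/
  F : Fin n → ℝ
  /-- the quotients `σ_{k-2}(λ|op) / σ_k` -/
  s : Fin n → ℝ
  /-- the pure second derivatives of `u` -/
  u2 : Fin n → Fin n → ℂ
  /-- the mixed second derivatives of `u` -/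
  b : Fin n → Fin n → ℂ
  /-- the derivatives of `g` -/
  T : Fin n → Fin n → Fin n → ℂ
  /-- the derivatives of the metric -/
  H : Fin n → Fin n → Fin n → ℂ
  /-- the third derivatives of `u` of type `∂̄_i ∂_i ∂_m` -/
  U3 : Fin n → Fin n → ℂ
  /-- the gradient derivative of the right-hand side -/
  l : Fin n → ℂ
  /-- the components of the `(1,0)`-form -/
  a : Fin n → ℂ
  /-- `∂̄_i ∂_i g_{oo}` -/
  gOO : Fin n → ℝ
  /-- `∂̄_o ∂_o g_{ii}` -/
  gDD : Fin n → ℝ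
  /-- `∂_i φ` -/
  φ1 : Fin n → ℂ
  /-- `∂̄_i ∂_i φ` -/
  φ2 : Fin n → ℝ

namespace MaxPointData
variable {n : ℕ} (D : MaxPointData n)

/-- The largest eigenvalue. -/
def top : ℝ := D.lam D.o

/-- The size of the second derivatives that the right-hand side produces. -/
def W : ℝ := D.top + (∑ q, ‖D.u2 q D.o‖ ^ 2) / D.top

/-- The relations between the derivatives at a maximum point, with a constant `K` that controls the
geometry and a small `δ` from the strong concavity of `log σ_k`. -/
structure Rel (K δ : ℝ) : Prop where
  one_le : 1 ≤ D.top
  F_pos : ∀ i, 0 < D.F i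
  F_top_le : ∀ i, D.F D.o ≤ D.F i
  s_nonneg : ∀ p, 0 ≤ D.s p
  s_le : ∀ p, p ≠ D.o → D.top * D.s p ≤ D.F p
  le_s : ∀ p, p ≠ D.o → D.F p ≤ D.F D.o + D.top * D.s p
  u2_symm : ∀ p q, D.u2 p q = D.u2 q p
  b_le : ∀ p q, ‖D.b p q‖ ≤ K * D.top
  H_le : ∀ p q i, ‖D.H p q i‖ ≤ K
  l_le : ∀ q, ‖D.l q‖ ≤ K
  a_le : ∀ q, ‖D.a q‖ ≤ K
  torsion : ∀ p q i, ‖D.T p q i - D.T i q p‖ ≤ K * D.top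
  critical : ∀ i, D.T D.o D.o i = D.top * (D.H D.o D.o i - D.φ1 i)
  maximum : ∀ i, D.gOO i ≤
    D.top * (‖D.φ1 i‖ ^ 2 - D.φ2 i + K * ‖D.φ1 i‖ + K) -
      (1 / D.top) * ∑ p ∈ univ.erase D.o, (‖D.T D.o p i - D.top * D.H D.o p i‖ ^ 2 +
        ‖D.T p D.o i - D.top * D.H p D.o i‖ ^ 2)
  equation_two :
    2 * (∑ q, D.l q * D.U3 D.o q).re - K * (1 + D.top ^ 2 + ∑ q, ‖D.u2 q D.o‖ ^ 2) +
      ((1 - δ) * D.F D.o * ‖D.T D.o D.o D.o‖ ^ 2 / D.top -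
        δ / D.top * (∑ p ∈ univ.erase D.o, D.F p * ‖D.T p p D.o‖ ^ 2) -
        ‖∑ p, (D.F p : ℂ) * D.T p p D.o‖ ^ 2) +
      (∑ p ∈ univ.erase D.o, D.s p * ‖D.T p D.o D.o‖ ^ 2) -
      K * (∑ p, ∑ q, D.F p * ‖D.T p q D.o‖) - K ≤ ∑ p, D.F p * D.gDD p
  equation_one : ∀ m, ‖(∑ i, (D.F i : ℂ) * D.T i i m) -
    ∑ q, (D.l q * D.u2 q m + (starRingEnd ℂ) (D.l q) * D.b m q)‖ ≤ K
  third : ∀ i m, ‖D.U3 i m - D.T i i m‖ ≤ K * (1 + ‖D.b i m‖ + ‖D.u2 i m‖)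
  commute : ∀ i, D.gDD i ≤ D.gOO i - 2 * (D.a D.o * (starRingEnd ℂ) (D.U3 i D.o)).re +
    2 * (D.a i * (starRingEnd ℂ) (D.U3 D.o i)).re + K * (D.top + ‖D.u2 D.o i‖)

variable {D} {K δ : ℝ}

namespace Rel

lemma top_pos (h : D.Rel K δ) : 0 < D.top := by linarith [h.one_le]

lemma top_le_W (h : D.Rel K δ) : D.top ≤ D.W := by
  have := h.top_pos
  have : 0 ≤ (∑ q, ‖D.u2 q D.o‖ ^ 2) / D.top := by positivity
  unfold W; linarith

lemma top_mul_W (h : D.Rel K δ) : D.top * D.W = D.top ^ 2 + ∑ q, ‖D.u2 q D.o‖ ^ 2 := by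
  have := h.top_pos.ne'
  unfold W; field_simp

lemma norm_u2_le_W (h : D.Rel K δ) (q : Fin n) : ‖D.u2 q D.o‖ ≤ D.W := by
  have h1 := h.top_pos
  have h2 := h.top_mul_W
  have h3 : ‖D.u2 q D.o‖ ^ 2 ≤ ∑ q, ‖D.u2 q D.o‖ ^ 2 :=
    single_le_sum (f := fun q => ‖D.u2 q D.o‖ ^ 2) (fun i _ => sq_nonneg _) (mem_univ q)
  refine le_of_mul_le_mul_left ?_ h1
  nlinarith [sq_nonneg (D.top - ‖D.u2 q D.o‖), norm_nonneg (D.u2 q D.o)]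

lemma norm_T_top (h : D.Rel K δ) (i : Fin n) :
    ‖D.T D.o D.o i‖ ≤ D.top * (K + ‖D.φ1 i‖) := by
  rw [h.critical, norm_mul, Complex.norm_real, Real.norm_of_nonneg h.top_pos.le]
  exact mul_le_mul_of_nonneg_left ((norm_sub_le _ _).trans (by linarith [h.H_le D.o D.o i]))
    h.top_pos.le

lemma norm_third_top (h : D.Rel K δ) (hK : 1 ≤ K) (i m : Fin n) :
    ‖D.U3 i m - D.T i i m‖ ≤ K * (2 * K * D.top + ‖D.u2 i m‖) := by
  refine (h.third i m).trans (mul_le_mul_of_nonneg_left ?_ (by linarith))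
  nlinarith [h.b_le i m, h.one_le]

lemma gradient_term (h : D.Rel K δ) (hK : 1 ≤ K) :
    - (2 * D.top * (∑ q, D.l q * D.φ1 q).re) - 8 * n * K ^ 3 * D.W ≤
      2 * (∑ q, D.l q * D.U3 D.o q).re := by
  have h1 : ∀ q, - (2 * D.top * (D.l q * D.φ1 q).re) - 8 * K ^ 3 * D.W ≤
      2 * (D.l q * D.U3 D.o q).re := by
    intro q
    have e : D.l q * D.U3 D.o q = - (D.top * (D.l q * D.φ1 q)) +
        D.l q * (D.top * D.H D.o D.o q + (D.U3 D.o q - D.T D.o D.o q)) := by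
      rw [h.critical q]; ring
    have h2 : ‖D.l q * (D.top * D.H D.o D.o q + (D.U3 D.o q - D.T D.o D.o q))‖ ≤
        K * (D.W * K + K * (2 * K * D.W + D.W)) := by
      rw [norm_mul]
      refine mul_le_mul (h.l_le q) ?_ (norm_nonneg _) (by linarith)
      refine (norm_add_le _ _).trans (add_le_add ?_ ?_)
      · rw [norm_mul, Complex.norm_real, Real.norm_of_nonneg h.top_pos.le]
        exact mul_le_mul h.top_le_W (h.H_le _ _ _) (norm_nonneg _)
          (h.top_pos.le.trans h.top_le_W)
      · refine (h.norm_third_top hK D.o q).trans (mul_le_mul_of_nonneg_left ?_ (by linarith))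
        rw [h.u2_symm]
        have := h.norm_u2_le_W q
        have := mul_le_mul_of_nonneg_left h.top_le_W (by linarith : 0 ≤ 2 * K)
        linarith
    have h3 := (abs_le.1 (Complex.abs_re_le_norm
      (D.l q * (D.top * D.H D.o D.o q + (D.U3 D.o q - D.T D.o D.o q))))).1
    rw [e, Complex.add_re, Complex.neg_re, Complex.re_ofReal_mul]
    have hW : 0 ≤ D.W := h.top_pos.le.trans h.top_le_W
    have hKW : K ^ 2 * D.W ≤ K ^ 3 * D.W :=
      mul_le_mul_of_nonneg_right (pow_le_pow_right₀ hK (by norm_num)) hW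
    nlinarith
  have h4 := sum_le_sum fun q (_ : q ∈ univ) => h1 q
  simp only [sum_sub_distrib, sum_neg_distrib, ← mul_sum, sum_const, card_univ,
    Fintype.card_fin, nsmul_eq_mul] at h4
  rw [Complex.re_sum, Complex.re_sum]
  linarith

lemma norm_trace_le (h : D.Rel K δ) (m : Fin n) : ‖∑ i, (D.F i : ℂ) * D.T i i m‖ ≤
    K + n * K ^ 2 * D.top + K * ∑ q, ‖D.u2 q m‖ := by
  have h1 : ‖∑ q, (D.l q * D.u2 q m + (starRingEnd ℂ) (D.l q) * D.b m q)‖ ≤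
      ∑ q, (K * ‖D.u2 q m‖ + K * (K * D.top)) := by
    refine (norm_sum_le _ _).trans (sum_le_sum fun q _ => (norm_add_le _ _).trans ?_)
    have hK : 0 ≤ K := (norm_nonneg _).trans (h.l_le q)
    rw [norm_mul, norm_mul, RCLike.norm_conj]
    exact add_le_add (mul_le_mul_of_nonneg_right (h.l_le q) (norm_nonneg _))
      (mul_le_mul (h.l_le q) (h.b_le m q) (norm_nonneg _) hK)
  rw [sum_add_distrib (f := fun q => K * ‖D.u2 q m‖), ← mul_sum, sum_const, card_univ,
    Fintype.card_fin, nsmul_eq_mul] at h1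
  have h2 := norm_sub_norm_le (∑ i, (D.F i : ℂ) * D.T i i m)
    (∑ q, (D.l q * D.u2 q m + (starRingEnd ℂ) (D.l q) * D.b m q))
  have h3 := h.equation_one m
  nlinarith

lemma norm_trace_top_sq_le (h : D.Rel K δ) (hK : 1 ≤ K) :
    ‖∑ i, (D.F i : ℂ) * D.T i i D.o‖ ^ 2 ≤ 8 * n ^ 2 * K ^ 4 * (D.top * D.W) := by
  have hn : (1 : ℝ) ≤ n := by exact_mod_cast (Fin.pos D.o)
  have h1 := h.norm_trace_le D.o
  have hcs : (∑ q, ‖D.u2 q D.o‖) ^ 2 ≤ n * ∑ q, ‖D.u2 q D.o‖ ^ 2 := by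
    simpa using sq_sum_le_card_mul_sum_sq (s := univ) (f := fun q => ‖D.u2 q D.o‖)
  have hK2 : K ≤ n * K ^ 2 * D.top := by
    have : K * 1 ≤ K * (K * (n * D.top)) := by
      refine mul_le_mul_of_nonneg_left ?_ (by linarith)
      have := one_le_mul_of_one_le_of_one_le hn h.one_le
      exact one_le_mul_of_one_le_of_one_le hK this
    nlinarith
  set y := ∑ q, ‖D.u2 q D.o‖ with hy
  set Y := ∑ q, ‖D.u2 q D.o‖ ^ 2 with hY
  have hy0 : 0 ≤ y := sum_nonneg fun q _ => norm_nonneg _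
  have hY0 : 0 ≤ Y := sum_nonneg fun q _ => sq_nonneg _
  rw [h.top_mul_W, ← hY]
  have h2 : ‖∑ i, (D.F i : ℂ) * D.T i i D.o‖ ≤ 2 * (n * K ^ 2 * D.top) + K * y := by linarith
  have h3 := pow_le_pow_left₀ (norm_nonneg _) h2 2
  have h4 : (2 * (n * K ^ 2 * D.top) + K * y) ^ 2 ≤
      2 * (2 * (n * K ^ 2 * D.top)) ^ 2 + 2 * (K * y) ^ 2 := by
    nlinarith [sq_nonneg (2 * (n * K ^ 2 * D.top) - K * y)]
  have h5 : 2 * (K * y) ^ 2 ≤ 8 * n ^ 2 * K ^ 4 * Y := by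
    have e1 : K ^ 2 ≤ K ^ 4 := pow_le_pow_right₀ hK (by norm_num)
    have e2 : (n : ℝ) ≤ n ^ 2 := by nlinarith
    calc 2 * (K * y) ^ 2 = 2 * (K ^ 2 * y ^ 2) := by ring
      _ ≤ 2 * (K ^ 4 * (n ^ 2 * Y)) := by
        have : y ^ 2 ≤ n ^ 2 * Y := hcs.trans (mul_le_mul_of_nonneg_right e2 hY0)
        have := mul_le_mul e1 this (sq_nonneg y) (by positivity)
        linarith
      _ ≤ _ := by nlinarith [mul_nonneg (mul_nonneg (sq_nonneg (n : ℝ)) (by positivity : 0 ≤ K ^ 4)) hY0]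
  calc _ ≤ _ := h3.trans h4
    _ ≤ 2 * (2 * (n * K ^ 2 * D.top)) ^ 2 + 8 * n ^ 2 * K ^ 4 * Y := by linarith
    _ = _ := by ring

/-- The commutation error, after summation against `F`. -/
lemma sum_gDD_le (h : D.Rel K δ) (hK : 1 ≤ K) :
    ∑ i, D.F i * D.gDD i ≤ ∑ i, D.F i * D.gOO i + D.top * (6 * n * K ^ 3 * D.W +
      11 * K ^ 3 * ∑ i, D.F i + 2 * K * ∑ i, D.F i * ‖D.φ1 i‖ +
      5 * K ^ 2 * ((∑ i, D.F i * ‖D.u2 D.o i‖) / D.top)) := by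
  have hn : (1 : ℝ) ≤ n := by exact_mod_cast (Fin.pos D.o)
  have ht := h.top_pos
  have hW : 0 ≤ D.W := h.top_pos.le.trans h.top_le_W
  -- the part with `U3 i o` is traced before it is estimated
  have h1 : ∀ i, D.F i * D.gDD i ≤ D.F i * D.gOO i
      - 2 * (D.a D.o * (starRingEnd ℂ) ((D.F i : ℂ) * D.U3 i D.o)).re +
      D.F i * (2 * K * (D.top * (K + ‖D.φ1 i‖) + K * (2 * K * D.top + ‖D.u2 D.o i‖))
        + K * (D.top + ‖D.u2 D.o i‖)) := by
    intro i
    have e : (D.a D.o * (starRingEnd ℂ) ((D.F i : ℂ) * D.U3 i D.o)).re =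
        D.F i * (D.a D.o * (starRingEnd ℂ) (D.U3 i D.o)).re := by
      rw [map_mul, Complex.conj_ofReal, mul_left_comm, Complex.re_ofReal_mul]
    rw [e]
    have h2 : 2 * (D.a i * (starRingEnd ℂ) (D.U3 D.o i)).re ≤
        2 * K * (D.top * (K + ‖D.φ1 i‖) + K * (2 * K * D.top + ‖D.u2 D.o i‖)) := by
      have h3 : ‖D.U3 D.o i‖ ≤ D.top * (K + ‖D.φ1 i‖) + K * (2 * K * D.top + ‖D.u2 D.o i‖) := by
        have e1 := norm_sub_norm_le (D.U3 D.o i) (D.T D.o D.o i)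
        have e2 := h.norm_third_top hK D.o i
        have e3 := h.norm_T_top i
        linarith
      have h4 := Complex.re_le_norm (D.a i * (starRingEnd ℂ) (D.U3 D.o i))
      rw [norm_mul, RCLike.norm_conj] at h4
      have h5 := mul_le_mul (h.a_le i) h3 (norm_nonneg _) (by linarith : 0 ≤ K)
      linarith
    have h6 := h.commute i
    have := mul_le_mul_of_nonneg_left (h6.trans (add_le_add_left (add_le_add_right h2 _) _)) (h.F_pos i).le
    linarith
  have h2 := sum_le_sum fun i (_ : i ∈ univ) => h1 i
  refine h2.trans ?_
  rw [sum_add_distrib, sum_sub_distrib]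
  have h3 : - (∑ i, 2 * (D.a D.o * (starRingEnd ℂ) ((D.F i : ℂ) * D.U3 i D.o)).re) ≤
      2 * K * (3 * n * K ^ 2 * D.W + ∑ i, D.F i * (K * (2 * K * D.top + ‖D.u2 D.o i‖))) := by
    rw [← mul_sum, ← Complex.re_sum, ← mul_sum, ← map_sum]
    have e1 : ‖∑ i, (D.F i : ℂ) * D.U3 i D.o‖ ≤
        3 * n * K ^ 2 * D.W + ∑ i, D.F i * (K * (2 * K * D.top + ‖D.u2 D.o i‖)) := by
      have e : ∑ i, (D.F i : ℂ) * D.U3 i D.o = ∑ i, (D.F i : ℂ) * D.T i i D.o +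
          ∑ i, (D.F i : ℂ) * (D.U3 i D.o - D.T i i D.o) := by
        rw [← sum_add_distrib]; exact sum_congr rfl fun i _ => by ring
      rw [e]
      refine (norm_add_le _ _).trans (add_le_add ?_ ?_)
      · refine (h.norm_trace_le D.o).trans ?_
        have s1 : ∑ q, ‖D.u2 q D.o‖ ≤ n * D.W := by
          refine (sum_le_sum fun q _ => h.norm_u2_le_W q).trans ?_
          simp
        have s2 : K * ∑ q, ‖D.u2 q D.o‖ ≤ K * (n * D.W) := mul_le_mul_of_nonneg_left s1 (by linarith)
        have s3 : (n : ℝ) * K ^ 2 * D.top ≤ n * K ^ 2 * D.W :=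
          mul_le_mul_of_nonneg_left h.top_le_W (by positivity)
        have s4 : K * (n * D.W) ≤ n * K ^ 2 * D.W := by
          have : K * (n * D.W) ≤ K * (K * (n * D.W)) := mul_le_mul_of_nonneg_left
            (le_mul_of_one_le_left (by positivity) hK) (by linarith)
          linarith
        have s5 : K ≤ K * (n * D.W) :=
          le_mul_of_one_le_right (by linarith)
            (one_le_mul_of_one_le_of_one_le hn (h.one_le.trans h.top_le_W))
        linarith
      · refine (norm_sum_le _ _).trans (sum_le_sum fun i _ => ?_)
        rw [norm_mul, Complex.norm_real, Real.norm_of_nonneg (h.F_pos i).le]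
        have := h.norm_third_top hK i D.o
        rw [h.u2_symm i] at this
        exact mul_le_mul_of_nonneg_left this (h.F_pos i).le
    have e2 := (abs_le.1 (Complex.abs_re_le_norm
      (D.a D.o * (starRingEnd ℂ) (∑ i, (D.F i : ℂ) * D.U3 i D.o)))).1
    rw [norm_mul, RCLike.norm_conj] at e2
    have e3 := mul_le_mul (h.a_le D.o) e1 (norm_nonneg _) (by linarith : 0 ≤ K)
    linarith
  set SF := ∑ i, D.F i with hSF
  set X := ∑ i, D.F i * ‖D.φ1 i‖ with hX
  set V := ∑ i, D.F i * ‖D.u2 D.o i‖ with hV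
  have e1 : ∑ i, D.F i * (K * (2 * K * D.top + ‖D.u2 D.o i‖)) = 2 * K ^ 2 * D.top * SF + K * V := by
    rw [hSF, hV, mul_sum, mul_sum, ← sum_add_distrib]; exact sum_congr rfl fun i _ => by ring
  have e2 : ∑ i, D.F i * (2 * K * (D.top * (K + ‖D.φ1 i‖) + K * (2 * K * D.top + ‖D.u2 D.o i‖))
        + K * (D.top + ‖D.u2 D.o i‖)) =
      (2 * K ^ 2 + 4 * K ^ 3 + K) * D.top * SF + 2 * K * D.top * X + (2 * K ^ 2 + K) * V := by
    rw [hSF, hV, hX, mul_sum, mul_sum, mul_sum, ← sum_add_distrib, ← sum_add_distrib]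
    exact sum_congr rfl fun i _ => by ring
  rw [e1] at h3
  rw [e2]
  have hSF0 : 0 ≤ D.top * SF := mul_nonneg ht.le (sum_nonneg fun i _ => (h.F_pos i).le)
  have hV0 : 0 ≤ V := sum_nonneg fun i _ => mul_nonneg (h.F_pos i).le (norm_nonneg _)
  have k1 : K ≤ K ^ 3 := le_self_pow₀ hK (by norm_num)
  have k2 : K ^ 2 ≤ K ^ 3 := pow_le_pow_right₀ hK (by norm_num)
  have k3 : K ≤ K ^ 2 := le_self_pow₀ hK (by norm_num)
  have eR : D.top * (6 * n * K ^ 3 * D.W + 11 * K ^ 3 * SF + 2 * K * X + 5 * K ^ 2 * (V / D.top)) =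
      6 * n * K ^ 3 * (D.top * D.W) + 11 * K ^ 3 * (D.top * SF) + 2 * K * D.top * X +
        5 * K ^ 2 * V := by field_simp
  rw [eR]
  have m1 : D.W ≤ D.top * D.W := le_mul_of_one_le_left hW h.one_le
  have m2 : 6 * n * K ^ 3 * D.W ≤ 6 * n * K ^ 3 * (D.top * D.W) :=
    mul_le_mul_of_nonneg_left m1 (by positivity)
  have m3 := mul_le_mul_of_nonneg_right k1 hSF0
  have m4 := mul_le_mul_of_nonneg_right k2 hSF0
  have m5 := mul_le_mul_of_nonneg_right k3 hV0
  linarith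

lemma norm_add_phi_le (h : D.Rel K δ) (p : Fin n) :
    ‖D.φ1 p‖ - 2 * K ≤ ‖D.T p D.o D.o‖ / D.top ∧ ‖D.T p D.o D.o‖ / D.top ≤ ‖D.φ1 p‖ + 2 * K ∧
    ‖D.φ1 p‖ - 3 * K ≤ ‖D.T p D.o D.o - D.top * D.H p D.o D.o‖ / D.top := by
  have ht := h.top_pos
  have h1 : ‖D.T p D.o D.o + D.top * D.φ1 p‖ ≤ 2 * K * D.top := by
    have e : D.T p D.o D.o + D.top * D.φ1 p =
        (D.T p D.o D.o - D.T D.o D.o p) + D.top * D.H D.o D.o p := by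
      rw [h.critical p]; ring
    rw [e]
    refine (norm_add_le _ _).trans ?_
    rw [norm_mul, Complex.norm_real, Real.norm_of_nonneg ht.le]
    nlinarith [h.torsion p D.o D.o, h.H_le D.o D.o p]
  have h2 : ‖(D.top : ℂ) * D.φ1 p‖ = D.top * ‖D.φ1 p‖ := by
    rw [norm_mul, Complex.norm_real, Real.norm_of_nonneg ht.le]
  have h3 : ‖(D.top : ℂ) * D.H p D.o D.o‖ ≤ D.top * K := by
    rw [norm_mul, Complex.norm_real, Real.norm_of_nonneg ht.le]
    exact mul_le_mul_of_nonneg_left (h.H_le _ _ _) ht.le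
  have a1 := norm_sub_le (D.T p D.o D.o + D.top * D.φ1 p) (D.T p D.o D.o)
  have a2 := norm_sub_le (D.T p D.o D.o + D.top * D.φ1 p) (D.top * D.φ1 p)
  rw [add_sub_cancel_left] at a1
  rw [add_sub_cancel_right] at a2
  have a3 := norm_add_le (D.T p D.o D.o - D.top * D.H p D.o D.o) (D.top * D.H p D.o D.o)
  rw [sub_add_cancel] at a3
  refine ⟨?_, ?_, ?_⟩
  · rw [le_div_iff₀ ht]; linarith
  · rw [div_le_iff₀ ht]; linarith
  · rw [le_div_iff₀ ht]; linarith

/-- In the directions `p ≠ o`, the off-diagonal part of the concavity and the second variation of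
the largest eigenvalue together absorb `F_p |∂_p φ|²` exactly. -/
lemma off_diagonal (h : D.Rel K δ) (hK : 1 ≤ K) {p : Fin n} (hp : p ≠ D.o) :
    D.F p * ‖D.φ1 p‖ ^ 2 - 12 * K * (D.F p * ‖D.φ1 p‖) ≤ D.s p * ‖D.T p D.o D.o‖ ^ 2 / D.top +
      D.F D.o * (‖D.T p D.o D.o - D.top * D.H p D.o D.o‖ / D.top) ^ 2 := by
  have ht := h.top_pos
  obtain ⟨h1, -, h3⟩ := h.norm_add_phi_le p
  have hx := norm_nonneg (D.φ1 p)
  have k1 := sq_sub_le_of_sub_le hx (by positivity) (by linarith : 0 ≤ 3 * K)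
    ((by linarith : ‖D.φ1 p‖ - 3 * K ≤ ‖D.φ1 p‖ - 2 * K).trans h1)
  have k3 := sq_sub_le_of_sub_le hx (by positivity) (by linarith : 0 ≤ 3 * K) h3
  have e : D.s p * ‖D.T p D.o D.o‖ ^ 2 / D.top =
      D.top * D.s p * (‖D.T p D.o D.o‖ / D.top) ^ 2 := by field_simp
  rw [e]
  have m1 := mul_le_mul_of_nonneg_left k1 (mul_nonneg ht.le (h.s_nonneg p))
  have m3 := mul_le_mul_of_nonneg_left k3 (h.F_pos D.o).le
  have m4 := mul_le_mul_of_nonneg_right (h.le_s p hp) (sq_nonneg ‖D.φ1 p‖)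
  have hw : D.F D.o + D.top * D.s p ≤ 2 * D.F p := by linarith [h.s_le p hp, h.F_top_le p]
  have m5 := mul_le_mul_of_nonneg_right hw (mul_nonneg (by linarith : 0 ≤ 6 * K) hx)
  linarith

/-- The second variation of the largest eigenvalue, in the scaling of the other terms. -/
def variation (D : MaxPointData n) (p q : Fin n) : ℝ :=
  D.F p * (‖D.T D.o q p - D.top * D.H D.o q p‖ / D.top) ^ 2

lemma variation_nonneg (h : D.Rel K δ) (p q : Fin n) : 0 ≤ variation D p q :=
  mul_nonneg (h.F_pos p).le (sq_nonneg _)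

lemma norm_T_le (h : D.Rel K δ) (p q : Fin n) : ‖D.T p q D.o‖ / D.top ≤
    ‖D.T D.o q p - D.top * D.H D.o q p‖ / D.top + 2 * K := by
  have ht := h.top_pos
  have h3 : ‖(D.top : ℂ) * D.H D.o q p‖ ≤ D.top * K := by
    rw [norm_mul, Complex.norm_real, Real.norm_of_nonneg ht.le]
    exact mul_le_mul_of_nonneg_left (h.H_le _ _ _) ht.le
  have e : D.T p q D.o = (D.T p q D.o - D.T D.o q p) +
      (D.T D.o q p - D.top * D.H D.o q p) + D.top * D.H D.o q p := by ring
  rw [div_le_iff₀ ht, add_mul, div_mul_cancel₀ _ ht.ne', e]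
  refine (norm_add_le _ _).trans ?_
  have := norm_add_le (D.T p q D.o - D.T D.o q p) (D.T D.o q p - D.top * D.H D.o q p)
  linarith [h.torsion p q D.o]

lemma cross_term (h : D.Rel K δ) (hK : 1 ≤ K) :
    K * (∑ p, ∑ q, D.F p * ‖D.T p q D.o‖) / D.top ≤
      K * ∑ p, D.F p * ‖D.φ1 p‖ + 3 * n * K ^ 2 * ∑ p, D.F p +
      (1 / 2) * ∑ p, ∑ q ∈ univ.erase D.o, variation D p q := by
  have ht := h.top_pos
  have key : ∀ p, ∑ q, D.F p * (‖D.T p q D.o‖ / D.top) * K ≤ K * (D.F p * ‖D.φ1 p‖) +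
      3 * n * K ^ 2 * D.F p + (1 / 2) * ∑ q ∈ univ.erase D.o, variation D p q := by
    intro p
    rw [← add_sum_erase _ _ (mem_univ D.o)]
    have h1 := mul_le_mul_of_nonneg_left (h.norm_add_phi_le p).2.1 (h.F_pos p).le
    have h2 : ∀ q ∈ univ.erase D.o, D.F p * (‖D.T p q D.o‖ / D.top) * K ≤
        (1 / 2) * variation D p q + 3 * K ^ 2 * D.F p := by
      intro q _
      have a := mul_le_mul_of_nonneg_left (h.norm_T_le p q) (by linarith : 0 ≤ K)
      set t := ‖D.T D.o q p - D.top * D.H D.o q p‖ / D.top with htdef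
      have b : K * (t + 2 * K) ≤ (1 / 2) * t ^ 2 + 3 * K ^ 2 := by nlinarith [sq_nonneg (t - K)]
      have c := mul_le_mul_of_nonneg_left (a.trans b) (h.F_pos p).le
      unfold variation
      rw [← htdef]
      linarith
    have h3 := sum_le_sum h2
    rw [sum_add_distrib, ← mul_sum, sum_const, card_erase_of_mem (mem_univ _), card_univ,
      Fintype.card_fin, nsmul_eq_mul] at h3
    have hn : ((n - 1 : ℕ) : ℝ) = n - 1 := by
      rw [Nat.cast_sub (Fin.pos D.o)]; simp
    rw [hn] at h3
    have h4 : 0 ≤ K ^ 2 * D.F p := mul_nonneg (sq_nonneg _) (h.F_pos p).le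
    nlinarith
  have e : K * (∑ p, ∑ q, D.F p * ‖D.T p q D.o‖) / D.top =
      ∑ p, ∑ q, D.F p * (‖D.T p q D.o‖ / D.top) * K := by
    rw [mul_sum, sum_div]
    refine sum_congr rfl fun p _ => ?_
    rw [mul_sum, sum_div]
    exact sum_congr rfl fun q _ => by ring
  rw [e]
  refine (sum_le_sum fun p _ => key p).trans (le_of_eq ?_)
  simp only [sum_add_distrib, ← mul_sum]

lemma delta_term (h : D.Rel K δ) (hδ1 : δ ≤ 1 / 4) :
    (δ / D.top * (∑ p ∈ univ.erase D.o, D.F p * ‖D.T p p D.o‖ ^ 2)) / D.top ≤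
      2 * K ^ 2 * ∑ p, D.F p + (1 / 2) * ∑ p, ∑ q ∈ univ.erase D.o, variation D p q := by
  have ht := h.top_pos
  have e : (δ / D.top * (∑ p ∈ univ.erase D.o, D.F p * ‖D.T p p D.o‖ ^ 2)) / D.top =
      ∑ p ∈ univ.erase D.o, δ * (D.F p * (‖D.T p p D.o‖ / D.top) ^ 2) := by
    rw [mul_sum, sum_div]
    refine sum_congr rfl fun p _ => ?_
    field_simp
  rw [e, mul_sum, mul_sum, ← sum_add_distrib]
  have key : ∀ p ∈ univ.erase D.o, δ * (D.F p * (‖D.T p p D.o‖ / D.top) ^ 2) ≤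
      2 * K ^ 2 * D.F p + (1 / 2) * ∑ q ∈ univ.erase D.o, variation D p q := by
    intro p hp
    have h1 := h.norm_T_le p p
    have h2 : variation D p p ≤ ∑ q ∈ univ.erase D.o, variation D p q :=
      single_le_sum (f := fun q => variation D p q) (fun q _ => h.variation_nonneg p q) hp
    have h0 : 0 ≤ ‖D.T p p D.o‖ / D.top := by positivity
    have hv : variation D p p = D.F p * (‖D.T D.o p p - D.top * D.H D.o p p‖ / D.top) ^ 2 := rfl
    set t := ‖D.T D.o p p - D.top * D.H D.o p p‖ / D.top
    set r := ‖D.T p p D.o‖ / D.top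
    have h3 : r ^ 2 ≤ 2 * t ^ 2 + 8 * K ^ 2 := by
      nlinarith [pow_le_pow_left₀ h0 h1 2, sq_nonneg (t - 2 * K)]
    have h4 := mul_le_mul_of_nonneg_left h3 (h.F_pos p).le
    have h5 : δ * (D.F p * r ^ 2) ≤ 1 / 4 * (D.F p * r ^ 2) :=
      mul_le_mul_of_nonneg_right hδ1 (mul_nonneg (h.F_pos p).le (sq_nonneg _))
    linarith
  refine (sum_le_sum key).trans (sum_le_sum_of_subset_of_nonneg (erase_subset _ _) ?_)
  intro p _ _
  have := sum_nonneg fun q (_ : q ∈ univ.erase D.o) => h.variation_nonneg p q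
  have := mul_nonneg (sq_nonneg K) (h.F_pos p).le
  linarith

lemma sum_gOO_le (h : D.Rel K δ) :
    (∑ i, D.F i * D.gOO i) / D.top ≤
      ∑ i, D.F i * (‖D.φ1 i‖ ^ 2 - D.φ2 i + K * ‖D.φ1 i‖ + K) -
      (∑ p, ∑ q ∈ univ.erase D.o, variation D p q) -
      ∑ p ∈ univ.erase D.o, D.F D.o * (‖D.T p D.o D.o - D.top * D.H p D.o D.o‖ / D.top) ^ 2 := by
  have ht := h.top_pos
  set R : Fin n → ℝ := fun i =>
    ∑ p ∈ univ.erase D.o, D.F i * (‖D.T p D.o i - D.top * D.H p D.o i‖ / D.top) ^ 2 with hR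
  have hR0 : ∀ i, 0 ≤ R i := fun i => sum_nonneg fun p _ => mul_nonneg (h.F_pos i).le (sq_nonneg _)
  have h1 : ∀ i, D.F i * D.gOO i / D.top ≤
      D.F i * (‖D.φ1 i‖ ^ 2 - D.φ2 i + K * ‖D.φ1 i‖ + K) -
        (∑ q ∈ univ.erase D.o, variation D i q) - R i := by
    intro i
    have h2 := mul_le_mul_of_nonneg_left (h.maximum i) (h.F_pos i).le
    rw [div_le_iff₀ ht]
    refine h2.trans (le_of_eq ?_)
    have e : ∀ p ∈ univ.erase D.o, D.F i * (‖D.T D.o p i - D.top * D.H D.o p i‖ ^ 2 +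
        ‖D.T p D.o i - D.top * D.H p D.o i‖ ^ 2) / D.top = (variation D i p +
        D.F i * (‖D.T p D.o i - D.top * D.H p D.o i‖ / D.top) ^ 2) * D.top := by
      intro p _
      unfold variation
      field_simp
    have e2 : D.F i * (1 / D.top * ∑ p ∈ univ.erase D.o, (‖D.T D.o p i - D.top * D.H D.o p i‖ ^ 2 +
        ‖D.T p D.o i - D.top * D.H p D.o i‖ ^ 2)) =
        ((∑ q ∈ univ.erase D.o, variation D i q) + R i) * D.top := by
      rw [hR]
      simp only
      rw [← sum_add_distrib, sum_mul, ← sum_congr rfl e, ← sum_div, ← mul_sum]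
      ring
    rw [mul_sub, e2]
    ring
  rw [sum_div]
  refine (sum_le_sum fun i _ => h1 i).trans ?_
  rw [sum_sub_distrib, sum_sub_distrib]
  have h3 : R D.o ≤ ∑ i, R i := single_le_sum (fun i _ => hR0 i) (mem_univ _)
  linarith

set_option maxHeartbeats 800000 in
/-- The differential inequality for the auxiliary part `φ` of the test function: all third
derivatives of `u` have been absorbed, at the price of `δ F_o |∂_o φ|²`. -/
theorem phi_inequality (h : D.Rel K δ) (hK : 1 ≤ K) (hδ : 0 ≤ δ) (hδ1 : δ ≤ 1 / 4) :
    ∑ i, D.F i * D.φ2 i - 2 * (∑ q, D.l q * D.φ1 q).re ≤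
      δ * (D.F D.o * ‖D.φ1 D.o‖ ^ 2) + 40 * n ^ 2 * K ^ 4 * (∑ i, D.F i + ∑ i, D.F i * ‖D.φ1 i‖ +
        (∑ i, D.F i * ‖D.u2 D.o i‖) / D.top + D.W) := by
  have ht := h.top_pos
  have hn : (1 : ℝ) ≤ n := by exact_mod_cast (Fin.pos D.o)
  have hW : 0 ≤ D.W := h.top_pos.le.trans h.top_le_W
  have q1 := h.gradient_term hK
  have q2 := h.norm_trace_top_sq_le hK
  have q3 := h.sum_gDD_le hK
  have q4 := h.cross_term hK
  have q5 := h.delta_term hδ1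
  have q6 := h.sum_gOO_le
  have q7 := h.equation_two
  have hWW := h.top_mul_W
  have q8 : ∑ p ∈ univ.erase D.o, (D.F p * ‖D.φ1 p‖ ^ 2 - 12 * K * (D.F p * ‖D.φ1 p‖)) ≤
      (∑ p ∈ univ.erase D.o, D.s p * ‖D.T p D.o D.o‖ ^ 2) / D.top +
      ∑ p ∈ univ.erase D.o, D.F D.o * (‖D.T p D.o D.o - D.top * D.H p D.o D.o‖ / D.top) ^ 2 := by
    rw [sum_div, ← sum_add_distrib]
    exact sum_le_sum fun p hp => h.off_diagonal hK (ne_of_mem_erase hp)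
  have q9 : (1 - δ) * (D.F D.o * ‖D.φ1 D.o‖ ^ 2 - 2 * K * (D.F D.o * ‖D.φ1 D.o‖)) ≤
      (1 - δ) * D.F D.o * ‖D.T D.o D.o D.o‖ ^ 2 / D.top / D.top := by
    have e : (1 - δ) * D.F D.o * ‖D.T D.o D.o D.o‖ ^ 2 / D.top / D.top =
        (1 - δ) * (D.F D.o * (‖D.T D.o D.o D.o‖ / D.top) ^ 2) := by field_simp
    rw [e]
    refine mul_le_mul_of_nonneg_left ?_ (by linarith)
    have h1 : ‖D.φ1 D.o‖ - K ≤ ‖D.T D.o D.o D.o‖ / D.top := by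
      rw [h.critical, norm_mul, Complex.norm_real, Real.norm_of_nonneg ht.le,
        mul_div_cancel_left₀ _ ht.ne']
      have := norm_sub_norm_le (D.φ1 D.o) (D.H D.o D.o D.o)
      rw [norm_sub_rev] at this
      linarith [h.H_le D.o D.o D.o]
    have h2 := sq_sub_le_of_sub_le (norm_nonneg _) (by positivity) (by linarith : 0 ≤ K) h1
    have := mul_le_mul_of_nonneg_left h2 (h.F_pos D.o).le
    linarith
  -- split the sums that carry `|∂φ|²` into the direction `o` and the rest
  have s1 : ∑ i, D.F i * (‖D.φ1 i‖ ^ 2 - D.φ2 i + K * ‖D.φ1 i‖ + K) =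
      ∑ i, D.F i * ‖D.φ1 i‖ ^ 2 - ∑ i, D.F i * D.φ2 i + K * ∑ i, D.F i * ‖D.φ1 i‖ +
        K * ∑ i, D.F i := by
    rw [mul_sum, mul_sum, ← sum_sub_distrib, ← sum_add_distrib, ← sum_add_distrib]
    exact sum_congr rfl fun i _ => by ring
  have s2 := add_sum_erase univ (fun i => D.F i * ‖D.φ1 i‖ ^ 2) (mem_univ D.o)
  have s3 := add_sum_erase univ (fun i => D.F i * ‖D.φ1 i‖) (mem_univ D.o)
  rw [sum_sub_distrib, ← mul_sum] at q8
  rw [s1] at q6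
  -- divide the inequalities that are not yet scaled by the largest eigenvalue
  have d := div_le_div_of_nonneg_right (q7.trans q3) ht.le
  rw [add_div, mul_div_cancel_left₀ _ ht.ne'] at d
  have d1 : - (2 * (∑ q, D.l q * D.φ1 q).re) - 8 * n * K ^ 3 * D.W ≤
      2 * (∑ q, D.l q * D.U3 D.o q).re / D.top := by
    rw [le_div_iff₀ ht]
    have : 8 * n * K ^ 3 * D.W ≤ 8 * n * K ^ 3 * D.W * D.top :=
      le_mul_of_one_le_right (by positivity) h.one_le
    linarith
  have d2 : K * (1 + D.top ^ 2 + ∑ q, ‖D.u2 q D.o‖ ^ 2) / D.top ≤ 2 * K * D.W := by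
    rw [div_le_iff₀ ht]
    have : 1 ≤ D.top * D.W :=
      one_le_mul_of_one_le_of_one_le h.one_le (h.one_le.trans h.top_le_W)
    have e : K * (D.top * D.W) = K * (D.top ^ 2 + ∑ q, ‖D.u2 q D.o‖ ^ 2) := by rw [hWW]
    linarith [mul_le_mul_of_nonneg_left this (by linarith : 0 ≤ K)]
  have d3 : ‖∑ p, (D.F p : ℂ) * D.T p p D.o‖ ^ 2 / D.top ≤ 8 * n ^ 2 * K ^ 4 * D.W := by
    rw [div_le_iff₀ ht]; linarith
  have d4 : K / D.top ≤ K * D.W := by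
    rw [div_le_iff₀ ht]
    have : 1 ≤ D.W * D.top :=
      one_le_mul_of_one_le_of_one_le (h.one_le.trans h.top_le_W) h.one_le
    linarith [mul_le_mul_of_nonneg_left this (by linarith : 0 ≤ K)]
  set SF := ∑ i, D.F i
  set X := ∑ i, D.F i * ‖D.φ1 i‖
  set V := (∑ i, D.F i * ‖D.u2 D.o i‖) / D.top
  have hSF : 0 ≤ SF := sum_nonneg fun i _ => (h.F_pos i).le
  have hX : 0 ≤ X := sum_nonneg fun i _ => mul_nonneg (h.F_pos i).le (norm_nonneg _)
  have hV : 0 ≤ V := div_nonneg (sum_nonneg fun i _ => mul_nonneg (h.F_pos i).le (norm_nonneg _)) ht.le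
  have hXo : 0 ≤ D.F D.o * ‖D.φ1 D.o‖ := mul_nonneg (h.F_pos _).le (norm_nonneg _)
  set A := n ^ 2 * K ^ 4 with hA
  have kA : K ≤ A ∧ K ^ 2 ≤ A ∧ K ^ 3 ≤ A ∧ n * K ^ 3 ≤ A ∧ n * K ^ 2 ≤ A := by
    have e2 : (n : ℝ) ≤ n ^ 2 := by nlinarith
    have e1 : (1 : ℝ) ≤ n ^ 2 := by nlinarith
    have p4 : 0 ≤ K ^ 4 := by positivity
    refine ⟨?_, ?_, ?_, ?_, ?_⟩
    · exact (le_self_pow₀ hK (by norm_num)).trans (le_mul_of_one_le_left p4 e1)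
    · exact (pow_le_pow_right₀ hK (by norm_num)).trans (le_mul_of_one_le_left p4 e1)
    · exact (pow_le_pow_right₀ hK (by norm_num)).trans (le_mul_of_one_le_left p4 e1)
    · exact mul_le_mul e2 (pow_le_pow_right₀ hK (by norm_num)) (by positivity) (by positivity)
    · exact mul_le_mul e2 (pow_le_pow_right₀ hK (by norm_num)) (by positivity) (by positivity)
  obtain ⟨k1, k2, k3, k4, k5⟩ := kA
  have e40 : 40 * (n : ℝ) ^ 2 * K ^ 4 * (SF + X + V + D.W) =
      40 * (A * SF) + 40 * (A * X) + 40 * (A * V) + 40 * (A * D.W) := by rw [hA]; ring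
  rw [e40]
  have hXle : D.F D.o * ‖D.φ1 D.o‖ ≤ X :=
    single_le_sum (f := fun i => D.F i * ‖D.φ1 i‖)
      (fun i _ => mul_nonneg (h.F_pos i).le (norm_nonneg _)) (mem_univ _)
  have x1 := mul_le_mul_of_nonneg_right k1 hX
  have x2 : K * (D.F D.o * ‖D.φ1 D.o‖) ≤ A * X := mul_le_mul k1 hXle hXo (by positivity)
  have x2' : 0 ≤ K * (D.F D.o * ‖D.φ1 D.o‖) := mul_nonneg (by linarith) hXo
  have x3 := mul_le_mul_of_nonneg_right k1 hSF
  have x4 := mul_le_mul_of_nonneg_right k2 hSF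
  have x5 := mul_le_mul_of_nonneg_right k3 hSF
  have x6 := mul_le_mul_of_nonneg_right k5 hSF
  have x7 := mul_le_mul_of_nonneg_right k2 hV
  have x8 := mul_le_mul_of_nonneg_right k1 hW
  have x9 := mul_le_mul_of_nonneg_right k4 hW
  have x10 : 0 ≤ δ * (K * (D.F D.o * ‖D.φ1 D.o‖)) := mul_nonneg hδ x2'
  have x11 : 8 * (n : ℝ) ^ 2 * K ^ 4 * D.W = 8 * (A * D.W) := by rw [hA]; ring
  rw [x11] at d3
  simp only [sub_div, add_div] at d
  have x12 := congrArg (K * ·) s3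
  simp only [mul_add] at x12
  have hA0 : 0 ≤ A := by positivity
  have y1 := mul_nonneg hA0 hSF
  have y2 := mul_nonneg hA0 hX
  have y3 := mul_nonneg hA0 hV
  have y4 := mul_nonneg hA0 hW
  clear q1 q2 q3 q7 hWW s1 e40
  linarith

end Rel
end MaxPointData

namespace MaxPointData
variable {n : ℕ} (D : MaxPointData n)

/-- The relations that involve the auxiliary function `φ = N Γ + η`, where `Γ = |∂u|²` and
`η = exp (B (K₀ - u))`: here `u1 i = ∂_i u`, `Γ1 i = ∂_i Γ` and `Γ2 i = ∂̄_i ∂_i Γ`. -/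
structure AuxRel (K ε N B η : ℝ) (u1 Γ1 : Fin n → ℂ) (Γ2 : Fin n → ℝ) : Prop where
  F_lam : ∀ i, D.F i * D.lam i ≤ 1
  F_top : 1 / 2 ≤ D.F D.o * D.top
  u1_le : ∀ i, ‖u1 i‖ ≤ K
  b_diag : ∀ i, (D.b i i).re ≤ D.lam i - ε - 2 * (D.a i * (starRingEnd ℂ) (u1 i)).re
  b_top : D.top - K ≤ ‖D.b D.o D.o‖
  b_symm : ∀ i j, ‖D.b i j‖ = ‖D.b j i‖
  grad_one : ∀ i, ‖Γ1 i - ∑ m, (D.u2 m i * (starRingEnd ℂ) (u1 m) +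
    u1 m * (starRingEnd ℂ) (D.b m i))‖ ≤ K
  grad_two : ∀ i, ∑ m, (‖D.u2 m i‖ ^ 2 + ‖D.b m i‖ ^ 2) +
    2 * (∑ m, (starRingEnd ℂ) (u1 m) * D.U3 i m).re -
      K * (1 + ∑ m, (‖D.u2 m i‖ + ‖D.b m i‖)) ≤ Γ2 i
  φ1_eq : ∀ i, D.φ1 i = N * Γ1 i - (B * η : ℝ) * u1 i
  φ2_eq : ∀ i, D.φ2 i = N * Γ2 i + η * (B ^ 2 * ‖u1 i‖ ^ 2 - B * (D.b i i).re)

/-- The weighted square norm of all second derivatives of `u`. -/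
def Z : ℝ := ∑ i, D.F i * ∑ m, (‖D.u2 m i‖ ^ 2 + ‖D.b m i‖ ^ 2)

variable {D} {K δ ε N B η : ℝ} {u1 Γ1 : Fin n → ℂ} {Γ2 : Fin n → ℝ}

namespace AuxRel

lemma sq_le_Z (h : D.Rel K δ) (i : Fin n) :
    D.F i * ∑ m, (‖D.u2 m i‖ ^ 2 + ‖D.b m i‖ ^ 2) ≤ D.Z :=
  single_le_sum (f := fun i => D.F i * ∑ m, (‖D.u2 m i‖ ^ 2 + ‖D.b m i‖ ^ 2))
    (fun i _ => mul_nonneg (h.F_pos i).le (sum_nonneg fun m _ => by positivity)) (mem_univ i)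

lemma W_le (h : D.Rel K δ) (h' : D.AuxRel K ε N B η u1 Γ1 Γ2) :
    D.W ≤ 4 * D.Z + 4 * K ^ 2 := by
  have ht := h.top_pos
  have h1 := sq_le_Z h D.o
  have hF := h'.F_top
  have hF1 : D.F D.o ≤ 1 := by
    have := h'.F_lam D.o
    have h2 := le_mul_of_one_le_right (h.F_pos D.o).le h.one_le
    exact h2.trans this
  set Y := ∑ q, ‖D.u2 q D.o‖ ^ 2 with hY
  have hY0 : 0 ≤ Y := sum_nonneg fun q _ => sq_nonneg _
  have h2 : Y + ‖D.b D.o D.o‖ ^ 2 ≤ ∑ m, (‖D.u2 m D.o‖ ^ 2 + ‖D.b m D.o‖ ^ 2) := by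
    rw [sum_add_distrib]
    have : ‖D.b D.o D.o‖ ^ 2 ≤ ∑ m, ‖D.b m D.o‖ ^ 2 :=
      single_le_sum (f := fun m => ‖D.b m D.o‖ ^ 2) (fun m _ => sq_nonneg _) (mem_univ _)
    linarith
  have h3 : D.top ^ 2 / 2 - K ^ 2 ≤ ‖D.b D.o D.o‖ ^ 2 := by
    have := pow_le_pow_left₀ ht.le (by linarith [h'.b_top] : D.top ≤ ‖D.b D.o D.o‖ + K) 2
    nlinarith [sq_nonneg (‖D.b D.o D.o‖ - K)]
  have h4 : D.F D.o * (Y + D.top ^ 2 / 2 - K ^ 2) ≤ D.Z :=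
    (mul_le_mul_of_nonneg_left (by linarith) (h.F_pos D.o).le).trans h1
  have h5 : 1 / 2 * (Y / D.top + D.top / 2) ≤ D.F D.o * (Y + D.top ^ 2 / 2) := by
    have e : D.F D.o * (Y + D.top ^ 2 / 2) = (D.F D.o * D.top) * (Y / D.top + D.top / 2) := by
      field_simp
    rw [e]
    exact mul_le_mul_of_nonneg_right hF (by positivity)
  have h6 : D.F D.o * K ^ 2 ≤ K ^ 2 := mul_le_of_le_one_left (sq_nonneg _) hF1
  have h7 : 0 ≤ Y / D.top := by positivity
  unfold W
  linarith

/-- The gradient term of the test function: the first derivatives of the right-hand side cancel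
against the linearized operator. -/
lemma gradient_lower (h : D.Rel K δ) (h' : D.AuxRel K ε N B η u1 Γ1 Γ2) (hK : 1 ≤ K) :
    (1 / 2) * D.Z - 16 * n * K ^ 4 * ∑ i, D.F i - 4 * n * K ^ 2 ≤
      ∑ i, D.F i * Γ2 i - 2 * (∑ q, D.l q * Γ1 q).re := by
  have hn : (1 : ℝ) ≤ n := by exact_mod_cast (Fin.pos D.o)
  set E1 : Fin n → ℂ := fun m => (∑ i, (D.F i : ℂ) * D.T i i m) -
    ∑ q, (D.l q * D.u2 q m + (starRingEnd ℂ) (D.l q) * D.b m q) with hE1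
  set E2 : Fin n → ℂ := fun q => Γ1 q - ∑ m, (D.u2 m q * (starRingEnd ℂ) (u1 m) +
    u1 m * (starRingEnd ℂ) (D.b m q)) with hE2
  have key : (∑ m, (starRingEnd ℂ) (u1 m) * ∑ i, (D.F i : ℂ) * D.U3 i m).re =
      (∑ q, D.l q * Γ1 q).re + (∑ m, (starRingEnd ℂ) (u1 m) * E1 m).re -
        (∑ q, D.l q * E2 q).re +
        (∑ m, (starRingEnd ℂ) (u1 m) * ∑ i, (D.F i : ℂ) * (D.U3 i m - D.T i i m)).re := by
    have e1 : ∑ m, (starRingEnd ℂ) (u1 m) * ∑ i, (D.F i : ℂ) * D.U3 i m =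
        ∑ m, (starRingEnd ℂ) (u1 m) *
          (∑ q, (D.l q * D.u2 q m + (starRingEnd ℂ) (D.l q) * D.b m q)) +
        ∑ m, (starRingEnd ℂ) (u1 m) * E1 m +
        ∑ m, (starRingEnd ℂ) (u1 m) * ∑ i, (D.F i : ℂ) * (D.U3 i m - D.T i i m) := by
      rw [← sum_add_distrib, ← sum_add_distrib]
      refine sum_congr rfl fun m _ => ?_
      simp only [hE1, mul_sub, sum_sub_distrib]
      ring
    have e2 : (∑ m, (starRingEnd ℂ) (u1 m) *
          (∑ q, (D.l q * D.u2 q m + (starRingEnd ℂ) (D.l q) * D.b m q))).re =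
        (∑ q, D.l q * ∑ m, (D.u2 m q * (starRingEnd ℂ) (u1 m) +
          u1 m * (starRingEnd ℂ) (D.b m q))).re := by
      simp only [mul_sum, Complex.re_sum]
      rw [sum_comm]
      refine sum_congr rfl fun q _ => sum_congr rfl fun m _ => ?_
      rw [h.u2_symm q m]
      simp only [Complex.add_re, Complex.mul_re, Complex.conj_re, Complex.conj_im, Complex.add_im,
        Complex.mul_im]
      ring
    have e3 : ∑ q, D.l q * Γ1 q = ∑ q, D.l q * ∑ m, (D.u2 m q * (starRingEnd ℂ) (u1 m) +
          u1 m * (starRingEnd ℂ) (D.b m q)) + ∑ q, D.l q * E2 q := by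
      rw [← sum_add_distrib]
      refine sum_congr rfl fun m _ => ?_
      simp only [hE2]; ring
    rw [e1, Complex.add_re, Complex.add_re, e2, e3, Complex.add_re]
    ring
  have b1 : -(n * K ^ 2) ≤ (∑ m, (starRingEnd ℂ) (u1 m) * E1 m).re := by
    refine le_trans ?_ (abs_le.1 (Complex.abs_re_le_norm _)).1
    refine neg_le_neg ((norm_sum_le _ _).trans ?_)
    have : ∀ m ∈ univ, ‖(starRingEnd ℂ) (u1 m) * E1 m‖ ≤ K ^ 2 := fun m _ => by
      rw [norm_mul, RCLike.norm_conj, sq]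
      exact mul_le_mul (h'.u1_le m) (h.equation_one m) (norm_nonneg _) (by linarith)
    simpa using sum_le_sum this
  have b2 : (∑ q, D.l q * E2 q).re ≤ n * K ^ 2 := by
    refine (Complex.re_le_norm _).trans ((norm_sum_le _ _).trans ?_)
    have : ∀ m ∈ univ, ‖D.l m * E2 m‖ ≤ K ^ 2 := fun m _ => by
      rw [norm_mul, sq]
      exact mul_le_mul (h.l_le m) (h'.grad_one m) (norm_nonneg _) (by linarith)
    simpa using sum_le_sum this
  have b3 : -(∑ i, D.F i * (n * K ^ 2 + K ^ 2 * ∑ m, (‖D.u2 m i‖ + ‖D.b m i‖))) ≤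
      (∑ m, (starRingEnd ℂ) (u1 m) * ∑ i, (D.F i : ℂ) * (D.U3 i m - D.T i i m)).re := by
    refine le_trans ?_ (abs_le.1 (Complex.abs_re_le_norm _)).1
    refine neg_le_neg ?_
    simp only [mul_sum]
    rw [sum_comm]
    refine (norm_sum_le _ _).trans (sum_le_sum fun i _ => ?_)
    refine (norm_sum_le _ _).trans ?_
    have : ∀ m ∈ univ, ‖(starRingEnd ℂ) (u1 m) * ((D.F i : ℂ) * (D.U3 i m - D.T i i m))‖ ≤
        D.F i * (K ^ 2 + K ^ 2 * (‖D.u2 m i‖ + ‖D.b m i‖)) := fun m _ => by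
      rw [norm_mul, RCLike.norm_conj, norm_mul, Complex.norm_real,
        Real.norm_of_nonneg (h.F_pos i).le]
      have h3 := h.third i m
      rw [h'.b_symm i m, h.u2_symm i m] at h3
      have := mul_le_mul (h'.u1_le m) h3 (norm_nonneg _) (by linarith)
      have := mul_le_mul_of_nonneg_left this (h.F_pos i).le
      linarith
    refine (sum_le_sum this).trans (le_of_eq ?_)
    rw [← mul_sum, sum_add_distrib, ← mul_sum]
    simp
  have b4 : ∑ i, D.F i * (∑ m, (‖D.u2 m i‖ ^ 2 + ‖D.b m i‖ ^ 2) +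
      2 * (∑ m, (starRingEnd ℂ) (u1 m) * D.U3 i m).re -
      K * (1 + ∑ m, (‖D.u2 m i‖ + ‖D.b m i‖))) ≤ ∑ i, D.F i * Γ2 i :=
    sum_le_sum fun i _ => mul_le_mul_of_nonneg_left (h'.grad_two i) (h.F_pos i).le
  have e4 : ∑ i, D.F i * (∑ m, (‖D.u2 m i‖ ^ 2 + ‖D.b m i‖ ^ 2) +
      2 * (∑ m, (starRingEnd ℂ) (u1 m) * D.U3 i m).re -
      K * (1 + ∑ m, (‖D.u2 m i‖ + ‖D.b m i‖))) =
      D.Z + 2 * (∑ m, (starRingEnd ℂ) (u1 m) * ∑ i, (D.F i : ℂ) * D.U3 i m).re -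
      ∑ i, D.F i * (K * (1 + ∑ m, (‖D.u2 m i‖ + ‖D.b m i‖))) := by
    have : (∑ m, (starRingEnd ℂ) (u1 m) * ∑ i, (D.F i : ℂ) * D.U3 i m).re =
        ∑ i, D.F i * (∑ m, (starRingEnd ℂ) (u1 m) * D.U3 i m).re := by
      simp only [mul_sum, Complex.re_sum]
      rw [sum_comm]
      refine sum_congr rfl fun q _ => sum_congr rfl fun m _ => ?_
      rw [mul_left_comm, Complex.re_ofReal_mul]
    rw [this, Z, mul_sum, ← sum_add_distrib, ← sum_sub_distrib]
    exact sum_congr rfl fun i _ => by ring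
  have b5 : 2 * (∑ i, D.F i * (n * K ^ 2 + K ^ 2 * ∑ m, (‖D.u2 m i‖ + ‖D.b m i‖))) +
      ∑ i, D.F i * (K * (1 + ∑ m, (‖D.u2 m i‖ + ‖D.b m i‖))) ≤
      (1 / 2) * D.Z + 16 * n * K ^ 4 * ∑ i, D.F i := by
    rw [Z, mul_sum, mul_sum, mul_sum, ← sum_add_distrib, ← sum_add_distrib]
    refine sum_le_sum fun i _ => ?_
    have c1 : ∀ m ∈ univ, 3 * K ^ 2 * (‖D.u2 m i‖ + ‖D.b m i‖) ≤
        (1 / 2) * (‖D.u2 m i‖ ^ 2 + ‖D.b m i‖ ^ 2) + 9 * K ^ 4 := fun m _ => by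
      nlinarith [sq_nonneg (‖D.u2 m i‖ - 3 * K ^ 2), sq_nonneg (‖D.b m i‖ - 3 * K ^ 2)]
    have c2 := sum_le_sum c1
    have c2' : ∑ m, ((1 / 2) * (‖D.u2 m i‖ ^ 2 + ‖D.b m i‖ ^ 2) + 9 * K ^ 4) =
        (1 / 2) * ∑ m, (‖D.u2 m i‖ ^ 2 + ‖D.b m i‖ ^ 2) + n * (9 * K ^ 4) := by
      rw [sum_add_distrib, ← mul_sum]; simp
    rw [← mul_sum, c2'] at c2
    set v := ∑ m, (‖D.u2 m i‖ + ‖D.b m i‖)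
    have hv : 0 ≤ v := sum_nonneg fun m _ => by positivity
    have k1 : K ≤ K ^ 2 := le_self_pow₀ hK (by norm_num)
    have k2 : K ^ 2 ≤ K ^ 4 := pow_le_pow_right₀ hK (by norm_num)
    have k3 := mul_le_mul_of_nonneg_right k1 hv
    have k4 : (n : ℝ) * K ^ 2 ≤ n * K ^ 4 := mul_le_mul_of_nonneg_left k2 (by linarith)
    have k5 : K ^ 2 ≤ n * K ^ 2 := le_mul_of_one_le_left (sq_nonneg _) hn
    have c3 : 2 * (n * K ^ 2 + K ^ 2 * v) + K * (1 + v) ≤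
        (1 / 2) * ∑ m, (‖D.u2 m i‖ ^ 2 + ‖D.b m i‖ ^ 2) + 16 * n * K ^ 4 := by linarith
    have := mul_le_mul_of_nonneg_left c3 (h.F_pos i).le
    linarith
  rw [e4, key] at b4
  linarith

/-- The exponential term of the test function produces a multiple of `∑ F_i` and of
`∑ F_i |u_i|²`. -/
lemma exponential_lower (h : D.Rel K δ) (h' : D.AuxRel K ε N B η u1 Γ1 Γ2) (hK : 1 ≤ K)
    (hB : 0 ≤ B) (hη : 0 ≤ η) :
    η * ((1 / 2) * B ^ 2 * ∑ i, D.F i * ‖u1 i‖ ^ 2 + (B * ε - 2 * K ^ 2) * ∑ i, D.F i -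
      3 * n * K ^ 2 * B) ≤
      ∑ i, D.F i * (η * (B ^ 2 * ‖u1 i‖ ^ 2 - B * (D.b i i).re)) +
        2 * (∑ q, D.l q * ((B * η : ℝ) * u1 q)).re := by
  have hn : (1 : ℝ) ≤ n := by exact_mod_cast (Fin.pos D.o)
  have b1 : -(n * K ^ 2) ≤ (∑ q, D.l q * u1 q).re := by
    refine le_trans ?_ (abs_le.1 (Complex.abs_re_le_norm _)).1
    refine neg_le_neg ((norm_sum_le _ _).trans ?_)
    have : ∀ m ∈ univ, ‖D.l m * u1 m‖ ≤ K ^ 2 := fun m _ => by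
      rw [norm_mul, sq]
      exact mul_le_mul (h.l_le m) (h'.u1_le m) (norm_nonneg _) (by linarith)
    simpa using sum_le_sum this
  have e1 : (∑ q, D.l q * ((B * η : ℝ) * u1 q)).re = B * η * (∑ q, D.l q * u1 q).re := by
    rw [← Complex.re_ofReal_mul, mul_sum]
    congr 1
    exact sum_congr rfl fun q _ => by ring
  have e2 : ∑ i, D.F i * (η * (B ^ 2 * ‖u1 i‖ ^ 2 - B * (D.b i i).re)) =
      η * ∑ i, D.F i * (B ^ 2 * ‖u1 i‖ ^ 2 - B * (D.b i i).re) := by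
    rw [mul_sum]; exact sum_congr rfl fun i _ => by ring
  have b2 : (1 / 2) * B ^ 2 * ∑ i, D.F i * ‖u1 i‖ ^ 2 + (B * ε - 2 * K ^ 2) * ∑ i, D.F i - B * n ≤
      ∑ i, D.F i * (B ^ 2 * ‖u1 i‖ ^ 2 - B * (D.b i i).re) := by
    have e3 : (1 / 2) * B ^ 2 * ∑ i, D.F i * ‖u1 i‖ ^ 2 + (B * ε - 2 * K ^ 2) * ∑ i, D.F i - B * n =
        ∑ i, ((1 / 2) * B ^ 2 * (D.F i * ‖u1 i‖ ^ 2) + (B * ε - 2 * K ^ 2) * D.F i - B) := by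
      rw [sum_sub_distrib, sum_add_distrib, ← mul_sum, ← mul_sum]
      simp [mul_comm]
    rw [e3]
    refine sum_le_sum fun i _ => ?_
    have c1 : -(K * ‖u1 i‖) ≤ (D.a i * (starRingEnd ℂ) (u1 i)).re := by
      refine le_trans ?_ (abs_le.1 (Complex.abs_re_le_norm _)).1
      rw [norm_mul, RCLike.norm_conj]
      exact neg_le_neg (mul_le_mul_of_nonneg_right (h.a_le i) (norm_nonneg _))
    have c2 := mul_le_mul_of_nonneg_left (h'.b_diag i) hB
    have c3 : (1 / 2) * B ^ 2 * ‖u1 i‖ ^ 2 - 2 * K ^ 2 + B * ε - B * D.lam i ≤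
        B ^ 2 * ‖u1 i‖ ^ 2 - B * (D.b i i).re := by
      nlinarith [sq_nonneg (B * ‖u1 i‖ - 2 * K), mul_le_mul_of_nonneg_left c1 hB]
    have c4 := mul_le_mul_of_nonneg_left c3 (h.F_pos i).le
    have c5 := mul_le_mul_of_nonneg_left (h'.F_lam i) hB
    linarith
  rw [e1, e2]
  have c1 := mul_le_mul_of_nonneg_left b2 hη
  have c2 := mul_le_mul_of_nonneg_left b1 (mul_nonneg hB hη)
  have c3 : B * n ≤ B * (n * K ^ 2) := by
    refine mul_le_mul_of_nonneg_left ?_ hB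
    exact le_mul_of_one_le_right (by linarith) (one_le_pow₀ hK)
  have c4 := mul_le_mul_of_nonneg_left c3 hη
  linarith

lemma norm_phi_le (h' : D.AuxRel K ε N B η u1 Γ1 Γ2) (hN : 0 ≤ N) (hB : 0 ≤ B)
    (hη : 0 ≤ η) (i : Fin n) :
    ‖D.φ1 i‖ ≤ N * K * (1 + ∑ m, (‖D.u2 m i‖ + ‖D.b m i‖)) + B * η * ‖u1 i‖ := by
  have h1 : ‖Γ1 i‖ ≤ K * (1 + ∑ m, (‖D.u2 m i‖ + ‖D.b m i‖)) := by
    have h2 := norm_sub_norm_le (Γ1 i) (∑ m, (D.u2 m i * (starRingEnd ℂ) (u1 m) +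
      u1 m * (starRingEnd ℂ) (D.b m i)))
    have h3 : ‖∑ m, (D.u2 m i * (starRingEnd ℂ) (u1 m) + u1 m * (starRingEnd ℂ) (D.b m i))‖ ≤
        K * ∑ m, (‖D.u2 m i‖ + ‖D.b m i‖) := by
      rw [mul_sum]
      refine (norm_sum_le _ _).trans (sum_le_sum fun m _ => (norm_add_le _ _).trans ?_)
      rw [norm_mul, norm_mul, RCLike.norm_conj, RCLike.norm_conj]
      have a1 := mul_le_mul_of_nonneg_left (h'.u1_le m) (norm_nonneg (D.u2 m i))
      have a2 := mul_le_mul_of_nonneg_right (h'.u1_le m) (norm_nonneg (D.b m i))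
      linarith
    linarith [h'.grad_one i]
  rw [h'.φ1_eq i]
  refine (norm_sub_le _ _).trans ?_
  rw [norm_mul, norm_mul, Complex.norm_real, Complex.norm_real, Real.norm_of_nonneg hN,
    Real.norm_of_nonneg (mul_nonneg hB hη)]
  have := mul_le_mul_of_nonneg_left h1 hN
  linarith

lemma sq_sum_le (i : Fin n) : (∑ m, (‖D.u2 m i‖ + ‖D.b m i‖)) ^ 2 ≤
    2 * n * ∑ m, (‖D.u2 m i‖ ^ 2 + ‖D.b m i‖ ^ 2) := by
  have h1 := sq_sum_le_card_mul_sum_sq (s := univ) (f := fun m => ‖D.u2 m i‖ + ‖D.b m i‖)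
  simp only [card_univ, Fintype.card_fin] at h1
  refine h1.trans ?_
  have : ∑ m, (‖D.u2 m i‖ + ‖D.b m i‖) ^ 2 ≤ ∑ m, 2 * (‖D.u2 m i‖ ^ 2 + ‖D.b m i‖ ^ 2) :=
    sum_le_sum fun m _ => by nlinarith [sq_nonneg (‖D.u2 m i‖ - ‖D.b m i‖)]
  rw [← mul_sum] at this
  have := mul_le_mul_of_nonneg_left this (Nat.cast_nonneg (α := ℝ) n)
  linarith

end AuxRel

set_option maxHeartbeats 1600000 in
/-- The estimate at a maximum point. The constants are chosen in the order `N` (to beat the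
quadratic terms in the second derivatives of `u`), then `B` (to beat the multiples of `∑ F_i` that
`N` creates), then `δ`. -/
theorem top_le_of_rel (n : ℕ) (hn : 0 < n) (K ε : ℝ) (hK : 1 ≤ K) (hε : 0 < ε) :
    ∃ N B δ : ℝ, 0 ≤ N ∧ 0 ≤ B ∧ 0 < δ ∧ δ ≤ 1 / 4 ∧ ∀ E : ℝ, ∃ Λ : ℝ,
      ∀ (D : MaxPointData n) (η : ℝ) (u1 Γ1 : Fin n → ℂ) (Γ2 : Fin n → ℝ), D.Rel K δ →
        D.AuxRel K ε N B η u1 Γ1 Γ2 → 1 ≤ η → η ≤ E → D.top ≤ Λ := by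
  have hn1 : (1 : ℝ) ≤ n := by exact_mod_cast hn
  set A : ℝ := 40 * n ^ 2 * K ^ 4 with hA
  have hA1 : 1 ≤ A := by
    have h1 : (1 : ℝ) ≤ n ^ 2 := one_le_pow₀ hn1
    have h2 : 1 ≤ K ^ 4 := one_le_pow₀ hK
    have := one_le_mul_of_one_le_of_one_le h1 h2
    rw [hA]; linarith
  set N : ℝ := 160 * A with hN
  set R : ℝ := 2 * K ^ 2 + A ^ 2 + 16 * n * K ^ 4 * N + 2 * A + N * (8 * n * A ^ 2 * K ^ 2 + A * K)
    with hR
  have hR0 : 0 ≤ R := by positivity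
  set B : ℝ := R / ε with hB
  have hB0 : 0 ≤ B := by positivity
  have hBε : B * ε = R := by rw [hB]; field_simp
  set δ : ℝ := 1 / (128 * n * N * K ^ 2) with hδ
  have hNpos : 0 < N := by positivity
  have hden : 4 ≤ 128 * n * N * K ^ 2 := by
    have h1 : 1 ≤ N := by rw [hN]; linarith
    have h2 := one_le_mul_of_one_le_of_one_le (one_le_mul_of_one_le_of_one_le hn1 h1)
      (one_le_pow₀ hK (n := 2))
    linarith
  have hδ4 : δ ≤ 1 / 4 := one_div_le_one_div_of_le (by norm_num) hden
  have hδ0 : 0 < δ := by rw [hδ]; positivity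
  refine ⟨N, B, δ, hNpos.le, hB0, hδ0, hδ4, fun E => ?_⟩
  set Q : ℝ := 4 * n * K ^ 2 * N + 3 * n * K ^ 2 * B * E + (4 * N ^ 2 * K ^ 2 + 2 * B ^ 2 * E ^ 2 * K ^ 2)
    + 4 * A * K ^ 2 with hQ
  refine ⟨4 * (4 * Q + K ^ 2), fun D η u1 Γ1 Γ2 h h' hη hηE => ?_⟩
  have hη0 : 0 ≤ η := by linarith
  have ht := h.top_pos
  have hFo1 : D.F D.o ≤ 1 :=
    (le_mul_of_one_le_right (h.F_pos D.o).le h.one_le).trans (h'.F_lam D.o)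
  have up := h.phi_inequality hK hδ0.le hδ4
  have lo1 := AuxRel.gradient_lower h h' hK
  have lo2 := AuxRel.exponential_lower h h' hK hB0 hη0
  have hW := AuxRel.W_le h h'
  set SF := ∑ i, D.F i with hSF
  have hSF0 : 0 ≤ SF := sum_nonneg fun i _ => (h.F_pos i).le
  set Us := ∑ i, D.F i * ‖u1 i‖ ^ 2 with hUs
  have hUs0 : 0 ≤ Us := sum_nonneg fun i _ => mul_nonneg (h.F_pos i).le (sq_nonneg _)
  have hZ0 : 0 ≤ D.Z := sum_nonneg fun i _ =>
    mul_nonneg (h.F_pos i).le (sum_nonneg fun m _ => by positivity)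
  -- the linearized operator applied to `φ`
  have eL : ∑ i, D.F i * D.φ2 i - 2 * (∑ q, D.l q * D.φ1 q).re =
      N * (∑ i, D.F i * Γ2 i - 2 * (∑ q, D.l q * Γ1 q).re) +
      (∑ i, D.F i * (η * (B ^ 2 * ‖u1 i‖ ^ 2 - B * (D.b i i).re)) +
        2 * (∑ q, D.l q * ((B * η : ℝ) * u1 q)).re) := by
    have e1 : ∑ i, D.F i * D.φ2 i = N * ∑ i, D.F i * Γ2 i +
        ∑ i, D.F i * (η * (B ^ 2 * ‖u1 i‖ ^ 2 - B * (D.b i i).re)) := by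
      rw [mul_sum, ← sum_add_distrib]
      exact sum_congr rfl fun i _ => by rw [h'.φ2_eq i]; ring
    have e2 : ∑ q, D.l q * D.φ1 q = (N : ℂ) * ∑ q, D.l q * Γ1 q -
        ∑ q, D.l q * ((B * η : ℝ) * u1 q) := by
      rw [mul_sum, ← sum_sub_distrib]
      exact sum_congr rfl fun i _ => by rw [h'.φ1_eq i]; ring
    rw [e1, e2, Complex.sub_re, Complex.re_ofReal_mul]
    ring
  rw [eL] at up
  -- the term linear in `∂φ`
  have hX : A * ∑ i, D.F i * ‖D.φ1 i‖ ≤ N / 16 * D.Z + N * (8 * n * A ^ 2 * K ^ 2 + A * K) * SF +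
      η * ((1 / 4) * B ^ 2 * Us) + η * A ^ 2 * SF := by
    have e : N / 16 * D.Z + N * (8 * n * A ^ 2 * K ^ 2 + A * K) * SF +
      η * ((1 / 4) * B ^ 2 * Us) + η * A ^ 2 * SF = ∑ i, D.F i * (N / 16 *
        ∑ m, (‖D.u2 m i‖ ^ 2 + ‖D.b m i‖ ^ 2) + N * (8 * n * A ^ 2 * K ^ 2 + A * K) +
        η * ((1 / 4) * B ^ 2 * ‖u1 i‖ ^ 2) + η * A ^ 2) := by
      have e1 : ∀ i, D.F i * (N / 16 *
        ∑ m, (‖D.u2 m i‖ ^ 2 + ‖D.b m i‖ ^ 2) + N * (8 * n * A ^ 2 * K ^ 2 + A * K) +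
        η * ((1 / 4) * B ^ 2 * ‖u1 i‖ ^ 2) + η * A ^ 2) =
        N / 16 * (D.F i * ∑ m, (‖D.u2 m i‖ ^ 2 + ‖D.b m i‖ ^ 2)) +
        N * (8 * n * A ^ 2 * K ^ 2 + A * K) * D.F i +
        η * ((1 / 4) * B ^ 2) * (D.F i * ‖u1 i‖ ^ 2) + η * A ^ 2 * D.F i := fun i => by ring
      rw [sum_congr rfl fun i _ => e1 i, sum_add_distrib, sum_add_distrib, sum_add_distrib,
        ← mul_sum, ← mul_sum, ← mul_sum, ← mul_sum, hSF, hUs, Z]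
      ring
    rw [e, mul_sum]
    refine sum_le_sum fun i _ => ?_
    have c0 := AuxRel.norm_phi_le h' hNpos.le hB0 hη0 i
    have c1 : ∀ m ∈ univ, A * K * (‖D.u2 m i‖ + ‖D.b m i‖) ≤
        (1 / 16) * (‖D.u2 m i‖ ^ 2 + ‖D.b m i‖ ^ 2) + 8 * (A ^ 2 * K ^ 2) := fun m _ => by
      nlinarith only [sq_nonneg (‖D.u2 m i‖ - 8 * (A * K)), sq_nonneg (‖D.b m i‖ - 8 * (A * K))]
    have c2 := sum_le_sum c1
    have c2' : ∑ m, ((1 / 16) * (‖D.u2 m i‖ ^ 2 + ‖D.b m i‖ ^ 2) + 8 * (A ^ 2 * K ^ 2)) =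
        (1 / 16) * ∑ m, (‖D.u2 m i‖ ^ 2 + ‖D.b m i‖ ^ 2) + n * (8 * (A ^ 2 * K ^ 2)) := by
      rw [sum_add_distrib, ← mul_sum]; simp
    rw [← mul_sum, c2'] at c2
    have c3 : A * (B * ‖u1 i‖) ≤ (1 / 4) * B ^ 2 * ‖u1 i‖ ^ 2 + A ^ 2 := by
      linarith only [sq_nonneg (B * ‖u1 i‖ - 2 * A)]
    have c4 := mul_le_mul_of_nonneg_left c2 hNpos.le
    have c5 := mul_le_mul_of_nonneg_left c3 hη0
    have c6 := mul_le_mul_of_nonneg_left c0 (by linarith : 0 ≤ A)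
    have c7 : A * ‖D.φ1 i‖ ≤ N / 16 *
        ∑ m, (‖D.u2 m i‖ ^ 2 + ‖D.b m i‖ ^ 2) + N * (8 * n * A ^ 2 * K ^ 2 + A * K) +
        η * ((1 / 4) * B ^ 2 * ‖u1 i‖ ^ 2) + η * A ^ 2 := by linarith only [c4, c5, c6]
    have c8 := mul_le_mul_of_nonneg_left c7 (h.F_pos i).le
    linarith only [c8]
  -- the small quadratic term in `∂φ`
  have hφ : δ * (D.F D.o * ‖D.φ1 D.o‖ ^ 2) ≤ N / 16 * D.Z +
      (4 * N ^ 2 * K ^ 2 + 2 * B ^ 2 * E ^ 2 * K ^ 2) := by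
    have c0 := AuxRel.norm_phi_le h' hNpos.le hB0 hη0 D.o
    set v := ∑ m, (‖D.u2 m D.o‖ + ‖D.b m D.o‖) with hv
    set v2 := ∑ m, (‖D.u2 m D.o‖ ^ 2 + ‖D.b m D.o‖ ^ 2) with hv2
    have hv20 : 0 ≤ v2 := sum_nonneg fun m _ => by positivity
    have c1 : v ^ 2 ≤ 2 * n * v2 := AuxRel.sq_sum_le D.o
    have c2 : B * η * ‖u1 D.o‖ ≤ B * E * K := by
      exact mul_le_mul (mul_le_mul_of_nonneg_left hηE hB0) (h'.u1_le _) (norm_nonneg _)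
        (mul_nonneg hB0 (hη0.trans hηE))
    have c3 := pow_le_pow_left₀ (norm_nonneg _) (c0.trans (add_le_add_right c2 _)) 2
    have c4 : ‖D.φ1 D.o‖ ^ 2 ≤ 8 * n * N ^ 2 * K ^ 2 * v2 + (4 * N ^ 2 * K ^ 2 + 2 * B ^ 2 * E ^ 2 * K ^ 2) := by
      refine c3.trans ?_
      have d1 : (N * K * (1 + v) + B * E * K) ^ 2 ≤ 2 * (N * K) ^ 2 * (1 + v) ^ 2 + 2 * (B * E * K) ^ 2 := by
        linarith only [sq_nonneg (N * K * (1 + v) - B * E * K)]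
      have d2 : (1 + v) ^ 2 ≤ 2 + 4 * n * v2 := by
        linarith only [sq_nonneg (1 - v), c1]
      have d3 := mul_le_mul_of_nonneg_left d2 (by positivity : 0 ≤ 2 * (N * K) ^ 2)
      linarith only [d1, d3]
    have c5 : D.F D.o * v2 ≤ D.Z := AuxRel.sq_le_Z h D.o
    have c6 := mul_le_mul_of_nonneg_left c4 (h.F_pos D.o).le
    set q := 4 * N ^ 2 * K ^ 2 + 2 * B ^ 2 * E ^ 2 * K ^ 2 with hq
    have hq0 : 0 ≤ q := by positivity
    have c7 : D.F D.o * ‖D.φ1 D.o‖ ^ 2 ≤ 8 * n * N ^ 2 * K ^ 2 * D.Z + q := by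
      have a1 := mul_le_mul_of_nonneg_left c5 (by positivity : 0 ≤ 8 * n * N ^ 2 * K ^ 2)
      have a2 := mul_le_of_le_one_left hq0 hFo1
      linarith only [a1, a2, c6]
    have c8 := mul_le_mul_of_nonneg_left c7 hδ0.le
    have e : δ * (8 * n * N ^ 2 * K ^ 2 * D.Z) = N / 16 * D.Z := by
      rw [hδ]; field_simp; ring
    have c9 : δ * q ≤ q := mul_le_of_le_one_left hq0 (by linarith only [hδ4])
    linarith only [c8, c9, e]
  have hV : (∑ i, D.F i * ‖D.u2 D.o i‖) / D.top ≤ D.Z + SF := by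
    have hnn : 0 ≤ ∑ i, D.F i * ‖D.u2 D.o i‖ :=
      sum_nonneg fun i _ => mul_nonneg (h.F_pos i).le (norm_nonneg _)
    refine (div_le_self hnn h.one_le).trans ?_
    rw [Z, hSF, ← sum_add_distrib]
    refine sum_le_sum fun i _ => ?_
    have c1 : ‖D.u2 D.o i‖ ^ 2 ≤ ∑ m, (‖D.u2 m i‖ ^ 2 + ‖D.b m i‖ ^ 2) := by
      refine le_trans ?_ (single_le_sum (f := fun m => ‖D.u2 m i‖ ^ 2 + ‖D.b m i‖ ^ 2)
        (fun m _ => by positivity) (mem_univ D.o))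
      linarith only [sq_nonneg ‖D.b D.o i‖]
    have c2 : ‖D.u2 D.o i‖ ≤ (∑ m, (‖D.u2 m i‖ ^ 2 + ‖D.b m i‖ ^ 2)) + 1 := by
      linarith only [sq_nonneg (‖D.u2 D.o i‖ - 1), c1, norm_nonneg (D.u2 D.o i)]
    have c3 := mul_le_mul_of_nonneg_left c2 (h.F_pos i).le
    linarith only [c3]
  have lo1' := mul_le_mul_of_nonneg_left lo1 hNpos.le
  have hV' := mul_le_mul_of_nonneg_left hV (by linarith : 0 ≤ A)
  have hW' := mul_le_mul_of_nonneg_left hW (by linarith : 0 ≤ A)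
  rw [hBε] at lo2
  have hEB : η * (3 * n * K ^ 2 * B) ≤ 3 * n * K ^ 2 * B * E := by
    have := mul_le_mul_of_nonneg_left hηE (by positivity : 0 ≤ 3 * n * K ^ 2 * B)
    linarith only [this]
  -- the multiples of `∑ F_i` cancel by the choice of `B`
  have hcancel : (16 * n * K ^ 4 * N + 2 * A + N * (8 * n * A ^ 2 * K ^ 2 + A * K)) * SF ≤
      η * ((R - 2 * K ^ 2 - A ^ 2) * SF) := by
    have e : R - 2 * K ^ 2 - A ^ 2 =
        16 * n * K ^ 4 * N + 2 * A + N * (8 * n * A ^ 2 * K ^ 2 + A * K) := by rw [hR]; ring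
    rw [e]
    exact le_mul_of_one_le_left (by positivity) hη
  have hηU : 0 ≤ η * ((1 / 4) * B ^ 2 * Us) := by positivity
  have hAZ : A * D.Z = N / 160 * D.Z := by rw [hN]; ring
  have hNZ : N / 4 * D.Z ≤ Q := by
    rw [hQ]
    have hNZ0 : 0 ≤ N * D.Z := by positivity
    linarith only [up, lo1', lo2, hX, hφ, hV', hW', hEB, hcancel, hηU, hAZ, hNZ0]
  have hZQ : D.Z ≤ 4 * Q := by
    have : 1 * D.Z ≤ N * D.Z := mul_le_mul_of_nonneg_right (by rw [hN]; linarith) hZ0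
    linarith
  have hW2 : D.top ≤ 4 * D.Z + 4 * K ^ 2 := h.top_le_W.trans hW
  linarith

end MaxPointData

open Filter Topology

/-! ### Wirtinger calculus -/

section Wirtinger
variable {n : ℕ} {f g : Cn n → ℂ} {z : Cn n} {v w : Cn n}

/-- The Wirtinger derivative of `f` in the direction of the constant vector field `v` of
type `(1,0)`. -/
def dz (v : Cn n) (f : Cn n → ℂ) (z : Cn n) : ℂ :=
  (1 / 2 : ℂ) * (fderiv ℝ f z v - Complex.I * fderiv ℝ f z (Complex.I • v))

/-- The Wirtinger derivative of `f` in the direction of the conjugate of the constant vector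
field `v`. -/
def dzb (v : Cn n) (f : Cn n → ℂ) (z : Cn n) : ℂ :=
  (1 / 2 : ℂ) * (fderiv ℝ f z v + Complex.I * fderiv ℝ f z (Complex.I • v))

lemma fderiv_eq_dz_add_dzb : fderiv ℝ f z v = dz v f z + dzb v f z := by
  unfold dz dzb; ring

lemma fderiv_I_eq : fderiv ℝ f z (Complex.I • v) = Complex.I * (dz v f z - dzb v f z) := by
  unfold dz dzb
  linear_combination (fderiv ℝ f z (Complex.I • v)) * Complex.I_sq

lemma fderiv_smul_eq (c : ℂ) : fderiv ℝ f z (c • v) = c * dz v f z +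
    (starRingEnd ℂ) c * dzb v f z := by
  have h : c • v = c.re • v + c.im • (Complex.I • v) := by
    conv_lhs => rw [← Complex.re_add_im c, add_smul, mul_smul]
    rfl
  rw [h, map_add, map_smul, map_smul, fderiv_I_eq, fderiv_eq_dz_add_dzb]
  conv_rhs => rw [← Complex.re_add_im c]
  simp only [Complex.real_smul, map_add, map_mul, Complex.conj_ofReal, Complex.conj_I]
  ring

lemma dz_smul (c : ℂ) : dz (c • v) f z = c * dz v f z := by
  rw [dz, smul_smul, fderiv_smul_eq, fderiv_smul_eq, map_mul, Complex.conj_I]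
  linear_combination (1 / 2 * ((starRingEnd ℂ) c * dzb v f z - c * dz v f z)) * Complex.I_sq

lemma dzb_smul (c : ℂ) : dzb (c • v) f z = (starRingEnd ℂ) c * dzb v f z := by
  have h1 := fderiv_eq_dz_add_dzb (f := f) (z := z) (v := c • v)
  rw [fderiv_smul_eq, dz_smul] at h1
  exact (add_left_cancel h1).symm

lemma dz_add_vec : dz (v + w) f z = dz v f z + dz w f z := by
  unfold dz; rw [smul_add, map_add, map_add]; ring

lemma dzb_add_vec : dzb (v + w) f z = dzb v f z + dzb w f z := by
  unfold dzb; rw [smul_add, map_add, map_add]; ring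

lemma dz_zero_vec : dz 0 f z = 0 := by simp [dz]
lemma dzb_zero_vec : dzb 0 f z = 0 := by simp [dzb]

lemma dz_sum_vec {ι : Type*} (s : Finset ι) (c : ι → ℂ) (v : ι → Cn n) :
    dz (∑ i ∈ s, c i • v i) f z = ∑ i ∈ s, c i * dz (v i) f z := by
  classical
  induction s using Finset.induction_on with
  | empty => simp [dz_zero_vec]
  | insert a s ha ih => rw [sum_insert ha, sum_insert ha, dz_add_vec, ih, dz_smul]

lemma dzb_sum_vec {ι : Type*} (s : Finset ι) (c : ι → ℂ) (v : ι → Cn n) :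
    dzb (∑ i ∈ s, c i • v i) f z = ∑ i ∈ s, (starRingEnd ℂ) (c i) * dzb (v i) f z := by
  classical
  induction s using Finset.induction_on with
  | empty => simp [dzb_zero_vec]
  | insert a s ha ih => rw [sum_insert ha, sum_insert ha, dzb_add_vec, ih, dzb_smul]

lemma norm_fderiv_le_dz : ‖fderiv ℝ f z v‖ ≤ ‖dz v f z‖ + ‖dzb v f z‖ := by
  rw [fderiv_eq_dz_add_dzb]; exact norm_add_le _ _

lemma norm_fderiv_I_le_dz : ‖fderiv ℝ f z (Complex.I • v)‖ ≤ ‖dz v f z‖ + ‖dzb v f z‖ := by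
  rw [fderiv_I_eq, norm_mul, Complex.norm_I, one_mul]; exact norm_sub_le _ _

lemma norm_dz_le : ‖dz v f z‖ ≤ ‖fderiv ℝ f z‖ * ‖v‖ := by
  unfold dz
  have h1 := (fderiv ℝ f z).le_opNorm v
  have h2 := (fderiv ℝ f z).le_opNorm (Complex.I • v)
  rw [norm_smul, Complex.norm_I, one_mul] at h2
  have h3 := norm_sub_le (fderiv ℝ f z v) (Complex.I * fderiv ℝ f z (Complex.I • v))
  rw [norm_mul, Complex.norm_I, one_mul] at h3
  rw [norm_mul]
  norm_num
  linarith

lemma norm_dzb_le : ‖dzb v f z‖ ≤ ‖fderiv ℝ f z‖ * ‖v‖ := by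
  unfold dzb
  have h1 := (fderiv ℝ f z).le_opNorm v
  have h2 := (fderiv ℝ f z).le_opNorm (Complex.I • v)
  rw [norm_smul, Complex.norm_I, one_mul] at h2
  have h3 := norm_add_le (fderiv ℝ f z v) (Complex.I * fderiv ℝ f z (Complex.I • v))
  rw [norm_mul, Complex.norm_I, one_mul] at h3
  rw [norm_mul]
  norm_num
  linarith

lemma dz_congr (h : f =ᶠ[𝓝 z] g) : dz v f z = dz v g z := by
  unfold dz; rw [h.fderiv_eq]

lemma dzb_congr (h : f =ᶠ[𝓝 z] g) : dzb v f z = dzb v g z := by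
  unfold dzb; rw [h.fderiv_eq]

lemma dz_eventuallyEq (h : f =ᶠ[𝓝 z] g) : dz v f =ᶠ[𝓝 z] dz v g :=
  (eventually_eventually_nhds.2 h).mono fun _ hy => dz_congr hy

lemma dzb_eventuallyEq (h : f =ᶠ[𝓝 z] g) : dzb v f =ᶠ[𝓝 z] dzb v g :=
  (eventually_eventually_nhds.2 h).mono fun _ hy => dzb_congr hy

lemma dz_const (c : ℂ) : dz v (fun _ => c) z = 0 := by simp [dz]
lemma dzb_const (c : ℂ) : dzb v (fun _ => c) z = 0 := by simp [dzb]

lemma dz_add (hf : DifferentiableAt ℝ f z) (hg : DifferentiableAt ℝ g z) :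
    dz v (fun x => f x + g x) z = dz v f z + dz v g z := by
  unfold dz; rw [fderiv_fun_add hf hg]; simp only [_root_.add_apply]; ring

lemma dzb_add (hf : DifferentiableAt ℝ f z) (hg : DifferentiableAt ℝ g z) :
    dzb v (fun x => f x + g x) z = dzb v f z + dzb v g z := by
  unfold dzb; rw [fderiv_fun_add hf hg]; simp only [_root_.add_apply]; ring

lemma dz_sub (hf : DifferentiableAt ℝ f z) (hg : DifferentiableAt ℝ g z) :
    dz v (fun x => f x - g x) z = dz v f z - dz v g z := by
  unfold dz; rw [fderiv_fun_sub hf hg]; simp only [_root_.sub_apply]; ring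

lemma dzb_sub (hf : DifferentiableAt ℝ f z) (hg : DifferentiableAt ℝ g z) :
    dzb v (fun x => f x - g x) z = dzb v f z - dzb v g z := by
  unfold dzb; rw [fderiv_fun_sub hf hg]; simp only [_root_.sub_apply]; ring

lemma dz_mul (hf : DifferentiableAt ℝ f z) (hg : DifferentiableAt ℝ g z) :
    dz v (fun x => f x * g x) z = dz v f z * g z + f z * dz v g z := by
  unfold dz; rw [fderiv_fun_mul hf hg]
  simp only [_root_.add_apply, _root_.smul_apply, smul_eq_mul]; ring

lemma dzb_mul (hf : DifferentiableAt ℝ f z) (hg : DifferentiableAt ℝ g z) :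
    dzb v (fun x => f x * g x) z = dzb v f z * g z + f z * dzb v g z := by
  unfold dzb; rw [fderiv_fun_mul hf hg]
  simp only [_root_.add_apply, _root_.smul_apply, smul_eq_mul]; ring

lemma dz_const_mul (c : ℂ) (hf : DifferentiableAt ℝ f z) :
    dz v (fun x => c * f x) z = c * dz v f z := by
  rw [dz_mul (differentiableAt_const c) hf, dz_const]; ring

lemma dzb_const_mul (c : ℂ) (hf : DifferentiableAt ℝ f z) :
    dzb v (fun x => c * f x) z = c * dzb v f z := by
  rw [dzb_mul (differentiableAt_const c) hf, dzb_const]; ring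

lemma dz_sum {ι : Type*} (s : Finset ι) {f : ι → Cn n → ℂ}
    (hf : ∀ i ∈ s, DifferentiableAt ℝ (f i) z) :
    dz v (fun x => ∑ i ∈ s, f i x) z = ∑ i ∈ s, dz v (f i) z := by
  unfold dz; rw [fderiv_fun_sum hf]
  simp only [_root_.sum_apply, mul_sum, ← sum_sub_distrib]

lemma dzb_sum {ι : Type*} (s : Finset ι) {f : ι → Cn n → ℂ}
    (hf : ∀ i ∈ s, DifferentiableAt ℝ (f i) z) :
    dzb v (fun x => ∑ i ∈ s, f i x) z = ∑ i ∈ s, dzb v (f i) z := by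
  unfold dzb; rw [fderiv_fun_sum hf]
  simp only [_root_.sum_apply, mul_sum, ← sum_add_distrib]

lemma dz_conj (hf : DifferentiableAt ℝ f z) :
    dz v (fun x => (starRingEnd ℂ) (f x)) z = (starRingEnd ℂ) (dzb v f z) := by
  have h : fderiv ℝ (fun x => (starRingEnd ℂ) (f x)) z =
      (Complex.conjCLE : ℂ →L[ℝ] ℂ).comp (fderiv ℝ f z) :=
    ((Complex.conjCLE : ℂ →L[ℝ] ℂ).hasFDerivAt.comp z hf.hasFDerivAt).fderiv
  unfold dz dzb
  rw [h]
  simp only [ContinuousLinearMap.comp_apply, map_mul, map_add, Complex.conj_I, map_div₀, map_one,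
    map_ofNat]
  change _ * ((starRingEnd ℂ) (fderiv ℝ f z v) - _ * (starRingEnd ℂ) (fderiv ℝ f z _)) = _
  ring

lemma dzb_conj (hf : DifferentiableAt ℝ f z) :
    dzb v (fun x => (starRingEnd ℂ) (f x)) z = (starRingEnd ℂ) (dz v f z) := by
  have h : DifferentiableAt ℝ (fun x => (starRingEnd ℂ) (f x)) z :=
    (Complex.conjCLE : ℂ →L[ℝ] ℂ).differentiableAt.comp z hf
  have := dz_conj (v := v) h
  simp only [Complex.conj_conj] at this
  rw [show (fun x => f x) = f from rfl] at this
  rw [this, Complex.conj_conj]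

lemma dz_exp (hf : DifferentiableAt ℝ f z) :
    dz v (fun x => Complex.exp (f x)) z = Complex.exp (f z) * dz v f z := by
  have h := ((Complex.hasDerivAt_exp (f z)).hasFDerivAt.restrictScalars ℝ).comp z hf.hasFDerivAt
  have h' : fderiv ℝ (fun x => Complex.exp (f x)) z = _ := h.fderiv
  unfold dz
  rw [h']
  simp
  ring

lemma dzb_exp (hf : DifferentiableAt ℝ f z) :
    dzb v (fun x => Complex.exp (f x)) z = Complex.exp (f z) * dzb v f z := by
  have h := ((Complex.hasDerivAt_exp (f z)).hasFDerivAt.restrictScalars ℝ).comp z hf.hasFDerivAt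
  have h' : fderiv ℝ (fun x => Complex.exp (f x)) z = _ := h.fderiv
  unfold dzb
  rw [h']
  simp
  ring

lemma dz_prod {ι : Type*} [DecidableEq ι] (s : Finset ι) {f : ι → Cn n → ℂ}
    (hf : ∀ i ∈ s, DifferentiableAt ℝ (f i) z) :
    dz v (fun x => ∏ i ∈ s, f i x) z = ∑ i ∈ s, dz v (f i) z * ∏ j ∈ s.erase i, f j z := by
  have h := (HasFDerivAt.finsetProd (u := s) fun i hi => (hf i hi).hasFDerivAt).fderiv
  unfold dz
  rw [h]
  simp only [_root_.sum_apply, _root_.smul_apply, smul_eq_mul, mul_sum,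
    ← sum_sub_distrib]
  exact sum_congr rfl fun i _ => by ring

lemma dzb_prod {ι : Type*} [DecidableEq ι] (s : Finset ι) {f : ι → Cn n → ℂ}
    (hf : ∀ i ∈ s, DifferentiableAt ℝ (f i) z) :
    dzb v (fun x => ∏ i ∈ s, f i x) z = ∑ i ∈ s, dzb v (f i) z * ∏ j ∈ s.erase i, f j z := by
  have h := (HasFDerivAt.finsetProd (u := s) fun i hi => (hf i hi).hasFDerivAt).fderiv
  unfold dzb
  rw [h]
  simp only [_root_.sum_apply, _root_.smul_apply, smul_eq_mul, mul_sum,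
    ← sum_add_distrib]
  exact sum_congr rfl fun i _ => by ring

/-! ### Second derivatives -/

lemma contDiffAt_dz {m : ℕ∞} (hf : ContDiffAt ℝ (m + 1) f z) : ContDiffAt ℝ m (dz v f) z := by
  have h := hf.fderiv_right (m := m) le_rfl
  exact contDiffAt_const.mul ((h.clm_apply contDiffAt_const).sub
    (contDiffAt_const.mul (h.clm_apply contDiffAt_const)))

lemma contDiffAt_dzb {m : ℕ∞} (hf : ContDiffAt ℝ (m + 1) f z) : ContDiffAt ℝ m (dzb v f) z := by
  have h := hf.fderiv_right (m := m) le_rfl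
  exact contDiffAt_const.mul ((h.clm_apply contDiffAt_const).add
    (contDiffAt_const.mul (h.clm_apply contDiffAt_const)))

lemma eventually_differentiableAt (hf : ContDiffAt ℝ 1 f z) :
    ∀ᶠ x in 𝓝 z, DifferentiableAt ℝ f x :=
  (hf.eventually (by simp)).mono fun _ h => h.differentiableAt (by simp)

lemma differentiableAt_fderiv (hf : ContDiffAt ℝ 2 f z) : DifferentiableAt ℝ (fderiv ℝ f) z :=
  (hf.fderiv_right (m := 1) (by norm_num)).differentiableAt (by simp)

lemma differentiableAt_dz (hf : ContDiffAt ℝ 2 f z) : DifferentiableAt ℝ (dz v f) z :=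
  (contDiffAt_dz (m := 1) (by simpa using (by norm_num; exact hf))).differentiableAt (by simp)

lemma differentiableAt_dzb (hf : ContDiffAt ℝ 2 f z) : DifferentiableAt ℝ (dzb v f) z :=
  (contDiffAt_dzb (m := 1) (by simpa using (by norm_num; exact hf))).differentiableAt (by simp)

lemma fderiv_dz (hf : ContDiffAt ℝ 2 f z) : fderiv ℝ (dz v f) z w =
    (1 / 2 : ℂ) * (fderiv ℝ (fderiv ℝ f) z w v -
      Complex.I * fderiv ℝ (fderiv ℝ f) z w (Complex.I • v)) := by
  have h := (differentiableAt_fderiv hf).hasFDerivAt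
  have h1 := (h.clm_apply (hasFDerivAt_const v z))
  have h2 := (h.clm_apply (hasFDerivAt_const (Complex.I • v) z))
  have h3 := (h1.sub (h2.const_mul Complex.I)).const_mul (1 / 2 : ℂ)
  have : fderiv ℝ (dz v f) z = _ := h3.fderiv
  rw [this]
  simp

lemma fderiv_dzb (hf : ContDiffAt ℝ 2 f z) : fderiv ℝ (dzb v f) z w =
    (1 / 2 : ℂ) * (fderiv ℝ (fderiv ℝ f) z w v +
      Complex.I * fderiv ℝ (fderiv ℝ f) z w (Complex.I • v)) := by
  have h := (differentiableAt_fderiv hf).hasFDerivAt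
  have h1 := (h.clm_apply (hasFDerivAt_const v z))
  have h2 := (h.clm_apply (hasFDerivAt_const (Complex.I • v) z))
  have h3 := (h1.add (h2.const_mul Complex.I)).const_mul (1 / 2 : ℂ)
  have : fderiv ℝ (dzb v f) z = _ := h3.fderiv
  rw [this]
  simp
  ring

lemma fderiv_fderiv_symm {V : Type*} [NormedAddCommGroup V] [NormedSpace ℝ V] {f : V → ℂ} {z : V}
    (hf : ContDiffAt ℝ 2 f z) (v w : V) :
    fderiv ℝ (fderiv ℝ f) z v w = fderiv ℝ (fderiv ℝ f) z w v :=
  (hf.isSymmSndFDerivAt (by simp)) v w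

lemma dz_dz_comm (hf : ContDiffAt ℝ 2 f z) : dz v (dz w f) z = dz w (dz v f) z := by
  have hs := fderiv_fderiv_symm hf
  conv_lhs => rw [dz, fderiv_dz hf, fderiv_dz hf, hs v w,
    hs v (Complex.I • w), hs (Complex.I • v) w, hs (Complex.I • v) (Complex.I • w)]
  conv_rhs => rw [dz, fderiv_dz hf, fderiv_dz hf]
  ring

lemma dzb_dz_comm (hf : ContDiffAt ℝ 2 f z) : dzb v (dz w f) z = dz w (dzb v f) z := by
  have hs := fderiv_fderiv_symm hf
  conv_lhs => rw [dzb, fderiv_dz hf, fderiv_dz hf, hs v w,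
    hs v (Complex.I • w), hs (Complex.I • v) w, hs (Complex.I • v) (Complex.I • w)]
  conv_rhs => rw [dz, fderiv_dzb hf, fderiv_dzb hf]
  ring

lemma dzb_dzb_comm (hf : ContDiffAt ℝ 2 f z) : dzb v (dzb w f) z = dzb w (dzb v f) z := by
  have hs := fderiv_fderiv_symm hf
  conv_lhs => rw [dzb, fderiv_dzb hf, fderiv_dzb hf, hs v w,
    hs v (Complex.I • w), hs (Complex.I • v) w, hs (Complex.I • v) (Complex.I • w)]
  conv_rhs => rw [dzb, fderiv_dzb hf, fderiv_dzb hf]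
  ring

lemma dzb_dz_self (hf : ContDiffAt ℝ 2 f z) : dzb v (dz v f) z =
    (1 / 4 : ℂ) * (fderiv ℝ (fderiv ℝ f) z v v +
      fderiv ℝ (fderiv ℝ f) z (Complex.I • v) (Complex.I • v)) := by
  have hs := fderiv_fderiv_symm hf v (Complex.I • v)
  rw [dzb, fderiv_dz hf, fderiv_dz hf, hs]
  linear_combination (-(1 / 4 : ℂ) * fderiv ℝ (fderiv ℝ f) z (Complex.I • v) (Complex.I • v)) *
    Complex.I_sq

lemma dzb_dz_mul (hf : ContDiffAt ℝ 2 f z) (hg : ContDiffAt ℝ 2 g z) :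
    dzb v (dz v (fun x => f x * g x)) z = dzb v (dz v f) z * g z + dz v f z * dzb v g z +
      dzb v f z * dz v g z + f z * dzb v (dz v g) z := by
  have hf1 := hf.of_le (m := 1) (by norm_num)
  have hg1 := hg.of_le (m := 1) (by norm_num)
  have h : dz v (fun x => f x * g x) =ᶠ[𝓝 z] fun x => dz v f x * g x + f x * dz v g x := by
    filter_upwards [eventually_differentiableAt hf1, eventually_differentiableAt hg1] with x h1 h2
    exact dz_mul h1 h2
  have a1 := hf1.differentiableAt (by simp)
  have a2 := hg1.differentiableAt (by simp)
  have a3 := differentiableAt_dz (v := v) hf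
  have a4 := differentiableAt_dz (v := v) hg
  rw [dzb_congr h, dzb_add (a3.fun_mul a2) (a1.fun_mul a4), dzb_mul a3 a2, dzb_mul a1 a4]
  ring

end Wirtinger

/-! ### Derivatives of determinants at a diagonal matrix -/

section Det
variable {n : ℕ}

/-- In the first derivative of a determinant at a diagonal matrix only the identity contributes. -/
lemma sum_perm_erase (m A : Fin n → Fin n → ℂ) (hm : ∀ i j, i ≠ j → m i j = 0) (p : Fin n) :
    ∑ σ : Equiv.Perm (Fin n), ((Equiv.Perm.sign σ : ℤ) : ℂ) *
      (A (σ p) p * ∏ i ∈ univ.erase p, m (σ i) i) = A p p * ∏ i ∈ univ.erase p, m i i := by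
  rw [sum_eq_single (1 : Equiv.Perm (Fin n))]
  · simp
  · intro σ _ hσ
    obtain ⟨r, hrp, hr⟩ : ∃ r, r ≠ p ∧ σ r ≠ r := by
      by_contra hcon
      push Not at hcon
      refine hσ (Equiv.ext fun i => ?_)
      by_cases hi : i = p
      · subst hi
        by_contra hne
        have h2 := hcon (σ i) hne
        exact hne (σ.injective h2)
      · exact hcon i hi
    have h0 : ∏ i ∈ univ.erase p, m (σ i) i = 0 :=
      prod_eq_zero (mem_erase.2 ⟨hrp, mem_univ r⟩) (hm _ _ hr)
    rw [h0]
    ring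
  · simp

/-- In the second derivative of a determinant at a diagonal matrix only the identity and the
transposition of the two differentiated columns contribute. -/
lemma sum_perm_erase_erase (m A B : Fin n → Fin n → ℂ) (hm : ∀ i j, i ≠ j → m i j = 0)
    {p q : Fin n} (hpq : q ≠ p) :
    ∑ σ : Equiv.Perm (Fin n), ((Equiv.Perm.sign σ : ℤ) : ℂ) *
      (A (σ p) p * (B (σ q) q * ∏ i ∈ (univ.erase p).erase q, m (σ i) i)) =
      (A p p * B q q - A q p * B p q) * ∏ i ∈ (univ.erase p).erase q, m i i := by
  have hne : (1 : Equiv.Perm (Fin n)) ≠ Equiv.swap p q := by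
    intro h
    have := congrArg (fun σ : Equiv.Perm (Fin n) => σ p) h
    simp only [Equiv.Perm.coe_one, id_eq, Equiv.swap_apply_left] at this
    exact hpq this.symm
  rw [← sum_subset (subset_univ {(1 : Equiv.Perm (Fin n)), Equiv.swap p q})]
  · rw [sum_pair hne, Equiv.Perm.sign_swap hpq.symm]
    have : ∏ i ∈ (univ.erase p).erase q, m (Equiv.swap p q i) i =
        ∏ i ∈ (univ.erase p).erase q, m i i := by
      refine prod_congr rfl fun i hi => ?_
      have h1 := mem_erase.1 hi
      have h2 := mem_erase.1 h1.2
      rw [Equiv.swap_apply_of_ne_of_ne h2.1 h1.1]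
    rw [this, Equiv.swap_apply_left, Equiv.swap_apply_right]
    simp
    ring
  · intro σ _ hσ
    simp only [mem_insert, mem_singleton, not_or] at hσ
    obtain ⟨r, hrp, hrq, hr⟩ : ∃ r, r ≠ p ∧ r ≠ q ∧ σ r ≠ r := by
      by_contra hcon
      push Not at hcon
      have hp : σ p = p ∨ σ p = q := by
        by_contra h; push Not at h
        exact h.1 (σ.injective (hcon _ h.1 h.2))
      have hq : σ q = p ∨ σ q = q := by
        by_contra h; push Not at h
        exact h.2 (σ.injective (hcon _ h.1 h.2))
      rcases hp with hp | hp
      · refine hσ.1 (Equiv.ext fun i => ?_)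
        by_cases hi : i = p
        · rw [hi]; exact hp
        by_cases hi' : i = q
        · rw [hi']
          rcases hq with hq | hq
          · exact absurd (σ.injective (hq.trans hp.symm)) hpq
          · exact hq
        · exact hcon i hi hi'
      · refine hσ.2 (Equiv.ext fun i => ?_)
        by_cases hi : i = p
        · rw [hi, Equiv.swap_apply_left]; exact hp
        by_cases hi' : i = q
        · rw [hi', Equiv.swap_apply_right]
          rcases hq with hq | hq
          · exact hq
          · exact absurd (σ.injective (hq.trans hp.symm)) hpq
        · rw [Equiv.swap_apply_of_ne_of_ne hi hi']; exact hcon i hi hi'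
    have h0 : ∏ i ∈ (univ.erase p).erase q, m (σ i) i = 0 :=
      prod_eq_zero (mem_erase.2 ⟨hrq, mem_erase.2 ⟨hrp, mem_univ r⟩⟩) (hm _ _ hr)
    rw [h0]
    ring

variable {M : Fin n → Fin n → Cn n → ℂ} {z : Cn n} {v : Cn n} {m : Fin n → ℂ}

lemma differentiableAt_prod {ι : Type*} {s : Finset ι} {f : ι → Cn n → ℂ}
    (hf : ∀ i ∈ s, DifferentiableAt ℝ (f i) z) : DifferentiableAt ℝ (fun x => ∏ i ∈ s, f i x) z := by
  classical
  exact (HasFDerivAt.finsetProd fun i hi => (hf i hi).hasFDerivAt).differentiableAt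

lemma contDiffAt_det {k : ℕ∞} (hM : ∀ i j, ContDiffAt ℝ k (M i j) z) :
    ContDiffAt ℝ k (fun x => (Matrix.of fun i j => M i j x).det) z := by
  simp only [Matrix.det_apply']
  exact ContDiffAt.sum fun σ _ => contDiffAt_const.mul (contDiffAt_prod fun i _ => hM _ _)

lemma dz_det (hM : ∀ i j, ContDiffAt ℝ 1 (M i j) z)
    (hd : ∀ i j, M i j z = if i = j then m i else 0) :
    dz v (fun x => (Matrix.of fun i j => M i j x).det) z =
      ∑ p, dz v (M p p) z * ∏ r ∈ univ.erase p, m r := by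
  have hdiff : ∀ i j, DifferentiableAt ℝ (M i j) z := fun i j => (hM i j).differentiableAt (by simp)
  simp only [Matrix.det_apply', Matrix.of_apply]
  rw [dz_sum _ fun σ _ => (differentiableAt_prod fun i _ => hdiff _ _).const_mul _]
  have h1 : ∀ σ : Equiv.Perm (Fin n),
      dz v (fun x => ((Equiv.Perm.sign σ : ℤ) : ℂ) * ∏ i, M (σ i) i x) z =
      ∑ p, ((Equiv.Perm.sign σ : ℤ) : ℂ) * (dz v (M (σ p) p) z *
        ∏ i ∈ univ.erase p, M (σ i) i z) := fun σ => by
    rw [dz_const_mul _ (differentiableAt_prod fun i _ => hdiff _ _),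
      dz_prod _ (fun i _ => hdiff _ _), mul_sum]
  rw [sum_congr rfl fun σ _ => h1 σ, sum_comm]
  refine sum_congr rfl fun p _ => ?_
  rw [sum_perm_erase (fun i j => M i j z) (fun i j => dz v (M i j) z)
    (fun i j hij => by rw [hd, if_neg hij])]
  simp [hd]

lemma dzb_dz_det (hM : ∀ i j, ContDiffAt ℝ 2 (M i j) z)
    (hd : ∀ i j, M i j z = if i = j then m i else 0) :
    dzb v (dz v (fun x => (Matrix.of fun i j => M i j x).det)) z =
      ∑ p, dzb v (dz v (M p p)) z * ∏ r ∈ univ.erase p, m r +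
      ∑ p, ∑ q ∈ univ.erase p, (dz v (M p p) z * dzb v (M q q) z -
        dz v (M q p) z * dzb v (M p q) z) * ∏ r ∈ (univ.erase p).erase q, m r := by
  have hM1 : ∀ i j, ContDiffAt ℝ 1 (M i j) z := fun i j => (hM i j).of_le (by norm_num)
  have hdiff : ∀ i j, DifferentiableAt ℝ (M i j) z := fun i j => (hM1 i j).differentiableAt (by simp)
  have hdiff2 : ∀ i j, DifferentiableAt ℝ (dz v (M i j)) z := fun i j => differentiableAt_dz (hM i j)
  have hev : ∀ᶠ x in 𝓝 z, ∀ i j, DifferentiableAt ℝ (M i j) x :=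
    eventually_all.2 fun i => eventually_all.2 fun j => eventually_differentiableAt (hM1 i j)
  have h0 : dz v (fun x => (Matrix.of fun i j => M i j x).det) =ᶠ[𝓝 z]
      fun x => ∑ σ : Equiv.Perm (Fin n), ((Equiv.Perm.sign σ : ℤ) : ℂ) * ∑ p,
        (dz v (M (σ p) p) x * ∏ i ∈ univ.erase p, M (σ i) i x) := by
    filter_upwards [hev] with x hx
    simp only [Matrix.det_apply', Matrix.of_apply]
    rw [dz_sum _ fun σ _ => (differentiableAt_prod fun i _ => hx _ _).const_mul _]
    refine sum_congr rfl fun σ _ => ?_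
    rw [dz_const_mul _ (differentiableAt_prod fun i _ => hx _ _),
      dz_prod _ (fun i _ => hx _ _)]
  have hp : ∀ (σ : Equiv.Perm (Fin n)) (p : Fin n), DifferentiableAt ℝ
      (fun x => dz v (M (σ p) p) x * ∏ i ∈ univ.erase p, M (σ i) i x) z := fun σ p =>
    (hdiff2 _ _).fun_mul (differentiableAt_prod fun i _ => hdiff _ _)
  rw [dzb_congr h0, dzb_sum _ fun σ _ => (DifferentiableAt.fun_sum fun p _ => hp σ p).const_mul _]
  have h1 : ∀ σ : Equiv.Perm (Fin n),
      dzb v (fun x => ((Equiv.Perm.sign σ : ℤ) : ℂ) * ∑ p,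
        (dz v (M (σ p) p) x * ∏ i ∈ univ.erase p, M (σ i) i x)) z =
      ∑ p, ((Equiv.Perm.sign σ : ℤ) : ℂ) * (dzb v (dz v (M (σ p) p)) z *
        ∏ i ∈ univ.erase p, M (σ i) i z) +
      ∑ p, ∑ q ∈ univ.erase p, ((Equiv.Perm.sign σ : ℤ) : ℂ) * (dz v (M (σ p) p) z *
        (dzb v (M (σ q) q) z * ∏ i ∈ (univ.erase p).erase q, M (σ i) i z)) := fun σ => by
    rw [dzb_const_mul _ (DifferentiableAt.fun_sum fun p _ => hp σ p), dzb_sum _ fun p _ => hp σ p,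
      mul_sum, ← sum_add_distrib]
    refine sum_congr rfl fun p _ => ?_
    rw [dzb_mul (hdiff2 _ _) (differentiableAt_prod fun i _ => hdiff _ _),
      dzb_prod _ (fun i _ => hdiff _ _), mul_add, mul_sum, mul_sum]
  rw [sum_congr rfl fun σ _ => h1 σ, sum_add_distrib]
  congr 1
  · rw [sum_comm]
    refine sum_congr rfl fun p _ => ?_
    rw [sum_perm_erase (fun i j => M i j z) (fun i j => dzb v (dz v (M i j)) z)
      (fun i j hij => by rw [hd, if_neg hij])]
    simp [hd]
  · rw [sum_comm]
    refine sum_congr rfl fun p _ => ?_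
    rw [sum_comm]
    refine sum_congr rfl fun q hq => ?_
    rw [sum_perm_erase_erase (fun i j => M i j z) (fun i j => dz v (M i j) z)
      (fun i j => dzb v (M i j) z) (fun i j hij => by rw [hd, if_neg hij]) (ne_of_mem_erase hq)]
    simp [hd]

/-! ### Coefficients of the characteristic polynomial -/

/-- A coefficient of a polynomial of bounded degree is a fixed linear combination of its values
at `0, …, n`. -/
lemma exists_coeff_eq_sum_eval (n k : ℕ) : ∃ c : ℕ → ℂ, ∀ P : Polynomial ℂ, P.natDegree ≤ n →
    P.coeff k = ∑ j ∈ range (n + 1), c j * P.eval (j : ℂ) := by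
  refine ⟨fun j => (Lagrange.basis (range (n + 1)) (fun j : ℕ => (j : ℂ)) j).coeff k,
    fun P hP => ?_⟩
  have hinj : Set.InjOn (fun j : ℕ => (j : ℂ)) (range (n + 1)) := fun a _ b _ h => by
    exact Nat.cast_injective h
  have hdeg : P.degree < (range (n + 1)).card := by
    rw [card_range]
    exact (Polynomial.degree_le_natDegree).trans_lt (by exact_mod_cast Nat.lt_succ_of_le hP)
  conv_lhs => rw [Lagrange.eq_interpolate hinj hdeg, Lagrange.interpolate_apply]
  simp [Polynomial.finsetSum_coeff, mul_comm]

/-- The coefficient of `t^k` in `det (h + t g)`; it equals `σ_k(λ) det h` with `λ` the eigenvalues of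
`g` with respect to `h`. -/
def hessCoeff (k : ℕ) (h g : Matrix (Fin n) (Fin n) ℂ) : ℂ :=
  (Matrix.det ((Polynomial.X : Polynomial ℂ) • g.map Polynomial.C + h.map Polynomial.C)).coeff k

/-- Interpolation expresses `hessCoeff` through determinants, so that it is differentiated by
differentiating determinants. -/
lemma exists_hessCoeff_eq (n k : ℕ) : ∃ c : ℕ → ℂ, (∀ P : Polynomial ℂ, P.natDegree ≤ n →
    P.coeff k = ∑ j ∈ range (n + 1), c j * P.eval (j : ℂ)) ∧
    ∀ h g : Matrix (Fin n) (Fin n) ℂ, hessCoeff k h g =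
      ∑ j ∈ range (n + 1), c j * (h + (j : ℂ) • g).det := by
  obtain ⟨c, hc⟩ := exists_coeff_eq_sum_eval n k
  refine ⟨c, hc, fun h g => ?_⟩
  rw [hessCoeff, hc _ (by simpa using Polynomial.natDegree_det_X_add_C_le g h)]
  refine sum_congr rfl fun j _ => ?_
  congr 1
  rw [← Polynomial.coe_evalRingHom, RingHom.map_det]
  congr 1
  ext a b
  simp only [RingHom.mapMatrix_apply, Matrix.map_apply, Matrix.add_apply, Matrix.smul_apply,
    smul_eq_mul, Polynomial.coe_evalRingHom, Polynomial.eval_add, Polynomial.eval_mul,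
    Polynomial.eval_X, Polynomial.eval_C]
  ring

lemma coeff_prod_one_add (s : Finset (Fin n)) (x : Fin n → ℝ) (k : ℕ) :
    (∏ r ∈ s, (1 + Polynomial.C (x r : ℂ) * Polynomial.X)).coeff k = (esym s k x : ℂ) := by
  induction s using Finset.induction_on generalizing k with
  | empty =>
    cases k with
    | zero => simp [esym_zero]
    | succ k => rw [esym_eq_zero (by simp)]; simp [Polynomial.coeff_one]
  | insert a s ha ih =>
    rw [prod_insert ha, add_mul, one_mul, Polynomial.coeff_add, ih]
    cases k with
    | zero => simp [esym_zero, mul_assoc, Polynomial.mul_coeff_zero]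
    | succ k =>
      rw [mul_assoc, Polynomial.coeff_C_mul, Polynomial.coeff_X_mul, ih, esym_insert ha]
      push_cast
      ring

lemma natDegree_prod_one_add_le (s : Finset (Fin n)) (x : Fin n → ℝ) :
    (∏ r ∈ s, (1 + Polynomial.C (x r : ℂ) * Polynomial.X)).natDegree ≤ s.card := by
  refine (Polynomial.natDegree_prod_le _ _).trans ?_
  rw [card_eq_sum_ones]
  refine sum_le_sum fun r _ => ?_
  compute_degree

lemma hessCoeff_diagonal (k : ℕ) (x : Fin n → ℝ) :
    hessCoeff k 1 (Matrix.diagonal fun i => (x i : ℂ)) = (esym univ k x : ℂ) := by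
  rw [← coeff_prod_one_add, hessCoeff]
  congr 1
  rw [← Matrix.det_diagonal]
  congr 1
  ext1 a b
  by_cases hab : a = b
  · subst hab
    simp only [Matrix.add_apply, Matrix.smul_apply, Matrix.map_apply, Matrix.diagonal_apply_eq,
      Matrix.one_apply_eq, Polynomial.C_1, smul_eq_mul]
    ring
  · simp only [Matrix.add_apply, Matrix.smul_apply, Matrix.map_apply,
      Matrix.diagonal_apply_ne _ hab, Matrix.one_apply_ne hab, Polynomial.C_0, smul_eq_mul]
    ring

variable {h g : Fin n → Fin n → Cn n → ℂ} {lam : Fin n → ℝ}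

/-- The first derivative of `hessCoeff`, where the metric is the identity and `g` is diagonal. -/
lemma dz_hessCoeff (k : ℕ) (hh : ∀ i j, ContDiffAt ℝ 1 (h i j) z)
    (hg : ∀ i j, ContDiffAt ℝ 1 (g i j) z) (h1 : ∀ i j, h i j z = if i = j then 1 else 0)
    (g1 : ∀ i j, g i j z = if i = j then (lam i : ℂ) else 0) :
    dz v (fun x => hessCoeff (k + 1) (Matrix.of fun i j => h i j x) (Matrix.of fun i j => g i j x)) z
      = ∑ p, (dz v (h p p) z * (esym (univ.erase p) (k + 1) lam : ℝ) +
        dz v (g p p) z * (esym (univ.erase p) k lam : ℝ)) := by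
  obtain ⟨c, hc, hc'⟩ := exists_hessCoeff_eq n (k + 1)
  set P : Polynomial ℂ := ∑ p, (Polynomial.C (dz v (h p p) z) + Polynomial.C (dz v (g p p) z) *
    Polynomial.X) * ∏ r ∈ univ.erase p, (1 + Polynomial.C (lam r : ℂ) * Polynomial.X) with hP
  have e1 : P.coeff (k + 1) = ∑ p, (dz v (h p p) z * (esym (univ.erase p) (k + 1) lam : ℝ) +
        dz v (g p p) z * (esym (univ.erase p) k lam : ℝ)) := by
    rw [hP, Polynomial.finsetSum_coeff]
    refine sum_congr rfl fun p _ => ?_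
    rw [add_mul, Polynomial.coeff_add, Polynomial.coeff_C_mul, mul_assoc, Polynomial.coeff_C_mul,
      Polynomial.coeff_X_mul, coeff_prod_one_add, coeff_prod_one_add]
  have hdeg : P.natDegree ≤ n := by
    rw [hP]
    refine Polynomial.natDegree_sum_le_of_forall_le _ _ fun p _ => ?_
    refine Polynomial.natDegree_mul_le.trans ?_
    have a1 : (Polynomial.C (dz v (h p p) z) + Polynomial.C (dz v (g p p) z) *
      Polynomial.X).natDegree ≤ 1 := by compute_degree
    have a2 := natDegree_prod_one_add_le (univ.erase p) lam
    rw [card_erase_of_mem (mem_univ p), card_univ, Fintype.card_fin] at a2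
    have := Fin.pos p
    omega
  rw [← e1, hc P hdeg]
  simp only [hc']
  have hM : ∀ (j : ℕ) i i', ContDiffAt ℝ 1 (fun x => h i i' x + (j : ℂ) * g i i' x) z :=
    fun j i i' => (hh i i').add (contDiffAt_const.mul (hg i i'))
  have e0 : ∀ (j : ℕ) x, ((Matrix.of fun i i' => h i i' x) + (j : ℂ) • (Matrix.of fun i i' => g i i' x))
      = Matrix.of fun i i' => h i i' x + (j : ℂ) * g i i' x := fun j x => by ext; simp
  simp only [e0]
  rw [dz_sum _ fun j _ => ((contDiffAt_det (hM j)).differentiableAt (by simp)).const_mul _]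
  refine sum_congr rfl fun j _ => ?_
  rw [dz_const_mul _ ((contDiffAt_det (hM j)).differentiableAt (by simp)),
    dz_det (m := fun i => 1 + (lam i : ℂ) * j) (hM j)]
  · rw [hP, Polynomial.eval_finsetSum]
    congr 1
    refine sum_congr rfl fun p _ => ?_
    rw [dz_add ((hh p p).differentiableAt (by simp)) (((hg p p).differentiableAt (by simp)).const_mul _),
      dz_const_mul _ ((hg p p).differentiableAt (by simp))]
    simp only [Polynomial.eval_mul, Polynomial.eval_add, Polynomial.eval_C, Polynomial.eval_X,
      Polynomial.eval_prod, Polynomial.eval_one]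
    rw [mul_comm (j : ℂ)]
  · intro a b
    rw [h1, g1]
    split_ifs <;> simp [mul_comm]

/-- The second derivative of `hessCoeff`, where the metric is the identity and `g` is diagonal. -/
lemma dzb_dz_hessCoeff (k : ℕ) (hh : ∀ i j, ContDiffAt ℝ 2 (h i j) z)
    (hg : ∀ i j, ContDiffAt ℝ 2 (g i j) z) (h1 : ∀ i j, h i j z = if i = j then 1 else 0)
    (g1 : ∀ i j, g i j z = if i = j then (lam i : ℂ) else 0) :
    dzb v (dz v (fun x => hessCoeff (k + 2) (Matrix.of fun i j => h i j x)
      (Matrix.of fun i j => g i j x))) z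
      = ∑ p, (dzb v (dz v (h p p)) z * (esym (univ.erase p) (k + 2) lam : ℝ) +
        dzb v (dz v (g p p)) z * (esym (univ.erase p) (k + 1) lam : ℝ)) +
      ∑ p, ∑ q ∈ univ.erase p,
        ((dz v (h p p) z * dzb v (h q q) z - dz v (h q p) z * dzb v (h p q) z) *
          (esym ((univ.erase p).erase q) (k + 2) lam : ℝ) +
        (dz v (h p p) z * dzb v (g q q) z + dz v (g p p) z * dzb v (h q q) z -
          dz v (h q p) z * dzb v (g p q) z - dz v (g q p) z * dzb v (h p q) z) *
          (esym ((univ.erase p).erase q) (k + 1) lam : ℝ) +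
        (dz v (g p p) z * dzb v (g q q) z - dz v (g q p) z * dzb v (g p q) z) *
          (esym ((univ.erase p).erase q) k lam : ℝ)) := by
  obtain ⟨c, hc, hc'⟩ := exists_hessCoeff_eq n (k + 2)
  set P : Polynomial ℂ := ∑ p, (Polynomial.C (dzb v (dz v (h p p)) z) +
      Polynomial.C (dzb v (dz v (g p p)) z) *
    Polynomial.X) * ∏ r ∈ univ.erase p, (1 + Polynomial.C (lam r : ℂ) * Polynomial.X) with hP
  set R : Polynomial ℂ := ∑ p, ∑ q ∈ univ.erase p,
    (Polynomial.C (dz v (h p p) z * dzb v (h q q) z - dz v (h q p) z * dzb v (h p q) z) +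
      Polynomial.C (dz v (h p p) z * dzb v (g q q) z + dz v (g p p) z * dzb v (h q q) z -
          dz v (h q p) z * dzb v (g p q) z - dz v (g q p) z * dzb v (h p q) z) * Polynomial.X +
      Polynomial.C (dz v (g p p) z * dzb v (g q q) z - dz v (g q p) z * dzb v (g p q) z) *
        (Polynomial.X * Polynomial.X)) *
      ∏ r ∈ (univ.erase p).erase q, (1 + Polynomial.C (lam r : ℂ) * Polynomial.X) with hR
  have e1 : P.coeff (k + 2) = ∑ p, (dzb v (dz v (h p p)) z * (esym (univ.erase p) (k + 2) lam : ℝ) +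
        dzb v (dz v (g p p)) z * (esym (univ.erase p) (k + 1) lam : ℝ)) := by
    rw [hP, Polynomial.finsetSum_coeff]
    refine sum_congr rfl fun p _ => ?_
    rw [add_mul, Polynomial.coeff_add, Polynomial.coeff_C_mul, mul_assoc, Polynomial.coeff_C_mul,
      Polynomial.coeff_X_mul, coeff_prod_one_add, coeff_prod_one_add]
  have e2 : R.coeff (k + 2) = ∑ p, ∑ q ∈ univ.erase p,
        ((dz v (h p p) z * dzb v (h q q) z - dz v (h q p) z * dzb v (h p q) z) *
          (esym ((univ.erase p).erase q) (k + 2) lam : ℝ) +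
        (dz v (h p p) z * dzb v (g q q) z + dz v (g p p) z * dzb v (h q q) z -
          dz v (h q p) z * dzb v (g p q) z - dz v (g q p) z * dzb v (h p q) z) *
          (esym ((univ.erase p).erase q) (k + 1) lam : ℝ) +
        (dz v (g p p) z * dzb v (g q q) z - dz v (g q p) z * dzb v (g p q) z) *
          (esym ((univ.erase p).erase q) k lam : ℝ)) := by
    rw [hR, Polynomial.finsetSum_coeff]
    refine sum_congr rfl fun p _ => ?_
    rw [Polynomial.finsetSum_coeff]
    refine sum_congr rfl fun q _ => ?_
    rw [add_mul, add_mul, Polynomial.coeff_add, Polynomial.coeff_add, Polynomial.coeff_C_mul,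
      mul_assoc, Polynomial.coeff_C_mul, Polynomial.coeff_X_mul, mul_assoc, Polynomial.coeff_C_mul,
      mul_assoc, Polynomial.coeff_X_mul, Polynomial.coeff_X_mul, coeff_prod_one_add,
      coeff_prod_one_add, coeff_prod_one_add]
  have hdeg : (P + R).natDegree ≤ n := by
    refine (Polynomial.natDegree_add_le _ _).trans (max_le ?_ ?_)
    · rw [hP]
      refine Polynomial.natDegree_sum_le_of_forall_le _ _ fun p _ => ?_
      refine Polynomial.natDegree_mul_le.trans ?_
      have a1 : (Polynomial.C (dzb v (dz v (h p p)) z) + Polynomial.C (dzb v (dz v (g p p)) z) *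
        Polynomial.X).natDegree ≤ 1 := by compute_degree
      have a2 := natDegree_prod_one_add_le (univ.erase p) lam
      rw [card_erase_of_mem (mem_univ p), card_univ, Fintype.card_fin] at a2
      have := Fin.pos p
      omega
    · rw [hR]
      refine Polynomial.natDegree_sum_le_of_forall_le _ _ fun p _ => ?_
      refine Polynomial.natDegree_sum_le_of_forall_le _ _ fun q hq => ?_
      refine Polynomial.natDegree_mul_le.trans ?_
      have a1 : ∀ a b c : ℂ, (Polynomial.C a + Polynomial.C b * Polynomial.X + Polynomial.C c *
        (Polynomial.X * Polynomial.X)).natDegree ≤ 2 := fun a b c => by compute_degree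
      have a2 := natDegree_prod_one_add_le ((univ.erase p).erase q) lam
      rw [card_erase_of_mem hq, card_erase_of_mem (mem_univ p), card_univ, Fintype.card_fin] at a2
      have h3 : 0 < (univ.erase p).card := card_pos.2 ⟨q, hq⟩
      rw [card_erase_of_mem (mem_univ p), card_univ, Fintype.card_fin] at h3
      exact (add_le_add (a1 _ _ _) a2).trans (by omega)
  rw [← e1, ← e2, ← Polynomial.coeff_add, hc _ hdeg]
  simp only [hc']
  have hM : ∀ (j : ℕ) i i', ContDiffAt ℝ 2 (fun x => h i i' x + (j : ℂ) * g i i' x) z :=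
    fun j i i' => (hh i i').add (contDiffAt_const.mul (hg i i'))
  have e0 : ∀ (j : ℕ) x, ((Matrix.of fun i i' => h i i' x) + (j : ℂ) • (Matrix.of fun i i' => g i i' x))
      = Matrix.of fun i i' => h i i' x + (j : ℂ) * g i i' x := fun j x => by ext; simp
  simp only [e0]
  have hD2 : ∀ j : ℕ, ContDiffAt ℝ 2
      (fun x => (Matrix.of fun i i' => h i i' x + (j : ℂ) * g i i' x).det) z :=
    fun j => contDiffAt_det (hM j)
  have hev : dz v (fun x => ∑ j ∈ range (n + 1), c j *
      (Matrix.of fun i i' => h i i' x + (j : ℂ) * g i i' x).det) =ᶠ[𝓝 z]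
      fun x => ∑ j ∈ range (n + 1), c j *
        dz v (fun x => (Matrix.of fun i i' => h i i' x + (j : ℂ) * g i i' x).det) x := by
    have : ∀ᶠ x in 𝓝 z, ∀ j ∈ range (n + 1), DifferentiableAt ℝ
        (fun x => (Matrix.of fun i i' => h i i' x + (j : ℂ) * g i i' x).det) x :=
      (eventually_all_finset _).2 fun j _ =>
        eventually_differentiableAt ((hD2 j).of_le (by norm_num))
    filter_upwards [this] with x hx
    rw [dz_sum _ fun j hj => (hx j hj).const_mul _]
    exact sum_congr rfl fun j hj => dz_const_mul _ (hx j hj)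
  rw [dzb_congr hev, dzb_sum _ fun j _ => (differentiableAt_dz (hD2 j)).const_mul _]
  refine sum_congr rfl fun j _ => ?_
  rw [dzb_const_mul _ (differentiableAt_dz (hD2 j)),
    dzb_dz_det (m := fun i => 1 + (lam i : ℂ) * j) (hM j)]
  · have dh : ∀ a b, DifferentiableAt ℝ (h a b) z := fun a b =>
      (hh a b).differentiableAt (by simp)
    have dg : ∀ a b, DifferentiableAt ℝ (g a b) z := fun a b =>
      (hg a b).differentiableAt (by simp)
    have k1 : ∀ a b, dz v (fun x => h a b x + (j : ℂ) * g a b x) z =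
        dz v (h a b) z + j * dz v (g a b) z := fun a b => by
      rw [dz_add (dh a b) ((dg a b).const_mul _), dz_const_mul _ (dg a b)]
    have k2 : ∀ a b, dzb v (fun x => h a b x + (j : ℂ) * g a b x) z =
        dzb v (h a b) z + j * dzb v (g a b) z := fun a b => by
      rw [dzb_add (dh a b) ((dg a b).const_mul _), dzb_const_mul _ (dg a b)]
    have k3 : ∀ a b, dzb v (dz v (fun x => h a b x + (j : ℂ) * g a b x)) z =
        dzb v (dz v (h a b)) z + j * dzb v (dz v (g a b)) z := fun a b => by
      have : dz v (fun x => h a b x + (j : ℂ) * g a b x) =ᶠ[𝓝 z]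
          fun x => dz v (h a b) x + j * dz v (g a b) x := by
        filter_upwards [eventually_differentiableAt ((hh a b).of_le (by norm_num)),
          eventually_differentiableAt ((hg a b).of_le (by norm_num))] with x x1 x2
        rw [dz_add x1 (x2.const_mul _), dz_const_mul _ x2]
      rw [dzb_congr this, dzb_add (differentiableAt_dz (hh a b))
        ((differentiableAt_dz (hg a b)).const_mul _), dzb_const_mul _ (differentiableAt_dz (hg a b))]
    simp only [k1, k2, k3]
    rw [Polynomial.eval_add, hP, hR, Polynomial.eval_finsetSum, Polynomial.eval_finsetSum]
    simp only [Polynomial.eval_finsetSum, Polynomial.eval_mul, Polynomial.eval_add,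
      Polynomial.eval_C, Polynomial.eval_X, Polynomial.eval_prod, Polynomial.eval_one]
    congr 2
    · exact sum_congr rfl fun p _ => by ring
    · exact sum_congr rfl fun p _ => sum_congr rfl fun q _ => by ring
  · intro a b
    rw [h1, g1]
    split_ifs <;> simp [mul_comm]

end Det

/-! ### The chain rule and bounds on second jets -/

section Jets
variable {n : ℕ} {z v : Cn n} {K : ℝ}
variable {X Y : Type*} [NormedAddCommGroup X] [NormedSpace ℝ X] [NormedAddCommGroup Y]
  [NormedSpace ℝ Y]

/-- `F` is twice continuously differentiable at `x`, and its derivatives of order at most two there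
are bounded by `K`. -/
structure JetBound (K : ℝ) (F : X → ℂ) (x : X) : Prop where
  contDiffAt : ContDiffAt ℝ 2 F x
  norm_le : ‖F x‖ ≤ K
  fderiv_le : ‖fderiv ℝ F x‖ ≤ K
  fderiv_fderiv_le : ‖fderiv ℝ (fderiv ℝ F) x‖ ≤ K

lemma JetBound.nonneg {F : X → ℂ} {x : X} (h : JetBound K F x) : 0 ≤ K :=
  (norm_nonneg _).trans h.norm_le

lemma norm_fderiv_fderiv_apply_le {F : X → ℂ} {x : X} (h : JetBound K F x) (y : X) :
    ‖fderiv ℝ (fderiv ℝ F) x y y‖ ≤ K * ‖y‖ ^ 2 := by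
  have h1 := (fderiv ℝ (fderiv ℝ F) x).le_opNorm₂ y y
  have h2 := mul_le_mul_of_nonneg_right h.fderiv_fderiv_le (sq_nonneg ‖y‖)
  linarith

lemma JetBound.norm_dz_le {f : Cn n → ℂ} (h : JetBound K f z) (hv : ‖v‖ ≤ K) :
    ‖dz v f z‖ ≤ K ^ 2 :=
  HermitianHessian.norm_dz_le.trans (by
    rw [sq]; exact mul_le_mul h.fderiv_le hv (norm_nonneg _) h.nonneg)

lemma JetBound.norm_dzb_le {f : Cn n → ℂ} (h : JetBound K f z) (hv : ‖v‖ ≤ K) :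
    ‖dzb v f z‖ ≤ K ^ 2 :=
  HermitianHessian.norm_dzb_le.trans (by
    rw [sq]; exact mul_le_mul h.fderiv_le hv (norm_nonneg _) h.nonneg)

lemma JetBound.norm_dzb_dz_le {f : Cn n → ℂ} (h : JetBound K f z) (hv : ‖v‖ ≤ K) :
    ‖dzb v (dz v f) z‖ ≤ K ^ 3 := by
  rw [dzb_dz_self h.contDiffAt]
  have h1 := norm_fderiv_fderiv_apply_le h v
  have h2 := norm_fderiv_fderiv_apply_le h (Complex.I • v)
  rw [norm_smul, Complex.norm_I, one_mul] at h2
  have h3 := mul_le_mul_of_nonneg_left (pow_le_pow_left₀ (norm_nonneg v) hv 2) h.nonneg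
  have h4 := norm_add_le (fderiv ℝ (fderiv ℝ f) z v v)
    (fderiv ℝ (fderiv ℝ f) z (Complex.I • v) (Complex.I • v))
  have h5 : 0 ≤ K ^ 3 := pow_nonneg h.nonneg 3
  rw [norm_mul]
  norm_num
  linarith

lemma fderiv_fderiv_apply {G : X → Y} {x : X} (hG : ContDiffAt ℝ 2 G x) (w w' : X) :
    fderiv ℝ (fderiv ℝ G) x w w' = fderiv ℝ (fun y => fderiv ℝ G y w') x w := by
  have h := ((hG.fderiv_right (m := 1) (by norm_num)).differentiableAt (by simp)).hasFDerivAt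
  rw [(h.clm_apply (hasFDerivAt_const w' x)).fderiv]
  simp

lemma fderiv_fderiv_comp {V : Type*} [NormedAddCommGroup V] [NormedSpace ℝ V] {Φ : Y → V}
    {G : X → Y} {x : X} (hΦ : ContDiffAt ℝ 2 Φ (G x)) (hG : ContDiffAt ℝ 2 G x) (w w' : X) :
    fderiv ℝ (fderiv ℝ fun y => Φ (G y)) x w w' =
      fderiv ℝ (fderiv ℝ Φ) (G x) (fderiv ℝ G x w) (fderiv ℝ G x w') +
        fderiv ℝ Φ (G x) (fderiv ℝ (fderiv ℝ G) x w w') := by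
  have h1 : ∀ᶠ y in 𝓝 x, DifferentiableAt ℝ G y :=
    ((hG.of_le (by norm_num : (1 : WithTop ℕ∞) ≤ 2)).eventually (by simp)).mono
      fun _ h => h.differentiableAt (by simp)
  have h2 : ∀ᶠ y in 𝓝 x, DifferentiableAt ℝ Φ (G y) :=
    hG.continuousAt.eventually
      (((hΦ.of_le (by norm_num : (1 : WithTop ℕ∞) ≤ 2)).eventually (by simp)).mono
        fun _ h => h.differentiableAt (by simp))
  have e : fderiv ℝ (fun y => Φ (G y)) =ᶠ[𝓝 x]
      fun y => (fderiv ℝ Φ (G y)).comp (fderiv ℝ G y) := by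
    filter_upwards [h1, h2] with y y1 y2
    exact fderiv_comp y y2 y1
  have hG1 := ((hG.fderiv_right (m := 1) (by norm_num)).differentiableAt (by simp)).hasFDerivAt
  have hΦ1 := ((hΦ.fderiv_right (m := 1) (by norm_num)).differentiableAt (by simp)).hasFDerivAt
  have hG0 := (hG.differentiableAt (by simp)).hasFDerivAt
  have h := ((hΦ1.comp x hG0).clm_comp hG1).fderiv
  simp only [Function.comp_def] at h
  rw [e.fderiv_eq, h]
  simp [add_comm]

variable {c : Cn n → Y} {Φ : Cn n × Y → ℂ}

lemma fderiv_graph (hc : ContDiffAt ℝ 1 c z) (w : Cn n) :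
    fderiv ℝ (fun x => (x, c x)) z w = (w, fderiv ℝ c z w) := by
  have h := ((hasFDerivAt_id z).prodMk (hc.differentiableAt (by simp)).hasFDerivAt).fderiv
  simp only [id_eq] at h
  rw [h]
  rfl

lemma fderiv_fderiv_graph (hc : ContDiffAt ℝ 2 c z) (w w' : Cn n) :
    fderiv ℝ (fderiv ℝ fun x => (x, c x)) z w w' = (0, fderiv ℝ (fderiv ℝ c) z w w') := by
  have hG : ContDiffAt ℝ 2 (fun x => (x, c x)) z := contDiffAt_id.prodMk hc
  rw [fderiv_fderiv_apply hG]
  have hev : (fun y => fderiv ℝ (fun x => (x, c x)) y w') =ᶠ[𝓝 z]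
      fun y => (w', fderiv ℝ c y w') :=
    ((hc.of_le (by norm_num : (1 : WithTop ℕ∞) ≤ 2)).eventually (by simp)).mono
      fun y hy => fderiv_graph hy w'
  have h := ((hc.fderiv_right (m := 1) (by norm_num)).differentiableAt (by simp)).hasFDerivAt
  rw [hev.fderiv_eq, ((hasFDerivAt_const w' z).prodMk
    (h.clm_apply (hasFDerivAt_const w' z))).fderiv]
  simp

lemma norm_inl_add_le (a : Cn n) (b : Y) : ‖(a, b)‖ ≤ ‖a‖ + ‖b‖ :=
  max_le (by linarith [norm_nonneg b]) (by linarith [norm_nonneg a])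

/-- The first derivative of `x ↦ Φ (x, c x)`, up to the derivatives of `Φ` in the first variable. -/
lemma dz_graph (hΦ : JetBound K Φ (z, c z)) (hc : ContDiffAt ℝ 1 c z) :
    ‖dz v (fun x => Φ (x, c x)) z - (1 / 2 : ℂ) * (fderiv ℝ Φ (z, c z) (0, fderiv ℝ c z v) -
      Complex.I * fderiv ℝ Φ (z, c z) (0, fderiv ℝ c z (Complex.I • v)))‖ ≤ K * ‖v‖ := by
  have hd : ∀ w, fderiv ℝ (fun x => Φ (x, c x)) z w = fderiv ℝ Φ (z, c z) (w, 0) +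
      fderiv ℝ Φ (z, c z) (0, fderiv ℝ c z w) := fun w => by
    have h1 : fderiv ℝ (fun x => Φ (x, c x)) z = (fderiv ℝ Φ (z, c z)).comp
        (fderiv ℝ (fun x => (x, c x)) z) :=
      fderiv_comp z (hΦ.contDiffAt.differentiableAt (by simp))
        (differentiableAt_id.prodMk (hc.differentiableAt (by simp)))
    rw [h1, ContinuousLinearMap.comp_apply, fderiv_graph hc, ← map_add]
    simp
  have e : dz v (fun x => Φ (x, c x)) z - (1 / 2 : ℂ) * (fderiv ℝ Φ (z, c z) (0, fderiv ℝ c z v) -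
      Complex.I * fderiv ℝ Φ (z, c z) (0, fderiv ℝ c z (Complex.I • v))) =
      (1 / 2 : ℂ) * (fderiv ℝ Φ (z, c z) (v, 0) -
        Complex.I * fderiv ℝ Φ (z, c z) (Complex.I • v, 0)) := by
    rw [dz, hd, hd]; ring
  rw [e, norm_mul]
  have a : ∀ w, ‖fderiv ℝ Φ (z, c z) (w, 0)‖ ≤ K * ‖w‖ := fun w => by
    refine ((fderiv ℝ Φ (z, c z)).le_opNorm _).trans (mul_le_mul hΦ.fderiv_le ?_ (norm_nonneg _)
      hΦ.nonneg)
    simp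
  have a1 := a v
  have a2 := a (Complex.I • v)
  rw [norm_smul, Complex.norm_I, one_mul] at a2
  have h3 := norm_sub_le (fderiv ℝ Φ (z, c z) (v, 0))
    (Complex.I * fderiv ℝ Φ (z, c z) (Complex.I • v, 0))
  rw [norm_mul, Complex.norm_I, one_mul] at h3
  norm_num
  linarith

/-- The Laplacian of `x ↦ Φ (x, c x)` in the direction `v`, up to terms that are quadratic in the
first derivatives of `c`. -/
lemma dzb_dz_graph (hΦ : JetBound K Φ (z, c z)) (hc : ContDiffAt ℝ 2 c z) {r : ℝ}
    (h1 : ‖v‖ + ‖fderiv ℝ c z v‖ ≤ r) (h2 : ‖v‖ + ‖fderiv ℝ c z (Complex.I • v)‖ ≤ r) :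
    ‖dzb v (dz v (fun x => Φ (x, c x))) z - (1 / 4 : ℂ) * fderiv ℝ Φ (z, c z)
      (0, fderiv ℝ (fderiv ℝ c) z v v +
        fderiv ℝ (fderiv ℝ c) z (Complex.I • v) (Complex.I • v))‖ ≤ K * r ^ 2 := by
  have hG : ContDiffAt ℝ 2 (fun x => (x, c x)) z := contDiffAt_id.prodMk hc
  have hd := fun w => fderiv_fderiv_comp (Φ := Φ) (G := fun x => (x, c x)) hΦ.contDiffAt hG w w
  have hc1 := hc.of_le (by norm_num : (1 : WithTop ℕ∞) ≤ 2)
  simp only [fderiv_graph hc1, fderiv_fderiv_graph hc] at hd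
  have e0 : ∀ a b : Y, ((0 : Cn n), a + b) = (0, a) + (0, b) := fun a b => by simp
  have e : dzb v (dz v (fun x => Φ (x, c x))) z - (1 / 4 : ℂ) * fderiv ℝ Φ (z, c z)
      (0, fderiv ℝ (fderiv ℝ c) z v v +
        fderiv ℝ (fderiv ℝ c) z (Complex.I • v) (Complex.I • v)) =
      (1 / 4 : ℂ) * (fderiv ℝ (fderiv ℝ Φ) (z, c z) (v, fderiv ℝ c z v) (v, fderiv ℝ c z v) +
        fderiv ℝ (fderiv ℝ Φ) (z, c z) (Complex.I • v, fderiv ℝ c z (Complex.I • v))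
          (Complex.I • v, fderiv ℝ c z (Complex.I • v))) := by
    have hcomp : ContDiffAt ℝ 2 (fun x => Φ (x, c x)) z :=
      ContDiffAt.comp z (f := fun x => (x, c x)) hΦ.contDiffAt hG
    rw [dzb_dz_self hcomp, hd, hd, e0, map_add]
    ring
  have a : ∀ y : Cn n × Y, ‖y‖ ≤ r → ‖fderiv ℝ (fderiv ℝ Φ) (z, c z) y y‖ ≤ K * r ^ 2 :=
    fun y hy => (norm_fderiv_fderiv_apply_le hΦ y).trans
      (mul_le_mul_of_nonneg_left (pow_le_pow_left₀ (norm_nonneg _) hy 2) hΦ.nonneg)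
  have a1 := a (v, fderiv ℝ c z v) ((norm_inl_add_le _ _).trans h1)
  have a2 := a (Complex.I • v, fderiv ℝ c z (Complex.I • v)) ((norm_inl_add_le _ _).trans
    (by rwa [norm_smul, Complex.norm_I, one_mul]))
  rw [e, norm_mul]
  have h3 := norm_add_le (fderiv ℝ (fderiv ℝ Φ) (z, c z) (v, fderiv ℝ c z v) (v, fderiv ℝ c z v))
    (fderiv ℝ (fderiv ℝ Φ) (z, c z) (Complex.I • v, fderiv ℝ c z (Complex.I • v))
          (Complex.I • v, fderiv ℝ c z (Complex.I • v)))
  have h4 : 0 ≤ K * r ^ 2 := mul_nonneg hΦ.nonneg (sq_nonneg _)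
  norm_num
  linarith

/-! ### Real functions -/

variable {u : Cn n → ℝ}

lemma fderiv_ofReal (hu : DifferentiableAt ℝ u z) (w : Cn n) :
    fderiv ℝ (fun x => (u x : ℂ)) z w = (fderiv ℝ u z w : ℂ) := by
  have : HasFDerivAt (fun x => (u x : ℂ)) (Complex.ofRealCLM.comp (fderiv ℝ u z)) z :=
    Complex.ofRealCLM.hasFDerivAt.comp z hu.hasFDerivAt
  rw [this.fderiv]; rfl

lemma contDiffAt_ofReal {k : WithTop ℕ∞} (hu : ContDiffAt ℝ k u z) :
    ContDiffAt ℝ k (fun x => (u x : ℂ)) z :=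
  Complex.ofRealCLM.contDiff.contDiffAt.comp z hu

lemma contDiffAt_conj {k : WithTop ℕ∞} {f : Cn n → ℂ} (hu : ContDiffAt ℝ k f z) :
    ContDiffAt ℝ k (fun x => (starRingEnd ℂ) (f x)) z :=
  (Complex.conjCLE : ℂ →L[ℝ] ℂ).contDiff.contDiffAt.comp z hu

lemma dzb_ofReal (hu : DifferentiableAt ℝ u z) :
    dzb v (fun x => (u x : ℂ)) z = (starRingEnd ℂ) (dz v (fun x => (u x : ℂ)) z) := by
  rw [dz, dzb, fderiv_ofReal hu, fderiv_ofReal hu]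
  simp only [map_mul, map_sub, map_div₀, map_one, map_ofNat, Complex.conj_ofReal, Complex.conj_I]
  ring

lemma fderiv_fderiv_ofReal (hu : ContDiffAt ℝ 2 u z) (w w' : Cn n) :
    fderiv ℝ (fderiv ℝ fun x => (u x : ℂ)) z w w' = (fderiv ℝ (fderiv ℝ u) z w w' : ℂ) := by
  rw [fderiv_fderiv_apply (contDiffAt_ofReal hu), fderiv_fderiv_apply hu]
  have hev : (fun y => fderiv ℝ (fun x => (u x : ℂ)) y w') =ᶠ[𝓝 z]
      fun y => ((fderiv ℝ u y w' : ℝ) : ℂ) :=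
    ((hu.of_le (by norm_num : (1 : WithTop ℕ∞) ≤ 2)).eventually (by simp)).mono
      fun y hy => fderiv_ofReal (hy.differentiableAt (by simp)) w'
  rw [hev.fderiv_eq, fderiv_ofReal]
  exact ((hu.fderiv_right (m := 1) (by norm_num)).differentiableAt (by simp)).clm_apply
    (differentiableAt_const _)

end Jets

/-! ### The local data at a maximum point -/

section Commute
variable {n : ℕ} {f : Cn n → ℂ} {z v w : Cn n}

lemma eventually_contDiffAt {k : ℕ} (hf : ContDiffAt ℝ k f z) : ∀ᶠ x in 𝓝 z, ContDiffAt ℝ k f x :=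
  hf.eventually (by simp)

lemma dz_dz_comm_eventually (hf : ContDiffAt ℝ 2 f z) :
    dz v (dz w f) =ᶠ[𝓝 z] dz w (dz v f) :=
  (eventually_contDiffAt hf).mono fun _ h => dz_dz_comm h

lemma dzb_dz_comm_eventually (hf : ContDiffAt ℝ 2 f z) :
    dzb v (dz w f) =ᶠ[𝓝 z] dz w (dzb v f) :=
  (eventually_contDiffAt hf).mono fun _ h => dzb_dz_comm h

end Commute

/-- Functions on a neighbourhood of a point `z` of `ℂⁿ` with a constant frame `v`: the components
`h`, `χ`, `a` of the given tensors in the frame, a matrix `P` inverse to `h`, the right-hand side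
`f` of the equation in logarithmic form, and the unknown `u`. The vectors `w` express the
components of `∂u` in the standard frame through those in the frame `v`. -/
structure LocalData (n : ℕ) where
  /-- the point -/
  z : Cn n
  /-- the direction of the largest eigenvalue -/
  o : Fin n
  /-- the eigenvalues of `g` at the point -/
  lam : Fin n → ℝ
  /-- the frame -/
  v : Fin n → Cn n
  /-- the dual frame -/
  w : Fin n → Cn n
  /-- the metric -/
  h : Fin n → Fin n → Cn n → ℂ
  /-- the inverse of the metric -/
  P : Fin n → Fin n → Cn n → ℂ
  /-- the family of `(1,1)`-forms -/
  χ : Fin n → Fin n → Cn n × ℝ → ℂ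
  /-- the `(1,0)`-form -/
  a : Fin n → Cn n → ℂ
  /-- the logarithm of the right-hand side -/
  f : Cn n × (Cn n × ℝ) → ℝ
  /-- the unknown function -/
  u : Cn n → ℝ

namespace LocalData
variable {n : ℕ} (L : LocalData n)

/-- The unknown function, with complex values. -/
def uC (x : Cn n) : ℂ := (L.u x : ℂ)

/-- The components of `∂u`. -/
def U (q : Fin n) : Cn n → ℂ := dz (L.v q) L.uC

/-- The components of `∂∂̄u`. -/
def b (p q : Fin n) : Cn n → ℂ := dz (L.v p) (dzb (L.v q) L.uC)

/-- The pair `(∂u, u)`. -/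
def c (x : Cn n) : Cn n × ℝ := (∑ q, L.U q x • L.w q, L.u x)

/-- The components of `χ(z, u)`. -/
def X (p q : Fin n) (x : Cn n) : ℂ := L.χ p q (x, L.u x)

/-- The components of `χ(z, u) + √-1 a ∧ ∂̄u - √-1 ā ∧ ∂u + √-1 ∂∂̄u`. -/
def g (p q : Fin n) (x : Cn n) : ℂ :=
  L.X p q x + L.a p x * (starRingEnd ℂ) (L.U q x) + L.U p x * (starRingEnd ℂ) (L.a q x) + L.b p q x

/-- The square norm of `∂u`. -/
def Γ (x : Cn n) : ℂ := ∑ l, ∑ m, L.P l m x * (L.U m x * (starRingEnd ℂ) (L.U l x))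

/-- The regularity, normalization and bounds of the local data. -/
structure Regular (K ε : ℝ) : Prop where
  one_le : 1 ≤ K
  reg_u : ContDiffAt ℝ 4 L.u L.z
  v_le : ∀ p, ‖L.v p‖ ≤ K
  w_le : ∀ p, ‖L.w p‖ ≤ K
  lam_pos : ∀ p, 0 < L.lam p
  lam_le : ∀ p, L.lam p ≤ L.lam L.o
  jet_h : ∀ p q, JetBound K (L.h p q) L.z
  jet_P : ∀ p q, JetBound K (L.P p q) L.z
  jet_χ : ∀ p q, JetBound K (L.χ p q) (L.z, L.u L.z)
  jet_a : ∀ p, JetBound K (L.a p) L.z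
  jet_f : JetBound K (fun y => (L.f y : ℂ)) (L.z, L.c L.z)
  herm_h : ∀ᶠ x in 𝓝 L.z, ∀ p q, L.h q p x = (starRingEnd ℂ) (L.h p q x)
  herm_P : ∀ᶠ x in 𝓝 L.z, ∀ p q, L.P q p x = (starRingEnd ℂ) (L.P p q x)
  herm_χ : ∀ᶠ x in 𝓝 L.z, ∀ t p q, L.χ q p (x, t) = (starRingEnd ℂ) (L.χ p q (x, t))
  h_one : ∀ p q, L.h p q L.z = if p = q then 1 else 0
  P_one : ∀ p q, L.P p q L.z = if p = q then 1 else 0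
  g_diag : ∀ p q, L.g p q L.z = if p = q then (L.lam p : ℂ) else 0
  U_le : ∀ q, ‖L.U q L.z‖ ≤ K
  χ_ge : ∀ p, ε ≤ (L.χ p p (L.z, L.u L.z)).re

variable {L} {K ε : ℝ}

namespace Regular

lemma reg_uC (h : L.Regular K ε) : ContDiffAt ℝ 4 L.uC L.z := contDiffAt_ofReal h.reg_u

lemma reg_U (h : L.Regular K ε) (q : Fin n) : ContDiffAt ℝ 3 (L.U q) L.z :=
  contDiffAt_dz (m := 3) (by norm_num; exact h.reg_uC)

lemma reg_Ub (h : L.Regular K ε) (q : Fin n) : ContDiffAt ℝ 3 (dzb (L.v q) L.uC) L.z :=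
  contDiffAt_dzb (m := 3) (by norm_num; exact h.reg_uC)

lemma reg_U2 (h : L.Regular K ε) (q : Fin n) : ContDiffAt ℝ 2 (L.U q) L.z :=
  (h.reg_U q).of_le (by norm_num)

lemma reg_b (h : L.Regular K ε) (p q : Fin n) : ContDiffAt ℝ 2 (L.b p q) L.z :=
  contDiffAt_dz (m := 2) (by norm_num; exact h.reg_Ub q)

lemma reg_X (h : L.Regular K ε) (p q : Fin n) : ContDiffAt ℝ 2 (L.X p q) L.z :=
  ContDiffAt.comp L.z (f := fun x => (x, L.u x)) (h.jet_χ p q).contDiffAt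
    (contDiffAt_id.prodMk (h.reg_u.of_le (by norm_num)))

lemma reg_g (h : L.Regular K ε) (p q : Fin n) : ContDiffAt ℝ 2 (L.g p q) L.z :=
  (((h.reg_X p q).add ((h.jet_a p).contDiffAt.mul (contDiffAt_conj (h.reg_U2 q)))).add
    ((h.reg_U2 p).mul (contDiffAt_conj (h.jet_a q).contDiffAt))).add (h.reg_b p q)

lemma diff_U (h : L.Regular K ε) (q : Fin n) : DifferentiableAt ℝ (L.U q) L.z :=
  (h.reg_U q).differentiableAt (by simp)

lemma diff_a (h : L.Regular K ε) (q : Fin n) : DifferentiableAt ℝ (L.a q) L.z :=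
  (h.jet_a q).contDiffAt.differentiableAt (by simp)

/-- Near the point the derivatives of type `∂̄` of `u` are conjugate to those of type `∂`. -/
lemma dzb_uC (h : L.Regular K ε) (q : Fin n) :
    dzb (L.v q) L.uC =ᶠ[𝓝 L.z] fun x => (starRingEnd ℂ) (L.U q x) :=
  ((h.reg_u.eventually (by simp)).mono fun _ hx =>
    dzb_ofReal (hx.differentiableAt (by simp)))

lemma dzb_U (h : L.Regular K ε) (i m : Fin n) : dzb (L.v i) (L.U m) =ᶠ[𝓝 L.z] L.b m i :=
  dzb_dz_comm_eventually (h.reg_uC.of_le (by norm_num))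

lemma dzb_U_self (h : L.Regular K ε) (i m : Fin n) :
    dzb (L.v i) (L.U m) L.z = L.b m i L.z := (h.dzb_U i m).eq_of_nhds

lemma b_herm (h : L.Regular K ε) (p q : Fin n) :
    ∀ᶠ x in 𝓝 L.z, L.b q p x = (starRingEnd ℂ) (L.b p q x) := by
  have h1 := (dz_eventuallyEq (v := L.v q) (h.dzb_uC p))
  filter_upwards [h1, h.dzb_U q p,
    eventually_differentiableAt ((h.reg_U p).of_le (by norm_num))] with x x1 x2 x3
  change dz (L.v q) (dzb (L.v p) L.uC) x = _
  rw [x1, dz_conj x3, x2]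

lemma X_herm (h : L.Regular K ε) (p q : Fin n) :
    ∀ᶠ x in 𝓝 L.z, L.X q p x = (starRingEnd ℂ) (L.X p q x) :=
  h.herm_χ.mono fun _ hx => hx _ _ _

lemma g_herm (h : L.Regular K ε) (p q : Fin n) :
    ∀ᶠ x in 𝓝 L.z, L.g q p x = (starRingEnd ℂ) (L.g p q x) := by
  filter_upwards [h.X_herm p q, h.b_herm p q] with _ x1 x2
  simp only [g, x1, x2, map_add, map_mul, Complex.conj_conj]
  ring

/-! ### First derivatives -/

lemma dz_g (h : L.Regular K ε) (p q i : Fin n) : dz (L.v i) (L.g p q) L.z =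
    dz (L.v i) (L.X p q) L.z + (dz (L.v i) (L.a p) L.z * (starRingEnd ℂ) (L.U q L.z) +
      L.a p L.z * (starRingEnd ℂ) (L.b q i L.z)) +
      (dz (L.v i) (L.U p) L.z * (starRingEnd ℂ) (L.a q L.z) +
        L.U p L.z * (starRingEnd ℂ) (dzb (L.v i) (L.a q) L.z)) + dz (L.v i) (L.b p q) L.z := by
  have dX := (h.reg_X p q).differentiableAt (by simp)
  have dU := h.diff_U
  have da := h.diff_a
  have dUc : ∀ q, DifferentiableAt ℝ (fun x => (starRingEnd ℂ) (L.U q x)) L.z := fun q =>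
    (contDiffAt_conj (h.reg_U q)).differentiableAt (by simp)
  have dac : ∀ q, DifferentiableAt ℝ (fun x => (starRingEnd ℂ) (L.a q x)) L.z := fun q =>
    (contDiffAt_conj (h.jet_a q).contDiffAt).differentiableAt (by simp)
  have db := (h.reg_b p q).differentiableAt (by simp)
  have e : L.g p q = fun x => L.X p q x + L.a p x * (starRingEnd ℂ) (L.U q x) +
    L.U p x * (starRingEnd ℂ) (L.a q x) + L.b p q x := rfl
  rw [e, dz_add ((dX.fun_add ((da p).fun_mul (dUc q))).fun_add ((dU p).fun_mul (dac q))) db,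
    dz_add (dX.fun_add ((da p).fun_mul (dUc q))) ((dU p).fun_mul (dac q)),
    dz_add dX ((da p).fun_mul (dUc q)), dz_mul (da p) (dUc q), dz_mul (dU p) (dac q),
    dz_conj (dU q), dz_conj (da q), h.dzb_U_self]

lemma norm_fderiv_u_le (h : L.Regular K ε) (i : Fin n) :
    ‖fderiv ℝ L.u L.z (L.v i)‖ ≤ 2 * K ∧ ‖fderiv ℝ L.u L.z (Complex.I • L.v i)‖ ≤ 2 * K := by
  have hd : DifferentiableAt ℝ L.u L.z := h.reg_u.differentiableAt (by simp)
  have hb : dzb (L.v i) L.uC L.z = (starRingEnd ℂ) (L.U i L.z) := (h.dzb_uC i).eq_of_nhds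
  have h1 : ‖dzb (L.v i) L.uC L.z‖ ≤ K := by rw [hb, RCLike.norm_conj]; exact h.U_le i
  have h2 : ‖dz (L.v i) L.uC L.z‖ ≤ K := h.U_le i
  constructor
  · rw [← Complex.norm_real, ← fderiv_ofReal hd]
    exact (norm_fderiv_le_dz (f := L.uC)).trans (by linarith)
  · rw [← Complex.norm_real, ← fderiv_ofReal hd]
    exact (norm_fderiv_I_le_dz (f := L.uC)).trans (by linarith)

lemma norm_zero_prod {Y : Type*} [NormedAddCommGroup Y] (y : Y) : ‖((0 : Cn n), y)‖ ≤ ‖y‖ := by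
  simp [Prod.norm_def]

lemma norm_dz_X_le (h : L.Regular K ε) (p q i : Fin n) : ‖dz (L.v i) (L.X p q) L.z‖ ≤ 3 * K ^ 2 := by
  have hK := h.one_le
  have h1 := dz_graph (v := L.v i) (h.jet_χ p q) (h.reg_u.of_le (by norm_num))
  rw [show (fun x => L.χ p q (x, L.u x)) = L.X p q from rfl] at h1
  have hb : ∀ t : ℝ, ‖t‖ ≤ 2 * K → ‖fderiv ℝ (L.χ p q) (L.z, L.u L.z) (0, t)‖ ≤ 2 * K ^ 2 := by
    intro t ht
    refine ((fderiv ℝ (L.χ p q) (L.z, L.u L.z)).le_opNorm _).trans ?_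
    have := mul_le_mul (h.jet_χ p q).fderiv_le ((norm_zero_prod (n := n) t).trans ht)
      (norm_nonneg _) (by linarith)
    linarith
  have h2 := hb _ (h.norm_fderiv_u_le i).1
  have h3 := hb _ (h.norm_fderiv_u_le i).2
  have h4 : ‖(1 / 2 : ℂ) * (fderiv ℝ (L.χ p q) (L.z, L.u L.z) (0, fderiv ℝ L.u L.z (L.v i)) -
      Complex.I * fderiv ℝ (L.χ p q) (L.z, L.u L.z)
        (0, fderiv ℝ L.u L.z (Complex.I • L.v i)))‖ ≤ 2 * K ^ 2 := by
    rw [norm_mul]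
    have := norm_sub_le (fderiv ℝ (L.χ p q) (L.z, L.u L.z) (0, fderiv ℝ L.u L.z (L.v i)))
      (Complex.I * fderiv ℝ (L.χ p q) (L.z, L.u L.z) (0, fderiv ℝ L.u L.z (Complex.I • L.v i)))
    rw [norm_mul, Complex.norm_I, one_mul] at this
    norm_num
    linarith
  have h5 := mul_le_mul_of_nonneg_left (h.v_le i) (by linarith : 0 ≤ K)
  have h6 := norm_le_insert' (dz (L.v i) (L.X p q) L.z) ((1 / 2 : ℂ) *
    (fderiv ℝ (L.χ p q) (L.z, L.u L.z) (0, fderiv ℝ L.u L.z (L.v i)) -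
      Complex.I * fderiv ℝ (L.χ p q) (L.z, L.u L.z)
        (0, fderiv ℝ L.u L.z (Complex.I • L.v i))))
  exact h6.trans (by
    have := add_le_add h4 h1
    linarith)

lemma fderiv_fderiv_u (h : L.Regular K ε) (i : Fin n) :
    ((fderiv ℝ (fderiv ℝ L.u) L.z (L.v i) (L.v i) +
      fderiv ℝ (fderiv ℝ L.u) L.z (Complex.I • L.v i) (Complex.I • L.v i) : ℝ) : ℂ) =
      4 * L.b i i L.z := by
  have h1 : L.b i i L.z = dzb (L.v i) (dz (L.v i) L.uC) L.z :=
    (dzb_dz_comm (h.reg_uC.of_le (by norm_num))).symm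
  have h2 : ContDiffAt ℝ 2 L.u L.z := h.reg_u.of_le (by norm_num)
  rw [h1, dzb_dz_self (h.reg_uC.of_le (by norm_num))]
  have : ∀ w, fderiv ℝ (fderiv ℝ L.uC) L.z w w = (fderiv ℝ (fderiv ℝ L.u) L.z w w : ℂ) :=
    fun w => fderiv_fderiv_ofReal h2 w w
  rw [this, this]
  push_cast
  ring

lemma norm_dzb_dz_X_le (h : L.Regular K ε) (p q i : Fin n) :
    ‖dzb (L.v i) (dz (L.v i) (L.X p q)) L.z‖ ≤ 9 * K ^ 3 + K * ‖L.b i i L.z‖ := by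
  have hK := h.one_le
  have a1 := (h.norm_fderiv_u_le i).1
  have a2 := (h.norm_fderiv_u_le i).2
  have a3 := h.v_le i
  have h1 := dzb_dz_graph (v := L.v i) (h.jet_χ p q) (h.reg_u.of_le (by norm_num)) (r := 3 * K)
    (by linarith) (by linarith)
  rw [show (fun x => L.χ p q (x, L.u x)) = L.X p q from rfl] at h1
  set t := fderiv ℝ (fderiv ℝ L.u) L.z (L.v i) (L.v i) +
      fderiv ℝ (fderiv ℝ L.u) L.z (Complex.I • L.v i) (Complex.I • L.v i) with ht
  have h2 : ‖t‖ = 4 * ‖L.b i i L.z‖ := by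
    rw [← Complex.norm_real, h.fderiv_fderiv_u i, norm_mul]; norm_num
  have h3 : ‖(1 / 4 : ℂ) * fderiv ℝ (L.χ p q) (L.z, L.u L.z) (0, t)‖ ≤ K * ‖L.b i i L.z‖ := by
    rw [norm_mul]
    have := (fderiv ℝ (L.χ p q) (L.z, L.u L.z)).le_opNorm (0, t)
    have h4 := mul_le_mul (h.jet_χ p q).fderiv_le (norm_zero_prod (n := n) t)
      (norm_nonneg _) (by linarith)
    rw [h2] at h4
    norm_num
    linarith
  have h6 := norm_le_insert' (dzb (L.v i) (dz (L.v i) (L.X p q)) L.z) ((1 / 4 : ℂ) *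
    fderiv ℝ (L.χ p q) (L.z, L.u L.z) (0, t))
  exact h6.trans (by
    have := add_le_add h3 h1
    linarith)

/-! ### Bounds at the point -/

lemma top_pos (h : L.Regular K ε) : 0 < L.lam L.o := h.lam_pos L.o

lemma b_eq (h : L.Regular K ε) (p q : Fin n) : L.b p q L.z = (if p = q then (L.lam p : ℂ) else 0) -
    (L.X p q L.z + L.a p L.z * (starRingEnd ℂ) (L.U q L.z) +
      L.U p L.z * (starRingEnd ℂ) (L.a q L.z)) := by
  rw [← h.g_diag, g]; ring

lemma norm_lower_terms_le (h : L.Regular K ε) (p q : Fin n) :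
    ‖L.X p q L.z + L.a p L.z * (starRingEnd ℂ) (L.U q L.z) +
      L.U p L.z * (starRingEnd ℂ) (L.a q L.z)‖ ≤ 3 * K ^ 2 := by
  have hK := h.one_le
  have hK2 : K ≤ K ^ 2 := le_self_pow₀ hK (by norm_num)
  have h1 : ∀ p q, ‖L.a p L.z * (starRingEnd ℂ) (L.U q L.z)‖ ≤ K ^ 2 := fun p q => by
    rw [norm_mul, RCLike.norm_conj, sq]
    exact mul_le_mul (h.jet_a p).norm_le (h.U_le q) (norm_nonneg _) (by linarith)
  have h2 : ‖L.U p L.z * (starRingEnd ℂ) (L.a q L.z)‖ ≤ K ^ 2 := by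
    rw [norm_mul, RCLike.norm_conj, sq]
    exact mul_le_mul (h.U_le p) (h.jet_a q).norm_le (norm_nonneg _) (by linarith)
  have h3 : ‖L.X p q L.z‖ ≤ K := (h.jet_χ p q).norm_le
  refine (norm_add_le_of_le (norm_add_le_of_le h3 (h1 p q)) h2).trans (by linarith)

lemma norm_b_le (h : L.Regular K ε) (p q : Fin n) : ‖L.b p q L.z‖ ≤ L.lam L.o + 3 * K ^ 2 := by
  rw [h.b_eq]
  refine norm_sub_le_of_le ?_ (h.norm_lower_terms_le p q)
  split_ifs
  · rw [Complex.norm_real, Real.norm_of_nonneg (h.lam_pos p).le]; exact h.lam_le p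
  · simpa using h.top_pos.le

lemma norm_b_le_mul (h : L.Regular K ε) (h1 : 1 ≤ L.lam L.o) (p q : Fin n) :
    ‖L.b p q L.z‖ ≤ 4 * K ^ 2 * L.lam L.o := by
  have h2 : 1 ≤ K ^ 2 := one_le_pow₀ h.one_le
  refine (h.norm_b_le p q).trans ?_
  have a1 := mul_le_mul_of_nonneg_right h2 h.top_pos.le
  have a2 := mul_le_mul_of_nonneg_left h1 (by linarith : 0 ≤ 3 * K ^ 2)
  linarith

lemma lam_sub_le_norm_b (h : L.Regular K ε) : L.lam L.o - 3 * K ^ 2 ≤ ‖L.b L.o L.o L.z‖ := by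
  have h1 := h.b_eq L.o L.o
  rw [if_pos rfl] at h1
  have h2 : (L.lam L.o : ℂ) = L.b L.o L.o L.z + (L.X L.o L.o L.z + L.a L.o L.z *
    (starRingEnd ℂ) (L.U L.o L.z) + L.U L.o L.z * (starRingEnd ℂ) (L.a L.o L.z)) := by
    rw [h1]; ring
  have h3 := norm_add_le_of_le (le_refl ‖L.b L.o L.o L.z‖) (h.norm_lower_terms_le L.o L.o)
  rw [← h2, Complex.norm_real, Real.norm_of_nonneg h.top_pos.le] at h3
  linarith

/-- The lower bound `χ ≥ ε` in the form that the exponential part of the test function uses. -/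
lemma b_diag_le (h : L.Regular K ε) (i : Fin n) : (L.b i i L.z).re ≤
    L.lam i - ε - 2 * (L.a i L.z * (starRingEnd ℂ) (L.U i L.z)).re := by
  have h1 := congrArg Complex.re (h.b_eq i i)
  rw [if_pos rfl] at h1
  simp only [Complex.sub_re, Complex.add_re, Complex.ofReal_re] at h1
  have h2 : (L.U i L.z * (starRingEnd ℂ) (L.a i L.z)).re =
      (L.a i L.z * (starRingEnd ℂ) (L.U i L.z)).re := by
    simp only [Complex.mul_re, Complex.conj_re, Complex.conj_im]; ring
  have h3 : ε ≤ (L.X i i L.z).re := h.χ_ge i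
  rw [h1, h2]
  linarith

lemma norm_b_symm (h : L.Regular K ε) (p q : Fin n) : ‖L.b p q L.z‖ = ‖L.b q p L.z‖ := by
  rw [(h.b_herm p q).self_of_nhds, RCLike.norm_conj]

lemma u2_symm (h : L.Regular K ε) (p q : Fin n) :
    dz (L.v q) (L.U p) L.z = dz (L.v p) (L.U q) L.z :=
  dz_dz_comm (h.reg_uC.of_le (by norm_num))

/-- The lower order terms of `∂_i g_{pq}`. -/
lemma norm_dz_g_sub_le (h : L.Regular K ε) (p q i : Fin n) :
    ‖dz (L.v i) (L.g p q) L.z - (dz (L.v i) (L.U p) L.z * (starRingEnd ℂ) (L.a q L.z) +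
      dz (L.v i) (L.b p q) L.z)‖ ≤ 5 * K ^ 3 + K * ‖L.b q i L.z‖ := by
  have hK := h.one_le
  have hK2 : K ^ 2 ≤ K ^ 3 := pow_le_pow_right₀ hK (by norm_num)
  rw [h.dz_g]
  have e : ∀ A B C D E G : ℂ, A + (B + C) + (D + E) + G - (D + G) = A + (B + C) + E := by
    intros; ring
  rw [e]
  have h2 : ‖dz (L.v i) (L.a p) L.z * (starRingEnd ℂ) (L.U q L.z)‖ ≤ K ^ 3 := by
    rw [norm_mul, RCLike.norm_conj, pow_succ]
    exact mul_le_mul ((h.jet_a p).norm_dz_le (h.v_le i)) (h.U_le q) (norm_nonneg _) (by positivity)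
  have h3 : ‖L.a p L.z * (starRingEnd ℂ) (L.b q i L.z)‖ ≤ K * ‖L.b q i L.z‖ := by
    rw [norm_mul, RCLike.norm_conj]
    exact mul_le_mul_of_nonneg_right (h.jet_a p).norm_le (norm_nonneg _)
  have h4 : ‖L.U p L.z * (starRingEnd ℂ) (dzb (L.v i) (L.a q) L.z)‖ ≤ K ^ 3 := by
    rw [norm_mul, RCLike.norm_conj, pow_succ, mul_comm]
    exact mul_le_mul ((h.jet_a q).norm_dzb_le (h.v_le i)) (h.U_le p) (norm_nonneg _) (by positivity)
  refine (norm_add_le_of_le (norm_add_le_of_le (h.norm_dz_X_le p q i)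
    (norm_add_le_of_le h2 h3)) h4).trans ?_
  linarith

/-- The derivatives of `g` are symmetric up to terms with two derivatives of `u`. The pure second
derivatives cancel, and the mixed ones are bounded by the largest eigenvalue. -/
lemma torsion (h : L.Regular K ε) (h1 : 1 ≤ L.lam L.o) (p q i : Fin n) :
    ‖dz (L.v i) (L.g p q) L.z - dz (L.v p) (L.g i q) L.z‖ ≤ 18 * K ^ 3 * L.lam L.o := by
  have hK := h.one_le
  have a1 := h.norm_dz_g_sub_le p q i
  have a2 := h.norm_dz_g_sub_le i q p
  have e1 := h.u2_symm p i
  have e2 : dz (L.v i) (L.b p q) L.z = dz (L.v p) (L.b i q) L.z :=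
    dz_dz_comm ((h.reg_Ub q).of_le (by norm_num))
  rw [← e1, ← e2] at a2
  have a3 := norm_sub_le_of_le a1 a2
  rw [sub_sub_sub_cancel_right] at a3
  have a4 := mul_le_mul_of_nonneg_left (h.norm_b_le_mul h1 q i) (by linarith : 0 ≤ K)
  have a5 := mul_le_mul_of_nonneg_left (h.norm_b_le_mul h1 q p) (by linarith : 0 ≤ K)
  have a6 := mul_le_mul_of_nonneg_left h1 (by positivity : 0 ≤ 10 * K ^ 3)
  linarith

lemma dz_b_diag (h : L.Regular K ε) (i m : Fin n) :
    dz (L.v m) (L.b i i) L.z = dzb (L.v i) (dz (L.v i) (L.U m)) L.z := by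
  have e1 : dz (L.v m) (L.U i) =ᶠ[𝓝 L.z] dz (L.v i) (L.U m) :=
    dz_dz_comm_eventually (h.reg_uC.of_le (by norm_num))
  rw [← dz_congr (h.dzb_U i i), ← dzb_dz_comm (h.reg_U2 i), dzb_congr e1]

/-- The third derivatives of `u` that occur in the second derivative of `|∂u|²` are derivatives of
`g`, up to second derivatives of `u`. -/
lemma third (h : L.Regular K ε) (i m : Fin n) :
    ‖dzb (L.v i) (dz (L.v i) (L.U m)) L.z - dz (L.v m) (L.g i i) L.z‖ ≤
      5 * K ^ 3 * (1 + ‖L.b i m L.z‖ + ‖dz (L.v m) (L.U i) L.z‖) := by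
  have hK := h.one_le
  have a1 := h.norm_dz_g_sub_le i i m
  rw [h.dz_b_diag] at a1
  have a2 : ‖dz (L.v m) (L.U i) L.z * (starRingEnd ℂ) (L.a i L.z)‖ ≤
      K * ‖dz (L.v m) (L.U i) L.z‖ := by
    rw [norm_mul, RCLike.norm_conj, mul_comm]
    exact mul_le_mul_of_nonneg_right (h.jet_a i).norm_le (norm_nonneg _)
  have a3 := norm_add_le_of_le a1 a2
  rw [← norm_neg, show ∀ A B C : ℂ, -(A - (B + C) + B) = C - A by intros; ring] at a3
  have hK3 : K ≤ 5 * K ^ 3 := by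
    have := le_self_pow₀ hK (by norm_num : 3 ≠ 0); linarith [pow_nonneg (by linarith : 0 ≤ K) 3]
  have b1 := mul_le_mul_of_nonneg_right hK3 (norm_nonneg (L.b i m L.z))
  have b2 := mul_le_mul_of_nonneg_right hK3 (norm_nonneg (dz (L.v m) (L.U i) L.z))
  linarith

end Regular
end LocalData

lemma dzb_dz_conj {n : ℕ} {f : Cn n → ℂ} {z v : Cn n} (hf : ContDiffAt ℝ 2 f z) :
    dzb v (dz v (fun x => (starRingEnd ℂ) (f x))) z = (starRingEnd ℂ) (dzb v (dz v f) z) := by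
  have h1 : dz v (fun x => (starRingEnd ℂ) (f x)) =ᶠ[𝓝 z]
      fun x => (starRingEnd ℂ) (dzb v f x) :=
    (eventually_differentiableAt (hf.of_le (by norm_num))).mono fun _ hx => dz_conj hx
  rw [dzb_congr h1, dzb_conj (differentiableAt_dzb hf), dzb_dz_comm hf]

lemma dzb_dz_add {n : ℕ} {f g : Cn n → ℂ} {z v : Cn n} (hf : ContDiffAt ℝ 2 f z)
    (hg : ContDiffAt ℝ 2 g z) :
    dzb v (dz v (fun x => f x + g x)) z = dzb v (dz v f) z + dzb v (dz v g) z := by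
  have h1 : dz v (fun x => f x + g x) =ᶠ[𝓝 z] fun x => dz v f x + dz v g x := by
    filter_upwards [eventually_differentiableAt (hf.of_le (by norm_num)),
      eventually_differentiableAt (hg.of_le (by norm_num))] with _ h1 h2
    exact dz_add h1 h2
  rw [dzb_congr h1, dzb_add (differentiableAt_dz hf) (differentiableAt_dz hg)]

lemma dzb_dz_sum {n : ℕ} {ι : Type*} (s : Finset ι) {f : ι → Cn n → ℂ} {z v : Cn n}
    (hf : ∀ i ∈ s, ContDiffAt ℝ 2 (f i) z) :
    dzb v (dz v (fun x => ∑ i ∈ s, f i x)) z = ∑ i ∈ s, dzb v (dz v (f i)) z := by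
  have h1 : dz v (fun x => ∑ i ∈ s, f i x) =ᶠ[𝓝 z] fun x => ∑ i ∈ s, dz v (f i) x := by
    filter_upwards [(eventually_all_finset s).2 fun i hi =>
      eventually_differentiableAt ((hf i hi).of_le (by norm_num))] with _ h1
    exact dz_sum s h1
  rw [dzb_congr h1, dzb_sum s fun i hi => differentiableAt_dz (hf i hi)]

lemma dzb_dz_const_mul {n : ℕ} (c : ℂ) {f : Cn n → ℂ} {z v : Cn n} (hf : ContDiffAt ℝ 2 f z) :
    dzb v (dz v (fun x => c * f x)) z = c * dzb v (dz v f) z := by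
  have h1 : dz v (fun x => c * f x) =ᶠ[𝓝 z] fun x => c * dz v f x :=
    (eventually_differentiableAt (hf.of_le (by norm_num))).mono fun _ hx => dz_const_mul c hx
  rw [dzb_congr h1, dzb_const_mul c (differentiableAt_dz hf)]

lemma dzb_dz_exp {n : ℕ} {f : Cn n → ℂ} {z v : Cn n} (hf : ContDiffAt ℝ 2 f z) :
    dzb v (dz v (fun x => Complex.exp (f x))) z =
      Complex.exp (f z) * (dzb v f z * dz v f z + dzb v (dz v f) z) := by
  have h1 : dz v (fun x => Complex.exp (f x)) =ᶠ[𝓝 z] fun x => Complex.exp (f x) * dz v f x :=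
    (eventually_differentiableAt (hf.of_le (by norm_num))).mono fun _ hx => dz_exp hx
  have h2 := hf.differentiableAt (by simp)
  rw [dzb_congr h1, dzb_mul h2.cexp (differentiableAt_dz hf), dzb_exp h2]
  ring

namespace LocalData
variable {n : ℕ} {L : LocalData n} {K ε : ℝ}

namespace Regular

/-! ### Second derivatives of the solution form -/

lemma dzb_dz_a_mul_conj (h : L.Regular K ε) (i j : Fin n) :
    dzb (L.v j) (dz (L.v j) (fun x => L.a i x * (starRingEnd ℂ) (L.U i x))) L.z =
      dzb (L.v j) (dz (L.v j) (L.a i)) L.z * (starRingEnd ℂ) (L.U i L.z) +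
      dz (L.v j) (L.a i) L.z * (starRingEnd ℂ) (dz (L.v j) (L.U i) L.z) +
      dzb (L.v j) (L.a i) L.z * (starRingEnd ℂ) (L.b i j L.z) +
      L.a i L.z * (starRingEnd ℂ) (dzb (L.v j) (dz (L.v j) (L.U i)) L.z) := by
  rw [dzb_dz_mul (h.jet_a i).contDiffAt (contDiffAt_conj (h.reg_U2 i)), dzb_dz_conj (h.reg_U2 i),
    dz_conj (h.diff_U i), dzb_conj (h.diff_U i), h.dzb_U_self]

lemma dzb_dz_g_diag (h : L.Regular K ε) (i j : Fin n) :
    |(dzb (L.v j) (dz (L.v j) (L.g i i)) L.z).re -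
      2 * (L.a i L.z * (starRingEnd ℂ) (dzb (L.v j) (dz (L.v j) (L.U i)) L.z)).re -
      (dzb (L.v j) (dz (L.v j) (L.b i i)) L.z).re| ≤
      9 * K ^ 3 + K * ‖L.b j j L.z‖ +
        2 * (K ^ 4 + K ^ 2 * ‖dz (L.v j) (L.U i) L.z‖ + K ^ 2 * ‖L.b i j L.z‖) := by
  have hK := h.one_le
  have hA : ContDiffAt ℝ 2 (fun x => L.a i x * (starRingEnd ℂ) (L.U i x)) L.z :=
    (h.jet_a i).contDiffAt.mul (contDiffAt_conj (h.reg_U2 i))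
  have e : L.g i i = fun x => (L.X i i x + (L.a i x * (starRingEnd ℂ) (L.U i x) +
      (starRingEnd ℂ) (L.a i x * (starRingEnd ℂ) (L.U i x)))) + L.b i i x := by
    funext x
    simp only [g, map_mul, Complex.conj_conj]
    ring
  rw [e, dzb_dz_add ((h.reg_X i i).add (hA.add (contDiffAt_conj hA))) (h.reg_b i i),
    dzb_dz_add (h.reg_X i i) (hA.add (contDiffAt_conj hA)), dzb_dz_add hA (contDiffAt_conj hA),
    dzb_dz_conj hA, h.dzb_dz_a_mul_conj]
  set A := dzb (L.v j) (dz (L.v j) (L.a i)) L.z * (starRingEnd ℂ) (L.U i L.z) +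
      dz (L.v j) (L.a i) L.z * (starRingEnd ℂ) (dz (L.v j) (L.U i) L.z) +
      dzb (L.v j) (L.a i) L.z * (starRingEnd ℂ) (L.b i j L.z) with hAdef
  have hAn : ‖A‖ ≤ K ^ 4 + K ^ 2 * ‖dz (L.v j) (L.U i) L.z‖ + K ^ 2 * ‖L.b i j L.z‖ := by
    refine norm_add_le_of_le (norm_add_le_of_le ?_ ?_) ?_
    · rw [norm_mul, RCLike.norm_conj, pow_succ]
      exact mul_le_mul ((h.jet_a i).norm_dzb_dz_le (h.v_le j)) (h.U_le i) (norm_nonneg _)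
        (by positivity)
    · rw [norm_mul, RCLike.norm_conj]
      exact mul_le_mul_of_nonneg_right ((h.jet_a i).norm_dz_le (h.v_le j)) (norm_nonneg _)
    · rw [norm_mul, RCLike.norm_conj]
      exact mul_le_mul_of_nonneg_right ((h.jet_a i).norm_dzb_le (h.v_le j)) (norm_nonneg _)
  have hX := (Complex.abs_re_le_norm _).trans (h.norm_dzb_dz_X_le i i j)
  have hAr := (Complex.abs_re_le_norm _).trans hAn
  simp only [Complex.add_re, Complex.conj_re, map_add]
  rw [abs_le] at hX hAr ⊢
  constructor <;> linarith [hX.1, hX.2, hAr.1, hAr.2]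

lemma dzb_dz_b (h : L.Regular K ε) (i j : Fin n) :
    dzb (L.v j) (dz (L.v j) (L.b i i)) L.z =
      dzb (L.v j) (dzb (L.v i) (dz (L.v i) (dz (L.v j) L.uC))) L.z := by
  have h3 : ContDiffAt ℝ 3 (L.U j) L.z := h.reg_U j
  have e1 : dz (L.v j) (L.b i i) =ᶠ[𝓝 L.z] dz (L.v i) (dz (L.v j) (dzb (L.v i) L.uC)) :=
    dz_dz_comm_eventually ((h.reg_Ub i).of_le (by norm_num))
  have e2 : dz (L.v j) (dzb (L.v i) L.uC) =ᶠ[𝓝 L.z] dzb (L.v i) (L.U j) :=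
    (h.dzb_U i j).symm
  have e3 : dz (L.v i) (dzb (L.v i) (L.U j)) =ᶠ[𝓝 L.z] dzb (L.v i) (dz (L.v i) (L.U j)) :=
    (dzb_dz_comm_eventually (h3.of_le (by norm_num))).symm
  exact dzb_congr ((e1.trans (dz_eventuallyEq e2)).trans e3)

/-- The fourth derivatives of `u` commute. -/
lemma dzb_dz_b_comm (h : L.Regular K ε) (i j : Fin n) :
    dzb (L.v j) (dz (L.v j) (L.b i i)) L.z = dzb (L.v i) (dz (L.v i) (L.b j j)) L.z := by
  rw [h.dzb_dz_b i j, h.dzb_dz_b j i]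
  have e : dz (L.v i) (dz (L.v j) L.uC) =ᶠ[𝓝 L.z] dz (L.v j) (dz (L.v i) L.uC) :=
    dz_dz_comm_eventually (h.reg_uC.of_le (by norm_num))
  have h2 : ContDiffAt ℝ 2 (dz (L.v i) (dz (L.v j) L.uC)) L.z :=
    contDiffAt_dz (m := 2) (by norm_num; exact h.reg_U j)
  rw [dzb_dzb_comm h2]
  exact dzb_congr (dzb_eventuallyEq e)

/-- Exchange of the directions of differentiation `o` and `i` in the second derivatives of `g`. The
third derivatives of `u` that enter through the gradient terms of `g` are kept. -/
lemma commute (h : L.Regular K ε) (h1 : 1 ≤ L.lam L.o) (i : Fin n) :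
    (dzb (L.v L.o) (dz (L.v L.o) (L.g i i)) L.z).re ≤
      (dzb (L.v i) (dz (L.v i) (L.g L.o L.o)) L.z).re -
      2 * (L.a L.o L.z * (starRingEnd ℂ) (dzb (L.v i) (dz (L.v i) (L.U L.o)) L.z)).re +
      2 * (L.a i L.z * (starRingEnd ℂ) (dzb (L.v L.o) (dz (L.v L.o) (L.U i)) L.z)).re +
      46 * K ^ 4 * (L.lam L.o + ‖dz (L.v i) (L.U L.o) L.z‖) := by
  have hK := h.one_le
  have a1 := (abs_le.1 (h.dzb_dz_g_diag i L.o)).2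
  have a2 := (abs_le.1 (h.dzb_dz_g_diag L.o i)).1
  rw [h.dzb_dz_b_comm i L.o, h.u2_symm i L.o] at a1
  have hb := h.norm_b_le_mul h1
  have k0 : 0 ≤ K := by linarith
  have k3 : K ^ 3 ≤ K ^ 4 := pow_le_pow_right₀ hK (by norm_num)
  have k4 : K ^ 2 ≤ K ^ 4 := pow_le_pow_right₀ hK (by norm_num)
  have b1 := mul_le_mul_of_nonneg_left (hb L.o L.o) k0
  have b2 := mul_le_mul_of_nonneg_left (hb i i) k0
  have b3 := mul_le_mul_of_nonneg_left (hb i L.o) (sq_nonneg K)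
  have b4 := mul_le_mul_of_nonneg_left (hb L.o i) (sq_nonneg K)
  have k5 := mul_le_mul_of_nonneg_right k3 h.top_pos.le
  have k6 := mul_le_mul_of_nonneg_left h1 (by positivity : 0 ≤ K ^ 4)
  have k7 := mul_le_mul_of_nonneg_right k4 (norm_nonneg (dz (L.v i) (L.U L.o) L.z))
  have k8 : 0 ≤ K ^ 4 * ‖dz (L.v i) (L.U L.o) L.z‖ := by positivity
  linarith

/-! ### Derivatives of the test function -/

lemma diff_UU (h : L.Regular K ε) (l m : Fin n) :
    ContDiffAt ℝ 2 (fun x => L.U m x * (starRingEnd ℂ) (L.U l x)) L.z :=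
  (h.reg_U2 m).mul (contDiffAt_conj (h.reg_U2 l))

lemma dz_UU (h : L.Regular K ε) (l m i : Fin n) :
    dz (L.v i) (fun x => L.U m x * (starRingEnd ℂ) (L.U l x)) L.z =
      dz (L.v i) (L.U m) L.z * (starRingEnd ℂ) (L.U l L.z) +
        L.U m L.z * (starRingEnd ℂ) (L.b l i L.z) := by
  rw [dz_mul (h.diff_U m) ((contDiffAt_conj (h.reg_U2 l)).differentiableAt (by simp)),
    dz_conj (h.diff_U l), h.dzb_U_self]

lemma dzb_UU (h : L.Regular K ε) (l m i : Fin n) :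
    dzb (L.v i) (fun x => L.U m x * (starRingEnd ℂ) (L.U l x)) L.z =
      L.b m i L.z * (starRingEnd ℂ) (L.U l L.z) +
        L.U m L.z * (starRingEnd ℂ) (dz (L.v i) (L.U l) L.z) := by
  rw [dzb_mul (h.diff_U m) ((contDiffAt_conj (h.reg_U2 l)).differentiableAt (by simp)),
    dzb_conj (h.diff_U l), h.dzb_U_self]

lemma dzb_dz_UU (h : L.Regular K ε) (l m i : Fin n) :
    dzb (L.v i) (dz (L.v i) (fun x => L.U m x * (starRingEnd ℂ) (L.U l x))) L.z =
      dzb (L.v i) (dz (L.v i) (L.U m)) L.z * (starRingEnd ℂ) (L.U l L.z) +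
      dz (L.v i) (L.U m) L.z * (starRingEnd ℂ) (dz (L.v i) (L.U l) L.z) +
      L.b m i L.z * (starRingEnd ℂ) (L.b l i L.z) +
      L.U m L.z * (starRingEnd ℂ) (dzb (L.v i) (dz (L.v i) (L.U l)) L.z) := by
  rw [dzb_dz_mul (h.reg_U2 m) (contDiffAt_conj (h.reg_U2 l)), dzb_dz_conj (h.reg_U2 l),
    dz_conj (h.diff_U l), dzb_conj (h.diff_U l), h.dzb_U_self, h.dzb_U_self]

lemma norm_UU_le (h : L.Regular K ε) (l m : Fin n) :
    ‖L.U m L.z * (starRingEnd ℂ) (L.U l L.z)‖ ≤ K ^ 2 := by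
  rw [norm_mul, RCLike.norm_conj, sq]
  exact mul_le_mul (h.U_le m) (h.U_le l) (norm_nonneg _) (by linarith [h.one_le])

lemma reg_Γ_term (h : L.Regular K ε) (l m : Fin n) : ContDiffAt ℝ 2
    (fun x => L.P l m x * (L.U m x * (starRingEnd ℂ) (L.U l x))) L.z :=
  (h.jet_P l m).contDiffAt.mul (h.diff_UU l m)

lemma reg_Γ (h : L.Regular K ε) : ContDiffAt ℝ 2 L.Γ L.z :=
  ContDiffAt.sum fun l _ => ContDiffAt.sum fun m _ => h.reg_Γ_term l m

lemma sum_P_mul (h : L.Regular K ε) (Y : Fin n → Fin n → ℂ) :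
    ∑ l, ∑ m, L.P l m L.z * Y l m = ∑ m, Y m m := by
  simp [h.P_one]

lemma Γ_conj (h : L.Regular K ε) : ∀ᶠ x in 𝓝 L.z, (starRingEnd ℂ) (L.Γ x) = L.Γ x := by
  filter_upwards [h.herm_P] with x hx
  simp only [Γ, map_sum, map_mul, Complex.conj_conj]
  rw [sum_comm]
  refine sum_congr rfl fun m _ => sum_congr rfl fun l _ => ?_
  rw [← hx]
  ring

/-- The first derivative of `|∂u|²`; the error comes from the derivatives of the metric. -/
lemma grad_one (h : L.Regular K ε) (i : Fin n) :
    ‖dz (L.v i) L.Γ L.z - ∑ m, (dz (L.v i) (L.U m) L.z * (starRingEnd ℂ) (L.U m L.z) +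
      L.U m L.z * (starRingEnd ℂ) (L.b m i L.z))‖ ≤ n ^ 2 * K ^ 4 := by
  have e : dz (L.v i) L.Γ L.z = ∑ l, ∑ m, dz (L.v i) (L.P l m) L.z *
      (L.U m L.z * (starRingEnd ℂ) (L.U l L.z)) +
      ∑ m, (dz (L.v i) (L.U m) L.z * (starRingEnd ℂ) (L.U m L.z) +
        L.U m L.z * (starRingEnd ℂ) (L.b m i L.z)) := by
    have d1 : ∀ l m, DifferentiableAt ℝ
        (fun x => L.P l m x * (L.U m x * (starRingEnd ℂ) (L.U l x))) L.z :=
      fun l m => (h.reg_Γ_term l m).differentiableAt (by simp)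
    change dz (L.v i) (fun x => ∑ l, ∑ m, L.P l m x * (L.U m x * (starRingEnd ℂ) (L.U l x))) L.z = _
    rw [dz_sum _ fun l _ => DifferentiableAt.fun_sum fun m _ => d1 l m,
      ← h.sum_P_mul (fun l m => dz (L.v i) (L.U m) L.z * (starRingEnd ℂ) (L.U l L.z) +
        L.U m L.z * (starRingEnd ℂ) (L.b l i L.z)), ← sum_add_distrib]
    refine sum_congr rfl fun l _ => ?_
    rw [dz_sum _ fun m _ => d1 l m, ← sum_add_distrib]
    refine sum_congr rfl fun m _ => ?_
    rw [dz_mul ((h.jet_P l m).contDiffAt.differentiableAt (by simp))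
      ((h.diff_UU l m).differentiableAt (by simp)), h.dz_UU]
  rw [e, add_sub_cancel_right]
  refine (norm_sum_le _ _).trans ((sum_le_sum fun l _ => norm_sum_le _ _).trans ?_)
  have : ∀ l ∈ univ, ∀ m ∈ univ, ‖dz (L.v i) (L.P l m) L.z *
      (L.U m L.z * (starRingEnd ℂ) (L.U l L.z))‖ ≤ K ^ 4 := fun l _ m _ => by
    rw [norm_mul, show K ^ 4 = K ^ 2 * K ^ 2 by ring]
    exact mul_le_mul ((h.jet_P l m).norm_dz_le (h.v_le i)) (h.norm_UU_le l m) (norm_nonneg _)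
      (sq_nonneg K)
  refine (sum_le_sum fun l hl => sum_le_sum (this l hl)).trans (le_of_eq ?_)
  simp
  ring

/-- The second derivative of `|∂u|²` contains the square norm of all second derivatives of `u`. -/
lemma grad_two (h : L.Regular K ε) (i : Fin n) :
    ∑ m, (‖dz (L.v i) (L.U m) L.z‖ ^ 2 + ‖L.b m i L.z‖ ^ 2) +
      2 * (∑ m, (starRingEnd ℂ) (L.U m L.z) * dzb (L.v i) (dz (L.v i) (L.U m)) L.z).re -
      2 * n ^ 2 * K ^ 5 * (1 + ∑ m, (‖dz (L.v i) (L.U m) L.z‖ + ‖L.b m i L.z‖)) ≤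
      (dzb (L.v i) (dz (L.v i) L.Γ) L.z).re := by
  have hK := h.one_le
  have hn : (1 : ℝ) ≤ n := by exact_mod_cast (Fin.pos i)
  set E : Fin n → Fin n → ℂ := fun l m =>
    dzb (L.v i) (dz (L.v i) (L.P l m)) L.z * (L.U m L.z * (starRingEnd ℂ) (L.U l L.z)) +
    dz (L.v i) (L.P l m) L.z * (L.b m i L.z * (starRingEnd ℂ) (L.U l L.z) +
        L.U m L.z * (starRingEnd ℂ) (dz (L.v i) (L.U l) L.z)) +
    dzb (L.v i) (L.P l m) L.z * (dz (L.v i) (L.U m) L.z * (starRingEnd ℂ) (L.U l L.z) +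
        L.U m L.z * (starRingEnd ℂ) (L.b l i L.z)) with hE
  have e : dzb (L.v i) (dz (L.v i) L.Γ) L.z = ∑ l, ∑ m, E l m +
      ∑ m, (dzb (L.v i) (dz (L.v i) (L.U m)) L.z * (starRingEnd ℂ) (L.U m L.z) +
      dz (L.v i) (L.U m) L.z * (starRingEnd ℂ) (dz (L.v i) (L.U m) L.z) +
      L.b m i L.z * (starRingEnd ℂ) (L.b m i L.z) +
      L.U m L.z * (starRingEnd ℂ) (dzb (L.v i) (dz (L.v i) (L.U m)) L.z)) := by
    change dzb (L.v i) (dz (L.v i)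
      (fun x => ∑ l, ∑ m, L.P l m x * (L.U m x * (starRingEnd ℂ) (L.U l x)))) L.z = _
    rw [dzb_dz_sum _ fun l _ => ContDiffAt.sum fun m _ => h.reg_Γ_term l m,
      ← h.sum_P_mul (fun l m =>
        dzb (L.v i) (dz (L.v i) (L.U m)) L.z * (starRingEnd ℂ) (L.U l L.z) +
        dz (L.v i) (L.U m) L.z * (starRingEnd ℂ) (dz (L.v i) (L.U l) L.z) +
        L.b m i L.z * (starRingEnd ℂ) (L.b l i L.z) +
        L.U m L.z * (starRingEnd ℂ) (dzb (L.v i) (dz (L.v i) (L.U l)) L.z)), ← sum_add_distrib]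
    refine sum_congr rfl fun l _ => ?_
    rw [dzb_dz_sum _ fun m _ => h.reg_Γ_term l m, ← sum_add_distrib]
    refine sum_congr rfl fun m _ => ?_
    rw [dzb_dz_mul (h.jet_P l m).contDiffAt (h.diff_UU l m), h.dz_UU, h.dzb_UU, h.dzb_dz_UU]
  set V : Fin n → ℝ := fun m => ‖dz (L.v i) (L.U m) L.z‖ + ‖L.b m i L.z‖ with hV
  have hEb : ∀ l m, ‖E l m‖ ≤ K ^ 5 + K ^ 3 * (V m + V l) := fun l m => by
    have k1 := (h.jet_P l m).norm_dz_le (h.v_le i)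
    have k2 := (h.jet_P l m).norm_dzb_le (h.v_le i)
    have k3 := (h.jet_P l m).norm_dzb_dz_le (h.v_le i)
    have m1 : ∀ x y : ℂ, ‖x * (starRingEnd ℂ) (L.U l L.z) + L.U m L.z * (starRingEnd ℂ) y‖ ≤
        K * (‖x‖ + ‖y‖) := fun x y => by
      refine (norm_add_le _ _).trans ?_
      rw [norm_mul, norm_mul, RCLike.norm_conj, RCLike.norm_conj]
      have c1 := mul_le_mul_of_nonneg_left (h.U_le l) (norm_nonneg x)
      have c2 := mul_le_mul_of_nonneg_right (h.U_le m) (norm_nonneg y)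
      linarith
    have t1 : ‖dzb (L.v i) (dz (L.v i) (L.P l m)) L.z *
        (L.U m L.z * (starRingEnd ℂ) (L.U l L.z))‖ ≤ K ^ 3 * K ^ 2 := by
      rw [norm_mul]
      exact mul_le_mul k3 (h.norm_UU_le l m) (norm_nonneg _) (by positivity)
    have t2 := mul_le_mul k1 (m1 (L.b m i L.z) (dz (L.v i) (L.U l) L.z)) (norm_nonneg _)
      (sq_nonneg K)
    have t3 := mul_le_mul k2 (m1 (dz (L.v i) (L.U m) L.z) (L.b l i L.z)) (norm_nonneg _)
      (sq_nonneg K)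
    rw [← norm_mul] at t2 t3
    refine (norm_add_le_of_le (norm_add_le_of_le t1 t2) t3).trans (le_of_eq ?_)
    simp only [hV]
    ring
  have hEs : -(n ^ 2 * K ^ 5 + 2 * n * K ^ 3 * ∑ m, V m) ≤ (∑ l, ∑ m, E l m).re := by
    refine le_trans ?_ (abs_le.1 (Complex.abs_re_le_norm _)).1
    refine neg_le_neg ((norm_sum_le _ _).trans ((sum_le_sum fun l _ => (norm_sum_le _ _).trans
      (sum_le_sum fun m _ => hEb l m)).trans (le_of_eq ?_)))
    simp only [sum_add_distrib, ← mul_sum, sum_const, card_univ, Fintype.card_fin, nsmul_eq_mul]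
    ring
  have hmain : (∑ m, (dzb (L.v i) (dz (L.v i) (L.U m)) L.z * (starRingEnd ℂ) (L.U m L.z) +
      dz (L.v i) (L.U m) L.z * (starRingEnd ℂ) (dz (L.v i) (L.U m) L.z) +
      L.b m i L.z * (starRingEnd ℂ) (L.b m i L.z) +
      L.U m L.z * (starRingEnd ℂ) (dzb (L.v i) (dz (L.v i) (L.U m)) L.z))).re =
      ∑ m, (‖dz (L.v i) (L.U m) L.z‖ ^ 2 + ‖L.b m i L.z‖ ^ 2) +
      2 * (∑ m, (starRingEnd ℂ) (L.U m L.z) * dzb (L.v i) (dz (L.v i) (L.U m)) L.z).re := by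
    rw [Complex.re_sum, Complex.re_sum, mul_sum, ← sum_add_distrib]
    refine sum_congr rfl fun m _ => ?_
    rw [Complex.mul_conj, Complex.mul_conj, Complex.normSq_eq_norm_sq, Complex.normSq_eq_norm_sq]
    simp only [Complex.add_re, Complex.mul_re, Complex.conj_re, Complex.conj_im, Complex.ofReal_re]
    ring
  rw [e, Complex.add_re, hmain]
  have hV0 : 0 ≤ ∑ m, V m := sum_nonneg fun m _ => by positivity
  have k1 : n * K ^ 3 ≤ n ^ 2 * K ^ 5 := mul_le_mul (le_self_pow₀ hn (by norm_num))
    (pow_le_pow_right₀ hK (by norm_num)) (by positivity) (by positivity)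
  have k2 := mul_le_mul_of_nonneg_right k1 hV0
  have k3 : 0 ≤ (n : ℝ) ^ 2 * K ^ 5 := by positivity
  linarith

end Regular

variable (L)

/-- The function `η = exp (B (K₀ - u))`. -/
def η (B K₀ : ℝ) (x : Cn n) : ℂ := Complex.exp ((B : ℂ) * (K₀ - L.uC x))

/-- The auxiliary function `φ = N |∂u|² + exp (B (K₀ - u))`. -/
def φ (N B K₀ : ℝ) (x : Cn n) : ℂ := N * L.Γ x + L.η B K₀ x

variable {L}

lemma η_eq (B K₀ : ℝ) (x : Cn n) : L.η B K₀ x = (Real.exp (B * (K₀ - L.u x)) : ℂ) := by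
  rw [η, uC]; push_cast; rfl

namespace Regular

lemma reg_exponent (h : L.Regular K ε) (B K₀ : ℝ) :
    ContDiffAt ℝ 2 (fun x => (B : ℂ) * (K₀ - L.uC x)) L.z :=
  contDiffAt_const.mul (contDiffAt_const.sub (h.reg_uC.of_le (by norm_num)))

lemma reg_η (h : L.Regular K ε) (B K₀ : ℝ) : ContDiffAt ℝ 2 (L.η B K₀) L.z :=
  (h.reg_exponent B K₀).cexp

lemma reg_φ (h : L.Regular K ε) (N B K₀ : ℝ) : ContDiffAt ℝ 2 (L.φ N B K₀) L.z :=
  (contDiffAt_const.mul h.reg_Γ).add (h.reg_η B K₀)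

lemma φ_real (h : L.Regular K ε) (N B K₀ : ℝ) :
    ∀ᶠ x in 𝓝 L.z, (starRingEnd ℂ) (L.φ N B K₀ x) = L.φ N B K₀ x := by
  filter_upwards [h.Γ_conj] with x hx
  simp only [φ, η_eq, map_add, map_mul, hx, Complex.conj_ofReal]

lemma dz_φ (h : L.Regular K ε) (N B K₀ : ℝ) (i : Fin n) :
    dz (L.v i) (L.φ N B K₀) L.z = N * dz (L.v i) L.Γ L.z -
      (B * Real.exp (B * (K₀ - L.u L.z)) : ℝ) * L.U i L.z := by
  have du : DifferentiableAt ℝ L.uC L.z := h.reg_uC.differentiableAt (by simp)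
  have dG : DifferentiableAt ℝ L.Γ L.z := h.reg_Γ.differentiableAt (by simp)
  have dη : DifferentiableAt ℝ (L.η B K₀) L.z := (h.reg_η B K₀).differentiableAt (by simp)
  have e1 : dz (L.v i) (L.η B K₀) L.z =
      -((B * Real.exp (B * (K₀ - L.u L.z)) : ℝ) * L.U i L.z) := by
    change dz (L.v i) (fun x => Complex.exp ((B : ℂ) * (K₀ - L.uC x))) L.z = _
    rw [dz_exp ((h.reg_exponent B K₀).differentiableAt (by simp)),
      dz_const_mul _ ((differentiableAt_const _).fun_sub du), dz_sub (differentiableAt_const _) du, dz_const]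
    have := L.η_eq B K₀ L.z
    rw [η] at this
    rw [this]
    push_cast
    change _ * (_ * (0 - L.U i L.z)) = _
    ring
  change dz (L.v i) (fun x => N * L.Γ x + L.η B K₀ x) L.z = _
  rw [dz_add (dG.const_mul _) dη, dz_const_mul _ dG, e1]
  ring

lemma dzb_dz_φ (h : L.Regular K ε) (N B K₀ : ℝ) (i : Fin n) :
    (dzb (L.v i) (dz (L.v i) (L.φ N B K₀)) L.z).re =
      N * (dzb (L.v i) (dz (L.v i) L.Γ) L.z).re + Real.exp (B * (K₀ - L.u L.z)) *
        (B ^ 2 * ‖L.U i L.z‖ ^ 2 - B * (L.b i i L.z).re) := by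
  have du : DifferentiableAt ℝ L.uC L.z := h.reg_uC.differentiableAt (by simp)
  have ru : ContDiffAt ℝ 2 L.uC L.z := h.reg_uC.of_le (by norm_num)
  have e0 : ∀ x, (B : ℂ) * (K₀ - L.uC x) = (B * K₀ : ℝ) + (-B : ℂ) * L.uC x := fun x => by
    push_cast; ring
  have e1 : dzb (L.v i) (dz (L.v i) (L.η B K₀)) L.z =
      Real.exp (B * (K₀ - L.u L.z)) * ((B : ℂ) ^ 2 * ((‖L.U i L.z‖ ^ 2 : ℝ) : ℂ) -
        B * L.b i i L.z) := by
    change dzb (L.v i) (dz (L.v i) (fun x => Complex.exp ((B : ℂ) * (K₀ - L.uC x)))) L.z = _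
    rw [dzb_dz_exp (h.reg_exponent B K₀)]
    have := L.η_eq B K₀ L.z
    rw [η] at this
    rw [this]
    simp only [e0]
    rw [dzb_add (differentiableAt_const _) (du.const_mul _), dzb_const_mul _ du, dzb_const,
      dz_add (differentiableAt_const _) (du.const_mul _), dz_const_mul _ du, dz_const,
      dzb_dz_add contDiffAt_const (contDiffAt_const.mul ru), dzb_dz_const_mul _ ru]
    have hb : dzb (L.v i) L.uC L.z = (starRingEnd ℂ) (L.U i L.z) := (h.dzb_uC i).eq_of_nhds
    have hb2 : dzb (L.v i) (dz (L.v i) L.uC) L.z = L.b i i L.z := h.dzb_U_self i i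
    have hc : dzb (L.v i) (dz (L.v i) (fun _ : Cn n => ((B * K₀ : ℝ) : ℂ))) L.z = 0 := by
      have : dz (L.v i) (fun _ : Cn n => ((B * K₀ : ℝ) : ℂ)) = fun _ => 0 := by
        funext x; exact dz_const _
      rw [this, dzb_const]
    have hn : ((‖L.U i L.z‖ ^ 2 : ℝ) : ℂ) = (starRingEnd ℂ) (L.U i L.z) * L.U i L.z := by
      rw [mul_comm, Complex.mul_conj, Complex.normSq_eq_norm_sq]
    rw [hb, hb2, hc, hn]
    change _ * ((_ + _) * (_ + -_ * L.U i L.z) + _) = _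
    ring
  change (dzb (L.v i) (dz (L.v i) (fun x => N * L.Γ x + L.η B K₀ x)) L.z).re = _
  rw [dzb_dz_add (contDiffAt_const.mul h.reg_Γ) (h.reg_η B K₀), dzb_dz_const_mul _ h.reg_Γ, e1,
    Complex.add_re, Complex.re_ofReal_mul, Complex.re_ofReal_mul, Complex.sub_re,
    Complex.re_ofReal_mul, ← Complex.ofReal_pow, Complex.re_ofReal_mul, Complex.ofReal_re]

end Regular
end LocalData

namespace LocalData
variable {n : ℕ} (L : LocalData n) {K ε : ℝ}

/-! ### The right-hand side of the equation -/

/-- The logarithm of the right-hand side, as a function of the point. -/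
def R (x : Cn n) : ℂ := (L.f (x, L.c x) : ℂ)

/-- The derivative of the logarithm of the right-hand side. -/
def df : Cn n × (Cn n × ℝ) →L[ℝ] ℂ := fderiv ℝ (fun y => (L.f y : ℂ)) (L.z, L.c L.z)

/-- The derivative of the logarithm of the right-hand side in the gradient variable. -/
def l (q : Fin n) : ℂ :=
  (1 / 2 : ℂ) * (L.df (0, (L.w q, 0)) - Complex.I * L.df (0, (Complex.I • L.w q, 0)))

variable {L}

namespace Regular

lemma norm_df_le (h : L.Regular K ε) (y : Cn n × ℝ) : ‖L.df (0, y)‖ ≤ K * ‖y‖ :=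
  (L.df.le_opNorm _).trans (mul_le_mul h.jet_f.fderiv_le (norm_zero_prod _) (norm_nonneg _)
    h.jet_f.nonneg)

lemma norm_prod_zero {Y : Type*} [NormedAddCommGroup Y] (y : Y) : ‖(y, (0 : ℝ))‖ ≤ ‖y‖ := by
  simp [Prod.norm_def]

lemma norm_zero_real (t : ℝ) : ‖((0 : Cn n), t)‖ ≤ ‖t‖ := by
  simp [Prod.norm_def]

lemma norm_l_le (h : L.Regular K ε) (q : Fin n) : ‖L.l q‖ ≤ K ^ 2 := by
  have h0 := h.jet_f.nonneg
  have a1 := (h.norm_df_le (L.w q, 0)).trans (mul_le_mul_of_nonneg_left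
    ((norm_prod_zero (L.w q)).trans (h.w_le q)) h0)
  have hw : ‖Complex.I • L.w q‖ ≤ K := by rw [norm_smul, Complex.norm_I, one_mul]; exact h.w_le q
  have a2 := (h.norm_df_le (Complex.I • L.w q, 0)).trans (mul_le_mul_of_nonneg_left
    ((norm_prod_zero (Complex.I • L.w q)).trans hw) h0)
  have a3 := norm_sub_le (L.df (0, (L.w q, 0))) (Complex.I * L.df (0, (Complex.I • L.w q, 0)))
  rw [norm_mul, Complex.norm_I, one_mul] at a3
  rw [l, norm_mul]
  norm_num
  linarith

lemma df_conj (h : L.Regular K ε) (y : Cn n × (Cn n × ℝ)) :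
    (starRingEnd ℂ) (L.df y) = L.df y := by
  have h1 : DifferentiableAt ℝ (fun y => (L.f y : ℂ)) (L.z, L.c L.z) :=
    h.jet_f.contDiffAt.differentiableAt (by simp)
  have h2 : HasFDerivAt (fun y => (starRingEnd ℂ) (L.f y : ℂ))
      ((Complex.conjCLE : ℂ →L[ℝ] ℂ).comp L.df) (L.z, L.c L.z) :=
    (Complex.conjCLE : ℂ →L[ℝ] ℂ).hasFDerivAt.comp _ h1.hasFDerivAt
  simp only [Complex.conj_ofReal] at h2
  have h3 := h2.unique h1.hasFDerivAt
  exact congrArg (fun T : Cn n × (Cn n × ℝ) →L[ℝ] ℂ => T y) h3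

lemma df_smul (h : L.Regular K ε) (q : Fin n) (x : ℂ) : L.df (0, (x • L.w q, 0)) =
    L.l q * x + (starRingEnd ℂ) (L.l q) * (starRingEnd ℂ) x := by
  have e : ((0 : Cn n), (x • L.w q, (0 : ℝ))) = x.re • ((0 : Cn n), (L.w q, (0 : ℝ))) +
      x.im • ((0 : Cn n), (Complex.I • L.w q, (0 : ℝ))) := by
    have : x • L.w q = x.re • L.w q + x.im • (Complex.I • L.w q) := by
      conv_lhs => rw [← Complex.re_add_im x, add_smul, mul_smul]
      rfl
    simp [this]
  rw [e, map_add, map_smul, map_smul, l]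
  simp only [map_mul, map_sub, map_div₀, map_one, map_ofNat, h.df_conj, Complex.conj_I,
    Complex.real_smul]
  conv_rhs => rw [← Complex.re_add_im x]
  simp only [map_add, map_mul, Complex.conj_ofReal, Complex.conj_I]
  linear_combination (L.df (0, (Complex.I • L.w q, 0)) * x.im) * Complex.I_sq

lemma df_sum (h : L.Regular K ε) (x : Fin n → ℂ) (t : ℝ) :
    L.df (0, (∑ q, x q • L.w q, t)) =
      ∑ q, (L.l q * x q + (starRingEnd ℂ) (L.l q) * (starRingEnd ℂ) (x q)) +
        L.df (0, (0, t)) := by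
  have e : ((0 : Cn n), (∑ q, x q • L.w q, t)) =
      ∑ q, ((0 : Cn n), (x q • L.w q, (0 : ℝ))) + ((0 : Cn n), ((0 : Cn n), t)) := by
    simp [Prod.ext_iff, Prod.fst_sum, Prod.snd_sum]
  rw [e, map_add, map_sum]
  simp only [h.df_smul]

lemma reg_c (h : L.Regular K ε) : ContDiffAt ℝ 2 L.c L.z :=
  (ContDiffAt.sum fun q _ => (h.reg_U2 q).smul contDiffAt_const).prodMk
    (h.reg_u.of_le (by norm_num))

lemma fderiv_c_eventually (h : L.Regular K ε) (w : Cn n) :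
    ∀ᶠ x in 𝓝 L.z, fderiv ℝ L.c x w = (∑ q, fderiv ℝ (L.U q) x w • L.w q, fderiv ℝ L.u x w) := by
  have h1 : ∀ᶠ x in 𝓝 L.z, ∀ q, DifferentiableAt ℝ (L.U q) x :=
    eventually_all.2 fun q => eventually_differentiableAt ((h.reg_U q).of_le (by norm_num))
  have h2 : ∀ᶠ x in 𝓝 L.z, DifferentiableAt ℝ L.u x :=
    (h.reg_u.eventually (by simp)).mono fun _ hx => hx.differentiableAt (by simp)
  filter_upwards [h1, h2] with x x1 x2
  have e := ((HasFDerivAt.fun_sum (u := univ) fun q _ =>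
    (x1 q).hasFDerivAt.smul_const (L.w q)).prodMk x2.hasFDerivAt).fderiv
  have e' : fderiv ℝ L.c x = _ := e
  rw [e']
  simp

lemma fderiv_c (h : L.Regular K ε) (w : Cn n) :
    fderiv ℝ L.c L.z w = (∑ q, fderiv ℝ (L.U q) L.z w • L.w q, fderiv ℝ L.u L.z w) :=
  (h.fderiv_c_eventually w).self_of_nhds

lemma fderiv_fderiv_c (h : L.Regular K ε) (w w' : Cn n) :
    fderiv ℝ (fderiv ℝ L.c) L.z w w' = (∑ q, fderiv ℝ (fderiv ℝ (L.U q)) L.z w w' • L.w q,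
      fderiv ℝ (fderiv ℝ L.u) L.z w w') := by
  have ru : ContDiffAt ℝ 2 L.u L.z := h.reg_u.of_le (by norm_num)
  have d : ∀ {V : Type} [NormedAddCommGroup V] [NormedSpace ℝ V] {F : Cn n → V},
      ContDiffAt ℝ 2 F L.z → DifferentiableAt ℝ (fun x => fderiv ℝ F x w') L.z := fun hF =>
    ((hF.fderiv_right (m := 1) (by norm_num)).differentiableAt (by simp)).clm_apply
      (differentiableAt_const _)
  have ev : (fun x => fderiv ℝ L.c x w') =ᶠ[𝓝 L.z] fun x =>
      (∑ q, fderiv ℝ (L.U q) x w' • L.w q, fderiv ℝ L.u x w') := h.fderiv_c_eventually w'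
  have e := ((HasFDerivAt.fun_sum (u := univ) fun q _ =>
    ((d (h.reg_U2 q)).hasFDerivAt.smul_const (L.w q))).prodMk (d ru).hasFDerivAt).fderiv
  rw [fderiv_fderiv_apply h.reg_c, ev.fderiv_eq, e, fderiv_fderiv_apply ru]
  simp only [fun q => fderiv_fderiv_apply (h.reg_U2 q) w w']
  simp

lemma reg_R (h : L.Regular K ε) : ContDiffAt ℝ 2 L.R L.z :=
  ContDiffAt.comp L.z (f := fun x => (x, L.c x)) h.jet_f.contDiffAt
    (contDiffAt_id.prodMk h.reg_c)

/-- The first derivative of the right-hand side, up to bounded terms, is its gradient derivative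
`l` applied to the derivative of `∂u`. -/
lemma dz_R (h : L.Regular K ε) (m : Fin n) : ‖dz (L.v m) L.R L.z -
    ∑ q, (L.l q * dz (L.v m) (L.U q) L.z + (starRingEnd ℂ) (L.l q) * L.b m q L.z)‖ ≤
      3 * K ^ 2 := by
  have h1 := dz_graph (Φ := fun y => (L.f y : ℂ)) (v := L.v m) h.jet_f (h.reg_c.of_le (by norm_num))
  rw [h.fderiv_c, h.fderiv_c] at h1
  change ‖dz (L.v m) L.R L.z - 1 / 2 * (L.df _ - Complex.I * L.df _)‖ ≤ _ at h1
  rw [h.df_sum, h.df_sum] at h1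
  have e : (1 / 2 : ℂ) * ((∑ q, (L.l q * fderiv ℝ (L.U q) L.z (L.v m) + (starRingEnd ℂ) (L.l q) *
      (starRingEnd ℂ) (fderiv ℝ (L.U q) L.z (L.v m))) + L.df (0, (0, fderiv ℝ L.u L.z (L.v m)))) -
      Complex.I * (∑ q, (L.l q * fderiv ℝ (L.U q) L.z (Complex.I • L.v m) + (starRingEnd ℂ) (L.l q) *
      (starRingEnd ℂ) (fderiv ℝ (L.U q) L.z (Complex.I • L.v m))) +
        L.df (0, (0, fderiv ℝ L.u L.z (Complex.I • L.v m))))) =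
      ∑ q, (L.l q * dz (L.v m) (L.U q) L.z + (starRingEnd ℂ) (L.l q) * L.b m q L.z) +
      (1 / 2 : ℂ) * (L.df (0, (0, fderiv ℝ L.u L.z (L.v m))) -
        Complex.I * L.df (0, (0, fderiv ℝ L.u L.z (Complex.I • L.v m)))) := by
    have e1 : ∀ A B C D : ℂ, (1 / 2 : ℂ) * ((A + B) - Complex.I * (C + D)) =
        (1 / 2 : ℂ) * (A - Complex.I * C) + (1 / 2 : ℂ) * (B - Complex.I * D) := by intros; ring
    rw [e1]
    congr 1
    rw [mul_sum, ← sum_sub_distrib, mul_sum]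
    refine sum_congr rfl fun q _ => ?_
    rw [fderiv_I_eq, fderiv_eq_dz_add_dzb, h.dzb_U_self, (h.b_herm q m).self_of_nhds]
    simp only [map_mul, map_add, map_sub, Complex.conj_I]
    linear_combination (-(1 / 2 : ℂ) * (L.l q * (dz (L.v m) (L.U q) L.z - L.b q m L.z)) +
      (1 / 2 : ℂ) * ((starRingEnd ℂ) (L.l q) * ((starRingEnd ℂ) (dz (L.v m) (L.U q) L.z) -
        (starRingEnd ℂ) (L.b q m L.z)))) * Complex.I_sq
  rw [e] at h1
  have h0 := h.jet_f.nonneg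
  have b : ∀ t : ℝ, ‖t‖ ≤ 2 * K → ‖L.df (0, (0, t))‖ ≤ 2 * K ^ 2 := fun t ht => by
    have := (h.norm_df_le (0, t)).trans (mul_le_mul_of_nonneg_left
      ((norm_zero_real t).trans ht) h0)
    linarith
  have b1 := b _ (h.norm_fderiv_u_le m).1
  have b2 := b _ (h.norm_fderiv_u_le m).2
  have b3 : ‖(1 / 2 : ℂ) * (L.df (0, (0, fderiv ℝ L.u L.z (L.v m))) -
        Complex.I * L.df (0, (0, fderiv ℝ L.u L.z (Complex.I • L.v m))))‖ ≤ 2 * K ^ 2 := by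
    have := norm_sub_le (L.df (0, (0, fderiv ℝ L.u L.z (L.v m))))
      (Complex.I * L.df (0, (0, fderiv ℝ L.u L.z (Complex.I • L.v m))))
    rw [norm_mul, Complex.norm_I, one_mul] at this
    rw [norm_mul]
    norm_num
    linarith
  have h2 := norm_add_le_of_le h1 b3
  rw [sub_add_eq_sub_sub, sub_add_cancel] at h2
  have := mul_le_mul_of_nonneg_left (h.v_le m) h0
  linarith

/-- The second derivative of the right-hand side, from below: third derivatives of `u` enter only
through `l`, the rest is quadratic in the second derivatives of `u`. -/
lemma dzb_dz_R (h : L.Regular K ε) (h1 : 1 ≤ L.lam L.o) (o : Fin n) :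
    2 * (∑ q, L.l q * dzb (L.v o) (dz (L.v o) (L.U q)) L.z).re -
      102 * n ^ 2 * K ^ 7 * (1 + L.lam L.o ^ 2 + ∑ q, ‖dz (L.v o) (L.U q) L.z‖ ^ 2) ≤
      (dzb (L.v o) (dz (L.v o) L.R) L.z).re := by
  have hK := h.one_le
  have hn : (1 : ℝ) ≤ n := by exact_mod_cast (Fin.pos o)
  have h0 := h.jet_f.nonneg
  set A := ∑ q, ‖dz (L.v o) (L.U q) L.z‖ with hA
  have hA0 : 0 ≤ A := sum_nonneg fun q _ => norm_nonneg _
  have hb := h.norm_b_le_mul h1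
  set r := 7 * n * K ^ 3 * L.lam L.o + K * A with hr
  have k1 : K ≤ K ^ 3 := le_self_pow₀ hK (by norm_num)
  have k2 : K ^ 3 ≤ n * K ^ 3 * L.lam L.o := by
    have a1 : K ^ 3 ≤ n * K ^ 3 := le_mul_of_one_le_left (by positivity) hn
    exact a1.trans (le_mul_of_one_le_right (by positivity) h1)
  have hsum : ∀ w, (∀ q, ‖fderiv ℝ (L.U q) L.z w‖ ≤ ‖dz (L.v o) (L.U q) L.z‖ +
      ‖dzb (L.v o) (L.U q) L.z‖) → ‖fderiv ℝ L.u L.z w‖ ≤ 2 * K →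
      ‖L.v o‖ + ‖fderiv ℝ L.c L.z w‖ ≤ r := fun w hw hw2 => by
    rw [h.fderiv_c]
    have a1 : ‖∑ q, fderiv ℝ (L.U q) L.z w • L.w q‖ ≤ K * A + 4 * n * K ^ 3 * L.lam L.o := by
      have a2 : ∀ q ∈ univ, ‖fderiv ℝ (L.U q) L.z w • L.w q‖ ≤
          K * ‖dz (L.v o) (L.U q) L.z‖ + 4 * K ^ 3 * L.lam L.o := fun q _ => by
        have c1 := hw q
        rw [h.dzb_U_self] at c1
        have c2 := c1.trans (add_le_add_right (hb q o) _)
        rw [norm_smul]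
        have := mul_le_mul c2 (h.w_le q) (norm_nonneg _) (by positivity)
        linarith
      refine (norm_sum_le _ _).trans ((sum_le_sum a2).trans (le_of_eq ?_))
      rw [sum_add_distrib, ← mul_sum]
      simp
      ring
    have a3 : ‖(∑ q, fderiv ℝ (L.U q) L.z w • L.w q, fderiv ℝ L.u L.z w)‖ ≤
        K * A + 4 * n * K ^ 3 * L.lam L.o + 2 * K := by
      have : 0 ≤ K * A + 4 * n * K ^ 3 * L.lam L.o := (norm_nonneg _).trans a1
      exact max_le (by linarith) (by linarith)
    have a4 := h.v_le o
    rw [hr]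
    linarith
  have hmain := dzb_dz_graph (Φ := fun y => (L.f y : ℂ)) (v := L.v o) h.jet_f h.reg_c (r := r)
    (hsum _ (fun q => norm_fderiv_le_dz) (h.norm_fderiv_u_le o).1)
    (hsum _ (fun q => norm_fderiv_I_le_dz) (h.norm_fderiv_u_le o).2)
  change ‖dzb (L.v o) (dz (L.v o) L.R) L.z - 1 / 4 * L.df _‖ ≤ _ at hmain
  set t := fderiv ℝ (fderiv ℝ L.u) L.z (L.v o) (L.v o) +
      fderiv ℝ (fderiv ℝ L.u) L.z (Complex.I • L.v o) (Complex.I • L.v o) with ht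
  have e0 : fderiv ℝ (fderiv ℝ L.c) L.z (L.v o) (L.v o) +
      fderiv ℝ (fderiv ℝ L.c) L.z (Complex.I • L.v o) (Complex.I • L.v o) =
      (∑ q, (4 * dzb (L.v o) (dz (L.v o) (L.U q)) L.z) • L.w q, t) := by
    rw [h.fderiv_fderiv_c, h.fderiv_fderiv_c, Prod.mk_add_mk, ← sum_add_distrib]
    congr 1
    refine sum_congr rfl fun q _ => ?_
    rw [← add_smul, dzb_dz_self (h.reg_U2 q)]
    congr 1
    ring
  rw [e0, h.df_sum] at hmain
  have ht4 : ‖t‖ = 4 * ‖L.b o o L.z‖ := by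
    rw [← Complex.norm_real, h.fderiv_fderiv_u o, norm_mul]; norm_num
  have e1 : (1 / 4 : ℂ) * (∑ q, (L.l q * (4 * dzb (L.v o) (dz (L.v o) (L.U q)) L.z) +
      (starRingEnd ℂ) (L.l q) * (starRingEnd ℂ) (4 * dzb (L.v o) (dz (L.v o) (L.U q)) L.z)) +
      L.df (0, (0, t))) = ∑ q, L.l q * dzb (L.v o) (dz (L.v o) (L.U q)) L.z +
      (starRingEnd ℂ) (∑ q, L.l q * dzb (L.v o) (dz (L.v o) (L.U q)) L.z) +
      (1 / 4 : ℂ) * L.df (0, (0, t)) := by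
    rw [map_sum, ← sum_add_distrib, mul_add, mul_sum]
    congr 1
    refine sum_congr rfl fun q _ => ?_
    simp only [map_mul, map_ofNat]
    ring
  rw [e1] at hmain
  have b1 : ‖(1 / 4 : ℂ) * L.df (0, (0, t))‖ ≤ 4 * K ^ 3 * L.lam L.o := by
    have c1 := (h.norm_df_le (0, t)).trans (mul_le_mul_of_nonneg_left (norm_zero_real t) h0)
    have c2 := mul_le_mul_of_nonneg_left (hb o o) h0
    rw [ht4] at c1
    rw [norm_mul]
    norm_num
    linarith
  have h2 := (Complex.abs_re_le_norm _).trans (norm_add_le_of_le hmain b1)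
  rw [sub_add_eq_sub_sub, sub_add_cancel] at h2
  have h3 := (abs_le.1 h2).1
  simp only [Complex.sub_re, Complex.add_re, Complex.conj_re] at h3
  have q1 : A ^ 2 ≤ n * ∑ q, ‖dz (L.v o) (L.U q) L.z‖ ^ 2 := by
    have := sq_sum_le_card_mul_sum_sq (s := univ) (f := fun q => ‖dz (L.v o) (L.U q) L.z‖)
    simpa using this
  set W := ∑ q, ‖dz (L.v o) (L.U q) L.z‖ ^ 2
  have hW0 : 0 ≤ W := sum_nonneg fun q _ => sq_nonneg _
  have q2 : r ^ 2 ≤ 98 * n ^ 2 * K ^ 6 * L.lam L.o ^ 2 + 2 * K ^ 2 * (n * W) := by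
    have c1 := add_sq_le (a := 7 * n * K ^ 3 * L.lam L.o) (b := K * A)
    have c2 := mul_le_mul_of_nonneg_left q1 (by positivity : 0 ≤ 2 * K ^ 2)
    rw [← hr] at c1
    linarith only [c1, c2]
  have q3 := mul_le_mul_of_nonneg_left q2 h0
  have q4 : K ^ 3 ≤ K ^ 7 := pow_le_pow_right₀ hK (by norm_num)
  have q5 : K ^ 7 ≤ n ^ 2 * K ^ 7 := le_mul_of_one_le_left (by positivity) (one_le_pow₀ hn)
  have q6 : n * K ^ 3 ≤ n ^ 2 * K ^ 7 := mul_le_mul (le_self_pow₀ hn (by norm_num)) q4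
    (by positivity) (by positivity)
  have q7 : L.lam L.o ≤ L.lam L.o ^ 2 := le_self_pow₀ h1 (by norm_num)
  have q8 := mul_le_mul (q4.trans q5) q7 h.top_pos.le (by positivity)
  have q9 := mul_le_mul_of_nonneg_right q6 hW0
  have q10 : 0 ≤ n ^ 2 * K ^ 7 * W := by positivity
  have q11 : 0 ≤ n ^ 2 * K ^ 7 := by positivity
  linarith only [h3, q3, q8, q9, q10, q11]

end Regular
end LocalData

lemma sum_pairs_le {n : ℕ} {F : Fin n → ℝ} (hF : ∀ p, 0 ≤ F p) (hn : (1 : ℝ) ≤ n) (K : ℝ)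
    {t : Fin n → Fin n → ℝ} (ht : ∀ p q, 0 ≤ t p q) :
    ∑ p, ∑ q ∈ univ.erase p, (2 * K ^ 4 + K ^ 2 * (F q * t q q + F p * t p p +
      2 * (F q * t q p))) ≤ 2 * n ^ 2 * K ^ 4 + 4 * n * K ^ 2 * ∑ p, ∑ q, F p * t p q := by
  set Θ := ∑ p, ∑ q, F p * t p q with hΘ
  have d1 : ∑ p, ∑ q ∈ univ.erase p, (2 * K ^ 4 + K ^ 2 * (F q * t q q +
      F p * t p p + 2 * (F q * t q p))) ≤
      ∑ p : Fin n, ∑ q : Fin n, (2 * K ^ 4 + K ^ 2 * (F q * t q q +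
      F p * t p p + 2 * (F q * t q p))) := by
    refine sum_le_sum fun p _ => sum_le_sum_of_subset_of_nonneg (erase_subset _ _) fun q _ _ => ?_
    have := mul_nonneg (hF q) (ht q q)
    have := mul_nonneg (hF p) (ht p p)
    have := mul_nonneg (hF q) (ht q p)
    positivity
  have d2 : ∑ p, F p * t p p ≤ Θ := sum_le_sum fun p _ =>
    single_le_sum (f := fun q => F p * t p q)
      (fun q _ => mul_nonneg (hF p) (ht _ _)) (mem_univ p)
  have d3 : ∑ p, ∑ q, F q * t q p = Θ := sum_comm
  have d7 : ∑ p, F p * (n * t p p) = n * ∑ p, F p * t p p := by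
    rw [mul_sum]; exact sum_congr rfl fun p _ => by ring
  have d4 : ∑ p : Fin n, ∑ q : Fin n, (2 * K ^ 4 + K ^ 2 * (F q * t q q +
      F p * t p p + 2 * (F q * t q p))) = 2 * n ^ 2 * K ^ 4 +
      2 * n * K ^ 2 * (∑ p, F p * t p p) + 2 * K ^ 2 * Θ := by
    simp only [sum_add_distrib, ← mul_sum, sum_const, card_univ, Fintype.card_fin,
      nsmul_eq_mul, d3, d7]
    ring
  have hΘ0 : 0 ≤ Θ := sum_nonneg fun p _ => sum_nonneg fun q _ =>
    mul_nonneg (hF p) (ht _ _)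
  have d5 := mul_le_mul_of_nonneg_left d2 (by positivity : 0 ≤ 2 * n * K ^ 2)
  have d6 := mul_le_mul_of_nonneg_right hn (by positivity : 0 ≤ 2 * K ^ 2 * Θ)
  rw [d4] at d1
  linarith only [d1, d5, d6]

namespace LocalData
variable {n : ℕ} (L : LocalData n) {K ε : ℝ} {m : ℕ}

/-! ### Differentiation of the equation -/

/-- The value `σ_{m+2}(λ)`. -/
def S (m : ℕ) : ℝ := esym univ (m + 2) L.lam

/-- The derivatives of `log σ_{m+2}` at the eigenvalues. -/
def F (m : ℕ) (p : Fin n) : ℝ := esym (univ.erase p) (m + 1) L.lam / L.S m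

/-- The quotients `σ_m(λ|op) / σ_{m+2}(λ)`. -/
def s (m : ℕ) (p : Fin n) : ℝ := esym ((univ.erase L.o).erase p) m L.lam / L.S m

/-- The Hessian equation near the point. -/
def Solves (k : ℕ) : Prop := ∀ᶠ x in 𝓝 L.z, hessCoeff k (Matrix.of fun i j => L.h i j x)
  (Matrix.of fun i j => L.g i j x) = Complex.exp (L.R x)

variable {L}

namespace Regular

lemma esym_eq_exp (h : L.Regular K ε) {k : ℕ} (hS : L.Solves k) :
    esym univ k L.lam = Real.exp (L.f (L.z, L.c L.z)) := by
  have h1 := hS.self_of_nhds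
  have e1 : (Matrix.of fun i j => L.h i j L.z) = (1 : Matrix (Fin n) (Fin n) ℂ) := by
    ext i j
    simp [h.h_one, Matrix.one_apply]
  have e2 : (Matrix.of fun i j => L.g i j L.z) = Matrix.diagonal fun i => (L.lam i : ℂ) := by
    ext i j
    simp [h.g_diag, Matrix.diagonal_apply]
  rw [e1, e2, hessCoeff_diagonal, R, ← Complex.ofReal_exp] at h1
  exact_mod_cast h1

lemma esym_le_exp (h : L.Regular K ε) {k : ℕ} (hS : L.Solves k) :
    esym univ k L.lam ≤ Real.exp K := by
  rw [h.esym_eq_exp hS]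
  refine Real.exp_le_exp.2 ((le_abs_self _).trans ?_)
  have := h.jet_f.norm_le
  rwa [Complex.norm_real] at this

lemma S_pos (h : L.Regular K ε) (hm : m + 2 ≤ n) : 0 < L.S m :=
  esym_pos (fun i _ => h.lam_pos i) (by simpa using hm)

lemma lam_nonneg (h : L.Regular K ε) {t : Finset (Fin n)} : ∀ i ∈ t, 0 ≤ L.lam i :=
  fun i _ => (h.lam_pos i).le

lemma F_pos (h : L.Regular K ε) (hm : m + 2 ≤ n) (p : Fin n) : 0 < L.F m p :=
  div_pos (esym_pos (fun i _ => h.lam_pos i) (by simp; omega)) (h.S_pos hm)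

lemma s_nonneg (h : L.Regular K ε) (hm : m + 2 ≤ n) (p : Fin n) : 0 ≤ L.s m p :=
  div_nonneg (esym_nonneg h.lam_nonneg) (h.S_pos hm).le

lemma F_lam (h : L.Regular K ε) (hm : m + 2 ≤ n) (p : Fin n) : L.F m p * L.lam p ≤ 1 := by
  rw [F, div_mul_eq_mul_div, div_le_one (h.S_pos hm), S, esym_erase (mem_univ p), mul_comm]
  have : 0 ≤ esym (univ.erase p) (m + 1 + 1) L.lam := esym_nonneg h.lam_nonneg
  linarith

lemma F_top_le (h : L.Regular K ε) (hm : m + 2 ≤ n) (p : Fin n) : L.F m L.o ≤ L.F m p := by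
  refine div_le_div_of_nonneg_right ?_ (h.S_pos hm).le
  rcases eq_or_ne p L.o with rfl | hp
  · exact le_rfl
  rw [esym_erase (mem_erase.2 ⟨hp, mem_univ p⟩), esym_erase (mem_erase.2 ⟨hp.symm, mem_univ L.o⟩),
    erase_right_comm]
  have := mul_le_mul_of_nonneg_right (h.lam_le p)
    (esym_nonneg h.lam_nonneg : 0 ≤ esym ((univ.erase p).erase L.o) m L.lam)
  linarith

lemma s_le (h : L.Regular K ε) (hm : m + 2 ≤ n) (p : Fin n) (hp : p ≠ L.o) :
    L.lam L.o * L.s m p ≤ L.F m p := by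
  rw [F, s, ← mul_div_assoc]
  refine div_le_div_of_nonneg_right ?_ (h.S_pos hm).le
  rw [esym_erase (mem_erase.2 ⟨hp.symm, mem_univ L.o⟩), erase_right_comm]
  have : 0 ≤ esym ((univ.erase L.o).erase p) (m + 1) L.lam := esym_nonneg h.lam_nonneg
  rw [erase_right_comm]
  linarith

lemma le_s (h : L.Regular K ε) (hm : m + 2 ≤ n) (p : Fin n) (hp : p ≠ L.o) :
    L.F m p ≤ L.F m L.o + L.lam L.o * L.s m p := by
  rw [F, F, s, ← mul_div_assoc, ← add_div]
  refine div_le_div_of_nonneg_right ?_ (h.S_pos hm).le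
  rw [esym_erase (mem_erase.2 ⟨hp.symm, mem_univ L.o⟩), esym_erase (mem_erase.2 ⟨hp, mem_univ p⟩),
    erase_right_comm]
  have := mul_nonneg (h.lam_pos p).le
    (esym_nonneg h.lam_nonneg : 0 ≤ esym ((univ.erase L.o).erase p) m L.lam)
  linarith

/-- If the largest eigenvalue is large, then `∂_o log σ_k · λ_o` is at least `1 / 2`: as `σ_k` is
bounded, the quotient `σ_k(λ|o) / σ_{k-1}(λ|o)` is bounded, hence at most `λ_o`. -/
lemma F_top (h : L.Regular K ε) (hm : m + 2 ≤ n) (hS : L.Solves (m + 2))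
    (hlarge : n * Real.exp K ≤ L.lam L.o) : 1 / 2 ≤ L.F m L.o * L.lam L.o := by
  have hK1 : 1 ≤ Real.exp K := Real.one_le_exp (by linarith [h.one_le])
  have h1 : esym (univ.erase L.o) (m + 1 + 1) L.lam ≤
      L.lam L.o * esym (univ.erase L.o) (m + 1) L.lam := by
    have hle : esym (univ.erase L.o) (m + 1 + 1) L.lam ≤ Real.exp K :=
      (esym_mono_set (erase_subset _ _) h.lam_nonneg).trans (h.esym_le_exp hS)
    refine (esym_succ_le (by linarith) h.lam_nonneg fun t ht htk =>
      exists_le_of_esym_le hK1 (fun i _ => h.lam_pos i) hle ht htk).trans ?_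
    refine mul_le_mul_of_nonneg_right (le_trans ?_ hlarge) (esym_nonneg h.lam_nonneg)
    refine mul_le_mul_of_nonneg_right ?_ (by linarith)
    have := card_erase_le (s := (univ : Finset (Fin n))) (a := L.o)
    rw [card_univ, Fintype.card_fin] at this
    exact_mod_cast this
  rw [F, div_mul_eq_mul_div, le_div_iff₀ (h.S_pos hm), S, esym_erase (mem_univ L.o)]
  linarith

lemma quot_le_one (h : L.Regular K ε) (hm : m + 2 ≤ n) (t : Finset (Fin n)) :
    esym t (m + 2) L.lam / L.S m ≤ 1 :=
  (div_le_one (h.S_pos hm)).2 (esym_mono_set (subset_univ _) h.lam_nonneg)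

lemma quot_nonneg (h : L.Regular K ε) (hm : m + 2 ≤ n) (t : Finset (Fin n)) (k : ℕ) :
    0 ≤ esym t k L.lam / L.S m :=
  div_nonneg (esym_nonneg h.lam_nonneg) (h.S_pos hm).le

lemma dz_h_norm (h : L.Regular K ε) (p q i : Fin n) : ‖dz (L.v i) (L.h p q) L.z‖ ≤ K ^ 2 :=
  (h.jet_h p q).norm_dz_le (h.v_le i)

lemma exp_R (h : L.Regular K ε) (hS : L.Solves (m + 2)) :
    Complex.exp (L.R L.z) = (L.S m : ℂ) := by
  rw [S, h.esym_eq_exp hS, R, Complex.ofReal_exp]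

lemma equation_one_eq (h : L.Regular K ε) (hm : m + 2 ≤ n) (hS : L.Solves (m + 2)) (i : Fin n) :
    ∑ p, (L.F m p : ℂ) * dz (L.v i) (L.g p p) L.z = dz (L.v i) L.R L.z -
      ∑ p, ((esym (univ.erase p) (m + 2) L.lam / L.S m : ℝ) : ℂ) * dz (L.v i) (L.h p p) L.z := by
  have h1 := dz_congr (v := L.v i) hS
  rw [dz_exp (h.reg_R.differentiableAt (by simp)), h.exp_R hS,
    dz_hessCoeff (m + 1) (fun i j => (h.jet_h i j).contDiffAt.of_le (by norm_num))
      (fun i j => (h.reg_g i j).of_le (by norm_num)) h.h_one h.g_diag] at h1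
  have hS0 : (L.S m : ℂ) ≠ 0 := by exact_mod_cast (h.S_pos hm).ne'
  rw [eq_sub_iff_add_eq, ← sum_add_distrib]
  have e : dz (L.v i) L.R L.z = (L.S m : ℂ)⁻¹ * (L.S m * dz (L.v i) L.R L.z) := by
    rw [inv_mul_cancel_left₀ hS0]
  rw [e, ← h1, mul_sum]
  refine sum_congr rfl fun p _ => ?_
  rw [F]
  push_cast
  field_simp
  ring

/-- The first derivative of the equation in logarithmic form. -/
lemma equation_one (h : L.Regular K ε) (hm : m + 2 ≤ n) (hS : L.Solves (m + 2)) (i : Fin n) :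
    ‖∑ p, (L.F m p : ℂ) * dz (L.v i) (L.g p p) L.z -
      ∑ q, (L.l q * dz (L.v i) (L.U q) L.z + (starRingEnd ℂ) (L.l q) * L.b i q L.z)‖ ≤
      4 * n * K ^ 2 := by
  have hn : (1 : ℝ) ≤ n := by exact_mod_cast (Fin.pos i)
  rw [h.equation_one_eq hm hS, sub_right_comm]
  have h2 : ‖∑ p, ((esym (univ.erase p) (m + 2) L.lam / L.S m : ℝ) : ℂ) *
      dz (L.v i) (L.h p p) L.z‖ ≤ n * K ^ 2 := by
    refine (norm_sum_le _ _).trans ?_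
    have : ∀ p ∈ univ, ‖((esym (univ.erase p) (m + 2) L.lam / L.S m : ℝ) : ℂ) *
        dz (L.v i) (L.h p p) L.z‖ ≤ K ^ 2 := fun p _ => by
      rw [norm_mul, Complex.norm_real, Real.norm_of_nonneg (h.quot_nonneg hm _ _)]
      exact (mul_le_of_le_one_left (norm_nonneg _) (h.quot_le_one hm _)).trans (h.dz_h_norm p p i)
    simpa using sum_le_sum this
  refine (norm_sub_le_of_le (h.dz_R i) h2).trans ?_
  have := mul_le_mul_of_nonneg_right hn (sq_nonneg K)
  linarith

lemma dzb_conj_symm (h : L.Regular K ε) (p q i : Fin n) :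
    dzb (L.v i) (L.g p q) L.z = (starRingEnd ℂ) (dz (L.v i) (L.g q p) L.z) ∧
    dzb (L.v i) (L.h p q) L.z = (starRingEnd ℂ) (dz (L.v i) (L.h q p) L.z) := by
  constructor
  · rw [dzb_congr (h.g_herm q p), dzb_conj ((h.reg_g q p).differentiableAt (by simp))]
  · have : L.h p q =ᶠ[𝓝 L.z] fun x => (starRingEnd ℂ) (L.h q p x) :=
      h.herm_h.mono fun _ hx => hx _ _
    rw [dzb_congr this, dzb_conj ((h.jet_h q p).contDiffAt.differentiableAt (by simp))]

lemma R_real (h : L.Regular K ε) (i : Fin n) :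
    dzb (L.v i) L.R L.z = (starRingEnd ℂ) (dz (L.v i) L.R L.z) := by
  rw [← dzb_conj (h.reg_R.differentiableAt (by simp))]
  exact dzb_congr (Eventually.of_forall fun x => (Complex.conj_ofReal _).symm)

/-- The second derivative of the equation in the direction `o`, in real form. -/
lemma equation_two_eq (h : L.Regular K ε) (hm : m + 2 ≤ n) (hS : L.Solves (m + 2)) (o : Fin n) :
    ∑ p, (L.F m p * (dzb (L.v o) (dz (L.v o) (L.g p p)) L.z).re +
        esym (univ.erase p) (m + 2) L.lam / L.S m *
          (dzb (L.v o) (dz (L.v o) (L.h p p)) L.z).re) +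
      ∑ p, ∑ q ∈ univ.erase p,
        (esym ((univ.erase p).erase q) (m + 2) L.lam / L.S m *
          (dz (L.v o) (L.h p p) L.z * (starRingEnd ℂ) (dz (L.v o) (L.h q q) L.z) -
            dz (L.v o) (L.h q p) L.z * (starRingEnd ℂ) (dz (L.v o) (L.h q p) L.z)).re +
        esym ((univ.erase p).erase q) (m + 1) L.lam / L.S m *
          (dz (L.v o) (L.h p p) L.z * (starRingEnd ℂ) (dz (L.v o) (L.g q q) L.z) +
            dz (L.v o) (L.g p p) L.z * (starRingEnd ℂ) (dz (L.v o) (L.h q q) L.z) -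
            dz (L.v o) (L.h q p) L.z * (starRingEnd ℂ) (dz (L.v o) (L.g q p) L.z) -
            dz (L.v o) (L.g q p) L.z * (starRingEnd ℂ) (dz (L.v o) (L.h q p) L.z)).re +
        esym ((univ.erase p).erase q) m L.lam / L.S m *
          ((dz (L.v o) (L.g p p) L.z * (starRingEnd ℂ) (dz (L.v o) (L.g q q) L.z)).re -
            ‖dz (L.v o) (L.g q p) L.z‖ ^ 2)) =
      ‖dz (L.v o) L.R L.z‖ ^ 2 + (dzb (L.v o) (dz (L.v o) L.R) L.z).re := by
  have h1 := dzb_congr (v := L.v o) (dz_eventuallyEq (v := L.v o) hS)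
  rw [dzb_dz_exp h.reg_R, h.exp_R hS, h.R_real,
    dzb_dz_hessCoeff m (fun i j => (h.jet_h i j).contDiffAt) h.reg_g h.h_one h.g_diag] at h1
  simp only [(h.dzb_conj_symm _ _ o).1, (h.dzb_conj_symm _ _ o).2] at h1
  have hS0 := (h.S_pos hm).ne'
  have h2 := congrArg Complex.re h1
  rw [Complex.re_ofReal_mul, mul_comm ((starRingEnd ℂ) _), Complex.mul_conj,
    Complex.normSq_eq_norm_sq, Complex.add_re, Complex.add_re, Complex.ofReal_re] at h2
  rw [← mul_right_inj' hS0, ← h2, mul_add, mul_sum, mul_sum, Complex.re_sum, Complex.re_sum]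
  have cancel : ∀ a b : ℝ, L.S m * (a / L.S m * b) = b * a := fun a b => by
    field_simp
  congr 1
  · refine sum_congr rfl fun p _ => ?_
    rw [mul_add, F, cancel, cancel, Complex.add_re, Complex.re_mul_ofReal, Complex.re_mul_ofReal]
    ring
  · refine sum_congr rfl fun p _ => ?_
    rw [mul_sum, Complex.re_sum]
    refine sum_congr rfl fun q _ => ?_
    rw [mul_add, mul_add, cancel, cancel, cancel, Complex.add_re, Complex.add_re,
      Complex.re_mul_ofReal, Complex.re_mul_ofReal, Complex.re_mul_ofReal]
    congr 2
    rw [Complex.sub_re, Complex.mul_conj (dz (L.v o) (L.g q p) L.z), Complex.normSq_eq_norm_sq,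
      Complex.ofReal_re]

/-- The strong concavity of `log σ_k` for complex vectors. -/
lemma concavity (h : L.Regular K ε) (hm : m + 2 ≤ n) (hS : L.Solves (m + 2)) {δ : ℝ} (hδ : 0 < δ)
    (hδ1 : δ ≤ 1) (hlarge : 4 * (n : ℝ) * (n * Real.exp K) ≤ δ ^ 2 * L.lam L.o) (x : Fin n → ℂ) :
    ∑ p, ∑ q ∈ univ.erase p, esym ((univ.erase p).erase q) m L.lam / L.S m *
      (x p * (starRingEnd ℂ) (x q)).re ≤ ‖∑ p, (L.F m p : ℂ) * x p‖ ^ 2 -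
      (1 - δ) * L.F m L.o * ‖x L.o‖ ^ 2 / L.lam L.o +
      δ / L.lam L.o * ∑ p ∈ univ.erase L.o, L.F m p * ‖x p‖ ^ 2 := by
  have hc := fun y => esym_strong_concavity (mem_univ L.o) (by simpa using hm)
    (fun i _ => h.lam_pos i) (fun i _ => h.lam_le i)
    (Real.one_le_exp (by linarith [h.one_le] : 0 ≤ K)) (h.esym_le_exp hS) hδ hδ1
    (by simpa using hlarge) y
  have h1 := hc fun p => (x p).re
  have h2 := hc fun p => (x p).im
  have e0 : ∑ p, ∑ q ∈ univ.erase p, esym ((univ.erase p).erase q) m L.lam / L.S m *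
      (x p * (starRingEnd ℂ) (x q)).re =
      (∑ p, ∑ q ∈ univ.erase p, esym ((univ.erase p).erase q) m L.lam * (x p).re * (x q).re) /
        esym univ (m + 2) L.lam +
      (∑ p, ∑ q ∈ univ.erase p, esym ((univ.erase p).erase q) m L.lam * (x p).im * (x q).im) /
        esym univ (m + 2) L.lam := by
    rw [sum_div, sum_div, ← sum_add_distrib]
    refine sum_congr rfl fun p _ => ?_
    rw [sum_div, sum_div, ← sum_add_distrib]
    refine sum_congr rfl fun q _ => ?_
    simp only [Complex.mul_re, Complex.conj_re, Complex.conj_im, S]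
    ring
  have nsq : ∀ y : ℂ, ‖y‖ ^ 2 = y.re ^ 2 + y.im ^ 2 := fun y => by
    rw [← Complex.normSq_eq_norm_sq, Complex.normSq_apply]; ring
  have e1 : ‖∑ p, (L.F m p : ℂ) * x p‖ ^ 2 =
      (∑ p, esym (univ.erase p) (m + 1) L.lam / esym univ (m + 2) L.lam * (x p).re) ^ 2 +
      (∑ p, esym (univ.erase p) (m + 1) L.lam / esym univ (m + 2) L.lam * (x p).im) ^ 2 := by
    rw [nsq, Complex.re_sum, Complex.im_sum]
    simp only [Complex.re_ofReal_mul, Complex.im_ofReal_mul, F, S]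
  have e2 : ∑ p ∈ univ.erase L.o, L.F m p * ‖x p‖ ^ 2 =
      ∑ p ∈ univ.erase L.o, esym (univ.erase p) (m + 1) L.lam / esym univ (m + 2) L.lam *
        (x p).re ^ 2 +
      ∑ p ∈ univ.erase L.o, esym (univ.erase p) (m + 1) L.lam / esym univ (m + 2) L.lam *
        (x p).im ^ 2 := by
    rw [← sum_add_distrib]
    refine sum_congr rfl fun p _ => ?_
    rw [nsq, F, S]; ring
  rw [e0, e1, e2, nsq (x L.o), F, S, mul_add, mul_add, add_div]
  linarith

/-- The second derivative of the equation in the direction of the largest eigenvalue, with the strong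
concavity of `log σ_k` inserted. -/
lemma equation_two (h : L.Regular K ε) (hm : m + 2 ≤ n) (hS : L.Solves (m + 2)) {δ : ℝ}
    (hδ : 0 < δ) (hδ1 : δ ≤ 1) (hlarge : 4 * (n : ℝ) * (n * Real.exp K) ≤ δ ^ 2 * L.lam L.o)
    (h1 : 1 ≤ L.lam L.o) :
    2 * (∑ q, L.l q * dzb (L.v L.o) (dz (L.v L.o) (L.U q)) L.z).re -
      102 * n ^ 2 * K ^ 7 *
        (1 + L.lam L.o ^ 2 + ∑ q, ‖dz (L.v L.o) (L.U q) L.z‖ ^ 2) +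
      ((1 - δ) * L.F m L.o * ‖dz (L.v L.o) (L.g L.o L.o) L.z‖ ^ 2 / L.lam L.o -
        δ / L.lam L.o * (∑ p ∈ univ.erase L.o, L.F m p * ‖dz (L.v L.o) (L.g p p) L.z‖ ^ 2) -
        ‖∑ p, (L.F m p : ℂ) * dz (L.v L.o) (L.g p p) L.z‖ ^ 2) +
      (∑ p ∈ univ.erase L.o, L.s m p * ‖dz (L.v L.o) (L.g p L.o) L.z‖ ^ 2) -
      4 * n * K ^ 2 * (∑ p, ∑ q, L.F m p * ‖dz (L.v L.o) (L.g p q) L.z‖) - 3 * n ^ 2 * K ^ 4 ≤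
      ∑ p, L.F m p * (dzb (L.v L.o) (dz (L.v L.o) (L.g p p)) L.z).re := by
  have hK := h.one_le
  have hn : (1 : ℝ) ≤ n := by exact_mod_cast (Fin.pos L.o)
  have heq := h.equation_two_eq hm hS L.o
  have hR := h.dzb_dz_R h1 L.o
  have hconc := h.concavity hm hS hδ hδ1 hlarge fun p => dz (L.v L.o) (L.g p p) L.z
  set T : Fin n → Fin n → ℂ := fun p q => dz (L.v L.o) (L.g p q) L.z with hT
  set H : Fin n → Fin n → ℂ := fun p q => dz (L.v L.o) (L.h p q) L.z with hH
  have hHb : ∀ p q, ‖H p q‖ ≤ K ^ 2 := fun p q => h.dz_h_norm p q L.o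
  have hF : ∀ p, 0 ≤ L.F m p := fun p => (h.F_pos hm p).le
  have mc : ∀ x y : ℂ, (x * (starRingEnd ℂ) y).re ≤ ‖x‖ * ‖y‖ := fun x y => by
    have := Complex.re_le_norm (x * (starRingEnd ℂ) y)
    rwa [norm_mul, RCLike.norm_conj] at this
  have mc' : ∀ x y : ℂ, -(x * (starRingEnd ℂ) y).re ≤ ‖x‖ * ‖y‖ := fun x y => by
    have := (abs_le.1 (Complex.abs_re_le_norm (x * (starRingEnd ℂ) y))).1
    rw [norm_mul, RCLike.norm_conj] at this
    linarith
  -- the terms with second derivatives of the metric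
  have t1 : ∑ p, esym (univ.erase p) (m + 2) L.lam / L.S m *
      (dzb (L.v L.o) (dz (L.v L.o) (L.h p p)) L.z).re ≤ n * K ^ 3 := by
    have : ∀ p ∈ univ, esym (univ.erase p) (m + 2) L.lam / L.S m *
      (dzb (L.v L.o) (dz (L.v L.o) (L.h p p)) L.z).re ≤ K ^ 3 := fun p _ => by
      have c1 := (Complex.re_le_norm _).trans ((h.jet_h p p).norm_dzb_dz_le (h.v_le L.o))
      have c2 := mul_le_mul_of_nonneg_left c1 (h.quot_nonneg hm (univ.erase p) (m + 2))
      exact c2.trans (mul_le_of_le_one_left (by positivity) (h.quot_le_one hm _))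
    simpa using sum_le_sum this
  -- the mixed terms
  have t2 : ∀ p, ∀ q ∈ univ.erase p,
      esym ((univ.erase p).erase q) (m + 2) L.lam / L.S m *
          (H p p * (starRingEnd ℂ) (H q q) - H q p * (starRingEnd ℂ) (H q p)).re +
        esym ((univ.erase p).erase q) (m + 1) L.lam / L.S m *
          (H p p * (starRingEnd ℂ) (T q q) + T p p * (starRingEnd ℂ) (H q q) -
            H q p * (starRingEnd ℂ) (T q p) - T q p * (starRingEnd ℂ) (H q p)).re ≤
      2 * K ^ 4 + K ^ 2 * (L.F m q * ‖T q q‖ + L.F m p * ‖T p p‖ + 2 * (L.F m q * ‖T q p‖)) := by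
    intro p q hq
    have E1p : esym ((univ.erase p).erase q) (m + 1) L.lam / L.S m ≤ L.F m p :=
      div_le_div_of_nonneg_right (esym_mono_set (erase_subset _ _) h.lam_nonneg) (h.S_pos hm).le
    have E1q : esym ((univ.erase p).erase q) (m + 1) L.lam / L.S m ≤ L.F m q := by
      rw [erase_right_comm]
      exact div_le_div_of_nonneg_right (esym_mono_set (erase_subset _ _) h.lam_nonneg)
        (h.S_pos hm).le
    have E1 := h.quot_nonneg hm ((univ.erase p).erase q) (m + 1)
    have E2 := h.quot_nonneg hm ((univ.erase p).erase q) (m + 2)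
    have E21 := h.quot_le_one hm ((univ.erase p).erase q)
    set e1 := esym ((univ.erase p).erase q) (m + 1) L.lam / L.S m
    set e2 := esym ((univ.erase p).erase q) (m + 2) L.lam / L.S m
    simp only [Complex.sub_re, Complex.add_re]
    have hh : ∀ x y : ℂ, ‖x‖ ≤ K ^ 2 → ‖y‖ ≤ K ^ 2 → ‖x‖ * ‖y‖ ≤ K ^ 4 := fun x y hx hy => by
      have := mul_le_mul hx hy (norm_nonneg _) (sq_nonneg K)
      linarith
    have a1 := (mc (H p p) (H q q)).trans (hh _ _ (hHb p p) (hHb q q))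
    have a2 := (mc' (H q p) (H q p)).trans (hh _ _ (hHb q p) (hHb q p))
    have a3 : e2 * ((H p p * (starRingEnd ℂ) (H q q)).re -
        (H q p * (starRingEnd ℂ) (H q p)).re) ≤ 2 * K ^ 4 := by
      have c1 := mul_le_mul_of_nonneg_left (add_le_add a1 a2) E2
      have c2 := mul_le_of_le_one_left (by positivity : 0 ≤ K ^ 4 + K ^ 4) E21
      linarith
    have b1 := (mc (H p p) (T q q)).trans (mul_le_mul_of_nonneg_right (hHb p p) (norm_nonneg _))
    have b2 := (mc (T p p) (H q q)).trans (mul_le_mul_of_nonneg_left (hHb q q) (norm_nonneg _))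
    have b3 := (mc' (H q p) (T q p)).trans (mul_le_mul_of_nonneg_right (hHb q p) (norm_nonneg _))
    have b4 := (mc' (T q p) (H q p)).trans (mul_le_mul_of_nonneg_left (hHb q p) (norm_nonneg _))
    have c1 := mul_le_mul_of_nonneg_left (add_le_add (add_le_add (add_le_add b1 b2) b3) b4) E1
    have k0 := sq_nonneg K
    have c2 := mul_le_mul_of_nonneg_right E1q (mul_nonneg k0 (norm_nonneg (T q q)))
    have c3 := mul_le_mul_of_nonneg_right E1p (mul_nonneg k0 (norm_nonneg (T p p)))
    have c4 := mul_le_mul_of_nonneg_right E1q (mul_nonneg k0 (norm_nonneg (T q p)))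
    linarith only [a3, c1, c2, c3, c4]
  set Θ := ∑ p, ∑ q, L.F m p * ‖T p q‖ with hΘ
  have t3 : ∑ p, ∑ q ∈ univ.erase p, (2 * K ^ 4 + K ^ 2 * (L.F m q * ‖T q q‖ + L.F m p * ‖T p p‖ +
      2 * (L.F m q * ‖T q p‖))) ≤ 2 * n ^ 2 * K ^ 4 + 4 * n * K ^ 2 * Θ :=
     sum_pairs_le hF hn K (t := fun p q => ‖T p q‖) fun p q => norm_nonneg _
  have t4 := (sum_le_sum fun p _ => sum_le_sum (t2 p)).trans t3
  -- the positive terms with the torsion components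
  have t5 : ∑ p ∈ univ.erase L.o, L.s m p * ‖T p L.o‖ ^ 2 ≤ ∑ p, ∑ q ∈ univ.erase p,
      esym ((univ.erase p).erase q) m L.lam / L.S m * ‖T q p‖ ^ 2 :=
    single_le_sum (f := fun p => ∑ q ∈ univ.erase p,
      esym ((univ.erase p).erase q) m L.lam / L.S m * ‖T q p‖ ^ 2)
      (fun p _ => sum_nonneg fun q _ => mul_nonneg (h.quot_nonneg hm _ _) (sq_nonneg _))
      (mem_univ L.o)
  have t6 : ∑ p, ∑ q ∈ univ.erase p,
        (esym ((univ.erase p).erase q) (m + 2) L.lam / L.S m *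
          (H p p * (starRingEnd ℂ) (H q q) - H q p * (starRingEnd ℂ) (H q p)).re +
        esym ((univ.erase p).erase q) (m + 1) L.lam / L.S m *
          (H p p * (starRingEnd ℂ) (T q q) + T p p * (starRingEnd ℂ) (H q q) -
            H q p * (starRingEnd ℂ) (T q p) - T q p * (starRingEnd ℂ) (H q p)).re +
        esym ((univ.erase p).erase q) m L.lam / L.S m *
          ((T p p * (starRingEnd ℂ) (T q q)).re - ‖T q p‖ ^ 2)) =
      ∑ p, ∑ q ∈ univ.erase p,
        (esym ((univ.erase p).erase q) (m + 2) L.lam / L.S m *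
          (H p p * (starRingEnd ℂ) (H q q) - H q p * (starRingEnd ℂ) (H q p)).re +
        esym ((univ.erase p).erase q) (m + 1) L.lam / L.S m *
          (H p p * (starRingEnd ℂ) (T q q) + T p p * (starRingEnd ℂ) (H q q) -
            H q p * (starRingEnd ℂ) (T q p) - T q p * (starRingEnd ℂ) (H q p)).re) +
      (∑ p, ∑ q ∈ univ.erase p, esym ((univ.erase p).erase q) m L.lam / L.S m *
          (T p p * (starRingEnd ℂ) (T q q)).re -
      ∑ p, ∑ q ∈ univ.erase p, esym ((univ.erase p).erase q) m L.lam / L.S m * ‖T q p‖ ^ 2) := by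
    rw [← sum_sub_distrib, ← sum_add_distrib]
    refine sum_congr rfl fun p _ => ?_
    rw [← sum_sub_distrib, ← sum_add_distrib]
    exact sum_congr rfl fun q _ => by ring
  rw [t6, sum_add_distrib] at heq
  have k3 : n * K ^ 3 ≤ n ^ 2 * K ^ 4 := mul_le_mul (le_self_pow₀ hn (by norm_num))
    (pow_le_pow_right₀ hK (by norm_num)) (by positivity) (by positivity)
  have hsq := sq_nonneg ‖dz (L.v L.o) L.R L.z‖
  linarith only [heq, hR, hconc, t1, t4, t5, k3, hsq]

end Regular
end LocalData

/-! ### The maximum principle -/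

section Variation
variable {n : ℕ} {z w : Cn n}

/-- The second derivative test at `s = 0` on the line `z + s w` for `a + s b + s² c`, the form that a
Hermitian form takes on a test vector depending affinely on `s`. -/
lemma second_variation_nonneg {a b c : Cn n → ℝ} (ha : ContDiffAt ℝ 2 a z)
    (hb : ContDiffAt ℝ 2 b z) (hc : ContDiffAt ℝ 2 c z) (w : Cn n)
    (hmin : ∀ᶠ s in 𝓝 (0 : ℝ), a z ≤ a (z + s • w) + s * b (z + s • w) + s ^ 2 * c (z + s • w)) :
    0 ≤ fderiv ℝ (fderiv ℝ a) z w w + 2 * fderiv ℝ b z w + 2 * c z := by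
  have hline : ∀ s : ℝ, HasDerivAt (fun s : ℝ => z + s • w) w s := fun s => by
    simpa using ((hasDerivAt_id s).smul_const w).const_add z
  have hcont : Tendsto (fun s : ℝ => z + s • w) (𝓝 0) (𝓝 z) := by
    have := (hline 0).continuousAt.tendsto
    simpa using this
  have hcomp : ∀ {f : Cn n → ℝ} {s : ℝ}, DifferentiableAt ℝ f (z + s • w) →
      HasDerivAt (fun s : ℝ => f (z + s • w)) (fderiv ℝ f (z + s • w) w) s := fun hf =>
    hf.hasFDerivAt.comp_hasDerivAt _ (hline _)
  have hev : ∀ {f : Cn n → ℝ}, ContDiffAt ℝ 2 f z →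
      ∀ᶠ s in 𝓝 (0 : ℝ), DifferentiableAt ℝ f (z + s • w) := fun hf =>
    hcont.eventually ((hf.eventually (by simp)).mono fun _ h => h.differentiableAt (by simp))
  have hz : z + (0 : ℝ) • w = z := by simp
  have h0 : ∀ {f : Cn n → ℝ}, ContDiffAt ℝ 2 f z →
      HasDerivAt (fun s : ℝ => f (z + s • w)) (fderiv ℝ f z w) 0 := fun {f} hf => by
    have := hcomp (f := f) (s := 0) (by rw [hz]; exact hf.differentiableAt (by simp))
    rwa [hz] at this
  have h2 : ∀ {f : Cn n → ℝ}, ContDiffAt ℝ 2 f z → HasDerivAt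
      (fun s : ℝ => fderiv ℝ f (z + s • w) w) (fderiv ℝ (fderiv ℝ f) z w w) 0 := fun {f} hf => by
    have hd : DifferentiableAt ℝ (fun x => fderiv ℝ f x w) z :=
      ((hf.fderiv_right (m := 1) (by norm_num)).differentiableAt (by simp)).clm_apply
        (differentiableAt_const _)
    have := hcomp (f := fun x => fderiv ℝ f x w) (s := 0) (by rw [hz]; exact hd)
    rwa [hz, ← fderiv_fderiv_apply hf] at this
  refine second_deriv_nonneg_of_isLocalMin (a := 0)
    (f := fun s => a (z + s • w) + s * b (z + s • w) + s ^ 2 * c (z + s • w))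
    (f' := fun s => fderiv ℝ a (z + s • w) w +
      (1 * b (z + s • w) + s * fderiv ℝ b (z + s • w) w) +
      ((2 * s) * c (z + s • w) + s ^ 2 * fderiv ℝ c (z + s • w) w)) ?_ ?_ ?_
  · filter_upwards [hmin] with s hs
    simpa using hs
  · filter_upwards [hev ha, hev hb, hev hc] with s s1 s2 s3
    have hsq : HasDerivAt (fun s : ℝ => s ^ 2) (2 * s) s := by simpa using hasDerivAt_pow 2 s
    exact ((hcomp s1).add ((hasDerivAt_id s).mul (hcomp s2))).add (hsq.mul (hcomp s3))
  · have e1 := ((h0 hb).const_mul 1).add ((hasDerivAt_id (0 : ℝ)).mul (h2 hb))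
    have hsq : HasDerivAt (fun s : ℝ => s ^ 2) 0 0 := by simpa using hasDerivAt_pow 2 (0 : ℝ)
    have e2 := (((hasDerivAt_id (0 : ℝ)).const_mul 2).mul (h0 hc)).add (hsq.mul (h2 hc))
    have e3 := ((h2 ha).add e1).add e2
    refine HasDerivAt.congr_deriv e3 ?_
    simp
    ring

lemma contDiffAt_re {f : Cn n → ℂ} (hf : ContDiffAt ℝ 2 f z) :
    ContDiffAt ℝ 2 (fun x => (f x).re) z :=
  Complex.reCLM.contDiff.contDiffAt.comp z hf

lemma fderiv_re {f : Cn n → ℂ} (hf : DifferentiableAt ℝ f z) (w : Cn n) :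
    fderiv ℝ (fun x => (f x).re) z w = (fderiv ℝ f z w).re := by
  have : HasFDerivAt (fun x => (f x).re) (Complex.reCLM.comp (fderiv ℝ f z)) z :=
    Complex.reCLM.hasFDerivAt.comp z hf.hasFDerivAt
  rw [this.fderiv]; rfl

lemma fderiv_fderiv_re {f : Cn n → ℂ} (hf : ContDiffAt ℝ 2 f z) (w w' : Cn n) :
    fderiv ℝ (fderiv ℝ fun x => (f x).re) z w w' = (fderiv ℝ (fderiv ℝ f) z w w').re := by
  rw [fderiv_fderiv_apply (contDiffAt_re hf), fderiv_fderiv_apply hf]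
  have hev : (fun y => fderiv ℝ (fun x => (f x).re) y w') =ᶠ[𝓝 z]
      fun y => (fderiv ℝ f y w').re :=
    ((hf.of_le (by norm_num : (1 : WithTop ℕ∞) ≤ 2)).eventually (by simp)).mono
      fun y hy => fderiv_re (hy.differentiableAt (by simp)) w'
  rw [hev.fderiv_eq, fderiv_re]
  exact ((hf.fderiv_right (m := 1) (by norm_num)).differentiableAt (by simp)).clm_apply
    (differentiableAt_const _)

lemma fderiv_conj {f : Cn n → ℂ} (hf : DifferentiableAt ℝ f z) (w : Cn n) :
    fderiv ℝ (fun x => (starRingEnd ℂ) (f x)) z w = (starRingEnd ℂ) (fderiv ℝ f z w) := by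
  have : HasFDerivAt (fun x => (starRingEnd ℂ) (f x))
      ((Complex.conjCLE : ℂ →L[ℝ] ℂ).comp (fderiv ℝ f z)) z :=
    (Complex.conjCLE : ℂ →L[ℝ] ℂ).hasFDerivAt.comp z hf.hasFDerivAt
  rw [this.fderiv]; rfl

/-- A family of Hermitian matrices that is nonnegative near `z`, and diagonal at `z` with a zero
in position `o`. -/
structure NonnegFamily (Q : Fin n → Fin n → Cn n → ℂ) (z : Cn n) (o : Fin n) (ν : Fin n → ℝ) :
    Prop where
  reg : ∀ p q, ContDiffAt ℝ 2 (Q p q) z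
  herm : ∀ᶠ x in 𝓝 z, ∀ p q, Q q p x = (starRingEnd ℂ) (Q p q x)
  diag : ∀ p q, Q p q z = if p = q then (ν p : ℂ) else 0
  zero : ν o = 0
  nonneg : ∀ᶠ x in 𝓝 z, ∀ y : Fin n → ℂ,
    0 ≤ (∑ p, ∑ q, Q p q x * y p * (starRingEnd ℂ) (y q)).re

namespace NonnegFamily
variable {Q : Fin n → Fin n → Cn n → ℂ} {o : Fin n} {ν : Fin n → ℝ}

/-- The Hermitian form with matrix `A` on the vector `e_o + s c`. -/
lemma re_expand (A : Fin n → Fin n → ℂ) (o : Fin n) (c : Fin n → ℂ) (s : ℝ) :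
    ∑ p, ∑ q, A p q * ((if p = o then 1 else 0) + s * c p) *
      (starRingEnd ℂ) ((if q = o then 1 else 0) + s * c q) =
    A o o + s * ((∑ p, A p o * c p) + ∑ q, A o q * (starRingEnd ℂ) (c q)) +
      s ^ 2 * ∑ p, ∑ q, A p q * c p * (starRingEnd ℂ) (c q) := by
  have h : ∀ p q, A p q * ((if p = o then 1 else 0) + s * c p) *
      (starRingEnd ℂ) ((if q = o then 1 else 0) + s * c q) =
      (if p = o then (if q = o then A p q else 0) else 0) +
      s * ((if q = o then A p q * c p else 0) +
        (if p = o then A p q * (starRingEnd ℂ) (c q) else 0)) +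
      s ^ 2 * (A p q * c p * (starRingEnd ℂ) (c q)) := fun p q => by
    by_cases hp : p = o <;> by_cases hq : q = o <;> simp [hp, hq] <;> ring
  rw [sum_congr rfl fun p _ => sum_congr rfl fun q _ => h p q]
  simp only [sum_add_distrib, ← mul_sum, sum_ite_eq', mem_univ, if_true]
  congr 2
  · rw [sum_eq_single o] <;> simp +contextual
  · congr 2
    rw [sum_eq_single o] <;> simp +contextual

lemma fderiv_eq_zero (h : NonnegFamily Q z o ν) (w : Cn n) : fderiv ℝ (Q o o) z w = 0 := by
  have hd := (h.reg o o).differentiableAt (by simp)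
  have hre : (fderiv ℝ (Q o o) z w).re = 0 := by
    rw [← fderiv_re hd]
    have : IsLocalMin (fun x => (Q o o x).re) z := by
      filter_upwards [h.nonneg] with x hx
      have h1 := hx fun p => if p = o then 1 else 0
      have h2 := re_expand (fun p q => Q p q x) o (fun _ => 0) 0
      simp only [mul_zero, add_zero] at h2
      rw [h2] at h1
      rw [h.diag, if_pos rfl, h.zero]
      simpa using h1
    rw [this.fderiv_eq_zero]
    rfl
  have him : (starRingEnd ℂ) (fderiv ℝ (Q o o) z w) = fderiv ℝ (Q o o) z w := by
    rw [← fderiv_conj hd]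
    have : (fun x => (starRingEnd ℂ) (Q o o x)) =ᶠ[𝓝 z] Q o o :=
      h.herm.mono fun x hx => (hx o o).symm
    rw [this.fderiv_eq]
  rw [Complex.conj_eq_iff_re] at him
  rw [← him, hre, Complex.ofReal_zero]

/-- The second variation of the entry `oo`: besides being nonnegative, it controls the first
derivatives of the other entries in the column `o`. This replaces the formula for the second
derivative of the largest eigenvalue, which need not be differentiable. -/
lemma second_variation (h : NonnegFamily Q z o ν) {r : ℝ} (hr : 0 < r)
    (hν : ∀ p, ν p ≤ r) (w : Cn n) :
    2 / r * ∑ p ∈ univ.erase o, ‖fderiv ℝ (Q p o) z w‖ ^ 2 ≤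
      (fderiv ℝ (fderiv ℝ (Q o o)) z w w).re := by
  -- this `c` minimizes the second-order term of the form on `e_o + s c` when the other diagonal
  -- entries equal `r`
  set c : Fin n → ℂ := fun p => if p = o then 0 else
    -((r⁻¹ : ℝ) : ℂ) * (starRingEnd ℂ) (fderiv ℝ (Q p o) z w) with hc
  have hdiff : ∀ p q, DifferentiableAt ℝ (Q p q) z := fun p q =>
    (h.reg p q).differentiableAt (by simp)
  have rB : ContDiffAt ℝ 2
      (fun x => (∑ p, Q p o x * c p) + ∑ q, Q o q x * (starRingEnd ℂ) (c q)) z :=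
    (ContDiffAt.sum fun p _ => (h.reg p o).mul contDiffAt_const).add
      (ContDiffAt.sum fun q _ => (h.reg o q).mul contDiffAt_const)
  have rC : ContDiffAt ℝ 2
      (fun x => ∑ p, ∑ q, Q p q x * c p * (starRingEnd ℂ) (c q)) z :=
    ContDiffAt.sum fun p _ => ContDiffAt.sum fun q _ =>
      ((h.reg p q).mul contDiffAt_const).mul contDiffAt_const
  have hline : Tendsto (fun s : ℝ => z + s • w) (𝓝 0) (𝓝 z) := by
    have : Continuous fun s : ℝ => z + s • w := by fun_prop
    simpa using this.tendsto 0
  have key := second_variation_nonneg (contDiffAt_re (h.reg o o)) (contDiffAt_re rB)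
    (contDiffAt_re rC) w (by
      filter_upwards [hline.eventually h.nonneg] with s hs
      have h1 := hs fun p => (if p = o then 1 else 0) + s * c p
      rw [re_expand (fun p q => Q p q (z + s • w)), ← Complex.ofReal_pow, Complex.add_re,
        Complex.add_re, Complex.re_ofReal_mul, Complex.re_ofReal_mul] at h1
      rw [h.diag, if_pos rfl, h.zero]
      simpa using h1)
  rw [fderiv_fderiv_re (h.reg o o), fderiv_re (rB.differentiableAt (by simp))] at key
  have hB : (fderiv ℝ (fun x => (∑ p, Q p o x * c p) + ∑ q, Q o q x * (starRingEnd ℂ) (c q)) z w).re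
      = -(2 / r) * ∑ p ∈ univ.erase o, ‖fderiv ℝ (Q p o) z w‖ ^ 2 := by
    have e1 : fderiv ℝ (fun x => (∑ p, Q p o x * c p) + ∑ q, Q o q x * (starRingEnd ℂ) (c q)) z w =
        (∑ p, fderiv ℝ (Q p o) z w * c p) +
          ∑ q, fderiv ℝ (Q o q) z w * (starRingEnd ℂ) (c q) := by
      have e := ((HasFDerivAt.fun_sum (u := univ) fun p _ =>
        (hdiff p o).hasFDerivAt.mul_const (c p)).add (HasFDerivAt.fun_sum (u := univ) fun q _ =>
        (hdiff o q).hasFDerivAt.mul_const ((starRingEnd ℂ) (c q)))).fderiv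
      have e' : fderiv ℝ (fun x => (∑ p, Q p o x * c p) +
        ∑ q, Q o q x * (starRingEnd ℂ) (c q)) z = _ := e
      rw [e']
      simp [mul_comm]
    have e2 : ∀ q, fderiv ℝ (Q o q) z w = (starRingEnd ℂ) (fderiv ℝ (Q q o) z w) := fun q => by
      rw [← fderiv_conj (hdiff q o)]
      have : Q o q =ᶠ[𝓝 z] fun x => (starRingEnd ℂ) (Q q o x) := h.herm.mono fun x hx => hx q o
      rw [this.fderiv_eq]
    rw [e1, ← sum_add_distrib, Complex.re_sum, mul_sum, ← sum_erase univ (a := o)]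
    · refine sum_congr rfl fun p hp => ?_
      have hpo := ne_of_mem_erase hp
      rw [e2, ← map_mul, Complex.add_re, Complex.conj_re]
      simp only [hc, if_neg hpo]
      rw [← Complex.normSq_eq_norm_sq]
      have : fderiv ℝ (Q p o) z w * (-((r⁻¹ : ℝ) : ℂ) * (starRingEnd ℂ) (fderiv ℝ (Q p o) z w)) =
          ((-r⁻¹ * Complex.normSq (fderiv ℝ (Q p o) z w) : ℝ) : ℂ) := by
        push_cast
        rw [← Complex.mul_conj]
        ring
      rw [this, Complex.ofReal_re]
      field_simp
      ring
    · simp [hc]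
  have hC : (∑ p, ∑ q, Q p q z * c p * (starRingEnd ℂ) (c q)).re ≤
      1 / r * ∑ p ∈ univ.erase o, ‖fderiv ℝ (Q p o) z w‖ ^ 2 := by
    have e1 : ∑ p, ∑ q, Q p q z * c p * (starRingEnd ℂ) (c q) =
        ∑ p, ((ν p * ‖c p‖ ^ 2 : ℝ) : ℂ) := by
      refine sum_congr rfl fun p _ => ?_
      rw [sum_eq_single p]
      · rw [h.diag, if_pos rfl, mul_assoc, Complex.mul_conj, Complex.normSq_eq_norm_sq]
        push_cast; ring
      · intro q _ hq
        rw [h.diag, if_neg hq.symm]; ring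
      · simp
    rw [e1, ← Complex.ofReal_sum, Complex.ofReal_re, mul_sum, ← sum_erase univ (a := o)]
    · refine sum_le_sum fun p hp => ?_
      have hpo := ne_of_mem_erase hp
      have : ‖c p‖ ^ 2 = r⁻¹ ^ 2 * ‖fderiv ℝ (Q p o) z w‖ ^ 2 := by
        simp only [hc, if_neg hpo, norm_mul, norm_neg, RCLike.norm_conj, Complex.norm_real, mul_pow]
        rw [Real.norm_of_nonneg (by positivity)]
      rw [this]
      have h1 := mul_le_mul_of_nonneg_right (hν p)
        (by positivity : 0 ≤ r⁻¹ ^ 2 * ‖fderiv ℝ (Q p o) z w‖ ^ 2)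
      refine h1.trans (le_of_eq ?_)
      field_simp
    · simp [hc]
  rw [hB] at key
  have e3 : 1 / r = 2 / r / 2 := by ring
  rw [e3] at hC
  linarith

/-- The second derivative test in complex form. -/
lemma laplacian (h : NonnegFamily Q z o ν) {r : ℝ} (hr : 0 < r) (hν : ∀ p, ν p ≤ r) (v : Cn n) :
    1 / r * ∑ p ∈ univ.erase o, (‖dz v (Q o p) z‖ ^ 2 + ‖dz v (Q p o) z‖ ^ 2) ≤
      (dzb v (dz v (Q o o)) z).re := by
  have h1 := h.second_variation hr hν v
  have h2 := h.second_variation hr hν (Complex.I • v)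
  have e : ∀ p ∈ univ.erase o, ‖dz v (Q o p) z‖ ^ 2 + ‖dz v (Q p o) z‖ ^ 2 =
      (‖fderiv ℝ (Q p o) z v‖ ^ 2 + ‖fderiv ℝ (Q p o) z (Complex.I • v)‖ ^ 2) / 2 := fun p _ => by
    have hd : ∀ p q, DifferentiableAt ℝ (Q p q) z := fun p q =>
      (h.reg p q).differentiableAt (by simp)
    have e1 : dz v (Q o p) z = (starRingEnd ℂ) (dzb v (Q p o) z) := by
      rw [← dz_conj (hd p o)]
      exact dz_congr (h.herm.mono fun x hx => hx p o)
    rw [e1, RCLike.norm_conj, fderiv_eq_dz_add_dzb, fderiv_I_eq, norm_mul, Complex.norm_I, one_mul]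
    have := parallelogram_law_with_norm ℝ (dz v (Q p o) z) (dzb v (Q p o) z)
    linarith
  rw [sum_congr rfl e, ← sum_div, sum_add_distrib, dzb_dz_self (h.reg o o)]
  have e4 : ((1 / 4 : ℂ) * (fderiv ℝ (fderiv ℝ (Q o o)) z v v +
      fderiv ℝ (fderiv ℝ (Q o o)) z (Complex.I • v) (Complex.I • v))).re = 1 / 4 *
      ((fderiv ℝ (fderiv ℝ (Q o o)) z v v).re +
        (fderiv ℝ (fderiv ℝ (Q o o)) z (Complex.I • v) (Complex.I • v)).re) := by
    rw [show (1 / 4 : ℂ) = ((1 / 4 : ℝ) : ℂ) by norm_num, Complex.re_ofReal_mul, Complex.add_re]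
  rw [e4]
  have e5 : 2 / r = 2 * (1 / r) := by ring
  rw [e5] at h1 h2
  linarith

end NonnegFamily
end Variation

namespace LocalData
variable {n : ℕ} (L : LocalData n) {K ε : ℝ} {m : ℕ}

/-- The point is a maximum of the largest eigenvalue of `g` times `e^φ`: near the point, `g` is
bounded by `λ e^{φ(z) - φ} h`. -/
def Touches (N B K₀ : ℝ) : Prop := ∀ᶠ x in 𝓝 L.z, ∀ y : Fin n → ℂ,
  (∑ p, ∑ q, L.g p q x * y p * (starRingEnd ℂ) (y q)).re ≤
    L.lam L.o * Real.exp ((L.φ N B K₀ L.z).re - (L.φ N B K₀ x).re) *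
      (∑ p, ∑ q, L.h p q x * y p * (starRingEnd ℂ) (y q)).re

/-- The factor `λ e^{φ(z) - φ}`. -/
def barrier (N B K₀ : ℝ) (x : Cn n) : ℂ :=
  L.lam L.o * Complex.exp (L.φ N B K₀ L.z - L.φ N B K₀ x)

/-- The nonnegative form `λ e^{φ(z) - φ} h - g`. -/
def Q (N B K₀ : ℝ) (p q : Fin n) (x : Cn n) : ℂ :=
  L.barrier N B K₀ x * L.h p q x - L.g p q x

variable {L} {N B K₀ : ℝ}

namespace Regular

lemma reg_barrier_exponent (h : L.Regular K ε) :
    ContDiffAt ℝ 2 (fun x => L.φ N B K₀ L.z - L.φ N B K₀ x) L.z :=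
  contDiffAt_const.sub (h.reg_φ N B K₀)

lemma reg_barrier (h : L.Regular K ε) : ContDiffAt ℝ 2 (L.barrier N B K₀) L.z :=
  contDiffAt_const.mul h.reg_barrier_exponent.cexp

lemma barrier_self : L.barrier N B K₀ L.z = L.lam L.o := by simp [barrier]

lemma barrier_eq (h : L.Regular K ε) : ∀ᶠ x in 𝓝 L.z, L.barrier N B K₀ x =
    ((L.lam L.o * Real.exp ((L.φ N B K₀ L.z).re - (L.φ N B K₀ x).re) : ℝ) : ℂ) := by
  filter_upwards [h.φ_real N B K₀] with x hx
  have hz := (h.φ_real N B K₀).self_of_nhds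
  rw [Complex.conj_eq_iff_re] at hx hz
  rw [barrier]
  push_cast
  rw [hx, hz]

lemma dz_barrier_exponent (h : L.Regular K ε) (i : Fin n) :
    dz (L.v i) (fun x => L.φ N B K₀ L.z - L.φ N B K₀ x) L.z = -dz (L.v i) (L.φ N B K₀) L.z ∧
    dzb (L.v i) (fun x => L.φ N B K₀ L.z - L.φ N B K₀ x) L.z =
      -(starRingEnd ℂ) (dz (L.v i) (L.φ N B K₀) L.z) ∧
    dzb (L.v i) (dz (L.v i) (fun x => L.φ N B K₀ L.z - L.φ N B K₀ x)) L.z =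
      -dzb (L.v i) (dz (L.v i) (L.φ N B K₀)) L.z := by
  have d := (h.reg_φ N B K₀).differentiableAt (by simp)
  refine ⟨?_, ?_, ?_⟩
  · rw [dz_sub (differentiableAt_const _) d, dz_const, zero_sub]
  · rw [dzb_sub (differentiableAt_const _) d, dzb_const, zero_sub, ← dzb_conj d]
    congr 1
    exact dzb_congr ((h.φ_real N B K₀).mono fun x hx => hx.symm)
  · have e : dz (L.v i) (fun x => L.φ N B K₀ L.z - L.φ N B K₀ x) =ᶠ[𝓝 L.z]
        fun x => (-1 : ℂ) * dz (L.v i) (L.φ N B K₀) x :=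
      (eventually_differentiableAt ((h.reg_φ N B K₀).of_le (by norm_num))).mono fun x hx => by
        rw [dz_sub (differentiableAt_const _) hx, dz_const]; ring
    rw [dzb_congr e, dzb_const_mul _ (differentiableAt_dz (h.reg_φ N B K₀))]
    ring

lemma dz_barrier (h : L.Regular K ε) (i : Fin n) :
    dz (L.v i) (L.barrier N B K₀) L.z = -(L.lam L.o * dz (L.v i) (L.φ N B K₀) L.z) ∧
    dzb (L.v i) (L.barrier N B K₀) L.z =
      -(L.lam L.o * (starRingEnd ℂ) (dz (L.v i) (L.φ N B K₀) L.z)) ∧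
    dzb (L.v i) (dz (L.v i) (L.barrier N B K₀)) L.z = L.lam L.o *
      (((‖dz (L.v i) (L.φ N B K₀) L.z‖ ^ 2 : ℝ) : ℂ) -
        dzb (L.v i) (dz (L.v i) (L.φ N B K₀)) L.z) := by
  obtain ⟨e1, e2, e3⟩ := h.dz_barrier_exponent (N := N) (B := B) (K₀ := K₀) i
  have r := h.reg_barrier_exponent (N := N) (B := B) (K₀ := K₀)
  have d := r.differentiableAt (by simp)
  have hb : L.barrier N B K₀ = fun x =>
    (L.lam L.o : ℂ) * Complex.exp (L.φ N B K₀ L.z - L.φ N B K₀ x) := rfl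
  refine ⟨?_, ?_, ?_⟩
  · rw [hb, dz_const_mul _ d.cexp, dz_exp d, e1, sub_self, Complex.exp_zero]; ring
  · rw [hb, dzb_const_mul _ d.cexp, dzb_exp d, e2, sub_self, Complex.exp_zero]; ring
  · rw [hb, dzb_dz_const_mul _ r.cexp, dzb_dz_exp r, e1, e2, e3, sub_self, Complex.exp_zero,
      ← Complex.normSq_eq_norm_sq, ← Complex.mul_conj]
    ring

lemma reg_Q (h : L.Regular K ε) (p q : Fin n) : ContDiffAt ℝ 2 (L.Q N B K₀ p q) L.z :=
  (h.reg_barrier.mul (h.jet_h p q).contDiffAt).sub (h.reg_g p q)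

lemma nonnegFamily (h : L.Regular K ε) (ht : L.Touches N B K₀) :
    NonnegFamily (L.Q N B K₀) L.z L.o (fun p => L.lam L.o - L.lam p) where
  reg := h.reg_Q
  herm := by
    have hg : ∀ᶠ x in 𝓝 L.z, ∀ p q, L.g q p x = (starRingEnd ℂ) (L.g p q x) :=
      eventually_all.2 fun p => eventually_all.2 fun q => h.g_herm p q
    filter_upwards [hg, h.herm_h, h.barrier_eq (N := N) (B := B) (K₀ := K₀)] with x x1 x2 x3 p q
    rw [Q, Q, x1 p q, x2 p q, x3, map_sub, map_mul, Complex.conj_ofReal]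
  diag := fun p q => by
    rw [Q, barrier_self, h.h_one, h.g_diag]
    split_ifs <;> simp
  zero := sub_self _
  nonneg := by
    filter_upwards [ht, h.barrier_eq (N := N) (B := B) (K₀ := K₀)] with x x1 x2 y
    have e : ∑ p, ∑ q, L.Q N B K₀ p q x * y p * (starRingEnd ℂ) (y q) =
        L.barrier N B K₀ x * (∑ p, ∑ q, L.h p q x * y p * (starRingEnd ℂ) (y q)) -
          ∑ p, ∑ q, L.g p q x * y p * (starRingEnd ℂ) (y q) := by
      rw [mul_sum, ← sum_sub_distrib]
      refine sum_congr rfl fun p _ => ?_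
      rw [mul_sum, ← sum_sub_distrib]
      refine sum_congr rfl fun q _ => ?_
      rw [Q]; ring
    rw [e, x2, Complex.sub_re, Complex.re_ofReal_mul]
    linarith [x1 y]

lemma dz_Q (h : L.Regular K ε) (p q i : Fin n) : dz (L.v i) (L.Q N B K₀ p q) L.z =
    L.lam L.o * dz (L.v i) (L.h p q) L.z -
      L.lam L.o * dz (L.v i) (L.φ N B K₀) L.z * (if p = q then 1 else 0) -
      dz (L.v i) (L.g p q) L.z := by
  have dh := (h.jet_h p q).contDiffAt.differentiableAt (by simp)
  have db := (h.reg_barrier (N := N) (B := B) (K₀ := K₀)).differentiableAt (by simp)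
  change dz (L.v i) (fun x => L.barrier N B K₀ x * L.h p q x - L.g p q x) L.z = _
  rw [dz_sub (db.fun_mul dh) ((h.reg_g p q).differentiableAt (by simp)), dz_mul db dh,
    (h.dz_barrier i).1, barrier_self, h.h_one]
  ring

/-- The first-order condition at the maximum. -/
lemma critical (h : L.Regular K ε) (ht : L.Touches N B K₀) (i : Fin n) :
    dz (L.v i) (L.g L.o L.o) L.z =
      L.lam L.o * (dz (L.v i) (L.h L.o L.o) L.z - dz (L.v i) (L.φ N B K₀) L.z) := by
  have h1 := h.dz_Q (N := N) (B := B) (K₀ := K₀) L.o L.o i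
  have h2 : dz (L.v i) (L.Q N B K₀ L.o L.o) L.z = 0 := by
    rw [dz, (h.nonnegFamily ht).fderiv_eq_zero, (h.nonnegFamily ht).fderiv_eq_zero]
    simp
  rw [h2, if_pos rfl] at h1
  linear_combination h1

/-- The second-order condition at the maximum, including the gain from the second variation of the
largest eigenvalue. -/
lemma maximum (h : L.Regular K ε) (ht : L.Touches N B K₀) (i : Fin n) :
    (dzb (L.v i) (dz (L.v i) (L.g L.o L.o)) L.z).re ≤
      L.lam L.o * (‖dz (L.v i) (L.φ N B K₀) L.z‖ ^ 2 -
        (dzb (L.v i) (dz (L.v i) (L.φ N B K₀)) L.z).re +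
        2 * K ^ 2 * ‖dz (L.v i) (L.φ N B K₀) L.z‖ + K ^ 3) -
      (1 / L.lam L.o) * ∑ p ∈ univ.erase L.o,
        (‖dz (L.v i) (L.g L.o p) L.z - L.lam L.o * dz (L.v i) (L.h L.o p) L.z‖ ^ 2 +
        ‖dz (L.v i) (L.g p L.o) L.z - L.lam L.o * dz (L.v i) (L.h p L.o) L.z‖ ^ 2) := by
  have hl := (h.nonnegFamily ht).laplacian h.top_pos
    (fun p => by linarith [h.lam_pos p]) (L.v i)
  obtain ⟨e1, e2, e3⟩ := h.dz_barrier (N := N) (B := B) (K₀ := K₀) i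
  have rb := h.reg_barrier (N := N) (B := B) (K₀ := K₀)
  have rh := (h.jet_h L.o L.o).contDiffAt
  have eQ : dzb (L.v i) (dz (L.v i) (L.Q N B K₀ L.o L.o)) L.z =
      dzb (L.v i) (dz (L.v i) (fun x => L.barrier N B K₀ x * L.h L.o L.o x)) L.z -
        dzb (L.v i) (dz (L.v i) (L.g L.o L.o)) L.z := by
    have e : L.Q N B K₀ L.o L.o = fun x => L.barrier N B K₀ x * L.h L.o L.o x +
        (-1 : ℂ) * L.g L.o L.o x := by funext x; rw [Q]; ring
    rw [e, dzb_dz_add (rb.mul rh) (contDiffAt_const.mul (h.reg_g L.o L.o)),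
      dzb_dz_const_mul _ (h.reg_g L.o L.o)]
    ring
  set φ1 := dz (L.v i) (L.φ N B K₀) L.z
  rw [dzb_dz_mul rb rh, e1, e2, e3, barrier_self, h.h_one, if_pos rfl] at eQ
  have es : ∑ p ∈ univ.erase L.o, (‖dz (L.v i) (L.Q N B K₀ L.o p) L.z‖ ^ 2 +
      ‖dz (L.v i) (L.Q N B K₀ p L.o) L.z‖ ^ 2) = ∑ p ∈ univ.erase L.o,
        (‖dz (L.v i) (L.g L.o p) L.z - L.lam L.o * dz (L.v i) (L.h L.o p) L.z‖ ^ 2 +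
        ‖dz (L.v i) (L.g p L.o) L.z - L.lam L.o * dz (L.v i) (L.h p L.o) L.z‖ ^ 2) := by
    refine sum_congr rfl fun p hp => ?_
    have hpo := ne_of_mem_erase hp
    rw [h.dz_Q, h.dz_Q, if_neg hpo, if_neg hpo.symm, mul_zero, sub_zero, norm_sub_rev,
      sub_zero, norm_sub_rev (_ * dz (L.v i) (L.h p L.o) L.z)]
  rw [es, eQ] at hl
  have b1 : (-(L.lam L.o * φ1) * dzb (L.v i) (L.h L.o L.o) L.z +
      -(L.lam L.o * (starRingEnd ℂ) φ1) * dz (L.v i) (L.h L.o L.o) L.z).re ≤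
      L.lam L.o * (2 * K ^ 2 * ‖φ1‖) := by
    refine (Complex.re_le_norm _).trans ((norm_add_le _ _).trans ?_)
    simp only [norm_mul, norm_neg, RCLike.norm_conj, Complex.norm_real,
      Real.norm_of_nonneg h.top_pos.le]
    have c1 := mul_le_mul_of_nonneg_left ((h.jet_h L.o L.o).norm_dzb_le (h.v_le i))
      (mul_nonneg h.top_pos.le (norm_nonneg φ1))
    have c2 := mul_le_mul_of_nonneg_left ((h.jet_h L.o L.o).norm_dz_le (h.v_le i))
      (mul_nonneg h.top_pos.le (norm_nonneg φ1))
    linarith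
  have b2 : (dzb (L.v i) (dz (L.v i) (L.h L.o L.o)) L.z).re ≤ K ^ 3 :=
    (Complex.re_le_norm _).trans ((h.jet_h L.o L.o).norm_dzb_dz_le (h.v_le i))
  have b3 := mul_le_mul_of_nonneg_left b2 h.top_pos.le
  have e4 : ∀ A B C D E G : ℂ, (A * 1 + B + C + D - E : ℂ).re = A.re + (B + C).re + D.re - E.re := by
    intros; simp; ring
  rw [e4 _ _ _ _ _ 0, Complex.re_ofReal_mul, Complex.re_ofReal_mul, Complex.sub_re,
    Complex.ofReal_re] at hl
  linarith

end Regular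

variable (L)

/-- The derivatives of the local data at the point. -/
def maxPoint (m : ℕ) (N B K₀ : ℝ) : MaxPointData n where
  o := L.o
  lam := L.lam
  F := L.F m
  s := L.s m
  u2 p i := dz (L.v i) (L.U p) L.z
  b p q := L.b p q L.z
  T p q i := dz (L.v i) (L.g p q) L.z
  H p q i := dz (L.v i) (L.h p q) L.z
  U3 i p := dzb (L.v i) (dz (L.v i) (L.U p)) L.z
  l := L.l
  a p := L.a p L.z
  gOO i := (dzb (L.v i) (dz (L.v i) (L.g L.o L.o)) L.z).re
  gDD i := (dzb (L.v L.o) (dz (L.v L.o) (L.g i i)) L.z).re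
  φ1 i := dz (L.v i) (L.φ N B K₀) L.z
  φ2 i := (dzb (L.v i) (dz (L.v i) (L.φ N B K₀)) L.z).re

variable {L}

/-- The constants that arise from the local data are all bounded by `102 n² K⁷`. -/
lemma mul_pow_le {K n : ℝ} (hK : 1 ≤ K) (hn : 1 ≤ n) {c : ℝ} (hc : c ≤ 102)
    {i j : ℕ} (hi : i ≤ 2) (hj : j ≤ 7) : c * n ^ i * K ^ j ≤ 102 * n ^ 2 * K ^ 7 := by
  have h1 : n ^ i ≤ n ^ 2 := pow_le_pow_right₀ hn hi
  have h2 : K ^ j ≤ K ^ 7 := pow_le_pow_right₀ hK hj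
  exact mul_le_mul (mul_le_mul hc h1 (by positivity) (by norm_num)) h2 (by positivity)
    (by positivity)

namespace Regular

lemma rel (h : L.Regular K ε) (hm : m + 2 ≤ n) (hS : L.Solves (m + 2)) (ht : L.Touches N B K₀)
    {δ : ℝ} (hδ : 0 < δ) (hδ1 : δ ≤ 1)
    (hlarge : 4 * (n : ℝ) * (n * Real.exp K) ≤ δ ^ 2 * L.lam L.o) (h1 : 1 ≤ L.lam L.o) :
    (L.maxPoint m N B K₀).Rel (102 * n ^ 2 * K ^ 7) δ := by
  have hK := h.one_le
  have hK0 : 0 ≤ K := by linarith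
  have hn : (1 : ℝ) ≤ n := by exact_mod_cast (Fin.pos L.o)
  have mp := fun {c : ℝ} (hc : c ≤ 102) (i j : ℕ) (hi : i ≤ 2) (hj : j ≤ 7) =>
    mul_pow_le hK hn hc hi hj
  set C := 102 * (n : ℝ) ^ 2 * K ^ 7 with hC
  have c1 : K ≤ C := by have := mp (c := 1) (by norm_num) 0 1 (by norm_num) (by norm_num); linarith
  have c2 : K ^ 2 ≤ C := by
    have := mp (c := 1) (by norm_num) 0 2 (by norm_num) (by norm_num); linarith
  have c3 : 18 * K ^ 3 ≤ C := by
    have := mp (c := 18) (by norm_num) 0 3 (by norm_num) (by norm_num); linarith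
  have c4 : 46 * K ^ 4 ≤ C := by
    have := mp (c := 46) (by norm_num) 0 4 (by norm_num) (by norm_num); linarith
  have c5 : 4 * K ^ 2 ≤ C := by
    have := mp (c := 4) (by norm_num) 0 2 (by norm_num) (by norm_num); linarith
  have c6 : 4 * n * K ^ 2 ≤ C := by
    have := mp (c := 4) (by norm_num) 1 2 (by norm_num) (by norm_num); linarith
  have c7 : 3 * n ^ 2 * K ^ 4 ≤ C :=
    mp (c := 3) (by norm_num) 2 4 (by norm_num) (by norm_num)
  have k3 : 0 ≤ K ^ 3 := by positivity
  have htop := h.top_pos.le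
  refine
    { one_le := h1
      F_pos := h.F_pos hm
      F_top_le := h.F_top_le hm
      s_nonneg := h.s_nonneg hm
      s_le := h.s_le hm
      le_s := h.le_s hm
      u2_symm := h.u2_symm
      b_le := fun p q => (h.norm_b_le_mul h1 p q).trans (mul_le_mul_of_nonneg_right c5 htop)
      H_le := fun p q i => (h.dz_h_norm p q i).trans c2
      l_le := fun q => (h.norm_l_le q).trans c2
      a_le := fun q => (h.jet_a q).norm_le.trans c1
      torsion := fun p q i => (h.torsion h1 p q i).trans (mul_le_mul_of_nonneg_right c3 htop)
      critical := h.critical ht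
      maximum := fun i => (h.maximum ht i).trans (sub_le_sub_right
        (mul_le_mul_of_nonneg_left ?_ htop) _)
      equation_two := ?_
      equation_one := fun i => (h.equation_one hm hS i).trans c6
      third := fun i p => (h.third i p).trans (mul_le_mul_of_nonneg_right (by linarith)
        (by positivity))
      commute := fun i => (h.commute h1 i).trans (add_le_add_right
        (mul_le_mul_of_nonneg_right c4 (by positivity)) _) }
  · have d1 := mul_le_mul_of_nonneg_right (by linarith [sq_nonneg K] : 2 * K ^ 2 ≤ C)
      (norm_nonneg (dz (L.v i) (L.φ N B K₀) L.z))
    have d2 : K ^ 3 ≤ C := by linarith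
    exact add_le_add (add_le_add_right d1 _) d2
  · have e := h.equation_two hm hS hδ hδ1 hlarge h1
    have d1 := mul_le_mul_of_nonneg_right c6 (sum_nonneg fun p _ => sum_nonneg fun q _ =>
      mul_nonneg (h.F_pos hm p).le (norm_nonneg (dz (L.v L.o) (L.g p q) L.z)) :
        0 ≤ ∑ p, ∑ q, L.F m p * ‖dz (L.v L.o) (L.g p q) L.z‖)
    exact le_trans (sub_le_sub (sub_le_sub_left d1 _) c7) e

lemma auxRel (h : L.Regular K ε) (hm : m + 2 ≤ n) (hS : L.Solves (m + 2))
    (hlarge : n * Real.exp K ≤ L.lam L.o) :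
    (L.maxPoint m N B K₀).AuxRel (102 * n ^ 2 * K ^ 7) ε N B (Real.exp (B * (K₀ - L.u L.z)))
      (fun i => L.U i L.z) (fun i => dz (L.v i) L.Γ L.z)
      (fun i => (dzb (L.v i) (dz (L.v i) L.Γ) L.z).re) := by
  have hK := h.one_le
  have hn : (1 : ℝ) ≤ n := by exact_mod_cast (Fin.pos L.o)
  have mp := fun {c : ℝ} (hc : c ≤ 102) (i j : ℕ) (hi : i ≤ 2) (hj : j ≤ 7) =>
    mul_pow_le hK hn hc hi hj
  set C := 102 * (n : ℝ) ^ 2 * K ^ 7 with hC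
  have c1 : K ≤ C := by have := mp (c := 1) (by norm_num) 0 1 (by norm_num) (by norm_num); linarith
  have c2 : 3 * K ^ 2 ≤ C := by
    have := mp (c := 3) (by norm_num) 0 2 (by norm_num) (by norm_num); linarith
  have c3 : n ^ 2 * K ^ 4 ≤ C := by
    have := mp (c := 1) (by norm_num) 2 4 (by norm_num) (by norm_num); linarith
  have c4 : 2 * n ^ 2 * K ^ 5 ≤ C :=
    mp (c := 2) (by norm_num) 2 5 (by norm_num) (by norm_num)
  exact
    { F_lam := h.F_lam hm
      F_top := h.F_top hm hS hlarge
      u1_le := fun i => (h.U_le i).trans c1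
      b_diag := h.b_diag_le
      b_top := le_trans (sub_le_sub_left c2 _) h.lam_sub_le_norm_b
      b_symm := h.norm_b_symm
      grad_one := fun i => (h.grad_one i).trans c3
      grad_two := fun i => le_trans (sub_le_sub_left (mul_le_mul_of_nonneg_right c4 (by
        have : 0 ≤ ∑ m, (‖dz (L.v i) (L.U m) L.z‖ + ‖L.b m i L.z‖) :=
          sum_nonneg fun m _ => by positivity
        exact add_nonneg zero_le_one this)) _) (h.grad_two i)
      φ1_eq := fun i => h.dz_φ N B K₀ i
      φ2_eq := fun i => h.dzb_dz_φ N B K₀ i }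

end Regular

/-- The estimate for local data: at a maximum point of the largest eigenvalue times `e^φ`, the
largest eigenvalue is bounded. -/
theorem exists_top_le {n k : ℕ} (hk : 1 ≤ k) (hkn : k ≤ n) (K ε K₀ : ℝ) (hK : 1 ≤ K) (hε : 0 < ε) :
    ∃ N B Λ : ℝ, 0 ≤ N ∧ 0 ≤ B ∧ ∀ L : LocalData n, L.Regular K ε → L.Solves k →
      L.Touches N B K₀ → |L.u L.z| ≤ K₀ → L.lam L.o ≤ Λ := by
  have hn : 0 < n := by omega
  have hn1 : (1 : ℝ) ≤ n := by exact_mod_cast hn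
  rcases Nat.lt_or_ge k 2 with hk1 | hk2
  -- for `k = 1` the trace of `g` is bounded, and the eigenvalues are positive
  · obtain rfl : k = 1 := by omega
    refine ⟨0, 0, Real.exp K, le_rfl, le_rfl, fun L h hS _ _ => ?_⟩
    refine le_trans ?_ (h.esym_le_exp hS)
    rw [esym_erase (mem_univ L.o), esym_zero, mul_one]
    have : 0 ≤ esym (univ.erase L.o) (0 + 1) L.lam := esym_nonneg h.lam_nonneg
    linarith
  obtain ⟨m, rfl⟩ : ∃ m, k = m + 2 := ⟨k - 2, by omega⟩
  have hC : 1 ≤ 102 * (n : ℝ) ^ 2 * K ^ 7 := by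
    have := mul_pow_le hK hn1 (c := 1) (by norm_num) (i := 0) (j := 0) (by norm_num)
      (by norm_num)
    simpa using this
  obtain ⟨N, B, δ, hN, hB, hδ, hδ4, H⟩ :=
    MaxPointData.top_le_of_rel n hn (102 * (n : ℝ) ^ 2 * K ^ 7) ε hC hε
  obtain ⟨Λ, hΛ⟩ := H (Real.exp (B * (2 * K₀)))
  refine ⟨N, B, max Λ (4 * n * (n * Real.exp K) / δ ^ 2), hN, hB, fun L h hS ht hu => ?_⟩
  by_contra! hcon
  obtain ⟨h1, h2⟩ := max_lt_iff.1 hcon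
  have hδ2 : 0 < δ ^ 2 := by positivity
  have hlarge : 4 * (n : ℝ) * (n * Real.exp K) ≤ δ ^ 2 * L.lam L.o := by
    rw [div_lt_iff₀ hδ2] at h2
    linarith
  have hE : 1 ≤ Real.exp K := Real.one_le_exp (by linarith)
  have hδ21 : δ ^ 2 ≤ 1 := pow_le_one₀ hδ.le (by linarith)
  have hlarge' : n * Real.exp K ≤ L.lam L.o := by
    have a1 : δ ^ 2 * L.lam L.o ≤ L.lam L.o := mul_le_of_le_one_left h.top_pos.le hδ21
    have a2 : n * Real.exp K ≤ n * (n * Real.exp K) := le_mul_of_one_le_left (by positivity) hn1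
    have a3 : 0 ≤ n * (n * Real.exp K) := by positivity
    linarith
  have hone : 1 ≤ L.lam L.o := le_trans (one_le_mul_of_one_le_of_one_le hn1 hE) hlarge'
  have hu' := abs_le.1 hu
  have hr := h.rel hkn hS ht hδ (by linarith) hlarge hone
  exact absurd (hΛ _ _ _ _ _ hr (h.auxRel hkn hS hlarge')
    (Real.one_le_exp (mul_nonneg hB (by linarith)))
    (Real.exp_le_exp.2 (mul_le_mul_of_nonneg_left (by linarith) hB))) (not_le.2 h1)

end LocalData

/-! ### Powers of exterior forms of degree two -/

section CommutingSquareZero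
variable {A : Type*} [Ring A]

lemma add_pow_succ_of_mul_self_eq_zero {x s : A} (hx : x * x = 0) (h : Commute x s) (m : ℕ) :
    (x + s) ^ (m + 1) = s ^ (m + 1) + (m + 1 : ℕ) • (x * s ^ m) := by
  induction m with
  | zero => simp [add_comm]
  | succ m ih =>
    have h1 : x * s ^ m * x = 0 := by
      rw [mul_assoc, ← (h.pow_right m).eq, ← mul_assoc, hx, zero_mul]
    have h2 : s ^ (m + 1) * x = x * s ^ (m + 1) := ((h.pow_right (m + 1)).eq).symm
    rw [pow_succ, ih, add_mul, mul_add, mul_add, smul_mul_assoc, smul_mul_assoc, h1, h2, smul_zero,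
      zero_add, mul_assoc, ← pow_succ, ← pow_succ, add_nsmul (x * s ^ (m + 1)) (m + 1) 1, one_nsmul]
    abel

/-- For commuting elements of square zero, the power of the sum with exponent the number of terms
is a multiple of the product, and the next power vanishes. -/
lemma sum_pow_length (l : List A) (h0 : ∀ x ∈ l, x * x = 0) (hc : ∀ x ∈ l, ∀ y ∈ l, Commute x y) :
    l.sum ^ l.length = l.length.factorial • l.prod ∧ l.sum ^ (l.length + 1) = 0 := by
  induction l with
  | nil => simp
  | cons x l ih =>
    obtain ⟨h1, h2⟩ := ih (fun y hy => h0 y (List.mem_cons_of_mem _ hy))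
      fun y hy y' hy' => hc y (List.mem_cons_of_mem _ hy) y' (List.mem_cons_of_mem _ hy')
    have hx : x * x = 0 := h0 x List.mem_cons_self
    have hs : Commute x l.sum := by
      have : ∀ t : List A, (∀ y ∈ t, Commute x y) → Commute x t.sum := by
        intro t
        induction t with
        | nil => simp
        | cons y t iht =>
          intro ht
          rw [List.sum_cons]
          exact (ht y List.mem_cons_self).add_right
            (iht fun y' hy' => ht y' (List.mem_cons_of_mem _ hy'))
      exact this l fun y hy => hc x List.mem_cons_self y (List.mem_cons_of_mem _ hy)
    constructor
    · rw [List.sum_cons, List.length_cons, add_pow_succ_of_mul_self_eq_zero hx hs, h2, h1, zero_add,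
        List.prod_cons, mul_smul_comm, smul_smul, Nat.factorial_succ]
    · rw [List.sum_cons, List.length_cons, add_pow_succ_of_mul_self_eq_zero hx hs, pow_succ, h2,
        zero_mul, mul_zero, smul_zero, add_zero]

end CommutingSquareZero

section ExteriorForms
variable {n : ℕ} {W : Type*} [AddCommGroup W] [Module ℂ W]

/-- The element `∑ Aᵢⱼ aᵢ ∧ bⱼ` of the exterior algebra. -/
def twoForm (a b : Fin n → W) (A : Matrix (Fin n) (Fin n) ℂ) : ExteriorAlgebra ℂ W :=
  ∑ i, ∑ j, A i j • (ExteriorAlgebra.ι ℂ (a i) * ExteriorAlgebra.ι ℂ (b j))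

lemma ι_mul_ι_mul_comm (x y w : W) :
    Commute (ExteriorAlgebra.ι ℂ x * ExteriorAlgebra.ι ℂ y) (ExteriorAlgebra.ι ℂ w) := by
  have h1 := eq_neg_of_add_eq_zero_left (ExteriorAlgebra.ι_add_mul_swap (R := ℂ) y w)
  have h2 := eq_neg_of_add_eq_zero_left (ExteriorAlgebra.ι_add_mul_swap (R := ℂ) x w)
  rw [Commute, SemiconjBy, mul_assoc, h1, mul_neg, ← mul_assoc, h2, neg_mul, neg_neg, mul_assoc]

/-- The top power of `∑ aᵢ ∧ (∑ⱼ Aᵢⱼ bⱼ)`: the summands commute and have square zero. -/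
lemma twoForm_pow (a b : Fin n → W) (A : Matrix (Fin n) (Fin n) ℂ) :
    twoForm a b A ^ n = n.factorial • (List.ofFn fun i => ExteriorAlgebra.ι ℂ (a i) *
      ExteriorAlgebra.ι ℂ (∑ j, A i j • b j)).prod := by
  set θ : Fin n → ExteriorAlgebra ℂ W := fun i => ExteriorAlgebra.ι ℂ (a i) *
      ExteriorAlgebra.ι ℂ (∑ j, A i j • b j) with hθ
  have hs : twoForm a b A = (List.ofFn θ).sum := by
    rw [List.sum_ofFn, twoForm]
    refine sum_congr rfl fun i _ => ?_
    simp only [hθ, map_sum, map_smul, mul_sum, mul_smul_comm]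
  have hc : ∀ i w, Commute (θ i) (ExteriorAlgebra.ι ℂ w) := fun i w => ι_mul_ι_mul_comm _ _ _
  have hcc : ∀ i j, Commute (θ i) (θ j) := fun i j => (hc i _).mul_right (hc i _)
  have h0 : ∀ i, θ i * θ i = 0 := by
    intro i
    change θ i * (ExteriorAlgebra.ι ℂ (a i) * _) = 0
    rw [← mul_assoc, (hc i _).eq, ← mul_assoc, ExteriorAlgebra.ι_sq_zero, zero_mul, zero_mul]
  have := (sum_pow_length (List.ofFn θ)
    (by simp only [List.mem_ofFn]; rintro _ ⟨i, rfl⟩; exact h0 i)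
    (by simp only [List.mem_ofFn]; rintro _ ⟨i, rfl⟩ _ ⟨j, rfl⟩; exact hcc i j)).1
  rw [List.length_ofFn] at this
  rw [hs, this]

/-- If the covectors `a` and `b` have dual coordinates, then the top power of `∑ Aᵢⱼ aᵢ ∧ bⱼ` is
`n! det A` in the trivialization given by the determinant of the coordinates. -/
lemma exists_twoForm_pow_eq_det (a b : Fin n → W) (c : W →ₗ[ℂ] (Fin n × Fin 2 → ℂ))
    (ha : ∀ i, c (a i) = Pi.single (i, 0) 1) (hb : ∀ i, c (b i) = Pi.single (i, 1) 1) :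
    ∃ Φ : ExteriorAlgebra ℂ W →ₗ[ℂ] ℂ, ∀ A, Φ (twoForm a b A ^ n) = n.factorial * A.det := by
  let D : W [⋀^Fin (n * 2)]→ₗ[ℂ] ℂ :=
    ((Matrix.detRowAlternating (R := ℂ) (n := Fin n × Fin 2)).compLinearMap c).domDomCongr
      finProdFinEquiv
  refine ⟨ExteriorAlgebra.liftAlternating (Pi.single (n * 2) D), fun A => ?_⟩
  let v : Fin n × Fin 2 → W := fun p => if p.2 = 0 then a p.1 else ∑ j, A p.1 j • b j
  have hp : (List.ofFn fun i => ExteriorAlgebra.ι ℂ (a i) *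
      ExteriorAlgebra.ι ℂ (∑ j, A i j • b j)).prod =
      ExteriorAlgebra.ιMulti ℂ (n * 2) (fun r => v (finProdFinEquiv.symm r)) := by
    rw [ExteriorAlgebra.ιMulti_apply, List.ofFn_mul, List.prod_flatten, List.map_ofFn]
    congr 2
    funext i
    have e : ∀ j : Fin 2, (finProdFinEquiv.symm
        (⟨(i : ℕ) * 2 + j, by omega⟩ : Fin (n * 2))) = (i, j) := by
      intro j
      rw [Equiv.symm_apply_eq]
      ext
      simp [finProdFinEquiv]
      ring
    simp only [Function.comp, e, List.ofFn_succ, List.ofFn_zero, List.prod_cons, List.prod_nil,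
      mul_one]
    simp [v]
  rw [twoForm_pow, hp, map_nsmul, ExteriorAlgebra.liftAlternating_apply_ιMulti, Pi.single_eq_same,
    nsmul_eq_mul]
  congr 1
  let B : Fin 2 → Matrix (Fin n) (Fin n) ℂ := fun k => if k = 0 then 1 else A
  have hB : (Matrix.blockDiagonal B).det = A.det := by
    rw [Matrix.det_blockDiagonal]
    simp [B]
  rw [← hB]
  change Matrix.det (fun p => c (v (finProdFinEquiv.symm (finProdFinEquiv p)))) = _
  congr 1
  ext ⟨i, k⟩ ⟨j, k'⟩
  rw [Equiv.symm_apply_apply, Matrix.blockDiagonal_apply]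
  fin_cases k <;> fin_cases k' <;>
    simp [v, B, ha, hb, Pi.single_apply, Matrix.one_apply, eq_comm]

/-- The equation `G^k ∧ H^(n-k) = c H^n` between exterior forms, in terms of determinants. -/
lemma hessCoeff_eq_of_twoForm_eq {k : ℕ} (hkn : k ≤ n) (a b : Fin n → W)
    (c : W →ₗ[ℂ] (Fin n × Fin 2 → ℂ))
    (ha : ∀ i, c (a i) = Pi.single (i, 0) 1) (hb : ∀ i, c (b i) = Pi.single (i, 1) 1)
    {H G : Matrix (Fin n) (Fin n) ℂ} {r : ℂ}
    (h : twoForm a b G ^ k * twoForm a b H ^ (n - k) = r • twoForm a b H ^ n) :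
    hessCoeff k H G = n.choose k * r * H.det := by
  obtain ⟨Φ, hΦ⟩ := exists_twoForm_pow_eq_det a b c ha hb
  have hfac : (n.factorial : ℂ) ≠ 0 := by exact_mod_cast n.factorial_ne_zero
  have hadd : ∀ t : ℂ, twoForm a b (t • G + H) = t • twoForm a b G + twoForm a b H := by
    intro t
    simp only [twoForm, smul_sum, ← sum_add_distrib, Matrix.add_apply, Matrix.smul_apply,
      smul_eq_mul, add_smul, mul_smul]
  have hcomm : Commute (twoForm a b G) (twoForm a b H) := by
    refine Commute.sum_left _ _ _ fun i _ => Commute.sum_left _ _ _ fun j _ =>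
      Commute.smul_left ?_ _
    refine Commute.sum_right _ _ _ fun i' _ => Commute.sum_right _ _ _ fun j' _ =>
      Commute.smul_right ((ι_mul_ι_mul_comm _ _ _).mul_right (ι_mul_ι_mul_comm _ _ _)) _
  have hP : Matrix.det ((Polynomial.X : Polynomial ℂ) • G.map Polynomial.C + H.map Polynomial.C) =
      ∑ m ∈ range (n + 1), Polynomial.C (n.choose m * Φ (twoForm a b G ^ m * twoForm a b H ^ (n - m)) /
        n.factorial) * Polynomial.X ^ m := by
    refine Polynomial.funext fun t => ?_
    have e1 : Polynomial.eval t (Matrix.det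
        ((Polynomial.X : Polynomial ℂ) • G.map Polynomial.C + H.map Polynomial.C)) =
        (t • G + H).det := by
      rw [← Polynomial.coe_evalRingHom, RingHom.map_det]
      congr 1
      ext i j
      simp only [RingHom.mapMatrix_apply, Matrix.map_apply, Matrix.add_apply, Matrix.smul_apply,
        smul_eq_mul, Polynomial.coe_evalRingHom, Polynomial.eval_add, Polynomial.eval_mul,
        Polynomial.eval_X, Polynomial.eval_C]
    have e2 := hΦ (t • G + H)
    rw [hadd, (hcomm.smul_left t).add_pow, map_sum] at e2
    rw [e1, Polynomial.eval_finsetSum, ← mul_right_inj' hfac, ← e2, mul_sum]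
    refine sum_congr rfl fun m _ => ?_
    rw [smul_pow, smul_mul_assoc, ← nsmul_eq_mul', map_nsmul, map_smul]
    simp only [Polynomial.eval_mul, Polynomial.eval_C, Polynomial.eval_pow, Polynomial.eval_X,
      nsmul_eq_mul, smul_eq_mul]
    field_simp
  rw [hessCoeff, hP, Polynomial.finsetSum_coeff, sum_eq_single k]
  · rw [Polynomial.coeff_C_mul_X_pow, if_pos rfl, h, map_smul, hΦ, smul_eq_mul]
    field_simp
  · intro m _ hm
    rw [Polynomial.coeff_C_mul_X_pow, if_neg hm.symm]
  · intro hk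
    exact absurd (mem_range.2 (by omega)) hk

end ExteriorForms

section Equation
variable {n : ℕ} {M : Type*} [TopologicalSpace M] [ChartedSpace (Cn n) M]

/-- The coordinates of a complex-valued real-linear form with respect to `dzⁱ` and `dz̄ⁱ`. -/
def covCoords (n : ℕ) : (Cn n →ₗ[ℝ] ℂ) →ₗ[ℂ] (Fin n × Fin 2 → ℂ) where
  toFun w p := (1 / 2 : ℂ) * (w (stdVec p.1) -
    (if p.2 = 0 then 1 else -1) * (Complex.I * w (Complex.I • stdVec p.1)))
  map_add' w w' := by
    funext p
    simp only [LinearMap.add_apply, Pi.add_apply]; ring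
  map_smul' c w := by
    funext p
    simp only [LinearMap.smul_apply, Pi.smul_apply, smul_eq_mul, RingHom.id_apply]; ring

lemma covCoords_cov10 (p : M) (i : Fin n) :
    covCoords n (cov10 (coordCov p i)) = Pi.single (i, 0) 1 := by
  funext ⟨j, k⟩
  have h1 : cov10 (coordCov p i) (stdVec j : Cn n) = if i = j then 1 else 0 :=
    coordCov_coordVec p i j
  have h2 : cov10 (coordCov p i) (Complex.I • stdVec j : Cn n) =
      Complex.I * if i = j then 1 else 0 := by
    rw [← coordCov_coordVec p i j]
    exact map_smul (coordCov p i) Complex.I (stdVec j : Cn n)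
  change (1 / 2 : ℂ) * (cov10 (coordCov p i) (stdVec j : Cn n) -
    (if k = 0 then 1 else -1) * (Complex.I * cov10 (coordCov p i) (Complex.I • stdVec j : Cn n))) = _
  rw [h1, h2, ← mul_assoc Complex.I, Complex.I_mul_I]
  by_cases hij : i = j
  · subst hij
    fin_cases k <;> norm_num [Pi.single_apply]
  · rw [if_neg hij]
    simp [Ne.symm hij]

lemma covCoords_cov01 (p : M) (i : Fin n) :
    covCoords n (cov01 (coordCov p i)) = Pi.single (i, 1) 1 := by
  funext ⟨j, k⟩
  have h1 : cov01 (coordCov p i) (stdVec j : Cn n) = if i = j then 1 else 0 := by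
    change (starRingEnd ℂ) (coordCov p i (coordVec p j)) = _
    rw [coordCov_coordVec]; split_ifs <;> simp
  have h2 : cov01 (coordCov p i) (Complex.I • stdVec j : Cn n) =
      -Complex.I * if i = j then 1 else 0 := by
    have : coordCov p i (Complex.I • stdVec j : Cn n) = Complex.I * if i = j then 1 else 0 := by
      rw [← coordCov_coordVec p i j]
      exact map_smul (coordCov p i) Complex.I (stdVec j : Cn n)
    change (starRingEnd ℂ) (coordCov p i (Complex.I • stdVec j : Cn n)) = _
    rw [this, map_mul, Complex.conj_I]; split_ifs <;> simp
  change (1 / 2 : ℂ) * (cov01 (coordCov p i) (stdVec j : Cn n) -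
    (if k = 0 then 1 else -1) * (Complex.I * cov01 (coordCov p i) (Complex.I • stdVec j : Cn n))) = _
  rw [h1, h2, ← mul_assoc Complex.I, mul_neg, Complex.I_mul_I]
  by_cases hij : i = j
  · subst hij
    fin_cases k <;> norm_num [Pi.single_apply]
  · rw [if_neg hij]
    simp [Ne.symm hij]

lemma toForm_eq_twoForm (p : M) (h : Sesq n p) : toForm p h = Complex.I • twoForm
    (fun i => cov10 (coordCov p i)) (fun i => cov01 (coordCov p i)) (formMatrix p h) := rfl

/-- The Hessian equation in the preferred chart, in terms of determinants. -/
lemma hessCoeff_of_toForm_eq {k : ℕ} (hkn : k ≤ n) {p : M} {h g : Sesq n p} {r : ℂ}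
    (heq : toForm p g ^ k * toForm p h ^ (n - k) = r • toForm p h ^ n) :
    hessCoeff k (formMatrix p h) (formMatrix p g) = n.choose k * r * (formMatrix p h).det := by
  refine hessCoeff_eq_of_twoForm_eq hkn _ _ (covCoords n) (covCoords_cov10 p) (covCoords_cov01 p) ?_
  rw [toForm_eq_twoForm, toForm_eq_twoForm, smul_pow, smul_pow, smul_pow, smul_mul_smul_comm,
    ← pow_add, Nat.add_sub_cancel' hkn, smul_comm] at heq
  exact smul_right_injective _ (pow_ne_zero n Complex.I_ne_zero) heq

end Equation

/-! ### Hermitian forms and changes of frame -/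

section Gram
open scoped Matrix
variable {n : ℕ}

section
variable {V : Type*} [AddCommGroup V] [Module ℂ V]

/-- The matrix of a sesquilinear form in a family of vectors. -/
def gram (B : V →ₗ[ℂ] V →ₗ⋆[ℂ] ℂ) (v : Fin n → V) : Matrix (Fin n) (Fin n) ℂ :=
  Matrix.of fun p q => B (v p) (v q)

lemma sesq_sum_smul (B : V →ₗ[ℂ] V →ₗ⋆[ℂ] ℂ) (c d : Fin n → ℂ) (w : Fin n → V) :
    B (∑ i, c i • w i) (∑ j, d j • w j) =
      ∑ i, ∑ j, gram B w i j * c i * (starRingEnd ℂ) (d j) := by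
  rw [LinearMap.map_sum₂]
  refine sum_congr rfl fun i _ => ?_
  rw [map_sum]
  refine sum_congr rfl fun j _ => ?_
  rw [LinearMap.map_smulₛₗ, LinearMap.map_smulₛₗ₂, gram, Matrix.of_apply]
  simp only [RingHom.id_apply, smul_eq_mul]
  ring

lemma gram_sum_smul (B : V →ₗ[ℂ] V →ₗ⋆[ℂ] ℂ) (A : Matrix (Fin n) (Fin n) ℂ) (w : Fin n → V) :
    gram B (fun p => ∑ i, A p i • w i) = A * gram B w * Aᴴ := by
  ext p q
  rw [gram, Matrix.of_apply, sesq_sum_smul, Matrix.mul_apply]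
  simp only [Matrix.mul_apply, sum_mul]
  rw [sum_comm]
  refine sum_congr rfl fun j _ => sum_congr rfl fun i _ => ?_
  rw [Matrix.conjTranspose_apply]
  simp only [RCLike.star_def]
  ring

end

/-- The square norm of a covector with components `α`, for the metric with matrix `H`. -/
def dualSq (H : Matrix (Fin n) (Fin n) ℂ) (α : Fin n → ℂ) : ℂ :=
  ∑ l, ∑ m, H⁻¹ l m * (α m * (starRingEnd ℂ) (α l))

lemma dualSq_eq (H : Matrix (Fin n) (Fin n) ℂ) (α : Fin n → ℂ) :
    dualSq H α = star α ⬝ᵥ (H⁻¹ *ᵥ α) := by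
  simp only [dualSq, dotProduct, Matrix.mulVec, mul_sum, Pi.star_apply, RCLike.star_def]
  refine sum_congr rfl fun l _ => sum_congr rfl fun m _ => ?_
  ring

lemma dualSq_change {A : Matrix (Fin n) (Fin n) ℂ} (hA : IsUnit A.det)
    (H : Matrix (Fin n) (Fin n) ℂ) (α : Fin n → ℂ) :
    dualSq (A * H * Aᴴ) (A *ᵥ α) = dualSq H α := by
  have hA' : IsUnit (Aᴴ).det := by rw [Matrix.det_conjTranspose]; exact hA.star
  rw [dualSq_eq, dualSq_eq, Matrix.mul_inv_rev, Matrix.mul_inv_rev, Matrix.star_mulVec,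
    ← Matrix.dotProduct_mulVec, Matrix.mulVec_mulVec, Matrix.mulVec_mulVec]
  congr 2
  rw [Matrix.mul_assoc, Matrix.mul_assoc, Matrix.nonsing_inv_mul_cancel_right _ _ hA,
    Matrix.mul_nonsing_inv_cancel_left _ _ hA']

lemma dualSq_one (α : Fin n → ℂ) : dualSq 1 α = ((∑ q, ‖α q‖ ^ 2 : ℝ) : ℂ) := by
  simp only [dualSq_eq, inv_one, Matrix.one_mulVec, dotProduct, Pi.star_apply, RCLike.star_def,
    Complex.conj_mul', Complex.ofReal_sum, Complex.ofReal_pow]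

lemma trace_change {A : Matrix (Fin n) (Fin n) ℂ} (hA : IsUnit A.det)
    (H U : Matrix (Fin n) (Fin n) ℂ) :
    Matrix.trace ((A * H * Aᴴ)⁻¹ * (A * U * Aᴴ) * (A * H * Aᴴ)⁻¹ * (A * U * Aᴴ)ᴴ) =
      Matrix.trace (H⁻¹ * U * H⁻¹ * Uᴴ) := by
  have hA' : IsUnit (Aᴴ).det := by rw [Matrix.det_conjTranspose]; exact hA.star
  have e : (A * H * Aᴴ)⁻¹ * (A * U * Aᴴ) * (A * H * Aᴴ)⁻¹ * (A * U * Aᴴ)ᴴ =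
      (Aᴴ)⁻¹ * ((H⁻¹ * U * H⁻¹ * Uᴴ) * Aᴴ) := by
    simp only [Matrix.mul_inv_rev, Matrix.conjTranspose_mul, Matrix.conjTranspose_conjTranspose,
      Matrix.mul_assoc, Matrix.nonsing_inv_mul_cancel_left _ _ hA,
      Matrix.mul_nonsing_inv_cancel_left _ _ hA']
  rw [e, Matrix.trace_mul_comm, Matrix.mul_assoc, Matrix.mul_nonsing_inv _ hA', Matrix.mul_one]

lemma trace_one (U : Matrix (Fin n) (Fin n) ℂ) :
    Matrix.trace ((1 : Matrix (Fin n) (Fin n) ℂ)⁻¹ * U * (1 : Matrix (Fin n) (Fin n) ℂ)⁻¹ * Uᴴ) =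
      ((∑ p, ∑ q, ‖U p q‖ ^ 2 : ℝ) : ℂ) := by
  simp only [inv_one, Matrix.one_mul, Matrix.mul_one, Matrix.trace, Matrix.diag_apply,
    Matrix.mul_apply, Matrix.conjTranspose_apply, RCLike.star_def, Complex.mul_conj',
    Complex.ofReal_sum, Complex.ofReal_pow]

lemma hessCoeff_change (k : ℕ) (A H G : Matrix (Fin n) (Fin n) ℂ) :
    hessCoeff k (A * H * Aᴴ) (A * G * Aᴴ) = A.det * Aᴴ.det * hessCoeff k H G := by
  have e : (Polynomial.X : Polynomial ℂ) • (A * G * Aᴴ).map Polynomial.C +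
      (A * H * Aᴴ).map Polynomial.C = A.map Polynomial.C *
        ((Polynomial.X : Polynomial ℂ) • G.map Polynomial.C + H.map Polynomial.C) *
        Aᴴ.map Polynomial.C := by
    simp only [Matrix.map_mul, Matrix.mul_add, Matrix.add_mul, Matrix.mul_smul, Matrix.smul_mul]
  have hd : ∀ B : Matrix (Fin n) (Fin n) ℂ, (B.map Polynomial.C).det = Polynomial.C B.det :=
    fun B => (RingHom.map_det Polynomial.C B).symm
  rw [hessCoeff, e, Matrix.det_mul, Matrix.det_mul, hd, hd, mul_right_comm, ← Polynomial.C_mul,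
    Polynomial.coeff_C_mul, hessCoeff]

section
open scoped ComplexOrder

lemma posDef_of_pos {H : Matrix (Fin n) (Fin n) ℂ} (hH : H.IsHermitian)
    (hpos : ∀ y : Fin n → ℂ, y ≠ 0 →
      0 < (∑ p, ∑ q, H p q * y p * (starRingEnd ℂ) (y q)).re) : H.PosDef := by
  refine Matrix.PosDef.of_dotProduct_mulVec_pos hH fun x hx => ?_
  have h1 := hpos (star x) (by simpa using hx)
  have e : ∑ p, ∑ q, H p q * star x p * (starRingEnd ℂ) (star x q) = star x ⬝ᵥ H *ᵥ x := by
    simp only [dotProduct, Matrix.mulVec, mul_sum]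
    refine sum_congr rfl fun p _ => sum_congr rfl fun q _ => ?_
    simp only [Pi.star_apply, RCLike.star_def, Complex.conj_conj]
    ring
  rw [e] at h1
  have h2 : (star x ⬝ᵥ H *ᵥ x).im = 0 := hH.im_star_dotProduct_mulVec_self x
  exact Complex.pos_iff.2 ⟨h1, h2.symm⟩

/-- Simultaneous diagonalization of a metric and a Hermitian form. -/
lemma exists_diagonalization {H G : Matrix (Fin n) (Fin n) ℂ} (hH : H.PosDef)
    (hG : G.IsHermitian) : ∃ (A : Matrix (Fin n) (Fin n) ℂ) (lam : Fin n → ℝ),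
      A * H * Aᴴ = 1 ∧ A * G * Aᴴ = Matrix.diagonal fun p => (lam p : ℂ) := by
  set U : Matrix (Fin n) (Fin n) ℂ := (hH.isHermitian.eigenvectorUnitary : Matrix (Fin n) (Fin n) ℂ)
  set d := hH.isHermitian.eigenvalues with hd
  have hU : star U * H * U = Matrix.diagonal fun p => (d p : ℂ) := by
    have := hH.isHermitian.conjStarAlgAut_star_eigenvectorUnitary
    rw [Unitary.conjStarAlgAut_apply] at this
    rw [Unitary.coe_star, star_star] at this
    exact this
  set D : Matrix (Fin n) (Fin n) ℂ := Matrix.diagonal fun p => (((Real.sqrt (d p))⁻¹ : ℝ) : ℂ)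
  have hDs : Dᴴ = D := by
    rw [Matrix.diagonal_conjTranspose]
    congr 1
    funext p
    simp
  have h1 : (D * star U) * H * (D * star U)ᴴ = 1 := by
    rw [Matrix.conjTranspose_mul, hDs, ← Matrix.star_eq_conjTranspose, star_star]
    calc D * star U * H * (U * D) = D * (star U * H * U) * D := by simp only [Matrix.mul_assoc]
      _ = 1 := by
        rw [hU, Matrix.diagonal_mul_diagonal, Matrix.diagonal_mul_diagonal, ← Matrix.diagonal_one]
        congr 1
        funext p
        have hp : 0 < d p := hH.eigenvalues_pos p
        have hs : Real.sqrt (d p) * Real.sqrt (d p) = d p := Real.mul_self_sqrt hp.le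
        have hs0 : Real.sqrt (d p) ≠ 0 := (Real.sqrt_pos.2 hp).ne'
        rw [← Complex.ofReal_mul, ← Complex.ofReal_mul, ← Complex.ofReal_one]
        congr 1
        field_simp
        rw [sq, hs]
  set E := D * star U
  have hG' : (E * G * Eᴴ).IsHermitian := Matrix.isHermitian_mul_mul_conjTranspose E hG
  set W : Matrix (Fin n) (Fin n) ℂ := (hG'.eigenvectorUnitary : Matrix (Fin n) (Fin n) ℂ) with hWdef
  have hW : star W * (E * G * Eᴴ) * W = Matrix.diagonal fun p => (hG'.eigenvalues p : ℂ) := by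
    have := hG'.conjStarAlgAut_star_eigenvectorUnitary
    rw [Unitary.conjStarAlgAut_apply] at this
    rw [Unitary.coe_star, star_star] at this
    exact this
  have hW1 : star W * W = 1 := Unitary.coe_star_mul_self _
  refine ⟨star W * E, hG'.eigenvalues, ?_, ?_⟩
  · rw [Matrix.conjTranspose_mul, ← Matrix.star_eq_conjTranspose (star W), star_star]
    calc star W * E * H * (Eᴴ * W) = star W * (E * H * Eᴴ) * W := by simp only [Matrix.mul_assoc]
      _ = 1 := by rw [h1, Matrix.mul_one, hW1]
  · rw [Matrix.conjTranspose_mul, ← Matrix.star_eq_conjTranspose (star W), star_star, ← hW]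
    simp only [Matrix.mul_assoc]

end

section Normalizing
variable {A H : Matrix (Fin n) (Fin n) ℂ}

/-- The inverse of a matrix that takes `H` to the identity. -/
lemma mul_conjTranspose_mul_of_eq_one (h : A * H * Aᴴ = 1) : H * Aᴴ * A = 1 :=
  mul_eq_one_comm.1 (by rw [← Matrix.mul_assoc]; exact h)

lemma isUnit_det_of_eq_one (h : A * H * Aᴴ = 1) : IsUnit A.det :=
  Matrix.isUnit_det_of_left_inverse (mul_conjTranspose_mul_of_eq_one h)

lemma inv_eq_conjTranspose_mul (h : A * H * Aᴴ = 1) : H⁻¹ = Aᴴ * A :=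
  Matrix.inv_eq_right_inv (by rw [← Matrix.mul_assoc]; exact mul_conjTranspose_mul_of_eq_one h)

/-- The entries of an orthonormalizing matrix are bounded through the inverse of the metric, since
`H⁻¹ = Aᴴ A`. -/
lemma norm_entry_le (h : A * H * Aᴴ = 1) {K : ℝ} (hK : ∀ i, ‖H⁻¹ i i‖ ≤ K) (p i : Fin n) :
    ‖A p i‖ ≤ 1 + K := by
  have h1 := hK i
  have e : H⁻¹ i i = ((∑ q, ‖A q i‖ ^ 2 : ℝ) : ℂ) := by
    rw [inv_eq_conjTranspose_mul h]
    simp only [Matrix.mul_apply, Matrix.conjTranspose_apply, RCLike.star_def, Complex.conj_mul',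
      Complex.ofReal_sum, Complex.ofReal_pow]
  have h2 : ‖A p i‖ ^ 2 ≤ ∑ q, ‖A q i‖ ^ 2 :=
    single_le_sum (f := fun q => ‖A q i‖ ^ 2) (fun q _ => by positivity) (mem_univ p)
  rw [e, Complex.norm_real] at h1
  have h3 := h2.trans ((le_abs_self _).trans h1)
  nlinarith [sq_nonneg (‖A p i‖ - 1), norm_nonneg (A p i)]

end Normalizing

end Gram

/-! ### Bounds of jets on compact sets -/

section JetBounds
variable {X : Type*} [NormedAddCommGroup X] [NormedSpace ℝ X] {K K' : ℝ} {F G : X → ℂ} {x : X}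

lemma JetBound.mono (h : JetBound K F x) (hK : K ≤ K') : JetBound K' F x where
  contDiffAt := h.contDiffAt
  norm_le := h.norm_le.trans hK
  fderiv_le := h.fderiv_le.trans hK
  fderiv_fderiv_le := h.fderiv_fderiv_le.trans hK

lemma JetBound.add (hF : JetBound K F x) (hG : JetBound K' G x) :
    JetBound (K + K') (fun y => F y + G y) x := by
  have e : fderiv ℝ (fun y => F y + G y) =ᶠ[𝓝 x] fun y => fderiv ℝ F y + fderiv ℝ G y := by
    filter_upwards [hF.contDiffAt.eventually (by simp), hG.contDiffAt.eventually (by simp)]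
      with y h1 h2
    exact fderiv_fun_add (h1.differentiableAt (by simp)) (h2.differentiableAt (by simp))
  have d : ∀ {F : X → ℂ}, ContDiffAt ℝ 2 F x → DifferentiableAt ℝ (fderiv ℝ F) x := fun h =>
    (h.fderiv_right (m := 1) (by norm_num)).differentiableAt (by simp)
  refine ⟨hF.contDiffAt.add hG.contDiffAt, ?_, ?_, ?_⟩
  · exact (norm_add_le _ _).trans (add_le_add hF.norm_le hG.norm_le)
  · rw [e.eq_of_nhds]
    exact (norm_add_le _ _).trans (add_le_add hF.fderiv_le hG.fderiv_le)
  · rw [e.fderiv_eq, fderiv_fun_add (d hF.contDiffAt) (d hG.contDiffAt)]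
    have := norm_add_le (fderiv ℝ (fderiv ℝ F) x) (fderiv ℝ (fderiv ℝ G) x)
    have h1 := hF.fderiv_fderiv_le
    have h2 := hG.fderiv_fderiv_le
    linarith

lemma jetBound_const (c : ℂ) : JetBound ‖c‖ (fun _ : X => c) x where
  contDiffAt := contDiffAt_const
  norm_le := le_rfl
  fderiv_le := by simp
  fderiv_fderiv_le := by
    have : fderiv ℝ (fderiv ℝ fun _ : X => c) x = 0 := by simp
    rw [this, ContinuousLinearMap.opNorm_zero]
    exact norm_nonneg c

lemma JetBound.const_mul (hF : JetBound K F x) {c : ℂ} {r : ℝ} (hc : ‖c‖ ≤ r) :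
    JetBound (r * K) (fun y => c * F y) x := by
  have hr : 0 ≤ r := (norm_nonneg c).trans hc
  have e : fderiv ℝ (fun y => c * F y) =ᶠ[𝓝 x] fun y => c • fderiv ℝ F y := by
    filter_upwards [hF.contDiffAt.eventually (by simp)] with y h1
    exact fderiv_const_mul (h1.differentiableAt (by simp)) c
  have d : DifferentiableAt ℝ (fderiv ℝ F) x :=
    (hF.contDiffAt.fderiv_right (m := 1) (by norm_num)).differentiableAt (by simp)
  refine ⟨contDiffAt_const.mul hF.contDiffAt, ?_, ?_, ?_⟩
  · rw [norm_mul]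
    exact mul_le_mul hc hF.norm_le (norm_nonneg _) hr
  · rw [e.eq_of_nhds, norm_smul]
    exact mul_le_mul hc hF.fderiv_le (norm_nonneg _) hr
  · rw [e.fderiv_eq, fderiv_fun_const_smul d]
    refine ContinuousLinearMap.opNorm_le_bound _ (mul_nonneg hr hF.nonneg) fun w => ?_
    rw [smul_apply, norm_smul, mul_assoc]
    refine mul_le_mul hc ?_ (norm_nonneg _) hr
    exact ((fderiv ℝ (fderiv ℝ F) x).le_opNorm w).trans
      (mul_le_mul_of_nonneg_right hF.fderiv_fderiv_le (norm_nonneg w))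

lemma jetBound_sum {ι : Type*} (s : Finset ι) {c : ι → ℂ} {F : ι → X → ℂ} {r : ℝ}
    (hc : ∀ i, ‖c i‖ ≤ r) (hF : ∀ i, JetBound K (F i) x) :
    JetBound (#s * (r * K)) (fun y => ∑ i ∈ s, c i * F i y) x := by
  classical
  induction s using Finset.induction_on with
  | empty => simpa using jetBound_const (X := X) (x := x) 0
  | insert i s hi ih =>
    have := ((hF i).const_mul (hc i)).add ih
    simp only [sum_insert hi, card_insert_of_notMem hi]
    refine this.mono (le_of_eq ?_)
    push_cast
    ring

lemma exists_jetBound {s C : Set X} (hs : IsOpen s) (hF : ContDiffOn ℝ ∞ F s) (hC : IsCompact C)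
    (hCs : C ⊆ s) : ∃ K, ∀ x ∈ C, JetBound K F x := by
  have h0 : ∀ x ∈ s, ContDiffAt ℝ ∞ F x := fun x hx => hF.contDiffAt (hs.mem_nhds hx)
  have h1 : ∀ x ∈ s, ContDiffAt ℝ ∞ (fderiv ℝ F) x := fun x hx => (h0 x hx).fderiv_right (by simp)
  have h2 : ∀ x ∈ s, ContDiffAt ℝ ∞ (fderiv ℝ (fderiv ℝ F)) x := fun x hx =>
    (h1 x hx).fderiv_right (by simp)
  obtain ⟨a, ha⟩ := hC.exists_bound_of_continuousOn
    (fun x hx => (h0 x (hCs hx)).continuousAt.continuousWithinAt)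
  obtain ⟨b, hb⟩ := hC.exists_bound_of_continuousOn
    (fun x hx => (h1 x (hCs hx)).continuousAt.continuousWithinAt)
  obtain ⟨c, hc⟩ := hC.exists_bound_of_continuousOn (E := X →L[ℝ] X →L[ℝ] ℂ)
    (fun x hx => (h2 x (hCs hx)).continuousAt.continuousWithinAt)
  refine ⟨max a (max b c), fun x hx => ⟨contDiffAt_infty.1 (h0 x (hCs hx)) 2, ?_, ?_, ?_⟩⟩
  · exact (ha x hx).trans (le_max_left _ _)
  · exact (hb x hx).trans ((le_max_left _ _).trans (le_max_right _ _))
  · exact (hc x hx).trans ((le_max_right _ _).trans (le_max_right _ _))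

lemma exists_jetBound_family {ι : Type*} [Finite ι] {F : ι → X → ℂ} {s C : Set X} (hs : IsOpen s)
    (hF : ∀ i, ContDiffOn ℝ ∞ (F i) s) (hC : IsCompact C) (hCs : C ⊆ s) :
    ∃ K, ∀ i, ∀ x ∈ C, JetBound K (F i) x := by
  choose K hK using fun i => exists_jetBound hs (hF i) hC hCs
  obtain ⟨B, hB⟩ := Finite.exists_le K
  exact ⟨B, fun i x hx => (hK i x hx).mono (hB i)⟩

end JetBounds

/-! ### Derivatives of a function in the charts of the atlas -/

section HolomorphicChange
variable {n : ℕ} {F : Cn n → ℂ} {τ : Cn n → Cn n} {z v w : Cn n}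

lemma eq_sum_stdVec (v : Cn n) : v = ∑ i, v i • stdVec i := by
  ext j
  simp [stdVec, Finset.sum_apply, Pi.single_apply]

lemma fderiv_comp_holomorphic (hF : DifferentiableAt ℝ F (τ z)) (hτ : DifferentiableAt ℂ τ z) :
    fderiv ℝ (fun y => F (τ y)) z w = fderiv ℝ F (τ z) (fderiv ℂ τ z w) := by
  have h := hF.hasFDerivAt.comp z (hτ.hasFDerivAt.restrictScalars ℝ)
  rw [show (fun y => F (τ y)) = F ∘ τ from rfl, h.fderiv]
  rfl

lemma dz_comp_holomorphic (hF : DifferentiableAt ℝ F (τ z)) (hτ : DifferentiableAt ℂ τ z) :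
    dz v (fun y => F (τ y)) z = dz (fderiv ℂ τ z v) F (τ z) := by
  rw [dz, fderiv_comp_holomorphic hF hτ, fderiv_comp_holomorphic hF hτ, map_smul, dz]

lemma dzb_comp_holomorphic (hF : DifferentiableAt ℝ F (τ z)) (hτ : DifferentiableAt ℂ τ z) :
    dzb v (fun y => F (τ y)) z = dzb (fderiv ℂ τ z v) F (τ z) := by
  rw [dzb, fderiv_comp_holomorphic hF hτ, fderiv_comp_holomorphic hF hτ, map_smul, dzb]

lemma dzb_of_differentiableAt (hF : DifferentiableAt ℂ F z) : dzb v F z = 0 := by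
  have h : fderiv ℝ F z (Complex.I • v) = Complex.I * fderiv ℝ F z v := by
    rw [hF.fderiv_restrictScalars ℝ]
    exact map_smul (fderiv ℂ F z) Complex.I v
  rw [dzb, h, ← mul_assoc, Complex.I_mul_I]
  ring

lemma dzb_eq_sum (w : Cn n) (F : Cn n → ℂ) (y : Cn n) :
    dzb w F y = ∑ i, (starRingEnd ℂ) (w i) * dzb (stdVec i) F y := by
  conv_lhs => rw [eq_sum_stdVec w]
  exact dzb_sum_vec _ _ _

lemma dz_eq_sum (w : Cn n) (F : Cn n → ℂ) (y : Cn n) :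
    dz w F y = ∑ i, w i * dz (stdVec i) F y := by
  conv_lhs => rw [eq_sum_stdVec w]
  exact dz_sum_vec _ _ _

/-- The mixed second derivatives transform as a tensor under holomorphic changes of coordinates:
the second derivatives of the change of coordinates do not contribute. -/
lemma dz_dzb_comp_holomorphic (hF : ContDiffAt ℝ 2 F (τ z)) (hτ : ContDiffAt ℂ ω τ z) :
    dz v (dzb w fun y => F (τ y)) z = dz (fderiv ℂ τ z v) (dzb (fderiv ℂ τ z w) F) (τ z) := by
  have hτd : ∀ᶠ y in 𝓝 z, DifferentiableAt ℂ τ y :=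
    (hτ.eventually (by simp)).mono fun y hy => hy.differentiableAt (by simp)
  have hFd : ∀ᶠ y in 𝓝 z, DifferentiableAt ℝ F (τ y) :=
    hτ.continuousAt.eventually (eventually_differentiableAt (hF.of_le (by norm_num)))
  have hτ' : DifferentiableAt ℂ (fderiv ℂ τ) z :=
    (hτ.fderiv_right (m := ω) le_top).differentiableAt (by simp)
  have hh : ∀ i, DifferentiableAt ℂ (fun y => fderiv ℂ τ y w i) z := fun i =>
    ((EuclideanSpace.proj i : Cn n →L[ℂ] ℂ).differentiableAt).comp z
      (hτ'.clm_apply (differentiableAt_const w))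
  have hG : ∀ i, DifferentiableAt ℝ (dzb (stdVec i) F) (τ z) := fun i => differentiableAt_dzb hF
  have hGc : ∀ i, DifferentiableAt ℝ (fun y => dzb (stdVec i) F (τ y)) z := fun i =>
    (hG i).comp z (hτd.self_of_nhds.restrictScalars ℝ)
  have hhr : ∀ i, DifferentiableAt ℝ (fun y => fderiv ℂ τ y w i) z := fun i =>
    (hh i).restrictScalars ℝ
  have hhc : ∀ i, DifferentiableAt ℝ (fun y => (starRingEnd ℂ) (fderiv ℂ τ y w i)) z := fun i =>
    (Complex.conjCLE.differentiableAt).comp z (hhr i)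
  have e1 : dzb w (fun y => F (τ y)) =ᶠ[𝓝 z]
      fun y => ∑ i, (starRingEnd ℂ) (fderiv ℂ τ y w i) * dzb (stdVec i) F (τ y) := by
    filter_upwards [hτd, hFd] with y h1 h2
    rw [dzb_comp_holomorphic h2 h1, dzb_eq_sum]
  have e2 : dzb (fderiv ℂ τ z w) F =
      fun y => ∑ i, (starRingEnd ℂ) (fderiv ℂ τ z w i) * dzb (stdVec i) F y :=
    funext fun y => dzb_eq_sum _ _ _
  rw [dz_congr e1, e2, dz_sum _ fun i _ => (hhc i).fun_mul (hGc i),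
    dz_sum _ fun i _ => (hG i).const_mul _]
  refine sum_congr rfl fun i _ => ?_
  rw [dz_mul (hhc i) (hGc i), dz_const_mul _ (hG i), dz_conj (hhr i),
    dzb_of_differentiableAt (hh i), map_zero, zero_mul, zero_add,
    dz_comp_holomorphic (hG i) hτd.self_of_nhds]

end HolomorphicChange

section Charts
variable {n : ℕ} {M : Type*} [TopologicalSpace M] [ChartedSpace (Cn n) M]

lemma del_apply (u : M → ℝ) (p : M) (X : Tan n p) :
    del n u p X = dz (X : Cn n) (inChart n u p) (chartAt (Cn n) p p) := by
  refine Eq.trans ?_ (dz_eq_sum (X : Cn n) _ _).symm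
  rw [del, LinearMap.sum_apply]
  exact sum_congr rfl fun i _ => mul_comm _ _

lemma levi_apply {u : M → ℝ} {p : M} (h : ContDiffAt ℝ 2 (inChart n u p) (chartAt (Cn n) p p))
    (X Y : Tan n p) :
    levi n u p X Y = dz (X : Cn n) (dzb (Y : Cn n) (inChart n u p)) (chartAt (Cn n) p p) := by
  have e : dzb (Y : Cn n) (inChart n u p) = _ := funext (dzb_eq_sum (Y : Cn n) (inChart n u p))
  have hc : ∀ a b c : ℂ, c * (a * b) = a * (b * c) := fun a b c => by ring
  refine Eq.trans ?_ (dz_eq_sum (X : Cn n) _ _).symm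
  rw [e, levi]
  simp only [LinearMap.sum_apply]
  refine sum_congr rfl fun i _ => ?_
  rw [dz_sum _ fun j _ => (differentiableAt_dzb h).const_mul _, mul_sum]
  refine sum_congr rfl fun j _ => ?_
  rw [dz_const_mul _ (differentiableAt_dzb h)]
  exact hc _ _ _

/-- The differential of the inverse of the chart `e`, at the point with coordinate `z`. -/
def push (e : OpenPartialHomeomorph M (Cn n)) (z : Cn n) : Cn n →L[ℂ] Tan n (e.symm z) :=
  mfderiv 𝓘(ℂ, Cn n) 𝓘(ℂ, Cn n) e.symm z

variable {e : OpenPartialHomeomorph M (Cn n)} {z : Cn n}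

lemma push_eq_sum (v : Cn n) : push e z v = ∑ i, v i • chartVec e z i := by
  conv_lhs => rw [eq_sum_stdVec v, map_sum]
  exact sum_congr rfl fun i _ => map_smul (push e z) _ _

lemma eventually_mem_source (hz : z ∈ e.target) :
    ∀ᶠ y in 𝓝 z, e.symm y ∈ (chartAt (Cn n) (e.symm z)).source :=
  (e.continuousAt_symm hz).eventually
    ((chartAt (Cn n) (e.symm z)).open_source.mem_nhds (mem_chart_source _ _))

lemma inChart_eventuallyEq (u : M → ℝ) (hz : z ∈ e.target) :
    (fun y => ((u (e.symm y) : ℝ) : ℂ)) =ᶠ[𝓝 z]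
      fun y => inChart n u (e.symm z) (chartAt (Cn n) (e.symm z) (e.symm y)) := by
  filter_upwards [eventually_mem_source hz] with y hy
  rw [inChart, OpenPartialHomeomorph.left_inv _ hy]

lemma contDiffAt_inChart {u : M → ℝ} (hu : ContMDiff 𝓘(ℝ, Cn n) 𝓘(ℝ, ℝ) 4 u) (p : M) :
    ContDiffAt ℝ 4 (fun y => u ((chartAt (Cn n) p).symm y)) (chartAt (Cn n) p p) := by
  have h := (contMDiffAt_iff.1 (hu p)).2
  simpa [Function.comp_def, contDiffWithinAt_univ, chartAt_self_eq] using h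

variable [IsManifold 𝓘(ℂ, Cn n) ω M]

lemma contDiffAt_transition (he : e ∈ atlas (Cn n) M) {p : M} {y : Cn n} (hy : y ∈ e.target)
    (hp : e.symm y ∈ (chartAt (Cn n) p).source) :
    ContDiffAt ℂ ω (fun y => chartAt (Cn n) p (e.symm y)) y := by
  have h := HasGroupoid.compatible (G := contDiffGroupoid ω 𝓘(ℂ, Cn n)) he
    (chart_mem_atlas (Cn n) p)
  have h2 : ContDiffOn ℂ ω (e.symm.trans (chartAt (Cn n) p)) (e.symm.trans (chartAt (Cn n) p)).source := by
    have := (mem_groupoid_of_pregroupoid.1 h).1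
    simpa [contDiffPregroupoid] using this
  exact h2.contDiffAt ((e.symm.trans (chartAt (Cn n) p)).open_source.mem_nhds (by simp [hy, hp]))

lemma push_apply (he : e ∈ atlas (Cn n) M) (hz : z ∈ e.target) (v : Cn n) :
    push e z v = fderiv ℂ (fun y => chartAt (Cn n) (e.symm z) (e.symm y)) z v := by
  have : IsManifold 𝓘(ℂ, Cn n) 1 M := IsManifold.of_le (n := ω) le_top
  have hd : MDifferentiableAt 𝓘(ℂ, Cn n) 𝓘(ℂ, Cn n) e.symm z :=
    (mdifferentiable_of_mem_atlas he).mdifferentiableAt_symm hz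
  refine (DFunLike.congr_fun hd.mfderiv v).trans ?_
  simp [writtenInExtChartAt, Function.comp_def, chartAt_self_eq]
  rfl

lemma contDiffAt_comp_symm (he : e ∈ atlas (Cn n) M) (hz : z ∈ e.target) {u : M → ℝ}
    (hu : ContMDiff 𝓘(ℝ, Cn n) 𝓘(ℝ, ℝ) 4 u) : ContDiffAt ℝ 4 (fun y => u (e.symm y)) z := by
  have h1 := contDiffAt_inChart hu (e.symm z)
  have h2 : ContDiffAt ℝ 4 (fun y => chartAt (Cn n) (e.symm z) (e.symm y)) z :=
    ((contDiffAt_transition he hz (mem_chart_source _ _)).restrict_scalars ℝ).of_le le_top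
  refine (ContDiffAt.comp z (g := fun y => u ((chartAt (Cn n) (e.symm z)).symm y)) h1 h2).congr_of_eventuallyEq ?_
  filter_upwards [eventually_mem_source hz] with y hy
  simp [OpenPartialHomeomorph.left_inv _ hy]

lemma del_push (he : e ∈ atlas (Cn n) M) (hz : z ∈ e.target) {u : M → ℝ}
    (hu : ContMDiff 𝓘(ℝ, Cn n) 𝓘(ℝ, ℝ) 4 u) (v : Cn n) :
    del n u (e.symm z) (push e z v) = dz v (fun y => ((u (e.symm y) : ℝ) : ℂ)) z := by
  have h1 : ContDiffAt ℝ 4 (inChart n u (e.symm z)) (chartAt (Cn n) (e.symm z) (e.symm z)) :=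
    contDiffAt_ofReal (contDiffAt_inChart hu (e.symm z))
  have h2 := contDiffAt_transition he hz (mem_chart_source (Cn n) (e.symm z))
  rw [del_apply, push_apply he hz, dz_congr (inChart_eventuallyEq u hz)]
  exact (dz_comp_holomorphic (τ := fun y => chartAt (Cn n) (e.symm z) (e.symm y))
    (h1.differentiableAt (by simp)) (h2.differentiableAt (by simp))).symm

lemma levi_push (he : e ∈ atlas (Cn n) M) (hz : z ∈ e.target) {u : M → ℝ}
    (hu : ContMDiff 𝓘(ℝ, Cn n) 𝓘(ℝ, ℝ) 4 u) (v w : Cn n) :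
    levi n u (e.symm z) (push e z v) (push e z w) =
      dz v (dzb w (fun y => ((u (e.symm y) : ℝ) : ℂ))) z := by
  have h1 : ContDiffAt ℝ 2 (inChart n u (e.symm z)) (chartAt (Cn n) (e.symm z) (e.symm z)) :=
    (contDiffAt_ofReal (contDiffAt_inChart hu (e.symm z))).of_le (by norm_num)
  have h2 := contDiffAt_transition he hz (mem_chart_source (Cn n) (e.symm z))
  rw [levi_apply h1, push_apply he hz, push_apply he hz,
    dz_congr (dzb_eventuallyEq (inChart_eventuallyEq u hz))]
  exact (dz_dzb_comp_holomorphic (τ := fun y => chartAt (Cn n) (e.symm z) (e.symm y)) h1 h2).symm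

/-- The differential of the inverse of a chart is invertible. -/
lemma mfderiv_push (he : e ∈ atlas (Cn n) M) (hz : z ∈ e.target) (v : Cn n) :
    mfderiv 𝓘(ℂ, Cn n) 𝓘(ℂ, Cn n) e (e.symm z) (push e z v) = v := by
  have : IsManifold 𝓘(ℂ, Cn n) 1 M := IsManifold.of_le (n := ω) le_top
  have h := (mdifferentiable_of_mem_atlas (I := 𝓘(ℂ, Cn n)) he).comp_symm_deriv hz
  exact DFunLike.congr_fun h v

lemma push_injective (he : e ∈ atlas (Cn n) M) (hz : z ∈ e.target) :
    Function.Injective (push e z) := fun v w h => by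
  have h1 := mfderiv_push he hz v
  rw [h] at h1
  exact h1.symm.trans (mfderiv_push he hz w)

lemma chartCov_push (he : e ∈ atlas (Cn n) M) (hz : z ∈ e.target) (ξ v : Cn n) :
    chartCov e z ξ (push e z v) = ∑ i, ξ i * v i := by
  refine (congrArg (fun w : Cn n => (∑ i, ξ i • ((EuclideanSpace.proj i : Cn n →L[ℂ] ℂ) :
    Cn n →ₗ[ℂ] ℂ)) w) (mfderiv_push he hz v)).trans ?_
  simp

lemma push_surjective (he : e ∈ atlas (Cn n) M) (hz : z ∈ e.target) :
    Function.Surjective (push e z) :=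
  (LinearMap.injective_iff_surjective (f := show Cn n →ₗ[ℂ] Cn n from
    (push e z).toLinearMap)).1 (push_injective he hz)

/-- `Du` in the chart `e`, as an argument of the right-hand side. -/
lemma del_eq_chartCov (he : e ∈ atlas (Cn n) M) (hz : z ∈ e.target) {u : M → ℝ}
    (hu : ContMDiff 𝓘(ℝ, Cn n) 𝓘(ℝ, ℝ) 4 u) {ξ : Cn n}
    (hξ : ∀ i, ξ i = dz (stdVec i) (fun y => ((u (e.symm y) : ℝ) : ℂ)) z) :
    del n u (e.symm z) = chartCov e z ξ := by
  refine LinearMap.ext fun X => ?_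
  obtain ⟨v, rfl⟩ := push_surjective he hz X
  rw [chartCov_push he hz, del_push he hz hu, dz_eq_sum]
  exact sum_congr rfl fun i _ => by rw [hξ, mul_comm]

end Charts

/-! ### Invariance of the norms and of the equation -/

section Invariance
variable {n : ℕ} {M : Type*} [TopologicalSpace M] [ChartedSpace (Cn n) M]
variable {Ω : HermitianMetric n M} {χ : FormFamily n M} {ψ : PositiveRHS n M} {a : OneZeroForm n M}
  {u : M → ℝ} {p : M}

lemma exists_eq_sum_coordVec (w : Fin n → Tan n p) :
    ∃ A : Matrix (Fin n) (Fin n) ℂ, w = fun q => ∑ i, A q i • coordVec p i :=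
  ⟨fun q i => (show Cn n from w q) i, funext fun q => eq_sum_stdVec (show Cn n from w q)⟩

lemma isUnit_det_of_gram {A : Matrix (Fin n) (Fin n) ℂ} {h : Sesq n p}
    (hw : IsUnit (gram h fun q => ∑ i, A q i • coordVec p i).det) : IsUnit A.det := by
  rw [gram_sum_smul, Matrix.det_mul, Matrix.det_mul] at hw
  exact isUnit_of_mul_isUnit_left (isUnit_of_mul_isUnit_left hw)

/-- The norm of `∂u`, computed in an arbitrary frame. -/
lemma normDel_eq {w : Fin n → Tan n p} (hw : IsUnit (gram (Ω.form p) w).det) :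
    normDel Ω u p = Real.sqrt (dualSq (gram (Ω.form p) w) fun q => del n u p (w q)).re := by
  obtain ⟨A, rfl⟩ := exists_eq_sum_coordVec w
  have hA := isUnit_det_of_gram hw
  have e : (fun q => del n u p (∑ i, A q i • coordVec p i)) =
      A.mulVec fun i => del n u p (coordVec p i) := by
    funext q
    rw [map_sum]
    exact sum_congr rfl fun i _ => map_smul _ _ _
  rw [e, gram_sum_smul, dualSq_change hA, normDel, dualSq]
  simp only [mul_assoc]
  rfl

/-- The norm of `∂∂̄u`, computed in an arbitrary frame. -/
lemma normLevi_eq {w : Fin n → Tan n p} (hw : IsUnit (gram (Ω.form p) w).det) :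
    normLevi Ω u p = Real.sqrt (Matrix.trace ((gram (Ω.form p) w)⁻¹ * gram (levi n u p) w *
      (gram (Ω.form p) w)⁻¹ * (gram (levi n u p) w).conjTranspose)).re := by
  obtain ⟨A, rfl⟩ := exists_eq_sum_coordVec w
  have hA := isUnit_det_of_gram hw
  rw [gram_sum_smul, gram_sum_smul, trace_change hA]
  rfl

/-- The equation in an arbitrary frame: both sides scale by the same determinant. -/
lemma IsSolution.hessCoeff_eq {k : ℕ} (hkn : k ≤ n) (h : IsSolution k Ω χ a ψ u)
    (w : Fin n → Tan n p) :
    hessCoeff k (gram (Ω.form p) w) (gram (gTilde χ a u p) w) =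
      n.choose k * (ψ.toFun p (del n u p) (u p) : ℝ) * (gram (Ω.form p) w).det := by
  obtain ⟨A, rfl⟩ := exists_eq_sum_coordVec w
  have h1 : hessCoeff k (gram (Ω.form p) (coordVec p)) (gram (gTilde χ a u p) (coordVec p)) = _ :=
    hessCoeff_of_toForm_eq hkn (h p)
  rw [gram_sum_smul, gram_sum_smul, hessCoeff_change, h1, Matrix.det_mul, Matrix.det_mul]
  change _ * _ * (_ * _ * (gram (Ω.form p) (coordVec p)).det) = _
  ring

lemma gram_isHermitian {h : Sesq n p} (hh : ∀ X Y, h Y X = (starRingEnd ℂ) (h X Y))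
    (w : Fin n → Tan n p) : (gram h w).IsHermitian := by
  ext i j
  exact (hh _ _).symm

end Invariance

section PosDef
open scoped ComplexOrder
variable {n : ℕ} {H : Matrix (Fin n) (Fin n) ℂ}

lemma isUnit_det_of_posDef (hH : H.PosDef) : IsUnit H.det := hH.det_pos.ne'.isUnit

lemma det_eq_re_of_posDef (hH : H.PosDef) : 0 < H.det.re ∧ H.det = (H.det.re : ℂ) := by
  obtain ⟨h1, h2⟩ := Complex.pos_iff.1 hH.det_pos
  exact ⟨h1, Complex.ext rfl (by simp [← h2])⟩

lemma dualSq_re_nonneg (hH : H.PosDef) (α : Fin n → ℂ) : 0 ≤ (dualSq H α).re := by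
  obtain ⟨A, lam, h1, -⟩ := exists_diagonalization hH (Matrix.isHermitian_zero (n := Fin n))
  rw [← dualSq_change (isUnit_det_of_eq_one h1), h1, dualSq_one, Complex.ofReal_re]
  positivity

end PosDef

/-! ### The metric in a chart -/

section ChartMetric
open scoped ComplexOrder
variable {n : ℕ} {M : Type*} [TopologicalSpace M] [ChartedSpace (Cn n) M]
variable (Ω : HermitianMetric n M) (e : OpenPartialHomeomorph M (Cn n))

/-- The matrix of the metric in the chart `e`. -/
def metricMatrix (x : Cn n) : Matrix (Fin n) (Fin n) ℂ :=
  gram (Ω.form (e.symm x)) (chartVec e x)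

lemma metricMatrix_isHermitian (x : Cn n) : (metricMatrix Ω e x).IsHermitian :=
  gram_isHermitian (Ω.herm _) _

variable {Ω e}

lemma form_push (B : ∀ p : M, Sesq n p) (x y y' : Cn n) :
    B (e.symm x) (push e x y) (push e x y') =
      ∑ i, ∑ j, gram (B (e.symm x)) (chartVec e x) i j * y i * (starRingEnd ℂ) (y' j) := by
  rw [push_eq_sum, push_eq_sum, sesq_sum_smul]

lemma contDiffOn_metricMatrix (he : e ∈ atlas (Cn n) M) (i j : Fin n) :
    ContDiffOn ℝ ∞ (fun x => metricMatrix Ω e x i j) e.target := Ω.smooth e he i j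

lemma contDiffOn_det_metricMatrix (he : e ∈ atlas (Cn n) M) :
    ContDiffOn ℝ ∞ (fun x => (metricMatrix Ω e x).det) e.target := fun _ hx =>
  (contDiffAt_det (k := ⊤) (M := fun i j x => metricMatrix Ω e x i j) fun i j =>
    (contDiffOn_metricMatrix he i j).contDiffAt (e.open_target.mem_nhds hx)).contDiffWithinAt

variable [IsManifold 𝓘(ℂ, Cn n) ω M]

lemma push_ne_zero (he : e ∈ atlas (Cn n) M) {x : Cn n} (hx : x ∈ e.target) {y : Cn n}
    (hy : y ≠ 0) : push e x y ≠ 0 := fun h =>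
  hy (push_injective he hx (h.trans (map_zero _).symm))

lemma metricMatrix_posDef (he : e ∈ atlas (Cn n) M) {x : Cn n} (hx : x ∈ e.target) :
    (metricMatrix Ω e x).PosDef := by
  refine posDef_of_pos (metricMatrix_isHermitian Ω e x) fun y hy => ?_
  have hy' : (WithLp.toLp 2 y : Cn n) ≠ 0 := by simpa using hy
  have := Ω.pos _ _ (push_ne_zero he hx hy')
  rwa [form_push Ω.form] at this

lemma contDiffOn_metricMatrix_inv (he : e ∈ atlas (Cn n) M) (i j : Fin n) :
    ContDiffOn ℝ ∞ (fun x => (metricMatrix Ω e x)⁻¹ i j) e.target := by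
  have hadj : ContDiffOn ℝ ∞ (fun x => (metricMatrix Ω e x).adjugate i j) e.target := by
    intro x hx
    simp only [Matrix.adjugate_apply]
    refine (contDiffAt_det (k := ⊤) (M := fun r s x =>
      (metricMatrix Ω e x).updateRow j (Pi.single i 1) r s) fun r s => ?_).contDiffWithinAt
    by_cases hr : r = j
    · subst hr
      simp only [Matrix.updateRow_self]
      exact contDiffAt_const
    · simp only [Matrix.updateRow_ne hr]
      exact (contDiffOn_metricMatrix he r s).contDiffAt (e.open_target.mem_nhds hx)
  have hdet : ContDiffOn ℝ ∞ (fun x => (metricMatrix Ω e x).det⁻¹) e.target :=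
    (contDiffOn_det_metricMatrix he).inv fun x hx =>
      (isUnit_det_of_posDef (metricMatrix_posDef he hx)).ne_zero
  refine (hdet.mul hadj).congr fun x hx => ?_
  rw [Matrix.inv_def, Matrix.smul_apply, Ring.inverse_eq_inv', smul_eq_mul]

end ChartMetric

/-! ### The given data in a chart -/

section ChartData
open scoped Matrix ComplexOrder
variable {n : ℕ} {M : Type*} [TopologicalSpace M] [ChartedSpace (Cn n) M]

/-- The hypotheses on the function `u`. -/
structure Admissible (k : ℕ) (Ω : HermitianMetric n M) (ε : ℝ) (χ : FormFamily n M)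
    (ψ : PositiveRHS n M) (a : OneZeroForm n M) (K₀ K₁ : ℝ) (u : M → ℝ) : Prop where
  smooth : ContMDiff 𝓘(ℝ, Cn n) 𝓘(ℝ, ℝ) 4 u
  psh : IsPsh χ a u
  sol : IsSolution k Ω χ a ψ u
  lower : LowerBound ε Ω χ u
  bound : ∀ p, |u p| ≤ K₀
  grad : ∀ p, normDel Ω u p ≤ K₁

variable (k : ℕ) (Ω : HermitianMetric n M) (χ : FormFamily n M) (ψ : PositiveRHS n M)
  (a : OneZeroForm n M) (e : OpenPartialHomeomorph M (Cn n))

/-- The logarithm of `C(n,k) ψ det Ω` in the chart `e`. -/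
def logRHS (y : Cn n × (Cn n × ℝ)) : ℝ :=
  Real.log (n.choose k * ψ.toFun (e.symm y.1) (chartCov e y.1 y.2.1) y.2.2) +
    Real.log (metricMatrix Ω e y.1).det.re

/-- Bounds for the given data in the chart `e`, at the point with coordinate `z`, for values of the
unknown function bounded by `K₀` and covectors bounded by `R`. -/
structure ChartBounds (κ K₀ : ℝ) (z : Cn n) : Prop where
  metric : ∀ i j, JetBound κ (fun x => metricMatrix Ω e x i j) z
  inverse : ∀ i j, JetBound κ (fun x => (metricMatrix Ω e x)⁻¹ i j) z
  family : ∀ i j t, |t| ≤ K₀ → JetBound κ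
    (fun q : Cn n × ℝ => χ.form (e.symm q.1) q.2 (chartVec e q.1 i) (chartVec e q.1 j)) (z, t)
  covector : ∀ i, JetBound κ (fun x => a.form (e.symm x) (chartVec e x i)) z
  logDet : |Real.log (metricMatrix Ω e z).det.re| ≤ κ

variable {k Ω χ ψ a e}

variable [IsManifold 𝓘(ℂ, Cn n) ω M]

lemma contDiffOn_det_re (he : e ∈ atlas (Cn n) M) :
    ContDiffOn ℝ ∞ (fun x => Real.log (metricMatrix Ω e x).det.re) e.target :=
  ContDiffOn.log (Complex.reCLM.contDiff.comp_contDiffOn (contDiffOn_det_metricMatrix he))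
    fun _ hx => (det_eq_re_of_posDef (metricMatrix_posDef he hx)).1.ne'

lemma exists_chartBounds (he : e ∈ atlas (Cn n) M) {C : Set (Cn n)} (hC : IsCompact C)
    (hCe : C ⊆ e.target) (K₀ : ℝ) : ∃ κ, 1 ≤ κ ∧ ∀ z ∈ C, ChartBounds Ω χ a e κ K₀ z := by
  obtain ⟨κ₁, h₁⟩ := exists_jetBound_family (ι := Fin n × Fin n) e.open_target
    (fun i => contDiffOn_metricMatrix (Ω := Ω) he i.1 i.2) hC hCe
  obtain ⟨κ₂, h₂⟩ := exists_jetBound_family (ι := Fin n × Fin n) e.open_target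
    (fun i => contDiffOn_metricMatrix_inv (Ω := Ω) he i.1 i.2) hC hCe
  obtain ⟨κ₃, h₃⟩ := exists_jetBound_family (ι := Fin n × Fin n)
    (e.open_target.prod isOpen_univ) (fun i => χ.smooth e he i.1 i.2)
    (hC.prod (isCompact_Icc (a := -K₀) (b := K₀))) (Set.prod_mono hCe (Set.subset_univ _))
  obtain ⟨κ₄, h₄⟩ := exists_jetBound_family e.open_target (a.smooth e he) hC hCe
  obtain ⟨κ₅, h₅⟩ := hC.exists_bound_of_continuousOn
    ((contDiffOn_det_re (Ω := Ω) he).continuousOn.mono hCe)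
  have hκ : ∀ i ∈ [(1 : ℝ), κ₁, κ₂, κ₃, κ₄, κ₅], i ≤ 1 + |κ₁| + |κ₂| + |κ₃| + |κ₄| + |κ₅| := by
    have := le_abs_self κ₁
    have := le_abs_self κ₂
    have := le_abs_self κ₃
    have := le_abs_self κ₄
    have := le_abs_self κ₅
    have := abs_nonneg κ₁
    have := abs_nonneg κ₂
    have := abs_nonneg κ₃
    have := abs_nonneg κ₄
    have := abs_nonneg κ₅
    simp only [List.mem_cons, List.not_mem_nil, or_false, forall_eq_or_imp, forall_eq]
    refine ⟨?_, ?_, ?_, ?_, ?_, ?_⟩ <;> linarith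
  simp only [List.mem_cons, List.not_mem_nil, or_false, forall_eq_or_imp, forall_eq] at hκ
  obtain ⟨g0, g1, g2, g3, g4, g5⟩ := hκ
  refine ⟨_, g0, fun z hz => ⟨fun i j => ?_, fun i j => ?_, fun i j t ht => ?_, fun i => ?_, ?_⟩⟩
  · exact (h₁ (i, j) z hz).mono g1
  · exact (h₂ (i, j) z hz).mono g2
  · exact (h₃ (i, j) (z, t) ⟨hz, abs_le.1 ht⟩).mono g3
  · exact (h₄ i z hz).mono g4
  · exact (h₅ z hz).trans g5

lemma exists_logRHS_bound {k : ℕ} (hkn : k ≤ n) (he : e ∈ atlas (Cn n) M) {C : Set (Cn n)}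
    (hC : IsCompact C) (hCe : C ⊆ e.target) (K₀ R : ℝ) :
    ∃ κ, ∀ z ∈ C, ∀ (ξ : Cn n) (t : ℝ), ‖ξ‖ ≤ R → |t| ≤ K₀ →
      JetBound κ (fun y => (logRHS k Ω ψ e y : ℂ)) (z, (ξ, t)) := by
  have hc : (0 : ℝ) < n.choose k := by exact_mod_cast Nat.choose_pos hkn
  have h1 : ContDiffOn ℝ ∞ (logRHS k Ω ψ e) (e.target ×ˢ Set.univ) :=
    (ContDiffOn.log (contDiffOn_const.mul (ψ.smooth e he))
      fun y _ => (mul_pos hc (ψ.pos _ _ _)).ne').add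
      ((contDiffOn_det_re he).comp contDiffOn_fst fun y hy => hy.1)
  have h2 : ContDiffOn ℝ ∞ (fun y => (logRHS k Ω ψ e y : ℂ)) (e.target ×ˢ Set.univ) :=
    Complex.ofRealCLM.contDiff.comp_contDiffOn h1
  obtain ⟨κ, hκ⟩ := exists_jetBound (e.open_target.prod isOpen_univ) h2
    (hC.prod ((isCompact_closedBall (0 : Cn n) R).prod (isCompact_Icc (a := -K₀) (b := K₀))))
    (Set.prod_mono hCe (Set.subset_univ _))
  exact ⟨κ, fun z hz ξ t hξ ht => hκ _ ⟨hz, by simpa using hξ, abs_le.1 ht⟩⟩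

end ChartData

/-! ### The local data in a frame -/

section Frame
open scoped Matrix ComplexOrder
variable {n : ℕ} {M : Type*} [TopologicalSpace M] [ChartedSpace (Cn n) M]
variable (k : ℕ) (Ω : HermitianMetric n M) (χ : FormFamily n M) (ψ : PositiveRHS n M)
  (a : OneZeroForm n M) (u : M → ℝ) (e : OpenPartialHomeomorph M (Cn n))
  (z : Cn n) (A : Matrix (Fin n) (Fin n) ℂ) (lam : Fin n → ℝ) (o : Fin n)

/-- The constant frame with the rows of `A` as components in the chart. -/
def frame (p : Fin n) : Cn n := ∑ i, A p i • stdVec i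

/-- The local data in the chart `e`, at the point with coordinate `z`, in the constant frame given
by the rows of `A`. -/
def localData : LocalData n where
  z := z
  o := o
  lam := lam
  v := frame A
  -- the matrix `H Aᴴ` is the inverse of `A` when `A` is orthonormal at `z`
  w q := ∑ i, (metricMatrix Ω e z * Aᴴ) i q • stdVec i
  h p q x := (A * metricMatrix Ω e x * Aᴴ) p q
  P l m x := (A * metricMatrix Ω e x * Aᴴ)⁻¹ l m
  χ p q y := (A * gram (χ.form (e.symm y.1) y.2) (chartVec e y.1) * Aᴴ) p q
  a p x := ∑ i, A p i * a.form (e.symm x) (chartVec e x i)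
  -- the summand normalizes the determinant of the metric at `z` to `1`
  f y := logRHS k Ω ψ e y - Real.log (metricMatrix Ω e z).det.re
  u x := u (e.symm x)

lemma norm_sum_stdVec_le {c : Fin n → ℂ} {r : ℝ} (hc : ∀ i, ‖c i‖ ≤ r) :
    ‖∑ i, c i • (stdVec i : Cn n)‖ ≤ n * r := by
  refine (norm_sum_le _ _).trans ((sum_le_card_nsmul univ _ r fun i _ => ?_).trans_eq (by simp))
  rw [norm_smul, stdVec, PiLp.norm_single, norm_one, mul_one]
  exact hc i

lemma mul_mul_conjTranspose_apply (B : Matrix (Fin n) (Fin n) ℂ) (p q : Fin n) :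
    (A * B * Aᴴ) p q = ∑ i : Fin n × Fin n, (A p i.1 * (starRingEnd ℂ) (A q i.2)) * B i.1 i.2 := by
  rw [Fintype.sum_prod_type, Matrix.mul_apply]
  simp only [Matrix.mul_apply, sum_mul]
  rw [sum_comm]
  refine sum_congr rfl fun i _ => sum_congr rfl fun j _ => ?_
  rw [Matrix.conjTranspose_apply, RCLike.star_def]
  ring

lemma jetBound_mul_mul_conjTranspose {X : Type*} [NormedAddCommGroup X] [NormedSpace ℝ X]
    {A : Matrix (Fin n) (Fin n) ℂ} {B : X → Matrix (Fin n) (Fin n) ℂ} {x : X} {r κ : ℝ}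
    (hA : ∀ p i, ‖A p i‖ ≤ r) (hB : ∀ i j, JetBound κ (fun y => B y i j) x) (p q : Fin n) :
    JetBound (n ^ 2 * (r ^ 2 * κ)) (fun y => (A * B y * Aᴴ) p q) x := by
  simp only [mul_mul_conjTranspose_apply]
  have h := jetBound_sum (x := x) (univ : Finset (Fin n × Fin n)) (r := r ^ 2)
    (c := fun i => A p i.1 * (starRingEnd ℂ) (A q i.2)) (F := fun i y => B y i.1 i.2)
    (fun i => by
      rw [norm_mul, RCLike.norm_conj, sq]
      exact mul_le_mul (hA _ _) (hA _ _) (norm_nonneg _) ((norm_nonneg _).trans (hA p i.1)))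
    (fun i => hB i.1 i.2)
  refine h.mono (le_of_eq ?_)
  rw [card_univ, Fintype.card_prod, Fintype.card_fin]
  push_cast
  ring

variable {k Ω χ ψ a u e z A lam o}

lemma push_frame (x : Cn n) (p : Fin n) : push e x (frame A p) = ∑ i, A p i • chartVec e x i := by
  rw [frame, map_sum]
  exact sum_congr rfl fun i _ => map_smul (push e x) _ _

lemma gram_push_frame (B : ∀ p : M, Sesq n p) (x : Cn n) :
    gram (B (e.symm x)) (fun p => push e x (frame A p)) =
      A * gram (B (e.symm x)) (chartVec e x) * Aᴴ := by
  rw [← gram_sum_smul]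
  congr 1
  exact funext fun p => push_frame x p

lemma localData_h (x : Cn n) : (Matrix.of fun p q => (localData k Ω χ ψ a u e z A lam o).h p q x) =
    gram (Ω.form (e.symm x)) (fun p => push e x (frame A p)) := by
  rw [gram_push_frame Ω.form]; rfl

lemma localData_a (x : Cn n) (p : Fin n) :
    (localData k Ω χ ψ a u e z A lam o).a p x = a.form (e.symm x) (push e x (frame A p)) := by
  rw [push_frame, map_sum]
  change ∑ i, A p i • a.form (e.symm x) (chartVec e x i) = _
  exact sum_congr rfl fun i _ => (map_smul (a.form (e.symm x)) _ _).symm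

variable [IsManifold 𝓘(ℂ, Cn n) ω M]

lemma localData_U (he : e ∈ atlas (Cn n) M) (hu : ContMDiff 𝓘(ℝ, Cn n) 𝓘(ℝ, ℝ) 4 u) {x : Cn n}
    (hx : x ∈ e.target) (p : Fin n) :
    (localData k Ω χ ψ a u e z A lam o).U p x = del n u (e.symm x) (push e x (frame A p)) :=
  (del_push he hx hu _).symm

lemma localData_g (he : e ∈ atlas (Cn n) M) (hu : ContMDiff 𝓘(ℝ, Cn n) 𝓘(ℝ, ℝ) 4 u) {x : Cn n}
    (hx : x ∈ e.target) (p q : Fin n) : (localData k Ω χ ψ a u e z A lam o).g p q x =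
      gTilde χ a u (e.symm x) (push e x (frame A p)) (push e x (frame A q)) := by
  have hX : (localData k Ω χ ψ a u e z A lam o).X p q x =
      χ.form (e.symm x) (u (e.symm x)) (push e x (frame A p)) (push e x (frame A q)) :=
    (congrFun (congrFun (gram_push_frame (A := A) (fun y => χ.form y (u y)) x) p) q).symm
  have hb : (localData k Ω χ ψ a u e z A lam o).b p q x = levi n u (e.symm x) (push e x (frame A p)) (push e x (frame A q)) :=
    (levi_push he hx hu _ _).symm
  rw [LocalData.g, hX, hb, localData_U he hu hx, localData_U he hu hx, localData_a, localData_a]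
  rfl

end Frame

section FrameProperties
open scoped Matrix ComplexOrder
variable {n : ℕ} {M : Type*} [TopologicalSpace M] [ChartedSpace (Cn n) M]
  [IsManifold 𝓘(ℂ, Cn n) ω M]
variable {k : ℕ} {Ω : HermitianMetric n M} {ε : ℝ} {χ : FormFamily n M} {ψ : PositiveRHS n M}
  {a : OneZeroForm n M} {K₀ K₁ : ℝ} {u : M → ℝ} {e : OpenPartialHomeomorph M (Cn n)}
  {z : Cn n} {A : Matrix (Fin n) (Fin n) ℂ} {lam : Fin n → ℝ} {o : Fin n}

lemma gram_push_frame_posDef (he : e ∈ atlas (Cn n) M) (hA : IsUnit A.det) {x : Cn n}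
    (hx : x ∈ e.target) : (gram (Ω.form (e.symm x)) fun p => push e x (frame A p)).PosDef := by
  rw [gram_push_frame Ω.form]
  exact (metricMatrix_posDef (Ω := Ω) he hx).mul_mul_conjTranspose_same
    (Matrix.vecMul_injective_of_isUnit ((Matrix.isUnit_iff_isUnit_det A).2 hA))

/-- In the local data, `Γ` is the square of the norm of `∂u`. -/
lemma localData_Γ (he : e ∈ atlas (Cn n) M) (hu : ContMDiff 𝓘(ℝ, Cn n) 𝓘(ℝ, ℝ) 4 u)
    (hA : IsUnit A.det) {x : Cn n} (hx : x ∈ e.target) :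
    ((localData k Ω χ ψ a u e z A lam o).Γ x).re = normDel Ω u (e.symm x) ^ 2 := by
  have hP := gram_push_frame_posDef (Ω := Ω) he hA hx
  rw [normDel_eq (isUnit_det_of_posDef hP), Real.sq_sqrt (dualSq_re_nonneg hP _), dualSq,
    gram_push_frame Ω.form, LocalData.Γ]
  simp only [localData_U he hu hx]
  rfl

lemma localData_φ (he : e ∈ atlas (Cn n) M) (hu : ContMDiff 𝓘(ℝ, Cn n) 𝓘(ℝ, ℝ) 4 u)
    (hA : IsUnit A.det) {x : Cn n} (hx : x ∈ e.target) (N B : ℝ) :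
    ((localData k Ω χ ψ a u e z A lam o).φ N B K₀ x).re =
      N * normDel Ω u (e.symm x) ^ 2 + Real.exp (B * (K₀ - u (e.symm x))) := by
  rw [LocalData.φ, LocalData.η_eq, Complex.add_re, Complex.re_ofReal_mul,
    localData_Γ he hu hA hx, Complex.ofReal_re]
  rfl

section Normalized
variable (hAH : A * metricMatrix Ω e z * Aᴴ = 1)
include hAH

lemma gram_push_frame_self : gram (Ω.form (e.symm z)) (fun p => push e z (frame A p)) = 1 := by
  rw [gram_push_frame Ω.form]; exact hAH

lemma form_push_frame_self (p : Fin n) :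
    Ω.form (e.symm z) (push e z (frame A p)) (push e z (frame A p)) = 1 := by
  have := congrFun (congrFun (gram_push_frame_self hAH) p) p
  rwa [Matrix.one_apply_eq] at this

lemma norm_del_frame_le (h : normDel Ω u (e.symm z) ≤ K₁) (q : Fin n) :
    ‖del n u (e.symm z) (push e z (frame A q))‖ ≤ K₁ := by
  have h1 := gram_push_frame_self hAH
  rw [normDel_eq (w := fun p => push e z (frame A p)) (by rw [h1]; simp), h1, dualSq_one,
    Complex.ofReal_re] at h
  refine le_trans (Real.le_sqrt_of_sq_le ?_) h
  exact single_le_sum (f := fun q => ‖del n u (e.symm z) (push e z (frame A q))‖ ^ 2)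
    (fun q _ => by positivity) (mem_univ q)

lemma normLevi_eq_sum : normLevi Ω u (e.symm z) = Real.sqrt (∑ p, ∑ q,
    ‖levi n u (e.symm z) (push e z (frame A p)) (push e z (frame A q))‖ ^ 2) := by
  have h1 := gram_push_frame_self hAH
  rw [normLevi_eq (w := fun p => push e z (frame A p)) (by rw [h1]; simp), h1, trace_one,
    Complex.ofReal_re]
  rfl

/-- The covector with components `∂u` in the chart, in terms of the components in the frame. -/
lemma localData_c_fst (i : Fin n) (x : Cn n) :
    ((localData k Ω χ ψ a u e z A lam o).c x).1 i =
      dz (stdVec i) (fun y => ((u (e.symm y) : ℝ) : ℂ)) x := by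
  set d : Fin n → ℂ := fun j => dz (stdVec j) (fun y => ((u (e.symm y) : ℝ) : ℂ)) x with hd
  have hU : ∀ q, (localData k Ω χ ψ a u e z A lam o).U q x = (A *ᵥ d) q := fun q =>
    dz_sum_vec univ (A q) stdVec
  have h1 : ((localData k Ω χ ψ a u e z A lam o).c x).1 i =
      ((metricMatrix Ω e z * Aᴴ) *ᵥ (A *ᵥ d)) i := by
    have h2 : ∀ q, (localData k Ω χ ψ a u e z A lam o).w q i = (metricMatrix Ω e z * Aᴴ) i q :=
      fun q => (congrArg (fun y : Cn n => y i) (eq_sum_stdVec (WithLp.toLp 2 fun j =>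
        (metricMatrix Ω e z * Aᴴ) j q))).symm
    simp only [LocalData.c, WithLp.ofLp_sum, WithLp.ofLp_smul, Finset.sum_apply, Pi.smul_apply,
      smul_eq_mul, h2, hU]
    rw [Matrix.mulVec, dotProduct]
    exact sum_congr rfl fun q _ => mul_comm _ _
  rw [h1, Matrix.mulVec_mulVec, mul_conjTranspose_mul_of_eq_one hAH, Matrix.one_mulVec]

/-- The equation for the local data. The constant `log det` of the metric at the point accounts for
the determinant of the frame, since `|det A|² det H = 1` there. -/
lemma localData_solves (hkn : k ≤ n) (he : e ∈ atlas (Cn n) M) (hz : z ∈ e.target)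
    (h : Admissible k Ω ε χ ψ a K₀ K₁ u) : (localData k Ω χ ψ a u e z A lam o).Solves k := by
  filter_upwards [e.open_target.mem_nhds hz] with x hx
  have hg : (Matrix.of fun p q => (localData k Ω χ ψ a u e z A lam o).g p q x) =
      gram (gTilde χ a u (e.symm x)) (fun p => push e x (frame A p)) := by
    ext p q
    exact localData_g he h.smooth hx p q
  have hc : del n u (e.symm x) = chartCov e x ((localData k Ω χ ψ a u e z A lam o).c x).1 :=
    del_eq_chartCov he hx h.smooth fun i => localData_c_fst hAH i x
  obtain ⟨d1, d2⟩ := det_eq_re_of_posDef (metricMatrix_posDef (Ω := Ω) he hx)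
  obtain ⟨d3, d4⟩ := det_eq_re_of_posDef (metricMatrix_posDef (Ω := Ω) he hz)
  have hdet : A.det * Aᴴ.det * (metricMatrix Ω e z).det = 1 := by
    have := congrArg Matrix.det hAH
    rw [Matrix.det_mul, Matrix.det_mul, Matrix.det_one] at this
    rw [← this]; ring
  have hψ := ψ.pos (e.symm x) (del n u (e.symm x)) (u (e.symm x))
  have hch : (0 : ℝ) < n.choose k := by exact_mod_cast Nat.choose_pos hkn
  rw [localData_h, hg, h.sol.hessCoeff_eq hkn, gram_push_frame Ω.form]
  change _ * (A * metricMatrix Ω e x * Aᴴ).det =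
    Complex.exp ((logRHS k Ω ψ e (x, (localData k Ω χ ψ a u e z A lam o).c x) -
      Real.log (metricMatrix Ω e z).det.re : ℝ) : ℂ)
  rw [logRHS, ← Complex.ofReal_exp]
  change _ = ((Real.exp (Real.log (n.choose k * ψ.toFun (e.symm x)
    (chartCov e x ((localData k Ω χ ψ a u e z A lam o).c x).1) (u (e.symm x))) +
      Real.log (metricMatrix Ω e x).det.re - Real.log (metricMatrix Ω e z).det.re) : ℝ) : ℂ)
  rw [← hc, Real.exp_sub, Real.exp_add, Real.exp_log (mul_pos hch hψ), Real.exp_log d1,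
    Real.exp_log d3, Complex.ofReal_div, Complex.ofReal_mul, ← d2, ← d4, eq_div_iff
    (isUnit_det_of_posDef (metricMatrix_posDef (Ω := Ω) he hz)).ne_zero, Matrix.det_mul,
    Matrix.det_mul]
  push_cast
  linear_combination (n.choose k * (ψ.toFun (e.symm x) (del n u (e.symm x)) (u (e.symm x)) : ℂ) *
    (metricMatrix Ω e x).det) * hdet

end Normalized

/-- The local data of an admissible function are regular, with a constant that does not depend on
the function. -/
lemma localData_regular {κ κ' R K : ℝ} (he : e ∈ atlas (Cn n) M) (hz : z ∈ e.target)
    (h : Admissible k Ω ε χ ψ a K₀ K₁ u) (hκ1 : 1 ≤ κ) (hκ : ChartBounds Ω χ a e κ K₀ z)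
    (hκ' : ∀ (ξ : Cn n) (t : ℝ), ‖ξ‖ ≤ R → |t| ≤ K₀ →
      JetBound κ' (fun y => (logRHS k Ω ψ e y : ℂ)) (z, (ξ, t)))
    (hAH : A * metricMatrix Ω e z * Aᴴ = 1)
    (hAG : A * gram (gTilde χ a u (e.symm z)) (chartVec e z) * Aᴴ =
      Matrix.diagonal fun p => (lam p : ℂ))
    (ho : ∀ p, lam p ≤ lam o) (hR : n * (n * (n * (κ * (1 + κ))) * K₁) ≤ R)
    (hK1 : 1 ≤ K) (hK2 : n * (1 + κ) ≤ K) (hK3 : n * (n * (κ * (1 + κ))) ≤ K)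
    (hK4 : n ^ 2 * ((1 + κ) ^ 2 * κ) ≤ K)
    (hK5 : n ^ 2 * ((n * (κ * (1 + κ))) ^ 2 * κ) ≤ K) (hK6 : n * ((1 + κ) * κ) ≤ K)
    (hK7 : κ' + κ ≤ K) (hK8 : K₁ ≤ K) :
    (localData k Ω χ ψ a u e z A lam o).Regular K ε := by
  have hu := h.smooth
  have hA : ∀ p i, ‖A p i‖ ≤ 1 + κ := norm_entry_le hAH fun i => (hκ.inverse i i).norm_le
  have hAdet := isUnit_det_of_eq_one hAH
  have hW : ∀ i q, ‖(metricMatrix Ω e z * Aᴴ) i q‖ ≤ n * (κ * (1 + κ)) := by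
    intro i q
    rw [Matrix.mul_apply]
    refine (norm_sum_le _ _).trans ((sum_le_card_nsmul univ _ (κ * (1 + κ)) fun j _ => ?_).trans_eq
      (by simp))
    rw [norm_mul, Matrix.conjTranspose_apply, norm_star]
    exact mul_le_mul (hκ.metric i j).norm_le (hA _ _) (norm_nonneg _) (by linarith)
  have hwq : ∀ q, ‖(localData k Ω χ ψ a u e z A lam o).w q‖ ≤ n * (n * (κ * (1 + κ))) := fun q =>
    norm_sum_stdVec_le fun i => hW i q
  have hUq : ∀ q, ‖(localData k Ω χ ψ a u e z A lam o).U q z‖ ≤ K₁ := fun q => by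
    rw [localData_U he hu hz]
    exact norm_del_frame_le hAH (h.grad _) q
  have hdiag : ∀ p q, (localData k Ω χ ψ a u e z A lam o).g p q z =
      if p = q then (lam p : ℂ) else 0 := by
    intro p q
    rw [localData_g he hu hz]
    have e1 := (gram_push_frame (A := A) (gTilde χ a u) z).trans hAG
    exact (congrFun (congrFun e1 p) q).trans (Matrix.diagonal_apply _ _ _)
  have hΩ := form_push_frame_self hAH
  have hκ0 : 0 ≤ κ := by linarith
  exact {
    one_le := hK1
    reg_u := contDiffAt_comp_symm he hz hu
    v_le := fun p => (norm_sum_stdVec_le fun i => hA p i).trans hK2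
    w_le := fun q => (hwq q).trans hK3
    lam_pos := fun p => by
      have h1 := hdiag p p
      rw [if_pos rfl, localData_g he hu hz] at h1
      have h2 : push e z (frame A p) ≠ 0 := fun h0 => by
        have := hΩ p
        rw [h0, map_zero] at this
        simp at this
      have h3 := h.psh (e.symm z) _ h2
      rw [h1, Complex.ofReal_re] at h3
      exact h3
    lam_le := ho
    jet_h := fun p q => (jetBound_mul_mul_conjTranspose hA hκ.metric p q).mono hK4
    jet_P := fun p q => by
      have e1 : (localData k Ω χ ψ a u e z A lam o).P p q = fun x =>
          ((metricMatrix Ω e z * Aᴴ)ᴴ * (metricMatrix Ω e x)⁻¹ * (metricMatrix Ω e z * Aᴴ)ᴴᴴ) p q := by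
        have e2 : A⁻¹ = metricMatrix Ω e z * Aᴴ :=
          Matrix.inv_eq_left_inv (mul_conjTranspose_mul_of_eq_one hAH)
        funext x
        change (A * metricMatrix Ω e x * Aᴴ)⁻¹ p q = _
        rw [Matrix.mul_inv_rev, Matrix.mul_inv_rev, ← Matrix.conjTranspose_nonsing_inv, e2,
          Matrix.conjTranspose_conjTranspose, Matrix.mul_assoc]
      rw [e1]
      refine (jetBound_mul_mul_conjTranspose (r := n * (κ * (1 + κ))) (fun i j => ?_)
        hκ.inverse p q).mono hK5
      rw [Matrix.conjTranspose_apply, norm_star]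
      exact hW j i
    jet_χ := fun p q => (jetBound_mul_mul_conjTranspose hA
      (fun i j => hκ.family i j _ (h.bound _)) p q).mono hK4
    jet_a := fun p => by
      refine (jetBound_sum univ (hA p) hκ.covector).mono ?_
      rw [card_univ, Fintype.card_fin]
      exact hK6
    jet_f := by
      have h1 : ‖((localData k Ω χ ψ a u e z A lam o).c z).1‖ ≤ R := by
        change ‖∑ q, (localData k Ω χ ψ a u e z A lam o).U q z •
          (localData k Ω χ ψ a u e z A lam o).w q‖ ≤ R
        refine (norm_sum_le _ _).trans ((sum_le_card_nsmul univ _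
          (n * (n * (κ * (1 + κ))) * K₁) fun q _ => ?_).trans ?_)
        · rw [norm_smul, mul_comm]
          exact mul_le_mul (hwq q) (hUq q) (norm_nonneg _) (by positivity)
        · simpa using hR
      have h2 := (hκ' _ _ h1 (h.bound (e.symm z))).add
        (jetBound_const (-(Real.log (metricMatrix Ω e z).det.re : ℂ)))
      have e1 : (fun y => ((localData k Ω χ ψ a u e z A lam o).f y : ℂ)) = fun y =>
          (logRHS k Ω ψ e y : ℂ) + -(Real.log (metricMatrix Ω e z).det.re : ℂ) := by
        funext y
        change ((logRHS k Ω ψ e y - Real.log (metricMatrix Ω e z).det.re : ℝ) : ℂ) = _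
        push_cast
        ring
      rw [e1]
      refine h2.mono (le_trans ?_ hK7)
      rw [norm_neg, Complex.norm_real]
      exact add_le_add le_rfl hκ.logDet
    herm_h := Eventually.of_forall fun x p q =>
      ((Matrix.isHermitian_mul_mul_conjTranspose A
        (metricMatrix_isHermitian Ω e x)).apply q p).symm
    herm_P := Eventually.of_forall fun x p q =>
      ((Matrix.isHermitian_mul_mul_conjTranspose A
        (metricMatrix_isHermitian Ω e x)).inv.apply q p).symm
    herm_χ := Eventually.of_forall fun x t p q =>
      ((Matrix.isHermitian_mul_mul_conjTranspose A
        (gram_isHermitian (χ.herm (e.symm x) t) (chartVec e x))).apply q p).symm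
    h_one := fun p q => by
      change (A * metricMatrix Ω e z * Aᴴ) p q = _
      rw [hAH, Matrix.one_apply]
    P_one := fun p q => by
      change (A * metricMatrix Ω e z * Aᴴ)⁻¹ p q = _
      rw [hAH, inv_one, Matrix.one_apply]
    g_diag := hdiag
    U_le := fun q => (hUq q).trans hK8
    χ_ge := fun p => by
      have h1 := h.lower (e.symm z) (push e z (frame A p))
      rw [hΩ p, Complex.one_re, mul_one] at h1
      have e1 := congrFun (congrFun (gram_push_frame (A := A) (e := e)
        (fun y => χ.form y (u y)) z) p) p
      exact h1.trans_eq (congrArg Complex.re e1) }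

end FrameProperties

/-! ### Existence of frames and of a maximum -/

section Global
open scoped Matrix ComplexOrder
variable {n : ℕ} {M : Type*} [TopologicalSpace M] [ChartedSpace (Cn n) M]
variable {k : ℕ} {Ω : HermitianMetric n M} {ε : ℝ} {χ : FormFamily n M} {ψ : PositiveRHS n M}
  {a : OneZeroForm n M} {K₀ K₁ : ℝ} {u : M → ℝ} {e : OpenPartialHomeomorph M (Cn n)}
  {z : Cn n}

lemma levi_herm (hu : ContMDiff 𝓘(ℝ, Cn n) 𝓘(ℝ, ℝ) 4 u) (p : M) (X Y : Tan n p) :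
    levi n u p Y X = (starRingEnd ℂ) (levi n u p X Y) := by
  have h4 := contDiffAt_inChart hu p
  have h2 : ContDiffAt ℝ 2 (inChart n u p) (chartAt (Cn n) p p) :=
    (contDiffAt_ofReal h4).of_le (by norm_num)
  have e1 : dzb (X : Cn n) (inChart n u p) =ᶠ[𝓝 (chartAt (Cn n) p p)]
      fun x => (starRingEnd ℂ) (dz (X : Cn n) (inChart n u p) x) :=
    (h4.eventually (by simp)).mono fun x hx => dzb_ofReal (hx.differentiableAt (by simp))
  rw [levi_apply h2, levi_apply h2]
  refine (dz_congr e1).trans ?_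
  refine (dz_conj (differentiableAt_dz h2)).trans ?_
  exact congrArg _ (dzb_dz_comm h2)

lemma gTilde_herm (hu : ContMDiff 𝓘(ℝ, Cn n) 𝓘(ℝ, ℝ) 4 u) (p : M) (X Y : Tan n p) :
    gTilde χ a u p Y X = (starRingEnd ℂ) (gTilde χ a u p X Y) := by
  change χ.form p (u p) Y X + a.form p Y * (starRingEnd ℂ) (del n u p X) +
      del n u p Y * (starRingEnd ℂ) (a.form p X) + levi n u p Y X =
    (starRingEnd ℂ) (χ.form p (u p) X Y + a.form p X * (starRingEnd ℂ) (del n u p Y) +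
      del n u p X * (starRingEnd ℂ) (a.form p Y) + levi n u p X Y)
  rw [χ.herm p (u p) X Y, levi_herm hu p X Y]
  simp only [map_add, map_mul, Complex.conj_conj]
  ring

variable (Ω u) in
/-- The auxiliary function `φ = N |∂u|² + exp (B (K₀ - u))` on the manifold. -/
def auxFun (N B K₀ : ℝ) (p : M) : ℝ := N * normDel Ω u p ^ 2 + Real.exp (B * (K₀ - u p))

variable (Ω χ a u) in
/-- The quotient of `gTilde` and the metric on the vector `X`, times `e^φ`. -/
def quotient (N B K₀ : ℝ) (p : M) (X : Tan n p) : ℝ :=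
  (gTilde χ a u p X X).re / (Ω.form p X X).re * Real.exp (auxFun Ω u N B K₀ p)

lemma quotient_smul (N B : ℝ) (p : M) (X : Tan n p) {c : ℂ} (hc : c ≠ 0) :
    quotient Ω χ a u N B K₀ p (c • X) = quotient Ω χ a u N B K₀ p X := by
  have h : ∀ B : Sesq n p, (B (c • X) (c • X)).re = ‖c‖ ^ 2 * (B X X).re := by
    intro B
    rw [LinearMap.map_smulₛₗ, LinearMap.map_smulₛₗ₂, RingHom.id_apply, smul_eq_mul, smul_eq_mul,
      ← mul_assoc, Complex.conj_mul', ← Complex.ofReal_pow, Complex.re_ofReal_mul]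
  have hc' : ‖c‖ ^ 2 ≠ 0 := by positivity
  rw [quotient, quotient, h, h, mul_div_mul_left _ _ hc']

lemma auxFun_nonneg {N : ℝ} (hN : 0 ≤ N) (B : ℝ) (p : M) : 0 ≤ auxFun Ω u N B K₀ p :=
  add_nonneg (mul_nonneg hN (sq_nonneg _)) (Real.exp_pos _).le

lemma Admissible.auxFun_le (h : Admissible k Ω ε χ ψ a K₀ K₁ u) {N B : ℝ} (hN : 0 ≤ N)
    (hB : 0 ≤ B) (p : M) : auxFun Ω u N B K₀ p ≤ N * K₁ ^ 2 + Real.exp (B * (2 * K₀)) := by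
  have h1 := (abs_le.1 (h.bound p)).1
  have h2 : normDel Ω u p ^ 2 ≤ K₁ ^ 2 := pow_le_pow_left₀ (Real.sqrt_nonneg _) (h.grad p) 2
  exact add_le_add (mul_le_mul_of_nonneg_left h2 hN)
    (Real.exp_le_exp.2 (mul_le_mul_of_nonneg_left (by linarith) hB))

variable [IsManifold 𝓘(ℂ, Cn n) ω M]

/-- At each point there is a frame that is orthonormal for the metric and diagonalizes `gTilde`. -/
lemma exists_frame (hn : 0 < n) (he : e ∈ atlas (Cn n) M) (hz : z ∈ e.target)
    (hu : ContMDiff 𝓘(ℝ, Cn n) 𝓘(ℝ, ℝ) 4 u) :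
    ∃ (A : Matrix (Fin n) (Fin n) ℂ) (lam : Fin n → ℝ) (o : Fin n),
      A * metricMatrix Ω e z * Aᴴ = 1 ∧
      A * gram (gTilde χ a u (e.symm z)) (chartVec e z) * Aᴴ =
        Matrix.diagonal (fun p => (lam p : ℂ)) ∧ ∀ p, lam p ≤ lam o := by
  obtain ⟨A, lam, h1, h2⟩ := exists_diagonalization (metricMatrix_posDef (Ω := Ω) he hz)
    (gram_isHermitian (gTilde_herm (χ := χ) (a := a) hu (e.symm z)) (chartVec e z))
  have : Nonempty (Fin n) := ⟨⟨0, hn⟩⟩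
  obtain ⟨o, ho⟩ := Finite.exists_max lam
  exact ⟨A, lam, o, h1, h2, ho⟩

/-- Regularity of the local data, uniformly on compact subsets of a chart. -/
lemma exists_regular (hn : 0 < n) (hkn : k ≤ n) (he : e ∈ atlas (Cn n) M) {C : Set (Cn n)}
    (hC : IsCompact C) (hCe : C ⊆ e.target) :
    ∃ K : ℝ, ∀ K' : ℝ, K ≤ K' → ∀ u, Admissible k Ω ε χ ψ a K₀ K₁ u → ∀ z ∈ C,
      ∃ (A : Matrix (Fin n) (Fin n) ℂ) (lam : Fin n → ℝ) (o : Fin n),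
        A * metricMatrix Ω e z * Aᴴ = 1 ∧
        A * gram (gTilde χ a u (e.symm z)) (chartVec e z) * Aᴴ =
          Matrix.diagonal (fun p => (lam p : ℂ)) ∧ (∀ p, lam p ≤ lam o) ∧
        (localData k Ω χ ψ a u e z A lam o).Regular K' ε := by
  obtain ⟨κ, hκ1, hκ⟩ := exists_chartBounds (Ω := Ω) (χ := χ) (a := a) he hC hCe K₀
  set R := n * (n * (n * (κ * (1 + κ))) * K₁)
  obtain ⟨κ', hκ'⟩ := exists_logRHS_bound (Ω := Ω) (ψ := ψ) hkn he hC hCe K₀ R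
  obtain ⟨K, hK⟩ := Finite.exists_le ![1, n * (1 + κ), n * (n * (κ * (1 + κ))),
    n ^ 2 * ((1 + κ) ^ 2 * κ), n ^ 2 * ((n * (κ * (1 + κ))) ^ 2 * κ), n * ((1 + κ) * κ),
    κ' + κ, K₁]
  refine ⟨K, fun K' hK' u h z hz => ?_⟩
  obtain ⟨A, lam, o, h1, h2, h3⟩ := exists_frame (Ω := Ω) (χ := χ) (a := a) hn he (hCe hz) h.smooth
  exact ⟨A, lam, o, h1, h2, h3, localData_regular he (hCe hz) h hκ1 (hκ z hz) (hκ' z hz) h1 h2 h3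
    le_rfl ((hK 0).trans hK') ((hK 1).trans hK') ((hK 2).trans hK') ((hK 3).trans hK')
    ((hK 4).trans hK') ((hK 5).trans hK') ((hK 6).trans hK') ((hK 7).trans hK')⟩

/-- In a frame that is orthonormal for the metric and diagonalizes `gTilde`, the largest eigenvalue
bounds `gTilde`. -/
lemma gTilde_le_top {A : Matrix (Fin n) (Fin n) ℂ} {lam : Fin n → ℝ} {o : Fin n}
    (he : e ∈ atlas (Cn n) M) (hz : z ∈ e.target)
    (hAH : A * metricMatrix Ω e z * Aᴴ = 1)
    (hAG : A * gram (gTilde χ a u (e.symm z)) (chartVec e z) * Aᴴ =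
      Matrix.diagonal fun p => (lam p : ℂ)) (ho : ∀ p, lam p ≤ lam o) (X : Tan n (e.symm z)) :
    (gTilde χ a u (e.symm z) X X).re ≤ lam o * (Ω.form (e.symm z) X X).re := by
  obtain ⟨y, rfl⟩ := push_surjective he hz X
  have hA := isUnit_det_of_eq_one hAH
  obtain ⟨c, hc⟩ : ∃ c : Fin n → ℂ, push e z y = ∑ p, c p • push e z (frame A p) := by
    refine ⟨Matrix.vecMul y A⁻¹, ?_⟩
    simp only [push_frame, smul_sum, smul_smul]
    rw [sum_comm, push_eq_sum]
    refine sum_congr rfl fun i _ => ?_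
    rw [← sum_smul]
    congr 1
    change _ = (Matrix.vecMul (Matrix.vecMul y A⁻¹) A) i
    rw [Matrix.vecMul_vecMul, Matrix.nonsing_inv_mul _ hA, Matrix.vecMul_one]
  have e1 : gram (Ω.form (e.symm z)) (fun p => push e z (frame A p)) = 1 :=
    gram_push_frame_self hAH
  have e2 : gram (gTilde χ a u (e.symm z)) (fun p => push e z (frame A p)) =
      Matrix.diagonal fun p => (lam p : ℂ) :=
    (gram_push_frame (A := A) (e := e) (gTilde χ a u) z).trans hAG
  have hd : ∀ d : Fin n → ℝ, (∑ p, ∑ q, Matrix.diagonal (fun p => (d p : ℂ)) p q * c p *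
      (starRingEnd ℂ) (c q)).re = ∑ p, d p * ‖c p‖ ^ 2 := by
    intro d
    rw [Complex.re_sum]
    refine sum_congr rfl fun p _ => ?_
    rw [sum_eq_single p (fun q _ hq => by rw [Matrix.diagonal_apply_ne _ hq.symm]; ring)
      (fun h => absurd (mem_univ p) h), Matrix.diagonal_apply_eq, mul_assoc, Complex.mul_conj',
      ← Complex.ofReal_pow, ← Complex.ofReal_mul, Complex.ofReal_re]
  have h1 : (1 : Matrix (Fin n) (Fin n) ℂ) = Matrix.diagonal fun _ => ((1 : ℝ) : ℂ) := by
    rw [← Matrix.diagonal_one]; simp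
  rw [hc, sesq_sum_smul, sesq_sum_smul, e1, e2, h1, hd, hd, mul_sum]
  refine sum_le_sum fun p _ => ?_
  rw [one_mul]
  exact mul_le_mul_of_nonneg_right (ho p) (by positivity)

lemma continuousOn_gram_gTilde (he : e ∈ atlas (Cn n) M)
    (hu : ContMDiff 𝓘(ℝ, Cn n) 𝓘(ℝ, ℝ) 4 u) (i j : Fin n) :
    ContinuousOn (fun x => gram (gTilde χ a u (e.symm x)) (chartVec e x) i j) e.target := by
  have hu4 : ∀ x ∈ e.target, ContDiffAt ℝ 4 (fun y => ((u (e.symm y) : ℝ) : ℂ)) x := fun x hx =>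
    contDiffAt_ofReal (contDiffAt_comp_symm he hx hu)
  have h1 : ∀ i, ContinuousOn (fun x => del n u (e.symm x) (chartVec e x i)) e.target := fun i =>
    ContinuousOn.congr (f := dz (stdVec i) (fun y => ((u (e.symm y) : ℝ) : ℂ)))
      (fun x hx => (contDiffAt_dz (m := 3) (by norm_num; exact hu4 x hx)).continuousAt.continuousWithinAt)
      fun x hx => del_push he hx hu _
  have h2 : ContinuousOn (fun x => levi n u (e.symm x) (chartVec e x i) (chartVec e x j)) e.target :=
    ContinuousOn.congr (f := dz (stdVec i) (dzb (stdVec j) (fun y => ((u (e.symm y) : ℝ) : ℂ))))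
      (fun x hx => (contDiffAt_dz (m := 2) (contDiffAt_dzb (m := 3)
        (by norm_num; exact hu4 x hx))).continuousAt.continuousWithinAt)
      fun x hx => levi_push he hx hu _ _
  have h3 : ContinuousOn (fun x => χ.form (e.symm x) (u (e.symm x)) (chartVec e x i)
      (chartVec e x j)) e.target :=
    (χ.smooth e he i j).continuousOn.comp (f := fun x => (x, u (e.symm x)))
      (continuousOn_id.prodMk fun x hx =>
        (contDiffAt_comp_symm he hx hu).continuousAt.continuousWithinAt)
      fun x hx => ⟨hx, Set.mem_univ _⟩
  have ha : ∀ i, ContinuousOn (fun x => a.form (e.symm x) (chartVec e x i)) e.target := fun i =>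
    (a.smooth e he i).continuousOn
  exact ((h3.add ((ha i).mul (Complex.continuous_conj.comp_continuousOn (h1 j)))).add
    ((h1 i).mul (Complex.continuous_conj.comp_continuousOn (ha j)))).add h2

lemma continuousOn_auxFun (he : e ∈ atlas (Cn n) M) (hu : ContMDiff 𝓘(ℝ, Cn n) 𝓘(ℝ, ℝ) 4 u)
    (N B : ℝ) : ContinuousOn (fun x => auxFun Ω u N B K₀ (e.symm x)) e.target := by
  have hd : ∀ i, ContinuousOn (dz (stdVec i) (fun y => ((u (e.symm y) : ℝ) : ℂ))) e.target :=
    fun i x hx => (contDiffAt_dz (m := 3) (by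
      norm_num; exact contDiffAt_ofReal (contDiffAt_comp_symm he hx hu))).continuousAt.continuousWithinAt
  have h1 : ContinuousOn (fun x => normDel Ω u (e.symm x) ^ 2) e.target := by
    refine ContinuousOn.congr (f := fun x => (dualSq (metricMatrix Ω e x)
      fun q => dz (stdVec q) (fun y => ((u (e.symm y) : ℝ) : ℂ)) x).re) ?_ fun x hx => ?_
    · refine Complex.continuous_re.comp_continuousOn
        (continuousOn_finsetSum _ fun l _ => continuousOn_finsetSum _ fun m _ => ?_)
      exact (contDiffOn_metricMatrix_inv he l m).continuousOn.mul
        ((hd m).mul (Complex.continuous_conj.comp_continuousOn (hd l)))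
    · have hP := metricMatrix_posDef (Ω := Ω) he hx
      simp only [normDel_eq (w := chartVec e x) (isUnit_det_of_posDef hP)]
      refine (Real.sq_sqrt (dualSq_re_nonneg hP _)).trans ?_
      congr 2
      exact funext fun q => del_push he hx hu _
  have h2 : ContinuousOn (fun x => u (e.symm x)) e.target := fun x hx =>
    (contDiffAt_comp_symm he hx hu).continuousAt.continuousWithinAt
  exact (continuousOn_const.mul h1).add
    (Real.continuous_exp.comp_continuousOn (continuousOn_const.mul (continuousOn_const.sub h2)))

lemma continuousOn_quotient (he : e ∈ atlas (Cn n) M)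
    (hu : ContMDiff 𝓘(ℝ, Cn n) 𝓘(ℝ, ℝ) 4 u) (N B : ℝ) :
    ContinuousOn (fun y : Cn n × Cn n => quotient Ω χ a u N B K₀ (e.symm y.1) (push e y.1 y.2))
      (e.target ×ˢ {0}ᶜ) := by
  have key : ∀ S : ∀ p : M, Sesq n p,
      (∀ i j, ContinuousOn (fun x => gram (S (e.symm x)) (chartVec e x) i j) e.target) →
      ContinuousOn (fun y : Cn n × Cn n => (S (e.symm y.1) (push e y.1 y.2) (push e y.1 y.2)).re)
        (e.target ×ˢ {0}ᶜ) := by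
    intro S hS
    simp only [form_push S]
    refine Complex.continuous_re.comp_continuousOn
      (continuousOn_finsetSum _ fun i _ => continuousOn_finsetSum _ fun j _ => ?_)
    have hc : ∀ i : Fin n, Continuous fun y : Cn n × Cn n => y.2 i := fun i =>
      (EuclideanSpace.proj i : Cn n →L[ℂ] ℂ).continuous.comp continuous_snd
    exact (((hS i j).comp continuousOn_fst fun y hy => hy.1).mul (hc i).continuousOn).mul
      (Complex.continuous_conj.comp (hc j)).continuousOn
  refine ((key (gTilde χ a u) (continuousOn_gram_gTilde he hu)).div
    (key Ω.form fun i j => (Ω.smooth e he i j).continuousOn) fun y hy => ?_).mul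
    (Real.continuous_exp.comp_continuousOn
      ((continuousOn_auxFun he hu N B).comp continuousOn_fst fun y hy => hy.1))
  exact (Ω.pos _ _ (push_ne_zero he hy.1 hy.2)).ne'

end Global

section Cover
variable {n : ℕ} {M : Type*} [TopologicalSpace M] [ChartedSpace (Cn n) M]

variable (n M) in
/-- A compact manifold is covered by finitely many closed balls in charts. -/
lemma exists_cover [CompactSpace M] : ∃ (s : Finset M) (r : M → ℝ), (∀ p, 0 < r p) ∧
    (∀ p, Metric.closedBall (chartAt (Cn n) p p) (r p) ⊆ (chartAt (Cn n) p).target) ∧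
    ∀ q : M, ∃ p ∈ s, ∃ x ∈ Metric.closedBall (chartAt (Cn n) p p) (r p),
      (chartAt (Cn n) p).symm x = q := by
  have h1 : ∀ p : M, ∃ r : ℝ, 0 < r ∧
      Metric.closedBall (chartAt (Cn n) p p) r ⊆ (chartAt (Cn n) p).target := fun p =>
    Metric.nhds_basis_closedBall.mem_iff.1
      ((chartAt (Cn n) p).open_target.mem_nhds (mem_chart_target (Cn n) p))
  choose r hr hrt using h1
  obtain ⟨s, hs⟩ := CompactSpace.elim_nhds_subcover
    (fun p : M => (chartAt (Cn n) p).source ∩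
      chartAt (Cn n) p ⁻¹' Metric.closedBall (chartAt (Cn n) p p) (r p))
    fun p => Filter.inter_mem ((chartAt (Cn n) p).open_source.mem_nhds (mem_chart_source _ p))
      ((chartAt (Cn n) p).continuousAt (mem_chart_source _ p)
        (Metric.closedBall_mem_nhds _ (hr p)))
  refine ⟨s, r, hr, hrt, fun q => ?_⟩
  have hq : q ∈ (⊤ : Set M) := trivial
  rw [← hs, Set.mem_iUnion₂] at hq
  obtain ⟨p, hp, h2, h3⟩ := hq
  exact ⟨p, hp, chartAt (Cn n) p q, h3, (chartAt (Cn n) p).left_inv h2⟩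

end Cover

section Maximum
open scoped Matrix ComplexOrder
variable {n : ℕ} {M : Type*} [TopologicalSpace M] [ChartedSpace (Cn n) M]
  [IsManifold 𝓘(ℂ, Cn n) ω M]
variable {k : ℕ} {Ω : HermitianMetric n M} {ε : ℝ} {χ : FormFamily n M} {ψ : PositiveRHS n M}
  {a : OneZeroForm n M} {K₀ K₁ : ℝ} {u : M → ℝ} {e : OpenPartialHomeomorph M (Cn n)}
  {z : Cn n}

/-- The quotient attains its maximum over the nonzero tangent vectors. -/
lemma exists_max_quotient (hn : 0 < n) [Nonempty M] {s : Finset M} {r : M → ℝ} (hr : ∀ p, 0 < r p)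
    (hrt : ∀ p, Metric.closedBall (chartAt (Cn n) p p) (r p) ⊆ (chartAt (Cn n) p).target)
    (hs : ∀ q : M, ∃ p ∈ s, ∃ x ∈ Metric.closedBall (chartAt (Cn n) p p) (r p),
      (chartAt (Cn n) p).symm x = q)
    (hu : ContMDiff 𝓘(ℝ, Cn n) 𝓘(ℝ, ℝ) 4 u) (N B : ℝ) :
    ∃ p ∈ s, ∃ z ∈ Metric.closedBall (chartAt (Cn n) p p) (r p),
      ∃ X : Tan n ((chartAt (Cn n) p).symm z), X ≠ 0 ∧ ∀ (q : M) (Y : Tan n q), Y ≠ 0 →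
        quotient Ω χ a u N B K₀ q Y ≤ quotient Ω χ a u N B K₀ ((chartAt (Cn n) p).symm z) X := by
  have : Nonempty (Fin n) := ⟨⟨0, hn⟩⟩
  have : Nontrivial (Cn n) := inferInstance
  -- the quotient is homogeneous of degree zero, so that unit coordinate vectors suffice
  let D : M → Set (Cn n × Cn n) := fun p =>
    Metric.closedBall (chartAt (Cn n) p p) (r p) ×ˢ Metric.sphere 0 1
  let F : M → Cn n × Cn n → ℝ := fun p y =>
    quotient Ω χ a u N B K₀ ((chartAt (Cn n) p).symm y.1) (push (chartAt (Cn n) p) y.1 y.2)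
  have hmax : ∀ p, ∃ y ∈ D p, IsMaxOn (F p) (D p) y := by
    intro p
    obtain ⟨v, hv⟩ := (NormedSpace.sphere_nonempty (E := Cn n) (x := 0) (r := 1)).2 zero_le_one
    refine ((isCompact_closedBall _ _).prod (isCompact_sphere _ _)).exists_isMaxOn
      ⟨(chartAt (Cn n) p p, v), Metric.mem_closedBall_self (hr p).le, hv⟩
      ((continuousOn_quotient (chart_mem_atlas _ p) hu N B).mono
        (Set.prod_mono (hrt p) fun y hy h0 => ?_))
    rw [Set.mem_singleton_iff.1 h0] at hy
    simp at hy
  choose y hy hmax using hmax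
  have hsne : s.Nonempty := (hs (Classical.arbitrary M)).imp fun p hp => hp.1
  obtain ⟨p, hp, hpm⟩ := s.exists_max_image (fun p => F p (y p)) hsne
  have hy2 : (y p).2 ≠ 0 := fun h0 => by
    have := (hy p).2
    rw [h0] at this
    simp at this
  refine ⟨p, hp, (y p).1, (hy p).1, push (chartAt (Cn n) p) (y p).1 (y p).2,
    push_ne_zero (chart_mem_atlas _ p) (hrt p (hy p).1) hy2, fun q Y hY => ?_⟩
  obtain ⟨p', hp', x, hx, rfl⟩ := hs q
  obtain ⟨v, rfl⟩ := push_surjective (chart_mem_atlas _ p') (hrt p' hx) Y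
  have hv : v ≠ 0 := fun h0 => hY (by rw [h0, map_zero])
  have hv' : ((‖v‖ : ℂ))⁻¹ ≠ 0 := by simpa using hv
  rw [← quotient_smul N B _ _ hv', ← map_smul]
  refine le_trans ?_ (hpm p' hp')
  refine hmax p' (a := (x, ((‖v‖ : ℂ))⁻¹ • v)) ⟨hx, ?_⟩
  have : ‖v‖ ≠ 0 := by simpa using hv
  simp [norm_smul, this]

variable {A : Matrix (Fin n) (Fin n) ℂ} {lam : Fin n → ℝ} {o : Fin n}

/-- The bound on `gTilde` on the whole manifold, from the largest eigenvalue at a maximum. -/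
lemma gTilde_le_of_max (he : e ∈ atlas (Cn n) M) (hz : z ∈ e.target) {N B : ℝ}
    (hAH : A * metricMatrix Ω e z * Aᴴ = 1)
    (hAG : A * gram (gTilde χ a u (e.symm z)) (chartVec e z) * Aᴴ =
      Matrix.diagonal fun p => (lam p : ℂ)) (ho : ∀ p, lam p ≤ lam o)
    {X : Tan n (e.symm z)} (hX : X ≠ 0) (hmax : ∀ (q : M) (Y : Tan n q), Y ≠ 0 →
        quotient Ω χ a u N B K₀ q Y ≤ quotient Ω χ a u N B K₀ (e.symm z) X)
    (q : M) (Y : Tan n q) : (gTilde χ a u q Y Y).re ≤ lam o *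
      Real.exp (auxFun Ω u N B K₀ (e.symm z) - auxFun Ω u N B K₀ q) * (Ω.form q Y Y).re := by
  by_cases hY : Y = 0
  · subst hY
    simp
  have h1 := hmax q Y hY
  have h2 := Ω.pos _ X hX
  have h3 := Ω.pos q Y hY
  have h4 : (gTilde χ a u (e.symm z) X X).re / (Ω.form (e.symm z) X X).re ≤ lam o :=
    (div_le_iff₀ h2).2 (gTilde_le_top he hz hAH hAG ho X)
  have h5 : quotient Ω χ a u N B K₀ q Y ≤ lam o * Real.exp (auxFun Ω u N B K₀ (e.symm z)) :=
    h1.trans (mul_le_mul_of_nonneg_right h4 (Real.exp_pos _).le)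
  rw [quotient, ← le_div_iff₀ (Real.exp_pos _), mul_div_assoc, ← Real.exp_sub,
    div_le_iff₀ h3] at h5
  exact h5

/-- The maximum property on the manifold, expressed for the local data. -/
lemma localData_touches (he : e ∈ atlas (Cn n) M) (hz : z ∈ e.target)
    (hu : ContMDiff 𝓘(ℝ, Cn n) 𝓘(ℝ, ℝ) 4 u) {N B : ℝ} (hAH : A * metricMatrix Ω e z * Aᴴ = 1)
    (hle : ∀ (q : M) (Y : Tan n q), (gTilde χ a u q Y Y).re ≤ lam o *
      Real.exp (auxFun Ω u N B K₀ (e.symm z) - auxFun Ω u N B K₀ q) * (Ω.form q Y Y).re) :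
    (localData k Ω χ ψ a u e z A lam o).Touches N B K₀ := by
  have hA := isUnit_det_of_eq_one hAH
  filter_upwards [e.open_target.mem_nhds hz] with x hx y
  have h1 := hle (e.symm x) (∑ p, y p • push e x (frame A p))
  rw [sesq_sum_smul, sesq_sum_smul] at h1
  have h2 := localData_φ (k := k) (Ω := Ω) (χ := χ) (ψ := ψ) (a := a) (z := z) (lam := lam) (o := o)
    (K₀ := K₀) he hu hA hx N B
  have h3 := localData_φ (k := k) (Ω := Ω) (χ := χ) (ψ := ψ) (a := a) (z := z) (lam := lam) (o := o)
    (K₀ := K₀) he hu hA hz N B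
  have h4 : ∀ p q, (localData k Ω χ ψ a u e z A lam o).h p q x =
      gram (Ω.form (e.symm x)) (fun p => push e x (frame A p)) p q := fun p q =>
    congrFun (congrFun (localData_h (k := k) (χ := χ) (ψ := ψ) (a := a) (u := u) (z := z)
      (lam := lam) (o := o) x) p) q
  simp only [localData_g he hu hx, h4]
  change _ ≤ lam o * Real.exp (((localData k Ω χ ψ a u e z A lam o).φ N B K₀ z).re - _) * _
  rw [h2, h3]
  exact h1

/-- In a diagonalizing frame `∂∂̄u` differs from `gTilde` by bounded terms, so that its norm is
bounded through the largest eigenvalue. Here `gTilde > 0` makes all eigenvalues positive. -/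
lemma localData_normLevi_le {K Λ : ℝ} (he : e ∈ atlas (Cn n) M) (hz : z ∈ e.target)
    (hu : ContMDiff 𝓘(ℝ, Cn n) 𝓘(ℝ, ℝ) 4 u) (hAH : A * metricMatrix Ω e z * Aᴴ = 1)
    (h : (localData k Ω χ ψ a u e z A lam o).Regular K ε) (hΛ : lam o ≤ Λ) :
    normLevi Ω u (e.symm z) ≤ n * (Λ + 3 * K ^ 2) := by
  have h0 : 0 ≤ Λ + 3 * K ^ 2 := by
    have : 0 < lam o := h.lam_pos o
    nlinarith [sq_nonneg K]
  have h1 : ∀ p q, ‖levi n u (e.symm z) (push e z (frame A p)) (push e z (frame A q))‖ ^ 2 ≤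
      (Λ + 3 * K ^ 2) ^ 2 := by
    intro p q
    rw [levi_push he hz hu]
    exact pow_le_pow_left₀ (norm_nonneg _) ((h.norm_b_le p q).trans (add_le_add hΛ le_rfl)) 2
  rw [normLevi_eq_sum hAH]
  refine Real.sqrt_le_iff.2 ⟨by positivity, ?_⟩
  refine (sum_le_sum fun p _ => sum_le_sum fun q _ => h1 p q).trans_eq ?_
  simp only [sum_const, card_univ, Fintype.card_fin, nsmul_eq_mul]
  ring

end Maximum

end HermitianHessian

end

open HermitianHessian in
theorem theorem2 {n k : ℕ} (hk : 1 ≤ k) (hkn : k ≤ n)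
    {M : Type*} [TopologicalSpace M] [T2Space M] [CompactSpace M]
    [ChartedSpace (Cn n) M] [IsManifold 𝓘(ℂ, Cn n) ω M]
    (Ω : HermitianMetric n M) (ε : ℝ) (hε : 0 < ε)
    (χ : FormFamily n M) (ψ : PositiveRHS n M) (a : OneZeroForm n M) (K₀ K₁ : ℝ) :
    ∃ C : ℝ, ∀ u : M → ℝ, ContMDiff 𝓘(ℝ, Cn n) 𝓘(ℝ, ℝ) 4 u →
      IsPsh χ a u → IsSolution k Ω χ a ψ u → LowerBound ε Ω χ u →
      (∀ p, |u p| ≤ K₀) → (∀ p, normDel Ω u p ≤ K₁) →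
      ∀ p, normLevi Ω u p ≤ C := by
  have hn : 0 < n := by omega
  obtain ⟨s, r, hr, hrt, hs⟩ := exists_cover n M
  choose K hK using fun p : M => exists_regular (Ω := Ω) (ε := ε) (χ := χ) (ψ := ψ) (a := a)
    (K₀ := K₀) (K₁ := K₁) hn hkn (chart_mem_atlas (Cn n) p)
    (isCompact_closedBall (chartAt (Cn n) p p) (r p)) (hrt p)
  obtain ⟨T, hT⟩ := (s.image K).exists_le
  have hKT : ∀ p ∈ s, K p ≤ max 1 T := fun p hp => (hT _ (Finset.mem_image_of_mem K hp)).trans (le_max_right _ _)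
  obtain ⟨N, B, Λ, hN, hB, hΛ⟩ :=
    LocalData.exists_top_le hk hkn (max 1 T) ε K₀ (le_max_left _ _) hε
  set Φ := N * K₁ ^ 2 + Real.exp (B * (2 * K₀))
  refine ⟨n * (Λ * Real.exp Φ + 3 * max 1 T ^ 2), fun u hu h1 h2 h3 h4 h5 q => ?_⟩
  have h : Admissible k Ω ε χ ψ a K₀ K₁ u := ⟨hu, h1, h2, h3, h4, h5⟩
  have : Nonempty M := ⟨q⟩
  obtain ⟨p, hp, z, hz, X, hX, hmax⟩ := exists_max_quotient (Ω := Ω) (χ := χ) (a := a) (K₀ := K₀)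
    hn hr hrt hs hu N B
  have hp' := chart_mem_atlas (Cn n) p
  obtain ⟨A, lam, o, hAH, hAG, ho, hreg⟩ := hK p _ (hKT p hp) u h z hz
  have hle := gTilde_le_of_max hp' (hrt p hz) hAH hAG ho hX hmax
  have htop : lam o ≤ Λ := hΛ _ hreg (localData_solves hAH hkn hp' (hrt p hz) h)
    (localData_touches hp' (hrt p hz) hu hAH hle) (h4 _)
  -- transfer the bound from the maximum point to `q`, in a diagonalizing frame at `q`
  obtain ⟨p₁, hp₁, x, hx, rfl⟩ := hs q
  have hp₁' := chart_mem_atlas (Cn n) p₁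
  obtain ⟨A₁, lam₁, o₁, hAH₁, hAG₁, ho₁, hreg₁⟩ := hK p₁ _ (hKT p₁ hp₁) u h x hx
  refine localData_normLevi_le hp₁' (hrt p₁ hx) hu hAH₁ hreg₁ ?_
  have e1 : gTilde χ a u ((chartAt (Cn n) p₁).symm x)
      (push (chartAt (Cn n) p₁) x (frame A₁ o₁)) (push (chartAt (Cn n) p₁) x (frame A₁ o₁)) =
      (lam₁ o₁ : ℂ) := by
    rw [← localData_g (k := k) (Ω := Ω) (ψ := ψ) (lam := lam₁) (o := o₁) (z := x) hp₁' hu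
      (hrt p₁ hx)]
    exact (hreg₁.g_diag o₁ o₁).trans (if_pos rfl)
  have h6 := hle _ (push (chartAt (Cn n) p₁) x (frame A₁ o₁))
  rw [e1, form_push_frame_self hAH₁, Complex.ofReal_re, Complex.one_re, mul_one] at h6
  have h7 : auxFun Ω u N B K₀ ((chartAt (Cn n) p).symm z) -
      auxFun Ω u N B K₀ ((chartAt (Cn n) p₁).symm x) ≤ Φ := by
    have h8 := h.auxFun_le hN hB ((chartAt (Cn n) p).symm z)
    have h9 := auxFun_nonneg (Ω := Ω) (u := u) (K₀ := K₀) hN B ((chartAt (Cn n) p₁).symm x)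
    linarith
  have h10 : 0 < lam o := hreg.lam_pos o
  exact h6.trans (mul_le_mul htop (Real.exp_le_exp.2 h7) (Real.exp_pos _).le (h10.le.trans htop))
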